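/- **Setting.** Let $\mathfrak g$ be a simple complex Lie algebra of rank $\ell$ with Killing form $\kappa$, $G$ the connected simply connected complex Lie group with Lie algebra $\mathfrak g$, $\mathfrak h\subset\mathfrak g$ a Cartan subalgebra with Cartan subgroup $H\subset G$, $\alpha_1,\dots,\alpha_\ell$ simple roots, $\alpha_*$ the highest root, and $\{E_\alpha\}\cup\{H_{\alpha_i}\}$ a Chevalley basis, with $H_\alpha=[E_\alpha,E_{-\alpha}]$ and $\alpha(H_\alpha)=2$. Let $\mathfrak k$ be the compact real form spanned over $\mathbb R$ by all $iH_\alpha$, $E_\alpha-E_{-\alpha}$, $i(E_\alpha+E_{-\alpha})$, let $\mathfrak a=\sum\mathbb R H_\alpha$ and $\mathfrak n=\sum_{\alpha>0}\mathbb C E_\alpha$, and let $K,A,N$ be the corresponding connected subgroups of $G$. Fix an embedding $G\subset SL(n,\mathbb C)$ for which the Iwasawa decomposition $G=KAN$ is the restriction of that of $SL(n,\mathbb C)$ (with $SU(n)$, positive diagonal matrices, and unipotent upper triangular matrices). For $g\in G$ let $k[g]$ be its $K$-factor in $G=K\exp(i\mathfrak k)$. Let $w:\mathbb Z\to(0,\infty)$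 satisfy $w(k+m)\le w(k)w(m)$, $w(-k)=w(k)$, $\lim_{k\to\infty}w(k)^{1/k}=1$, and $\lim_{k\to\infty}|k|^{-1/\lambda}\log w(k)=\infty$ for some $\lambda\in(1,2)$. Let $A_w$ be the space of $f(z)=\sum_{k\in\mathbb Z}a_kz^k$ on $S^1$ with $\|f\|_w=\sum|a_k|w(k)<\infty$, and norm $n\times n$ matrices over $A_w$ by $\|T\|_w=(\sum_{i,j}\|T_{ij}\|_w^2)^{1/2}$. Let $L\mathfrak g$ and $LG$ be the sets of matrices over $A_w$ whose values on $S^1$ lie in $\mathfrak g$ and in $G$ respectively. Let $\widetilde{L\mathfrak g}=L\mathfrak g\oplus\mathbb C$ be the central extension, with the real bilinear pairing $$\langle(\phi,p),(\psi,q)\rangle=\operatorname{Re}\Big\{\frac1{2\pi}\int_0^{2\pi}\kappa(\phi(e^{i\theta}),\psi(e^{i\theta}))\,d\theta+pq\Big\}.$$ Gradients $\nabla$ of real functions on $\widetilde{L\mathfrak g}$ are taken with respect to this pairing: $dF_x(y)=\langle y,\nabla F(x)\rangle$ for all $y$, where $dF_x$ is the real Fréchet derivative. The group $LG$ acts by $\mathrm{Ad}^*_\gamma(\phi,p)=(\gamma\phi\gamma^{-1}+p\,\gamma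 D\gamma^{-1},p)$, where $D=z\,d/dz$; elements related by this action are called gauge-conjugate. Put $\hat{\mathfrak k}=\tilde{\mathfrak k}+i\mathbb R$, where $\tilde{\mathfrak k}$ is the set of $\phi\in L\mathfrak g$ with values in $\mathfrak{su}(n)$, and $\hat{\mathfrak b}=\mathfrak a+\tilde{\mathfrak n}+\mathbb R$, where $\tilde{\mathfrak n}$ is the set of $\phi=\sum_{k\ge0}\phi_kz^k\in L\mathfrak g$ with $\phi_0$ strictly upper triangular. The Toda phase space is the coadjoint orbit through $(\phi_o,1)$, $$\phi_o(z)=\sum_i(E_{\alpha_i}+E_{-\alpha_i})+E_{\alpha_*}z^{-1}+E_{-\alpha_*}z,$$ of the group $\hat B$ of $\hat{\mathfrak b}$ in $\hat{\mathfrak k}^\perp\cong\hat{\mathfrak b}^*$, i.e. the set of projections to $\hat{\mathfrak k}^\perp$ along $\hat{\mathfrak b}^\perp$ of the elements $\mathrm{Ad}^*_b(\phi_o,1)\in\widetilde{L\mathfrak g}$, where $b=au$, $a\in A$, and $u=\sum_{k\ge0}u_kz^k\in LG$ with $u_0$ unipotent upper triangular. For $p\ne0$ the monodromy of $(\phi,p)$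 is $M_{(\phi,p)}=f(2\pi)\in G$, where $f:\mathbb R\to G$ solves $\dot f(t)f(t)^{-1}=\frac1{ip}\phi(e^{it})$, $f(0)=1$. The element $(\phi,p)$ is loop-regular if $p\neq0$ and the centralizer of $M_{(\phi,p)}$ in $G$ is conjugate to $H$. Let $\Psi_1,\dots,\Psi_\ell$ be the characters of the irreducible representations of $G$ with the fundamental highest weights. The dual of a fundamental representation is fundamental. Put $\chi_j=\operatorname{Im}\Psi_j$ if $\Psi_j$ is the character of the dual of the $i$-th fundamental representation for some $i<j$, and $\chi_j=\operatorname{Re}\Psi_j$ otherwise. Thus a self-dual representation contributes the real part of its character, and a dual pair contributes one real part and one imaginary part. For $(\phi,p)$, $p\ne0$, gauge-conjugate to some $(\mu,p)$ with $\mu\in\mathfrak h$ a constant loop, put $F_j(\phi,p)=\chi_j(k[M_{(\mu,p)}])$. (This covers all loop-regular elements; where no such $\mu$ exists the value of $F_j$ is immaterial and is set to $0$.) **Statement.** Let $c_1,\dots,c_\ell\in\mathbb R$ and $F=\sum_jc_jF_j$. If $(\phi,1)$ is a loop-regular element of the Toda phase space, then $F$ has a (unique) gradient $\nabla F(\phi,1)\in\widetilde{L\mathfrak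 g}$ at $(\phi,1)$, it satisfies $\nabla F(\phi,1)\in i\hat{\mathfrak k}$, and $$\nabla F(\phi,1)=0\iff c_1=\cdots=c_\ell=0.$$ -/

import Mathlib

open scoped Topology

attribute [local instance] LieRing.ofAssociativeRing

noncomputable section

namespace Toda

/-! ### Weighted Wiener algebras and matrices over them -/

/-- A symmetric weight function on `ℤ`, of non-analytic type and rapidly increasing at infinity. -/
structure LoopWeight where
  w : ℤ → ℝ
  pos : ∀ k, 0 < w k
  submul : ∀ k m, w (k + m) ≤ w k * w m
  symm : ∀ k, w (-k) = w k
  nonanalytic : Filter.Tendsto (fun k : ℕ => (w k) ^ (1 / (k : ℝ))) Filter.atTop (𝓝 1)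
  rapid : ∃ r : ℝ, 1 < r ∧ r < 2 ∧
    Filter.Tendsto (fun k : ℕ => (k : ℝ) ^ (-1 / r) * Real.log (w k)) Filter.atTop Filter.atTop

theorem LoopWeight.one_le (W : LoopWeight) (k : ℤ) : 1 ≤ W.w k := by
  have h0 : 1 ≤ W.w 0 := by
    have h := W.submul 0 0
    have hp := W.pos 0
    rw [add_zero] at h
    by_contra hlt
    nlinarith
  have h := W.submul k (-k)
  have hp := W.pos k
  rw [add_neg_cancel, W.symm] at h
  by_contra hlt
  nlinarith

/-- Sequences `a : ℤ → ℂ` with `∑ |a k| w k < ∞`. -/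
def awSubmodule (W : LoopWeight) : Submodule ℂ (ℤ → ℂ) where
  carrier := {a | Summable fun k => ‖a k‖ * W.w k}
  zero_mem' := by simp [summable_zero]
  add_mem' := by
    intro a b ha hb
    refine Summable.of_nonneg_of_le
      (fun k => mul_nonneg (norm_nonneg _) (W.pos k).le) (fun k => ?_) (Summable.add ha hb)
    rw [← add_mul]
    exact mul_le_mul_of_nonneg_right (norm_add_le _ _) (W.pos k).le
  smul_mem' := by
    intro c a ha
    have h := Summable.mul_left ‖c‖ ha
    refine h.congr fun k => ?_
    rw [Pi.smul_apply, norm_smul, mul_assoc]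

/-- The space `A_w` of functions `f z = ∑ a k z ^ k` on the circle with `∑ |a k| w k < ∞`,
an element being given by its Fourier coefficients. -/
def Aw (W : LoopWeight) : Type := awSubmodule W

namespace Aw

variable {W : LoopWeight}

instance : AddCommGroup (Aw W) := inferInstanceAs (AddCommGroup (awSubmodule W))

instance : Module ℂ (Aw W) := inferInstanceAs (Module ℂ (awSubmodule W))

/-- The `k`-th Fourier coefficient. -/
def coeff (f : Aw W) (k : ℤ) : ℂ := f.1 k

theorem summable (f : Aw W) : Summable fun k => ‖f.coeff k‖ * W.w k := f.2

theorem coeff_add (f g : Aw W) (k : ℤ) : (f + g).coeff k = f.coeff k + g.coeff k := rfl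

theorem coeff_smul (c : ℂ) (f : Aw W) (k : ℤ) : (c • f).coeff k = c * f.coeff k := rfl

theorem coeff_zero (k : ℤ) : (0 : Aw W).coeff k = 0 := rfl

theorem coeff_neg (f : Aw W) (k : ℤ) : (-f).coeff k = -f.coeff k := rfl

theorem ext_coeff {f g : Aw W} (h : ∀ k, f.coeff k = g.coeff k) : f = g :=
  Subtype.ext (funext h)

instance : Norm (Aw W) := ⟨fun f => ∑' k, ‖f.coeff k‖ * W.w k⟩

theorem norm_def (f : Aw W) : ‖f‖ = ∑' k, ‖f.coeff k‖ * W.w k := rfl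

theorem normCore : NormedSpace.Core ℂ (Aw W) where
  norm_nonneg f := tsum_nonneg fun k => mul_nonneg (norm_nonneg _) (W.pos k).le
  norm_smul c f := by
    rw [norm_def, norm_def, ← tsum_mul_left]
    congr 1
    funext k
    rw [coeff_smul, norm_mul, mul_assoc]
  norm_triangle f g := by
    rw [norm_def, norm_def, norm_def, ← Summable.tsum_add f.summable g.summable]
    refine Summable.tsum_le_tsum (fun k => ?_) (f + g).summable (f.summable.add g.summable)
    rw [coeff_add, ← add_mul]
    exact mul_le_mul_of_nonneg_right (norm_add_le _ _) (W.pos k).le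
  norm_eq_zero_iff f := by
    constructor
    · intro h
      have h0 := (hasSum_zero_iff_of_nonneg
        (fun k => mul_nonneg (norm_nonneg (f.coeff k)) (W.pos k).le)).1
          (by rw [← h]; exact f.summable.hasSum)
      refine ext_coeff fun k => ?_
      have hk := congrFun h0 k
      simp only [Pi.zero_apply, mul_eq_zero, norm_eq_zero, (W.pos k).ne', or_false] at hk
      rw [hk, coeff_zero]
    · rintro rfl
      simp [norm_def, coeff_zero]

instance : NormedAddCommGroup (Aw W) := NormedAddCommGroup.ofCore normCore

instance : NormedSpace ℂ (Aw W) := NormedSpace.ofCore normCore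

/-- The value `∑ a k z ^ k` at a point of the circle. -/
def eval (f : Aw W) (z : Circle) : ℂ := ∑' k : ℤ, f.coeff k * (z : ℂ) ^ k

theorem summable_eval (f : Aw W) (z : Circle) :
    Summable fun k : ℤ => f.coeff k * (z : ℂ) ^ k := by
  refine Summable.of_norm_bounded f.summable fun k => ?_
  rw [norm_mul, norm_zpow, Circle.norm_coe, one_zpow, mul_one]
  exact le_mul_of_one_le_right (norm_nonneg _) (W.one_le k)

theorem eval_add (f g : Aw W) (z : Circle) : (f + g).eval z = f.eval z + g.eval z := by
  unfold eval
  rw [← Summable.tsum_add (f.summable_eval z) (g.summable_eval z)]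
  simp only [coeff_add, add_mul]

theorem eval_smul (c : ℂ) (f : Aw W) (z : Circle) : (c • f).eval z = c * f.eval z := by
  unfold eval
  rw [← tsum_mul_left]
  simp only [coeff_smul, mul_assoc]

end Aw

/-- `n × n` matrices over `A_w`, with the norm `(∑ ‖T i j‖ ^ 2) ^ (1 / 2)`. -/
abbrev MatAw (W : LoopWeight) (n : ℕ) : Type := PiLp 2 (fun _ : Fin n × Fin n => Aw W)

namespace MatAw

variable {W : LoopWeight} {n : ℕ}

/-- The value of a matrix loop at a point of the circle. -/
def eval (T : MatAw W n) (z : Circle) : Matrix (Fin n) (Fin n) ℂ :=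
  Matrix.of fun i j => (T (i, j)).eval z

/-- The coefficient of `z ^ k` of a matrix loop. -/
def coeff (T : MatAw W n) (k : ℤ) : Matrix (Fin n) (Fin n) ℂ :=
  Matrix.of fun i j => (T (i, j)).coeff k

theorem eval_add (S T : MatAw W n) (z : Circle) : (S + T).eval z = S.eval z + T.eval z := by
  ext i j
  exact Aw.eval_add _ _ z

theorem eval_smul (c : ℂ) (T : MatAw W n) (z : Circle) : (c • T).eval z = c • T.eval z := by
  ext i j
  exact Aw.eval_smul _ _ z

end MatAw

/-! ### Some sets of constant matrices -/

/-- Strictly upper triangular matrices. -/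
def IsStrictUpper {n : ℕ} (A : Matrix (Fin n) (Fin n) ℂ) : Prop := ∀ i j, j ≤ i → A i j = 0

/-- Upper triangular matrices with ones on the diagonal. -/
def IsUnipotentUpper {n : ℕ} (A : Matrix (Fin n) (Fin n) ℂ) : Prop := IsStrictUpper (A - 1)

/-- Diagonal matrices with positive real diagonal entries. -/
def IsPosDiagonal {n : ℕ} (A : Matrix (Fin n) (Fin n) ℂ) : Prop :=
  ∃ d : Fin n → ℝ, (∀ i, 0 < d i) ∧ A = Matrix.diagonal fun i => (d i : ℂ)

/-- Elements of `su(n)`. -/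
def IsSu {n : ℕ} (A : Matrix (Fin n) (Fin n) ℂ) : Prop := A.conjTranspose = -A ∧ A.trace = 0

/-- The connected subgroup of `SL(n, ℂ)` generated by the exponentials of a set of matrices. For a
(real) Lie subalgebra of `sl(n, ℂ)` this is the connected Lie subgroup corresponding to it. -/
def expSubgroup {n : ℕ} (s : Set (Matrix (Fin n) (Fin n) ℂ)) :
    Subgroup (Matrix.SpecialLinearGroup (Fin n) ℂ) :=
  Subgroup.closure {g | ∃ X ∈ s, (g : Matrix (Fin n) (Fin n) ℂ) = NormedSpace.exp X}

/-! ### A simple Lie algebra of matrices with a Chevalley basis -/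

/-- A simple complex Lie algebra `𝔤` of `n × n` matrices, a Cartan subalgebra `𝔥`, a base of simple
roots `α_1, …, α_ℓ`, and a Chevalley basis: `E α` spans the `α` root space,
`⁅E α, E (-α)⁆ = H_α` is the coroot of `α` (so `α (H_α) = 2`), and the structure constants
satisfy `N_{α, β} = - N_{-α, -β}`. (The value of `E` at the zero weight is never used.) -/
structure ChevalleyData (n l : ℕ) where
  𝔤 : LieSubalgebra ℂ (Matrix (Fin n) (Fin n) ℂ)
  [simple : LieAlgebra.IsSimple ℂ 𝔤]
  𝔥 : LieSubalgebra ℂ 𝔤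
  [cartan : 𝔥.IsCartanSubalgebra]
  base : (LieAlgebra.IsKilling.rootSystem 𝔥).Base
  enum : Fin l ≃ base.support
  E : LieModule.Weight ℂ 𝔥 𝔤 → 𝔤
  E_mem : ∀ α : LieModule.Weight ℂ 𝔥 𝔤, α.IsNonZero → E α ∈ LieAlgebra.rootSpace 𝔥 α
  E_lie_neg : ∀ α : LieModule.Weight ℂ 𝔥 𝔤, α.IsNonZero → ⁅E α, E (-α)⁆ =
    (LieAlgebra.IsKilling.coroot α : 𝔥)
  E_lie : ∀ α β γ : LieModule.Weight ℂ 𝔥 𝔤, α.IsNonZero → β.IsNonZero → γ.IsNonZero →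
    (∀ h, γ h = α h + β h) →
      ∃ N : ℂ, ⁅E α, E β⁆ = N • E γ ∧ ⁅E (-α), E (-β)⁆ = -N • E (-γ)

namespace ChevalleyData

variable {n l : ℕ} (S : ChevalleyData n l)

attribute [instance] ChevalleyData.simple ChevalleyData.cartan

/-- The simple root `α_j`. -/
def simpleRoot (j : Fin l) : LieModule.Weight ℂ S.𝔥 S.𝔤 := ((S.enum j : S.𝔥.root) : _)

/-- The monoid of all sums of simple roots. -/
def positiveCone : AddSubmonoid (Module.Dual ℂ S.𝔥) :=
  AddSubmonoid.closure (Set.range fun j => (S.simpleRoot j).toLinear)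

/-- Positive roots. -/
def IsPositiveRoot (α : LieModule.Weight ℂ S.𝔥 S.𝔤) : Prop :=
  α.IsNonZero ∧ α.toLinear ∈ S.positiveCone

/-- The highest root. -/
def IsHighestRoot (α : LieModule.Weight ℂ S.𝔥 S.𝔤) : Prop :=
  α.IsNonZero ∧ ∀ β : LieModule.Weight ℂ S.𝔥 S.𝔤, β.IsNonZero →
    α.toLinear - β.toLinear ∈ S.positiveCone

/-- The element `E α` as a matrix. -/
def Emat (α : LieModule.Weight ℂ S.𝔥 S.𝔤) : Matrix (Fin n) (Fin n) ℂ := (S.E α : S.𝔤)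

/-- The coroot `H_α` as a matrix. -/
def Hmat (α : LieModule.Weight ℂ S.𝔥 S.𝔤) : Matrix (Fin n) (Fin n) ℂ :=
  ((LieAlgebra.IsKilling.coroot α : S.𝔥) : S.𝔤)

/-- The compact real form: the real span of `i H_α`, `E α - E (-α)`, `i (E α + E (-α))`. -/
def 𝔨 : Submodule ℝ (Matrix (Fin n) (Fin n) ℂ) :=
  Submodule.span ℝ {X | ∃ α : LieModule.Weight ℂ S.𝔥 S.𝔤, α.IsNonZero ∧
    (X = Complex.I • S.Hmat α ∨ X = S.Emat α - S.Emat (-α) ∨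
      X = Complex.I • (S.Emat α + S.Emat (-α)))}

/-- The real span of the coroots. -/
def 𝔞 : Submodule ℝ (Matrix (Fin n) (Fin n) ℂ) :=
  Submodule.span ℝ {X | ∃ α : LieModule.Weight ℂ S.𝔥 S.𝔤, α.IsNonZero ∧ X = S.Hmat α}

/-- The complex span of the `E α`, `α` positive. -/
def 𝔫 : Submodule ℂ (Matrix (Fin n) (Fin n) ℂ) :=
  Submodule.span ℂ {X | ∃ α, S.IsPositiveRoot α ∧ X = S.Emat α}

/-- The Cartan subalgebra as a set of matrices. -/
def 𝔥mat : Set (Matrix (Fin n) (Fin n) ℂ) := Set.range fun h : S.𝔥 => ((h : S.𝔤) : Matrix _ _ ℂ)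

/-- The connected Lie group `G ⊆ SL(n, ℂ)` with Lie algebra `𝔤`. -/
def G : Subgroup (Matrix.SpecialLinearGroup (Fin n) ℂ) := expSubgroup (S.𝔤 : Set _)

/-- The compact subgroup `K` of `G`. -/
def K : Subgroup (Matrix.SpecialLinearGroup (Fin n) ℂ) := expSubgroup (S.𝔨 : Set _)

/-- The subgroup `A` of `G`. -/
def A : Subgroup (Matrix.SpecialLinearGroup (Fin n) ℂ) := expSubgroup (S.𝔞 : Set _)

/-- The subgroup `N` of `G`. -/
def N : Subgroup (Matrix.SpecialLinearGroup (Fin n) ℂ) := expSubgroup (S.𝔫 : Set _)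

/-- The Cartan subgroup of `G` corresponding to `𝔥`. -/
def cartanSubgroup : Subgroup S.G := (expSubgroup S.𝔥mat).subgroupOf S.G

/-- An element of `G` as a matrix. -/
def mat (g : S.G) : Matrix (Fin n) (Fin n) ℂ := (g : Matrix.SpecialLinearGroup (Fin n) ℂ).1

/-- `G` is simply connected, and the embedding `G ⊆ SL(n, ℂ)` is compatible with Iwasawa
decompositions: the factors `K`, `A`, `N` of `G` lie in the factors of
`SL(n, ℂ) = SU(n) A_n N_n`, so that `g = k a n` in `G` is also the decomposition in `SL(n, ℂ)`. -/
structure IsAdmissible : Prop where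
  simplyConnected : SimplyConnectedSpace S.G
  K_le : ∀ g ∈ S.K, (g.1).conjTranspose * g.1 = 1
  A_le : ∀ g ∈ S.A, IsPosDiagonal g.1
  N_le : ∀ g ∈ S.N, IsUnipotentUpper g.1

/-- The factor `k[g]` in `K` of `g ∈ G`, for the Cartan decomposition `G = K exp (i 𝔨)`. -/
def cartanK (g : S.G) : S.G :=
  open Classical in
  if h : ∃ k : S.G, k.1 ∈ S.K ∧ ∃ X ∈ S.𝔨, S.mat g = S.mat k * NormedSpace.exp (Complex.I • X)
  then h.choose else 1

/-! ### Characters -/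

/-- `Ψ` is the character of the irreducible (holomorphic, finite dimensional) representation of `G`
whose highest weight is the `j`-th fundamental weight `ω_j`, where `ω_j (H_{α_i}) = δ_{ij}`.
Here `dρ` is the differential of the representation `ρ` and `v` is a highest weight vector. -/
def IsFundamentalCharacter (j : Fin l) (Ψ : S.G → ℂ) : Prop :=
  ∃ (d : ℕ) (ρ : S.G →* Matrix (Fin d) (Fin d) ℂ) (dρ : S.𝔤 →ₗ⁅ℂ⁆ Matrix (Fin d) (Fin d) ℂ),
    (∀ (g : S.G) (X : S.𝔤), S.mat g = NormedSpace.exp (X : Matrix (Fin n) (Fin n) ℂ) →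
      ρ g = NormedSpace.exp (dρ X)) ∧
    (∀ V : Submodule ℂ (Fin d → ℂ), (∀ g, ∀ v ∈ V, (ρ g).mulVec v ∈ V) → V = ⊥ ∨ V = ⊤) ∧
    (∃ v : Fin d → ℂ, v ≠ 0 ∧
      (∀ α, S.IsPositiveRoot α → (dρ (S.E α)).mulVec v = 0) ∧
      (∀ i, (dρ ((LieAlgebra.IsKilling.coroot (S.simpleRoot i) : S.𝔥) : S.𝔤)).mulVec v =
        if i = j then v else 0)) ∧
    ∀ g, Ψ g = (ρ g).trace

/-- The class functions `χ_1, …, χ_ℓ` made of the real and imaginary parts of the characters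
`Ψ_1, …, Ψ_ℓ`: the dual of a fundamental representation is again fundamental, a self-dual
one contributes the real part of its character, and from a dual pair `Ψ_i, Ψ_j` with `i < j`
one takes a real part (as `χ_i`) and an imaginary part (as `χ_j`). -/
def chi {G : Type*} [Group G] (Ψ : Fin l → G → ℂ) (j : Fin l) (g : G) : ℝ :=
  open Classical in
  if ∃ i < j, ∀ x, Ψ i x⁻¹ = Ψ j x then (Ψ j g).im else (Ψ j g).re

/-! ### Loop algebra, loop group and the central extension -/

variable (W : LoopWeight)

/-- The loop algebra `L𝔤`. -/
def LoopAlg : Submodule ℂ (MatAw W n) where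
  carrier := {T | ∀ z, T.eval z ∈ S.𝔤}
  zero_mem' := by
    intro z
    have h := MatAw.eval_smul (0 : ℂ) (0 : MatAw W n) z
    rw [zero_smul, zero_smul] at h
    rw [h]
    exact S.𝔤.zero_mem
  add_mem' := by
    intro a b ha hb z
    rw [MatAw.eval_add]
    exact S.𝔤.add_mem (ha z) (hb z)
  smul_mem' := by
    intro c a ha z
    rw [MatAw.eval_smul]
    exact S.𝔤.smul_mem c (ha z)

/-- The underlying space of the centrally extended loop algebra, `L𝔤 ⊕ ℂ`. -/
abbrev ExtLoopAlg : Type := S.LoopAlg W × ℂ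

variable {W}

/-- The value of an element of `L𝔤` at a point of the circle, as an element of `𝔤`. -/
def evalAlg (φ : S.LoopAlg W) (z : Circle) : S.𝔤 := ⟨φ.1.eval z, φ.2 z⟩

/-- The bilinear form `(1 / 2π) ∫ κ(φ(e^{iθ}), ψ(e^{iθ})) dθ` on `L𝔤`, `κ` the Killing form. -/
def loopForm (φ ψ : S.LoopAlg W) : ℂ :=
  (2 * Real.pi : ℂ)⁻¹ * ∫ θ in (0 : ℝ)..(2 * Real.pi),
    killingForm ℂ S.𝔤 (S.evalAlg φ (Circle.exp θ)) (S.evalAlg ψ (Circle.exp θ))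

/-- The real bilinear pairing `Re (⟨φ, ψ⟩ + p q)` on the extended loop algebra. -/
def pairing (x y : S.ExtLoopAlg W) : ℝ := (S.loopForm x.1 y.1 + x.2 * y.2).re

/-- Elements `γ` of the loop group `LG`. -/
def IsLoop (γ : MatAw W n) : Prop := ∀ z, ∃ g : S.G, S.mat g = γ.eval z

/-- The function `θ ↦ (φ, p)` transformed by the gauge (coadjoint) action of `γ`:
`γ φ γ⁻¹ + p γ D(γ⁻¹)` at `z = e^{iθ}`, where `D = z d/dz = -i d/dθ`. -/
def gaugeAct (γ : MatAw W n) (φ : ℝ → Matrix (Fin n) (Fin n) ℂ) (p : ℂ) (θ : ℝ) :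
    Matrix (Fin n) (Fin n) ℂ :=
  γ.eval (Circle.exp θ) * φ θ * (γ.eval (Circle.exp θ))⁻¹ +
    p • (γ.eval (Circle.exp θ) *
      (-Complex.I) • Matrix.of fun i j => deriv (fun s => (γ.eval (Circle.exp s))⁻¹ i j) θ)

/-- `(μ, p)`, for a constant loop `μ ∈ 𝔥`, is gauge-conjugate to `x = (φ, p)`. -/
def IsGaugeConjConst (μ : S.𝔥) (x : S.ExtLoopAlg W) : Prop :=
  ∃ γ : MatAw W n, S.IsLoop γ ∧
    ∀ θ : ℝ, x.1.1.eval (Circle.exp θ) =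
      gaugeAct γ (fun _ => ((μ : S.𝔤) : Matrix (Fin n) (Fin n) ℂ)) x.2 θ

/-! ### Monodromy -/

/-- `f : ℝ → G` solves `f' f⁻¹ = φ / (i p)`, `f 0 = 1`; here `φ` is a function of the angle. -/
def IsMonodromySolution (φ : ℝ → Matrix (Fin n) (Fin n) ℂ) (p : ℂ) (f : ℝ → S.G) : Prop :=
  f 0 = 1 ∧ ∀ (t : ℝ) (i j : Fin n),
    HasDerivAt (fun s => S.mat (f s) i j) (((1 / (Complex.I * p)) • (φ t * S.mat (f t))) i j) t

/-- The monodromy `f (2π) ∈ G` of `(φ, p)`, `p ≠ 0`. -/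
def monodromy (φ : ℝ → Matrix (Fin n) (Fin n) ℂ) (p : ℂ) : S.G :=
  open Classical in
  if h : ∃ f, S.IsMonodromySolution φ p f then h.choose (2 * Real.pi) else 1

/-- `x = (φ, p)` is loop-regular: `p ≠ 0`, and the centralizer in `G` of its monodromy is conjugate
to the Cartan subgroup. -/
def LoopRegular (x : S.ExtLoopAlg W) : Prop :=
  x.2 ≠ 0 ∧ ∃ g : S.G,
    Subgroup.centralizer {S.monodromy (fun θ => x.1.1.eval (Circle.exp θ)) x.2} =
      S.cartanSubgroup.map (MulAut.conj g).toMonoidHom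

/-- The gauge-invariant function `F_j (φ, p) = χ_j (k[M_{(μ, p)}])`, where `(μ, p)` with `μ ∈ 𝔥` is
gauge-conjugate to `(φ, p)`, `p ≠ 0` (and the value is `0` if there is no such `μ`). -/
def F (Ψ : Fin l → S.G → ℂ) (j : Fin l) (x : S.ExtLoopAlg W) : ℝ :=
  open Classical in
  if h : x.2 ≠ 0 ∧ ∃ μ : S.𝔥, S.IsGaugeConjConst μ x then
    chi Ψ j (S.cartanK
      (S.monodromy (fun _ => ((h.2.choose : S.𝔤) : Matrix (Fin n) (Fin n) ℂ)) x.2))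
  else 0

/-- `v` is the gradient at `x` of the real-valued function `f`, with respect to the pairing: `f` is
Fréchet differentiable (over `ℝ`) at `x` and its derivative there is `y ↦ ⟪y, v⟫`. -/
def HasGrad (f : S.ExtLoopAlg W → ℝ) (x v : S.ExtLoopAlg W) : Prop :=
  ∃ f' : S.ExtLoopAlg W →L[ℝ] ℝ, (∀ y, f' y = S.pairing y v) ∧ HasFDerivAt f f' x

/-! ### The splitting and the Toda phase space -/

variable (W) in
/-- The subalgebra `k̂ = (L𝔤 ∩ su_n(A_w)) + iℝ`. -/
def kHat : Set (S.ExtLoopAlg W) := {x | (∀ z, IsSu (x.1.1.eval z)) ∧ x.2.re = 0}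

variable (W) in
/-- The real subspace `i k̂`. -/
def iKHat : Set (S.ExtLoopAlg W) := {x | ∃ y ∈ S.kHat W, x = Complex.I • y}

variable (W) in
/-- The subalgebra `b̂ = 𝔞 + (L𝔤 ∩ 𝔫_n(A_w)) + ℝ`. -/
def bHat : Set (S.ExtLoopAlg W) :=
  {x | (∀ k < 0, x.1.1.coeff k = 0) ∧ (∃ a ∈ S.𝔞, IsStrictUpper (x.1.1.coeff 0 - a)) ∧ x.2.im = 0}

/-- The orthogonal of a set with respect to the pairing. -/
def perp (s : Set (S.ExtLoopAlg W)) : Set (S.ExtLoopAlg W) := {x | ∀ y ∈ s, S.pairing y x = 0}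

/-- `b` belongs to the subgroup `A (LG ∩ N_n(A_w))` of `LG`. -/
def IsBLoop (b : MatAw W n) : Prop :=
  ∃ a ∈ S.A, ∃ u : MatAw W n, S.IsLoop u ∧ (∀ k < 0, u.coeff k = 0) ∧
    IsUnipotentUpper (u.coeff 0) ∧ ∀ z, b.eval z = a.1 * u.eval z

/-- The loop `∑ (E α_i + E (-α_i)) + E α_* z⁻¹ + E (-α_*) z`, at `z = e^{iθ}`. -/
def phi0 (αs : LieModule.Weight ℂ S.𝔥 S.𝔤) (θ : ℝ) : Matrix (Fin n) (Fin n) ℂ :=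
  (∑ j, (S.Emat (S.simpleRoot j) + S.Emat (-S.simpleRoot j))) +
    ((Circle.exp θ : ℂ)⁻¹ • S.Emat αs + (Circle.exp θ : ℂ) • S.Emat (-αs))

variable (W) in
/-- The periodic Toda phase space: the coadjoint orbit through `(φ_o, 1)` of the group `B̂` in
`k̂^⊥ ≅ b̂*`, i.e. all projections to `k̂^⊥`, along `b̂^⊥`, of `Ad*_b (φ_o, 1)`.
The centre acts trivially, so only the image of `B̂` in `LG` matters. -/
def todaPhaseSpace : Set (S.ExtLoopAlg W) :=
  {x | x ∈ S.perp (S.kHat W) ∧ ∃ αs, S.IsHighestRoot αs ∧ ∃ b : MatAw W n, S.IsBLoop b ∧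
    ∃ y : S.ExtLoopAlg W, y.2 = 1 ∧
      (∀ θ, y.1.1.eval (Circle.exp θ) = gaugeAct b (S.phi0 αs) 1 θ) ∧
      y - x ∈ S.perp (S.bHat W)}

end ChevalleyData

end Toda

end

/-! Orthogonality to `kHat` makes the loop φ Hermitian-valued, so the fundamental solution of i f' =
φ f is unitary. Loop-regularity gives its monodromy the form g exp(x₀) g⁻¹ with x₀ ∈ 𝔥, where only
the Cartan subgroup commutes with exp(x₀). By Floquet, γ(t) = f(t) g exp(-t x₀/2π) is periodic and
gauges the constant μ = i x₀/2π to φ. Unitarity makes μ a real diagonal matrix. That γ has entries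
in A_w is a regularity statement for linear equations (`exists_matAw_of_ode`), proved by a
convolution estimate on Fourier coefficients (`exists_floquet`).

Transporting by γ⁻¹ reduces the problem to a neighbourhood of (μ, 1). There the operator ψ ↦ [ψ, μ]
- Dψ is diagonal in matrix entries and Fourier modes, with eigenvalues d_j - d_i - k. Regularity
puts its kernel inside the constants in 𝔥, and the nonzero eigenvalues are bounded away from 0. The
inverse function theorem then gauges every nearby connection to a constant in 𝔥
(`exists_normal_form`), whose variation to first order is q(ψ), the 𝔥-part of the zeroth Fourier
coefficient. On 𝔥 the K-factor of exp(x) is the exponential of the part of x with imaginary coroot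
coordinates (`cartanK_expG`). Characters of this factor depend only on the conjugacy class of
exp(x), so F is well defined, and the chain rule gives dF. Its gradient is the Killing dual x ∈ 𝔥 of
a real combination of fundamental weights, conjugated by γ, with central component -⟨φ, γxγ⁻¹⟩. Here
γxγ⁻¹ is Hermitian: its value is normal, being in the abelian centralizer of a unitary regular
element together with its adjoint, and it is similar to a real diagonal matrix. The pairing of two
Hermitian loops is real, so the gradient lies in `iKHat`.

The gradient vanishes exactly when the differential of Σ c_j χ_j on the compact torus vanishes, so
it remains to see that the dΨ_j are independent at a regular point (`linearIndependent_deriv`). If ξ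
is stationary for all Ψ_j at x₀, the product rule makes it stationary for all monomials in the Ψ_j.
Induction on dominant weights then makes it stationary for every Weyl orbit sum, i.e. Σ_w λ(wξ)
exp(λ(w x₀)) = 0 for every integral weight λ (`IsTop.orbit_zero`). Regularity makes the characters λ
↦ exp(λ(w x₀)) of the weight lattice distinct, and an extension of Dedekind independence to additive
coefficients gives ξ = 0. To pass to real and imaginary parts one uses that on the compact torus
complex conjugation permutes the Ψ_j, by duality of fundamental representations
(`exists_dual_index`). -/

noncomputable section

namespace Toda

/-! ### Exponentials in complex Banach algebras -/

section BanachAlgebra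

attribute [-instance] LieRing.ofAssociativeRing

variable {𝔸 : Type*} [NormedRing 𝔸] [NormedAlgebra ℂ 𝔸] [CompleteSpace 𝔸]

theorem hasDerivAt_exp_real_smul (x : 𝔸) (t : ℝ) :
    HasDerivAt (fun u : ℝ => NormedSpace.exp ((u : ℂ) • x)) (NormedSpace.exp ((t : ℂ) • x) * x) t := by
  have h := (hasDerivAt_exp_smul_const (𝕂 := ℂ) x (t : ℂ)).scomp t (Complex.ofRealCLM.hasDerivAt)
  simpa [Function.comp_def] using h

theorem hasDerivAt_exp_real_smul' (x : 𝔸) (t : ℝ) :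
    HasDerivAt (fun u : ℝ => NormedSpace.exp ((u : ℂ) • x)) (x * NormedSpace.exp ((t : ℂ) • x)) t := by
  have h := (hasDerivAt_exp_smul_const' (𝕂 := ℂ) x (t : ℂ)).scomp t (Complex.ofRealCLM.hasDerivAt)
  simpa [Function.comp_def] using h

theorem exp_mul_exp_neg' (A : 𝔸) : NormedSpace.exp A * NormedSpace.exp (-A) = 1 := by
  letI : NormedAlgebra ℚ 𝔸 := NormedAlgebra.restrictScalars ℚ ℂ 𝔸
  rw [← NormedSpace.exp_add_of_commute (Commute.neg_right (Commute.refl A)), add_neg_cancel,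
    NormedSpace.exp_zero]

/-- The operator `X ↦ A X - X A`. -/
def adCLM (A : 𝔸) : 𝔸 →L[ℂ] 𝔸 :=
  ContinuousLinearMap.mul ℂ _ A - (ContinuousLinearMap.mul ℂ _).flip A

/-- The curve z(s) = exp(s ad A) X solves z' = Az - zA, so exp(-sA) z(s) exp(sA) has zero
derivative; its values at s = 0 and s = 1 are compared. -/
theorem exp_adCLM (A X : 𝔸) :
    NormedSpace.exp (adCLM A) X = NormedSpace.exp A * X * NormedSpace.exp (-A) := by
  let z : ℝ → 𝔸 := fun s => NormedSpace.exp ((s : ℂ) • adCLM A) X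
  have hz : ∀ s, HasDerivAt z (A * z s - z s * A) s := fun s => by
    exact ((ContinuousLinearMap.apply ℂ 𝔸 X).restrictScalars ℝ).hasFDerivAt.comp_hasDerivAt s
      (hasDerivAt_exp_real_smul' (adCLM A) s)
  let w : ℝ → 𝔸 := fun s =>
    NormedSpace.exp ((s : ℂ) • (-A)) * z s * NormedSpace.exp ((s : ℂ) • A)
  have hw : ∀ s, HasDerivAt w 0 s := fun s => by
    have h := ((hasDerivAt_exp_real_smul (-A) s).mul (hz s)).mul (hasDerivAt_exp_real_smul' A s)
    refine h.congr_deriv ?_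
    simp only [Pi.mul_apply]
    noncomm_ring
  have hc : w 1 = w 0 := is_const_of_deriv_eq_zero (fun s => (hw s).differentiableAt)
    (fun s => (hw s).deriv) 1 0
  have h1 : NormedSpace.exp (-A) * NormedSpace.exp (adCLM A) X * NormedSpace.exp A = X := by
    have h0 : w 0 = X := by
      simp only [w, z, Complex.ofReal_zero]
      rw [zero_smul ℂ (-A), zero_smul ℂ A, zero_smul ℂ (adCLM A), NormedSpace.exp_zero,
        NormedSpace.exp_zero, one_mul, mul_one]
      rfl
    have h1 : w 1 = NormedSpace.exp (-A) * NormedSpace.exp (adCLM A) X * NormedSpace.exp A := by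
      simp only [w, z, Complex.ofReal_one]
      rw [one_smul ℂ (-A), one_smul ℂ A, one_smul ℂ (adCLM A)]
    rw [← h1, hc, h0]
  conv_rhs => rw [← h1]
  simp only [← mul_assoc, exp_mul_exp_neg', one_mul]
  simp only [mul_assoc, exp_mul_exp_neg', mul_one]

theorem exp_clm_mem {E : Type*} [NormedAddCommGroup E] [NormedSpace ℂ E] [CompleteSpace E]
    (T : E →L[ℂ] E) (V : Submodule ℂ E) (hV : IsClosed (V : Set E)) (h : ∀ x ∈ V, T x ∈ V)
    {x : E} (hx : x ∈ V) : NormedSpace.exp T x ∈ V := by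
  have h1 : HasSum (fun j : ℕ => (((j.factorial : ℂ)⁻¹) • T ^ j) x) (NormedSpace.exp T x) :=
    (NormedSpace.exp_series_hasSum_exp' (𝕂 := ℂ) T).mapL (ContinuousLinearMap.apply ℂ E x)
  have h2 : ∀ j : ℕ, (T ^ j) x ∈ V := by
    intro j
    induction j with
    | zero => simpa
    | succ j ih => rw [pow_succ']; exact h _ ih
  refine hV.mem_of_tendsto h1 (Filter.Eventually.of_forall fun s => ?_)
  exact V.sum_mem fun j _ => V.smul_mem _ (h2 j)

/-- Compare the two exponential series term by term. With L an evaluation map, this computes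
exponentials of operators on loop spaces pointwise on the circle. -/
theorem exp_clm_intertwine {E F : Type*} [NormedAddCommGroup E] [NormedSpace ℂ E] [CompleteSpace E]
    [NormedAddCommGroup F] [NormedSpace ℂ F] [CompleteSpace F]
    (T : E →L[ℂ] E) (U : F →L[ℂ] F) (L : E →L[ℂ] F) (h : ∀ x, L (T x) = U (L x)) (x : E) :
    L (NormedSpace.exp T x) = NormedSpace.exp U (L x) := by
  have h1 : HasSum (fun j : ℕ => L ((((j.factorial : ℂ)⁻¹) • T ^ j) x)) (L (NormedSpace.exp T x)) :=
    ((NormedSpace.exp_series_hasSum_exp' (𝕂 := ℂ) T).mapL (ContinuousLinearMap.apply ℂ E x)).mapL L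
  have h2 : HasSum (fun j : ℕ => (((j.factorial : ℂ)⁻¹) • U ^ j) (L x)) (NormedSpace.exp U (L x)) :=
    (NormedSpace.exp_series_hasSum_exp' (𝕂 := ℂ) U).mapL (ContinuousLinearMap.apply ℂ F (L x))
  have h3 : ∀ j : ℕ, L ((T ^ j) x) = (U ^ j) (L x) := by
    intro j
    induction j with
    | zero => simp
    | succ j ih => rw [pow_succ', pow_succ']; exact (h _).trans (congrArg U ih)
  refine h1.unique ?_
  convert h2 using 2 with j
  rw [_root_.smul_apply, _root_.smul_apply, map_smul, h3]

theorem exp_mul_left_clm (A X : 𝔸) :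
    NormedSpace.exp (ContinuousLinearMap.mul ℂ 𝔸 A) X = NormedSpace.exp A * X := by
  have h1 : HasSum (fun j : ℕ => (((j.factorial : ℂ)⁻¹) • (ContinuousLinearMap.mul ℂ 𝔸 A) ^ j) X)
      (NormedSpace.exp (ContinuousLinearMap.mul ℂ 𝔸 A) X) :=
    (NormedSpace.exp_series_hasSum_exp' (𝕂 := ℂ) _).mapL (ContinuousLinearMap.apply ℂ 𝔸 X)
  have h2 : HasSum (fun j : ℕ => (((j.factorial : ℂ)⁻¹) • A ^ j) * X) (NormedSpace.exp A * X) :=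
    (NormedSpace.exp_series_hasSum_exp' (𝕂 := ℂ) A).mul_right X
  have h3 : ∀ j : ℕ, ((ContinuousLinearMap.mul ℂ 𝔸 A) ^ j) X = A ^ j * X := by
    intro j
    induction j with
    | zero => simp
    | succ j ih =>
      rw [pow_succ', pow_succ', mul_assoc, ← ih]
      rfl
  refine h1.unique ?_
  convert h2 using 2 with j
  rw [_root_.smul_apply, h3, smul_mul_assoc]

theorem exp_conj_mem' (V : Submodule ℂ 𝔸) (hV : IsClosed (V : Set 𝔸)) {A : 𝔸}
    (h : ∀ X ∈ V, A * X - X * A ∈ V) {X : 𝔸} (hX : X ∈ V) :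
    NormedSpace.exp A * X * NormedSpace.exp (-A) ∈ V := by
  rw [← exp_adCLM]
  exact exp_clm_mem _ V hV h hX

/-- Differentiate the commutation relation at s = 0. -/
theorem commute_of_commute_exp' {Y B : 𝔸}
    (h : ∀ s : ℝ, Commute (NormedSpace.exp ((s : ℂ) • Y)) B) : Commute Y B := by
  have h1 := (hasDerivAt_exp_real_smul Y 0).mul_const B
  have h2 := (hasDerivAt_exp_real_smul Y 0).const_mul B
  have h3 : (fun u : ℝ => NormedSpace.exp ((u : ℂ) • Y) * B) =
      fun u : ℝ => B * NormedSpace.exp ((u : ℂ) • Y) := funext fun s => h s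
  rw [h3] at h1
  have := h1.unique h2
  rw [Complex.ofReal_zero, zero_smul, NormedSpace.exp_zero, one_mul] at this
  exact this

section
variable {E : Type*} [NormedAddCommGroup E] [NormedSpace ℂ E] [CompleteSpace E]

theorem map_exp_clm_eq_conj' (T : E →L[ℂ] E) (L : E →L[ℂ] 𝔸) 
    (A : 𝔸) (h : ∀ x, L (T x) = A * L x - L x * A) (x : E) :
    L (NormedSpace.exp T x) = NormedSpace.exp A * L x * NormedSpace.exp (-A) := by
  rw [← exp_adCLM]
  exact exp_clm_intertwine T (adCLM A) L h x

theorem map_exp_clm_eq_mul' (T : E →L[ℂ] E) (L : E →L[ℂ] 𝔸) 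
    (A : 𝔸) (h : ∀ x, L (T x) = A * L x) (x : E) :
    L (NormedSpace.exp T x) = NormedSpace.exp A * L x := by
  rw [← exp_mul_left_clm]
  exact exp_clm_intertwine T (ContinuousLinearMap.mul ℂ 𝔸 A) L h x

end

end BanachAlgebra

/-! ### Matrix exponentials and their derivatives -/

section MatrixExp

attribute [-instance] LieRing.ofAssociativeRing
open scoped Matrix.Norms.Operator
open Matrix

variable {m k : Type*} [Fintype m] [DecidableEq m] [Fintype k] [DecidableEq k]

theorem hasSum_exp_matrix (A : Matrix m m ℂ) :
    HasSum (fun j : ℕ => ((j.factorial : ℂ)⁻¹) • A ^ j) (NormedSpace.exp A) :=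
  NormedSpace.exp_series_hasSum_exp' (𝕂 := ℂ) A

/-- Term by term from A^j L = L B^j. The intertwiner may be rectangular or singular, which the block
matrix arguments need. -/
theorem exp_mul_of_intertwine {A : Matrix m m ℂ} {B : Matrix k k ℂ} {L : Matrix m k ℂ}
    (h : A * L = L * B) : NormedSpace.exp A * L = L * NormedSpace.exp B := by
  let f : Matrix m m ℂ →+ Matrix m k ℂ := AddMonoidHom.mk' (fun X => X * L) (fun X Y => Matrix.add_mul X Y L)
  let g : Matrix k k ℂ →+ Matrix m k ℂ := AddMonoidHom.mk' (fun X => L * X) (fun X Y => Matrix.mul_add L X Y)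
  have h1 : HasSum (fun j : ℕ => (((j.factorial : ℂ)⁻¹) • A ^ j) * L) (NormedSpace.exp A * L) :=
    (hasSum_exp_matrix A).map f (continuous_id.matrix_mul continuous_const)
  have h2 : HasSum (fun j : ℕ => L * (((j.factorial : ℂ)⁻¹) • B ^ j)) (L * NormedSpace.exp B) :=
    (hasSum_exp_matrix B).map g (continuous_const.matrix_mul continuous_id)
  have h3 : ∀ j : ℕ, A ^ j * L = L * B ^ j := by
    intro j
    induction j with
    | zero => simp
    | succ j ih => rw [pow_succ, pow_succ, Matrix.mul_assoc, h, ← Matrix.mul_assoc, ih,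
        Matrix.mul_assoc]
  refine h1.unique ?_
  convert h2 using 2 with j
  rw [Matrix.smul_mul, Matrix.mul_smul, h3]


theorem hasDerivAt_pi_pi {m k : Type*} [Fintype m] [Fintype k] {A : ℝ → m → k → ℂ}
    {A' : m → k → ℂ} {t : ℝ} :
    HasDerivAt A A' t ↔ ∀ i j, HasDerivAt (fun s => A s i j) (A' i j) t := by
  rw [hasDerivAt_pi]
  exact forall_congr' fun i => hasDerivAt_pi

theorem hasDerivAt_matrix {A : ℝ → Matrix m k ℂ} {A' : Matrix m k ℂ} {t : ℝ} :
    HasDerivAt A A' t ↔ ∀ i j, HasDerivAt (fun s => A s i j) (A' i j) t :=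
  hasDerivAt_pi_pi

theorem hasDerivAt_matrix_unique {A : ℝ → Matrix m k ℂ} {A' A'' : Matrix m k ℂ} {t : ℝ}
    (h : HasDerivAt A A' t) (h' : HasDerivAt A A'' t) : A' = A'' := by
  ext i j
  exact (hasDerivAt_matrix.1 h i j).unique (hasDerivAt_matrix.1 h' i j)

theorem hasDerivAt_matrix_const (A : Matrix m k ℂ) (t : ℝ) : HasDerivAt (fun _ => A) 0 t :=
  hasDerivAt_matrix.2 fun i j => by simpa using hasDerivAt_const t (A i j)

theorem eq_of_hasDerivAt_matrix_zero {A : ℝ → Matrix m k ℂ} (h : ∀ t, HasDerivAt A 0 t) (s t : ℝ) :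
    A s = A t := by
  ext i j
  have h1 : ∀ t, HasDerivAt (fun s => A s i j) 0 t := fun t => by
    simpa using hasDerivAt_matrix.1 (h t) i j
  exact is_const_of_deriv_eq_zero (fun s => (h1 s).differentiableAt) (fun s => (h1 s).deriv) s t

theorem hasDerivAt_matrix_mul {l : Type*} {A : ℝ → Matrix m k ℂ} {B : ℝ → Matrix k l ℂ} {A' : Matrix m k ℂ}
    {B' : Matrix k l ℂ} {t : ℝ} [Fintype l] [DecidableEq l] (hA : HasDerivAt A A' t) (hB : HasDerivAt B B' t) :
    HasDerivAt (fun s => A s * B s) (A' * B t + A t * B') t := by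
  rw [hasDerivAt_matrix] at hA hB ⊢
  intro i j
  have : HasDerivAt (fun s => ∑ x, A s i x * B s x j) (∑ x, (A' i x * B t x j + A t i x * B' x j)) t :=
    HasDerivAt.fun_sum fun x _ => (hA i x).mul (hB x j)
  simpa [Matrix.mul_apply, Finset.sum_add_distrib] using this

theorem exp_neg_mul_exp (A : Matrix m m ℂ) : NormedSpace.exp (-A) * NormedSpace.exp A = 1 := by
  rw [← Matrix.exp_add_of_commute _ _ (Commute.neg_left (Commute.refl A)), neg_add_cancel,
    NormedSpace.exp_zero]

theorem exp_mul_exp_neg (A : Matrix m m ℂ) : NormedSpace.exp A * NormedSpace.exp (-A) = 1 := by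
  rw [← Matrix.exp_add_of_commute _ _ (Commute.neg_right (Commute.refl A)), add_neg_cancel,
    NormedSpace.exp_zero]

theorem hasDerivAt_exp_smul (X : Matrix m m ℂ) (t : ℝ) :
    HasDerivAt (fun u : ℝ => NormedSpace.exp ((u : ℂ) • X)) (NormedSpace.exp ((t : ℂ) • X) * X) t :=
  hasDerivAt_exp_real_smul X t

theorem hasDerivAt_exp_smul' (X : Matrix m m ℂ) (t : ℝ) :
    HasDerivAt (fun u : ℝ => NormedSpace.exp ((u : ℂ) • X)) (X * NormedSpace.exp ((t : ℂ) • X)) t :=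
  hasDerivAt_exp_real_smul' X t

theorem commute_of_commute_exp {Y B : Matrix m m ℂ}
    (h : ∀ s : ℝ, Commute (NormedSpace.exp ((s : ℂ) • Y)) B) : Commute Y B :=
  commute_of_commute_exp' h

theorem exp_conj_mem (V : Submodule ℂ (Matrix m m ℂ)) {A : Matrix m m ℂ}
    (h : ∀ X ∈ V, A * X - X * A ∈ V) {X : Matrix m m ℂ} (hX : X ∈ V) :
    NormedSpace.exp A * X * NormedSpace.exp (-A) ∈ V :=
  exp_conj_mem' V V.closed_of_finiteDimensional h hX

section
variable {E : Type*} [NormedAddCommGroup E] [NormedSpace ℂ E] [CompleteSpace E]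

theorem map_exp_clm_eq_conj (T : E →L[ℂ] E) (L : E →ₗ[ℂ] Matrix m m ℂ) (hL : Continuous L)
    (A : Matrix m m ℂ) (h : ∀ x, L (T x) = A * L x - L x * A) (x : E) :
    L (NormedSpace.exp T x) = NormedSpace.exp A * L x * NormedSpace.exp (-A) := by
  exact map_exp_clm_eq_conj' (𝔸 := Matrix m m ℂ) T ⟨L, hL⟩ A h x

theorem map_exp_clm_eq_mul (T : E →L[ℂ] E) (L : E →ₗ[ℂ] Matrix m m ℂ) (hL : Continuous L)
    (A : Matrix m m ℂ) (h : ∀ x, L (T x) = A * L x) (x : E) :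
    L (NormedSpace.exp T x) = NormedSpace.exp A * L x := by
  exact map_exp_clm_eq_mul' (𝔸 := Matrix m m ℂ) T ⟨L, hL⟩ A h x

end

/-- The inclusion of the first summand and the projection to the second intertwine the block matrix
with its diagonal blocks. -/
theorem exp_fromBlocks_upper (A C B : Matrix m m ℂ) : ∃ J, NormedSpace.exp (fromBlocks A C 0 B) =
    fromBlocks (NormedSpace.exp A) J 0 (NormedSpace.exp B) := by
  let e : Matrix (m ⊕ m) m ℂ := Matrix.fromRows 1 0
  let f : Matrix m (m ⊕ m) ℂ := Matrix.fromCols 0 1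
  have h1 : NormedSpace.exp (fromBlocks A C 0 B) * e = e * NormedSpace.exp A := by
    apply exp_mul_of_intertwine
    simp [e, fromBlocks_mul_fromRows, fromRows_mul]
  have h2 : NormedSpace.exp B * f = f * NormedSpace.exp (fromBlocks A C 0 B) := by
    apply exp_mul_of_intertwine
    simp [f, fromCols_mul_fromBlocks, mul_fromCols]
  rw [← Matrix.fromBlocks_toBlocks (NormedSpace.exp (fromBlocks A C 0 B))] at h1 h2 ⊢
  simp only [e, fromBlocks_mul_fromRows, fromRows_mul, Matrix.mul_one, Matrix.mul_zero, add_zero,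
    Matrix.one_mul, Matrix.zero_mul] at h1
  simp only [f, fromCols_mul_fromBlocks, mul_fromCols, Matrix.mul_one, Matrix.mul_zero, zero_add,
    Matrix.one_mul, Matrix.zero_mul] at h2
  have h1' := fromRows_inj h1
  have h2' := fromCols_inj h2
  exact ⟨_, by rw [h1'.1, h1'.2, ← h2'.2]⟩

/-- The column (1, r) intertwines the block matrix with B, because A + (B - A) = B. Hence a
difference quotient in the corner exponentiates to the difference quotient of the exponentials, and
letting r tend to 0 differentiates exp along a curve. -/
theorem exp_fromBlocks_slope (A B : Matrix m m ℂ) {r : ℂ} (hr : r ≠ 0) :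
    NormedSpace.exp (fromBlocks A (r⁻¹ • (B - A)) 0 B) =
      fromBlocks (NormedSpace.exp A) (r⁻¹ • (NormedSpace.exp B - NormedSpace.exp A)) 0
        (NormedSpace.exp B) := by
  obtain ⟨J, hJ⟩ := exp_fromBlocks_upper A (r⁻¹ • (B - A)) B
  let e : Matrix (m ⊕ m) m ℂ := Matrix.fromRows 1 (r • (1 : Matrix m m ℂ))
  have h1 : NormedSpace.exp (fromBlocks A (r⁻¹ • (B - A)) 0 B) * e = e * NormedSpace.exp B := by
    apply exp_mul_of_intertwine
    simp [e, fromBlocks_mul_fromRows, fromRows_mul, smul_smul, hr]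
  rw [hJ] at h1
  simp only [e, fromBlocks_mul_fromRows, fromRows_mul, Matrix.mul_one, Matrix.one_mul,
    Matrix.mul_smul] at h1
  have h2 := (fromRows_inj h1).1
  rw [hJ, ← h2, add_sub_cancel_left, smul_smul, inv_mul_cancel₀ hr, one_smul]

theorem continuous_exp_matrix : Continuous fun X : Matrix m m ℂ => NormedSpace.exp X :=
  NormedSpace.exp_continuous

theorem continuous_toBlocks_exp (A : Matrix m m ℂ) : Continuous fun p : Matrix m m ℂ × Matrix m m ℂ =>
    (NormedSpace.exp (fromBlocks A p.1 0 p.2)).toBlocks₁₂ := by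
  have hd : Continuous fun p : Matrix m m ℂ × Matrix m m ℂ => fromBlocks A p.1 0 p.2 :=
    Continuous.matrix_fromBlocks continuous_const continuous_fst continuous_const continuous_snd
  exact (continuous_exp_matrix.comp hd).matrix_submatrix _ _

theorem tendsto_toBlocks_exp {A A' B' : Matrix m m ℂ} {ι : Type*} {l : Filter ι}
    {f g : ι → Matrix m m ℂ} (hf : Filter.Tendsto f l (𝓝 A')) (hg : Filter.Tendsto g l (𝓝 B')) :
    Filter.Tendsto (fun s => (NormedSpace.exp (fromBlocks A (f s) 0 (g s))).toBlocks₁₂) l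
      (𝓝 (NormedSpace.exp (fromBlocks A A' 0 B')).toBlocks₁₂) :=
  ((continuous_toBlocks_exp A).tendsto (A', B')).comp (hf.prodMk_nhds hg)

/-- The derivative of `exp (A t)` is an off-diagonal block of the exponential of a block matrix. -/
theorem hasDerivAt_exp_comp {A : ℝ → Matrix m m ℂ} {A' : Matrix m m ℂ} {t : ℝ}
    (h : HasDerivAt A A' t) :
    HasDerivAt (fun s => NormedSpace.exp (A s))
      (NormedSpace.exp (fromBlocks (A t) A' 0 (A t))).toBlocks₁₂ t := by
  rw [hasDerivAt_matrix] at h ⊢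
  have hs : Filter.Tendsto (fun s => ((s - t : ℝ) : ℂ)⁻¹ • (A s - A t)) (𝓝[≠] t) (𝓝 A') := by
    refine tendsto_pi_nhds.2 fun i => tendsto_pi_nhds.2 fun j => ?_
    refine ((hasDerivAt_iff_tendsto_slope.1 (h i j)).congr fun s => ?_)
    simp [slope_def_module]
  have hA : Filter.Tendsto A (𝓝[≠] t) (𝓝 (A t)) := by
    refine tendsto_pi_nhds.2 fun i => tendsto_pi_nhds.2 fun j => ?_
    exact (h i j).continuousAt.tendsto.mono_left nhdsWithin_le_nhds
  -- Continuity of exp on block matrices passes to the limit of the slopes in the corner.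
  have hB : Filter.Tendsto (fun s => (NormedSpace.exp
      (fromBlocks (A t) (((s - t : ℝ) : ℂ)⁻¹ • (A s - A t)) 0 (A s))).toBlocks₁₂)
      (𝓝[≠] t) (𝓝 (NormedSpace.exp (fromBlocks (A t) A' 0 (A t))).toBlocks₁₂) := by
    exact tendsto_toBlocks_exp hs hA
  intro i j
  rw [hasDerivAt_iff_tendsto_slope]
  refine (tendsto_pi_nhds.1 (tendsto_pi_nhds.1 hB i) j).congr' ?_
  filter_upwards [self_mem_nhdsWithin] with s hs
  have hs' : ((s - t : ℝ) : ℂ) ≠ 0 := by exact_mod_cast sub_ne_zero.2 hs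
  rw [exp_fromBlocks_slope _ _ hs', toBlocks_fromBlocks₁₂]
  simp [slope_def_module]

theorem exp_fromBlocks_diag (A C : Matrix m m ℂ) :
    NormedSpace.exp (fromBlocks A C 0 A) = fromBlocks (NormedSpace.exp A)
      (NormedSpace.exp (fromBlocks A C 0 A)).toBlocks₁₂ 0 (NormedSpace.exp A) := by
  obtain ⟨J, hJ⟩ := exp_fromBlocks_upper A C A
  rw [hJ, toBlocks_fromBlocks₁₂]

/-- The derivative of det exp(sX) at s = 0 is the trace of X, and the one-parameter group law
carries this to every s. -/
theorem det_exp_of_trace_eq_zero {X : Matrix m m ℂ} (hX : X.trace = 0) :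
    (NormedSpace.exp X).det = 1 := by
  have h0 : HasDerivAt (fun s : ℝ => (NormedSpace.exp ((s : ℂ) • X)).det) 0 0 := by
    have h1 := hasDerivAt_matrix.1 (hasDerivAt_exp_smul X 0)
    have h2 : HasDerivAt (fun s : ℝ => ∑ σ : Equiv.Perm m, ((Equiv.Perm.sign σ : ℤ) : ℂ) *
        ∏ i, (NormedSpace.exp ((s : ℂ) • X)) (σ i) i)
        (∑ σ : Equiv.Perm m, ((Equiv.Perm.sign σ : ℤ) : ℂ) *
          ∑ i, (∏ j ∈ Finset.univ.erase i, (1 : Matrix m m ℂ) (σ j) j) • X (σ i) i) 0 := by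
      refine HasDerivAt.fun_sum fun σ _ => HasDerivAt.const_mul _ ?_
      have := HasDerivAt.fun_finsetProd (u := Finset.univ) (x := (0 : ℝ))
        (f := fun i s => (NormedSpace.exp ((s : ℂ) • X)) (σ i) i)
        (f' := fun i => X (σ i) i) (fun i _ => by
          have h5 := h1 (σ i) i
          rw [Complex.ofReal_zero, zero_smul, NormedSpace.exp_zero, one_mul] at h5
          exact h5)
      simpa [NormedSpace.exp_zero] using this
    have h3 : (∑ σ : Equiv.Perm m, ((Equiv.Perm.sign σ : ℤ) : ℂ) *
          ∑ i, (∏ j ∈ Finset.univ.erase i, (1 : Matrix m m ℂ) (σ j) j) • X (σ i) i) = 0 := by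
      rw [Finset.sum_eq_single 1]
      · simpa [Matrix.trace, Matrix.one_apply] using hX
      · intro σ _ hσ
        rw [Finset.sum_eq_zero, mul_zero]
        intro i _
        -- A permutation other than the identity moves at least two points, so one different from i
        -- remains and contributes a zero entry of the identity matrix.
        obtain ⟨j, hji, hj⟩ : ∃ j, j ≠ i ∧ σ j ≠ j := by
          by_contra! hc
          apply hσ
          ext j
          by_cases hj : j = i
          · subst hj
            by_contra hne
            exact hne (σ.injective (hc _ hne))
          · exact hc j hj
        rw [Finset.prod_eq_zero (i := j) (by simp [hji]) (by simp [hj]), zero_smul]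
      · simp
    rw [h3] at h2
    simpa only [Matrix.det_apply'] using h2
  have h1 : ∀ t : ℝ, HasDerivAt (fun s : ℝ => (NormedSpace.exp ((s : ℂ) • X)).det) 0 t := by
    intro t
    have h2 : HasDerivAt (fun s : ℝ => (NormedSpace.exp (((s - t : ℝ) : ℂ) • X)).det) 0 t := by
      have := HasDerivAt.comp_sub_const t t (by simpa using h0)
      exact this
    have h3 := h2.const_mul (NormedSpace.exp ((t : ℂ) • X)).det
    rw [mul_zero] at h3
    refine h3.congr_of_eventuallyEq (Filter.Eventually.of_forall fun s => ?_)
    beta_reduce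
    rw [← Matrix.det_mul, ← Matrix.exp_add_of_commute, ← add_smul]
    · congr 3
      push_cast
      ring
    · exact ((Commute.refl X).smul_left _).smul_right _
  have := is_const_of_deriv_eq_zero (fun s => (h1 s).differentiableAt) (fun s => (h1 s).deriv) 1 0
  simpa [NormedSpace.exp_zero] using this

end MatrixExp

/-! ### Normal matrices -/

section Normal

open Matrix
open scoped ComplexOrder

variable {m : Type*} [Fintype m] [DecidableEq m]

/-- A normal matrix similar to a real diagonal matrix is Hermitian. -/
theorem conjTranspose_eq_of_normal {A P : Matrix m m ℂ} {d : m → ℝ} (hP : IsUnit P)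
    (hA : A * P = P * Matrix.diagonal fun i => (d i : ℂ)) (hn : Commute A Aᴴ) : Aᴴ = A := by
  -- For the normal matrix B = A - r one has ‖Bᴴv‖ = ‖Bv‖, so A and Aᴴ share eigenvectors, with the
  -- same eigenvalue since r is real.
  have key : ∀ (r : ℝ) (v : m → ℂ), A *ᵥ v = (r : ℂ) • v → Aᴴ *ᵥ v = (r : ℂ) • v := by
    intro r v hv
    set B : Matrix m m ℂ := A - (r : ℂ) • 1 with hB
    have hBv : B *ᵥ v = 0 := by simp [hB, sub_mulVec, hv, smul_mulVec]
    have hBB : Bᴴ = Aᴴ - (r : ℂ) • 1 := by simp [hB, conjTranspose_sub, conjTranspose_smul]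
    have hcomm : B * Bᴴ = Bᴴ * B := by
      rw [hBB, hB]
      have := hn.eq
      simp only [sub_mul, mul_sub, smul_mul_assoc, one_mul, mul_smul_comm, mul_one, this, smul_sub]
      abel
    have h2 : star (Bᴴ *ᵥ v) ⬝ᵥ (Bᴴ *ᵥ v) = 0 := by
      rw [star_mulVec, conjTranspose_conjTranspose, ← dotProduct_mulVec, mulVec_mulVec, hcomm,
        ← mulVec_mulVec, hBv, mulVec_zero, dotProduct_zero]
    have h3 : Bᴴ *ᵥ v = 0 := dotProduct_star_self_eq_zero.1 h2
    rw [hBB, sub_mulVec, sub_eq_zero] at h3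
    simpa [smul_mulVec] using h3
  have hAP : Aᴴ * P = A * P := by
    rw [hA]
    ext i j
    have h1 : A *ᵥ (P.col j) = (d j : ℂ) • P.col j := by
      ext i
      have := congrFun (congrFun hA i) j
      rw [Matrix.mul_diagonal, mul_comm] at this
      simpa [Matrix.mul_apply, mulVec, dotProduct] using this
    have := congrFun (key _ _ h1) i
    rw [Matrix.mul_diagonal, mul_comm (P i j)]
    simpa [Matrix.mul_apply, mulVec, dotProduct] using this
  exact hP.mul_left_injective hAP

end Normal

/-! ### Uniqueness of the polar decomposition -/

section Polar

open Matrix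
open scoped Matrix.Norms.L2Operator

variable {m : Type*} [Fintype m] [DecidableEq m]

/-- The logarithm of the continuous functional calculus inverts exp on self-adjoint elements. -/
theorem exp_injective_of_hermitian {S T : Matrix m m ℂ} (hS : Sᴴ = S) (hT : Tᴴ = T)
    (h : NormedSpace.exp S = NormedSpace.exp T) : S = T := by
  rw [← CFC.log_exp S hS, h, CFC.log_exp T hT]

/-- For g = k exp(S) one has gᴴg = exp(2S), which determines S and then k. -/
theorem polar_unique {k k' S T : Matrix m m ℂ} (hk : kᴴ * k = 1) (hk' : k'ᴴ * k' = 1)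
    (hS : Sᴴ = S) (hT : Tᴴ = T) (h : k * NormedSpace.exp S = k' * NormedSpace.exp T) : k = k' := by
  have h1 : ∀ {k S : Matrix m m ℂ}, kᴴ * k = 1 → Sᴴ = S →
      (k * NormedSpace.exp S)ᴴ * (k * NormedSpace.exp S) = NormedSpace.exp ((2 : ℂ) • S) := by
    intro k S hk hS
    rw [conjTranspose_mul, ← Matrix.exp_conjTranspose, hS, Matrix.mul_assoc, ← Matrix.mul_assoc kᴴ,
      hk, Matrix.one_mul, ← Matrix.exp_add_of_commute _ _ (Commute.refl S), two_smul]
  have h2 : NormedSpace.exp ((2 : ℂ) • S) = NormedSpace.exp ((2 : ℂ) • T) := by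
    rw [← h1 hk hS, ← h1 hk' hT, h]
  have h3 := exp_injective_of_hermitian (by simp [conjTranspose_smul, hS])
    (by simp [conjTranspose_smul, hT]) h2
  have h4 : S = T := smul_right_injective _ (two_ne_zero (α := ℂ)) h3
  rw [h4] at h
  exact (Matrix.isUnit_exp T).mul_left_injective h

end Polar

/-! ### The Lie algebra, its group and the adjoint action -/

namespace ChevalleyData

variable {n l : ℕ} (S : ChevalleyData n l)

/-- Weights of the adjoint representation. -/
abbrev Wt : Type := LieModule.Weight ℂ S.𝔥 S.𝔤

theorem coe_lie (X Y : S.𝔤) : ((⁅X, Y⁆ : S.𝔤) : Matrix (Fin n) (Fin n) ℂ) =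
    (X : Matrix (Fin n) (Fin n) ℂ) * Y - (Y : Matrix (Fin n) (Fin n) ℂ) * X := by
  rw [LieSubalgebra.coe_bracket, Ring.lie_def]

theorem lie_coroot_E (h : S.𝔥) {α : S.Wt} (hα : α.IsNonZero) :
    ⁅(h : S.𝔤), S.E α⁆ = α h • S.E α :=
  LieAlgebra.IsKilling.lie_eq_smul_of_mem_rootSpace (S.E_mem α hα) h

theorem coroot_ne_zero {α : S.Wt} (hα : α.IsNonZero) :
    ((LieAlgebra.IsKilling.coroot α : S.𝔥) : S.𝔤) ≠ 0 := by
  intro h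
  rw [ZeroMemClass.coe_eq_zero, LieAlgebra.IsKilling.coroot_eq_zero_iff] at h
  exact hα h

theorem E_ne_zero {α : S.Wt} (hα : α.IsNonZero) : S.E α ≠ 0 := by
  intro h
  have := S.E_lie_neg α hα
  rw [h, zero_lie] at this
  exact S.coroot_ne_zero hα this.symm

theorem isSl2Triple {α : S.Wt} (hα : α.IsNonZero) :
    IsSl2Triple ((LieAlgebra.IsKilling.coroot α : S.𝔥) : S.𝔤) (S.E α) (S.E (-α)) where
  h_ne_zero := S.coroot_ne_zero hα
  lie_e_f := S.E_lie_neg α hα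
  lie_h_e_nsmul := by
    rw [lie_coroot_E _ _ hα, LieAlgebra.IsKilling.root_apply_coroot hα, ← Nat.cast_smul_eq_nsmul ℂ]
    norm_num
  lie_h_f_nsmul := by
    rw [lie_coroot_E _ _ (LieModule.Weight.IsNonZero.neg hα)]
    simp only [LieModule.Weight.coe_neg, Pi.neg_apply]
    rw [LieAlgebra.IsKilling.root_apply_coroot hα, ← Nat.cast_smul_eq_nsmul ℂ, neg_smul]
    norm_num

theorem span_coroot : Submodule.span ℂ
    {h : S.𝔥 | ∃ α : S.Wt, α.IsNonZero ∧ h = LieAlgebra.IsKilling.coroot α} = ⊤ := by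
  rw [eq_top_iff, ← RootPairing.IsRootSystem.span_coroot_eq_top
    (P := LieAlgebra.IsKilling.rootSystem S.𝔥)]
  refine Submodule.span_mono ?_
  rintro _ ⟨α, rfl⟩
  exact ⟨α.1, LieSubalgebra.isNonZero_coe_root α, rfl⟩

theorem cartan_induction {p : S.𝔥 → Prop} (h0 : p 0) (hadd : ∀ x y, p x → p y → p (x + y))
    (hsmul : ∀ (c : ℂ) x, p x → p (c • x))
    (hc : ∀ α : S.Wt, α.IsNonZero → p (LieAlgebra.IsKilling.coroot α)) (x : S.𝔥) : p x := by
  have hx : x ∈ Submodule.span ℂ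
    {h : S.𝔥 | ∃ α : S.Wt, α.IsNonZero ∧ h = LieAlgebra.IsKilling.coroot α} := by
    rw [span_coroot]; trivial
  induction hx using Submodule.span_induction with
  | mem x h => obtain ⟨α, hα, rfl⟩ := h; exact hc α hα
  | zero => exact h0
  | add x y _ _ hx hy => exact hadd _ _ hx hy
  | smul c x _ hx => exact hsmul c _ hx

/-- This is the root space decomposition: the zero root space is 𝔥, and every other root space is a
line, spanned by `E α`. -/
theorem algebra_induction {p : S.𝔤 → Prop} (hadd : ∀ x y, p x → p y → p (x + y))
    (hsmul : ∀ (c : ℂ) x, p x → p (c • x)) (hh : ∀ h : S.𝔥, p h)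
    (hE : ∀ α : S.Wt, α.IsNonZero → p (S.E α)) (x : S.𝔤) : p x := by
  have h0 : p 0 := by simpa using hh 0
  let V : Submodule ℂ S.𝔤 :=
    { carrier := {x | p x}
      add_mem' := fun ha hb => hadd _ _ ha hb
      zero_mem' := h0
      smul_mem' := fun c x hx => hsmul c x hx }
  have htop : (⊤ : Submodule ℂ S.𝔤) ≤ V := by
    have h1 := congrArg LieSubmodule.toSubmodule (LieModule.iSup_genWeightSpace_eq_top' ℂ S.𝔥 S.𝔤)
    rw [LieSubmodule.top_toSubmodule, LieSubmodule.iSup_toSubmodule] at h1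
    rw [← h1, iSup_le_iff]
    intro α y hy
    by_cases hα : α.IsZero
    · have h2 : y ∈ LieAlgebra.rootSpace S.𝔥 (0 : S.𝔥 → ℂ) := by
        rw [← hα.eq]
        exact hy
      have h3 : y ∈ LieAlgebra.zeroRootSubalgebra ℂ S.𝔤 S.𝔥 := h2
      rw [LieAlgebra.zeroRootSubalgebra_eq_of_is_cartan] at h3
      exact hh ⟨y, h3⟩
    · have h2 := LieAlgebra.IsKilling.finrank_rootSpace_eq_one α hα
      obtain ⟨c, hc⟩ := (finrank_eq_one_iff_of_nonzero'
        (⟨S.E α, S.E_mem α hα⟩ : LieAlgebra.rootSpace S.𝔥 α) (by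
          intro h
          exact S.E_ne_zero hα (congrArg Subtype.val h))).1 h2 ⟨y, hy⟩
      have h3 : c • S.E α = y := congrArg Subtype.val hc
      rw [← h3]
      exact hsmul c _ (hE α hα)
  exact htop trivial

theorem span_lie_eq_top : (⁅(⊤ : LieIdeal ℂ S.𝔤), (⊤ : LieIdeal ℂ S.𝔤)⁆ : LieIdeal ℂ S.𝔤) = ⊤ := by
  rcases LieAlgebra.IsSimple.eq_bot_or_eq_top (R := ℂ)
    (⁅(⊤ : LieIdeal ℂ S.𝔤), (⊤ : LieIdeal ℂ S.𝔤)⁆ : LieIdeal ℂ S.𝔤) with h | h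
  · exfalso
    refine LieAlgebra.IsSimple.non_abelian (R := ℂ) (L := S.𝔤) ⟨fun x y => ?_⟩
    have := LieSubmodule.lie_mem_lie (I := (⊤ : LieIdeal ℂ S.𝔤)) (N := (⊤ : LieIdeal ℂ S.𝔤))
      (x := x) (m := y) trivial trivial
    rw [h] at this
    simpa using this
  · exact h

/-- A simple Lie algebra is spanned by commutators, which have trace zero. So exponentials of
elements of 𝔤 have determinant one. -/
theorem trace_eq_zero (X : S.𝔤) : (X : Matrix (Fin n) (Fin n) ℂ).trace = 0 := by
  have hX : X ∈ (⁅(⊤ : LieIdeal ℂ S.𝔤), (⊤ : LieIdeal ℂ S.𝔤)⁆ : LieIdeal ℂ S.𝔤) := by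
    rw [span_lie_eq_top]; trivial
  rw [← LieSubmodule.mem_toSubmodule, LieSubmodule.lieIdeal_oper_eq_linear_span'] at hX
  induction hX using Submodule.span_induction with
  | mem x h =>
    obtain ⟨y, -, z, -, rfl⟩ := h
    rw [coe_lie, Matrix.trace_sub, Matrix.trace_mul_comm, sub_self]
  | zero => simp
  | add x y _ _ hx hy => simp [Matrix.trace_add, hx, hy]
  | smul c x _ hx => simp [Matrix.trace_smul, hx]

theorem det_exp (X : S.𝔤) :
    (NormedSpace.exp (X : Matrix (Fin n) (Fin n) ℂ)).det = 1 :=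
  det_exp_of_trace_eq_zero (S.trace_eq_zero X)

/-- The exponential map `𝔤 → G`. -/
def expG (X : S.𝔤) : S.G :=
  ⟨⟨NormedSpace.exp (X : Matrix (Fin n) (Fin n) ℂ), S.det_exp X⟩,
    Subgroup.subset_closure ⟨X, X.2, rfl⟩⟩

theorem mat_expG (X : S.𝔤) : S.mat (S.expG X) = NormedSpace.exp (X : Matrix (Fin n) (Fin n) ℂ) :=
  rfl

theorem mat_mul (g h : S.G) : S.mat (g * h) = S.mat g * S.mat h := rfl

theorem mat_one : S.mat 1 = 1 := rfl

theorem mat_injective : Function.Injective S.mat := fun g h hgh => Subtype.ext (Subtype.ext hgh)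

theorem mat_inv_mul (g : S.G) : S.mat g⁻¹ * S.mat g = 1 := by
  rw [← mat_mul, inv_mul_cancel, mat_one]

theorem mat_mul_inv (g : S.G) : S.mat g * S.mat g⁻¹ = 1 := by
  rw [← mat_mul, mul_inv_cancel, mat_one]

theorem mat_inv (g : S.G) : S.mat g⁻¹ = (S.mat g)⁻¹ :=
  (Matrix.inv_eq_left_inv (S.mat_inv_mul g)).symm

theorem isUnit_mat (g : S.G) : IsUnit (S.mat g) :=
  ⟨⟨S.mat g, S.mat g⁻¹, S.mat_mul_inv g, S.mat_inv_mul g⟩, rfl⟩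

theorem expG_neg (X : S.𝔤) : S.expG (-X) = (S.expG X)⁻¹ := by
  apply S.mat_injective
  rw [mat_inv, mat_expG, mat_expG, ← Matrix.exp_neg]
  rfl

theorem G_induction {p : S.G → Prop} (hexp : ∀ X : S.𝔤, p (S.expG X))
    (hmul : ∀ g h, p g → p h → p (g * h)) (g : S.G) : p g := by
  -- Carrying g and g⁻¹ along together handles the inverse case: inverses of the generators exp(X)
  -- are again generators.
  have h1 : ∀ (g : Matrix.SpecialLinearGroup (Fin n) ℂ) (hg : g ∈ S.G),
      p ⟨g, hg⟩ ∧ p ⟨g⁻¹, S.G.inv_mem hg⟩ := by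
    intro g hg
    unfold ChevalleyData.G expSubgroup at hg
    induction hg using Subgroup.closure_induction with
    | mem x hx =>
      obtain ⟨X, hX, hxX⟩ := hx
      have h2 : ∀ h, (⟨x, h⟩ : S.G) = S.expG ⟨X, hX⟩ := fun h => S.mat_injective hxX
      have h3 : ∀ h, (⟨x⁻¹, h⟩ : S.G) = S.expG (-⟨X, hX⟩) := fun h => by
        rw [expG_neg, ← h2 (Subgroup.subset_closure ⟨X, hX, hxX⟩)]
        rfl
      exact ⟨(congrArg p (h2 _)).mpr (hexp _), (congrArg p (h3 _)).mpr (hexp _)⟩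
    | one =>
      have h2 : ∀ h, (⟨1, h⟩ : S.G) = S.expG 0 := fun h => by
        apply S.mat_injective
        rw [mat_expG]
        simp [NormedSpace.exp_zero, mat]
      have h3 : ∀ h, (⟨1⁻¹, h⟩ : S.G) = S.expG 0 := fun h => by
        apply S.mat_injective
        rw [mat_expG]
        simp [NormedSpace.exp_zero, mat]
      exact ⟨(congrArg p (h2 _)).mpr (hexp _), (congrArg p (h3 _)).mpr (hexp _)⟩
    | mul x y hx hy h1 h2 =>
      refine ⟨hmul _ _ h1.1 h2.1, ?_⟩
      have h3 := hmul _ _ h2.2 h1.2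
      have h4 : ∀ h, (⟨(x * y)⁻¹, h⟩ : S.G) = ⟨y⁻¹, S.G.inv_mem hy⟩ * ⟨x⁻¹, S.G.inv_mem hx⟩ := by
        intro h
        apply Subtype.ext
        simp
      rw [h4]
      exact h3
    | inv x hx h =>
      refine ⟨h.2, ?_⟩
      have h4 : ∀ h', (⟨x⁻¹⁻¹, h'⟩ : S.G) = ⟨x, hx⟩ := fun h' => Subtype.ext (inv_inv x)
      rw [h4]
      exact h.1
  exact (h1 g.1 g.2).1

theorem conj_mem (g : S.G) (X : S.𝔤) : S.mat g * (X : Matrix (Fin n) (Fin n) ℂ) * S.mat g⁻¹ ∈ S.𝔤 := by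
  induction g using S.G_induction generalizing X with
  | hexp Y =>
    rw [← expG_neg, mat_expG, mat_expG]
    refine exp_conj_mem S.𝔤.toSubmodule (fun Z hZ => ?_) X.2
    have := (⁅Y, ⟨Z, hZ⟩⁆ : S.𝔤).2
    rwa [coe_lie] at this
  | hmul g h hg hh =>
    have := hg ⟨_, hh X⟩
    rw [mul_inv_rev, mat_mul, mat_mul]
    simpa only [Matrix.mul_assoc] using this

/-- The adjoint action of `G` on `𝔤`. -/
def Ad (g : S.G) : S.𝔤 ≃ₗ⁅ℂ⁆ S.𝔤 where
  toFun X := ⟨S.mat g * X * S.mat g⁻¹, S.conj_mem g X⟩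
  invFun X := ⟨S.mat g⁻¹ * X * S.mat g, by simpa using S.conj_mem g⁻¹ X⟩
  map_add' X Y := Subtype.ext (by simp [mul_add, add_mul])
  map_smul' c X := Subtype.ext (by simp)
  map_lie' {X Y} := Subtype.ext (by
    simp only [coe_lie]
    have h := S.mat_inv_mul g
    calc _ = S.mat g * (X * 1 * Y) * S.mat g⁻¹ - S.mat g * (Y * 1 * X) * S.mat g⁻¹ := by
            noncomm_ring
      _ = _ := by rw [← h]; noncomm_ring)
  left_inv X := Subtype.ext (by
    have h := S.mat_inv_mul g
    simp only [← mul_assoc, h, one_mul]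
    simp only [mul_assoc, h, mul_one])
  right_inv X := Subtype.ext (by
    have h := S.mat_mul_inv g
    simp only [← mul_assoc, h, one_mul]
    simp only [mul_assoc, h, mul_one])

theorem coe_Ad (g : S.G) (X : S.𝔤) : ((S.Ad g X : S.𝔤) : Matrix (Fin n) (Fin n) ℂ) =
    S.mat g * X * S.mat g⁻¹ := rfl

theorem killingForm_Ad (g : S.G) (X Y : S.𝔤) :
    killingForm ℂ S.𝔤 (S.Ad g X) (S.Ad g Y) = killingForm ℂ S.𝔤 X Y :=
  LieAlgebra.killingForm_of_equiv_apply _ X Y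

/-- An element commuting with 𝔥 normalizes it, and a Cartan subalgebra is its own normalizer. -/
theorem mem_cartan_of_commute {Y : S.𝔤} (h : ∀ x : S.𝔥, Commute (Y : Matrix (Fin n) (Fin n) ℂ) (x : S.𝔤)) :
    Y ∈ S.𝔥 := by
  have h1 : Y ∈ S.𝔥.normalizer := by
    rw [LieSubalgebra.mem_normalizer_iff]
    intro y hy
    have h2 : ⁅Y, y⁆ = 0 := Subtype.ext (by
      rw [coe_lie, (h ⟨y, hy⟩).eq, sub_self]
      rfl)
    rw [h2]
    exact S.𝔥.zero_mem
  rwa [LieSubalgebra.IsCartanSubalgebra.self_normalizing] at h1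

theorem cartan_commute (x y : S.𝔥) : Commute ((x : S.𝔤) : Matrix (Fin n) (Fin n) ℂ) (y : S.𝔤) := by
  have h : ⁅x, y⁆ = 0 := trivial_lie_zero _ _ x y
  have h2 := S.coe_lie (x : S.𝔤) (y : S.𝔤)
  rw [← LieSubalgebra.coe_bracket, h] at h2
  exact (sub_eq_zero.1 h2.symm)

/-- As 𝔥 is abelian, products and inverses of exponentials of its elements are again such
exponentials. -/
theorem mem_cartanSubgroup {g : S.G} : g ∈ S.cartanSubgroup ↔ ∃ h : S.𝔥, g = S.expG h := by
  constructor
  · intro hg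
    rw [cartanSubgroup, Subgroup.mem_subgroupOf, expSubgroup] at hg
    have key : ∀ x ∈ Subgroup.closure {g : Matrix.SpecialLinearGroup (Fin n) ℂ | ∃ X ∈ S.𝔥mat,
      (g : Matrix (Fin n) (Fin n) ℂ) = NormedSpace.exp X}, ∃ h : S.𝔥, x = (S.expG h).1 := by
      intro x hx
      induction hx using Subgroup.closure_induction with
      | mem x hx =>
        obtain ⟨_, ⟨h, rfl⟩, hx⟩ := hx
        exact ⟨h, Subtype.ext hx⟩
      | one => exact ⟨0, Subtype.ext (by simp [expG, NormedSpace.exp_zero])⟩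
      | mul x y _ _ hx hy =>
        obtain ⟨a, rfl⟩ := hx
        obtain ⟨b, rfl⟩ := hy
        refine ⟨a + b, Subtype.ext ?_⟩
        exact (Matrix.exp_add_of_commute _ _ (S.cartan_commute a b)).symm
      | inv x _ hx =>
        obtain ⟨a, rfl⟩ := hx
        exact ⟨-a, (congrArg Subtype.val (S.expG_neg a)).symm⟩
    obtain ⟨h, hh⟩ := key _ hg
    exact ⟨h, Subtype.ext hh⟩
  · rintro ⟨h, rfl⟩
    rw [cartanSubgroup, Subgroup.mem_subgroupOf]
    exact Subgroup.subset_closure ⟨_, ⟨h, rfl⟩, rfl⟩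

end ChevalleyData

/-! ### Conjugate transpose on 𝔤 and positivity of the Killing form -/

namespace ChevalleyData

variable {n l : ℕ} (S : ChevalleyData n l)

open Matrix

theorem Emat_eq (α : S.Wt) : S.Emat α = (S.E α : Matrix (Fin n) (Fin n) ℂ) := rfl

theorem Hmat_mem_𝔞 {α : S.Wt} (hα : α.IsNonZero) : S.Hmat α ∈ S.𝔞 :=
  Submodule.subset_span ⟨α, hα, rfl⟩

theorem mem_algebra_of_mem_𝔨 {X : Matrix (Fin n) (Fin n) ℂ} (hX : X ∈ S.𝔨) : X ∈ S.𝔤 := by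
  unfold ChevalleyData.𝔨 at hX
  induction hX using Submodule.span_induction with
  | mem x h =>
    obtain ⟨α, hα, rfl | rfl | rfl⟩ := h
    · exact S.𝔤.smul_mem _ (Subtype.mem _)
    · exact S.𝔤.sub_mem (Subtype.mem _) (Subtype.mem _)
    · exact S.𝔤.smul_mem _ (S.𝔤.add_mem (Subtype.mem _) (Subtype.mem _))
  | zero => exact S.𝔤.zero_mem
  | add x y _ _ hx hy => exact S.𝔤.add_mem hx hy
  | smul c x _ hx => 
    have : (c • x) = ((c : ℂ) • x) := by ext; simp
    rw [this]
    exact S.𝔤.smul_mem _ hx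

theorem mem_algebra_of_mem_𝔞 {X : Matrix (Fin n) (Fin n) ℂ} (hX : X ∈ S.𝔞) :
    ∃ h : S.𝔥, X = (h : S.𝔤) := by
  unfold ChevalleyData.𝔞 at hX
  induction hX using Submodule.span_induction with
  | mem x h =>
    obtain ⟨α, hα, rfl⟩ := h
    exact ⟨_, rfl⟩
  | zero => exact ⟨0, rfl⟩
  | add x y _ _ hx hy => 
    obtain ⟨a, rfl⟩ := hx
    obtain ⟨b, rfl⟩ := hy
    exact ⟨a + b, rfl⟩
  | smul c x _ hx => 
    obtain ⟨a, rfl⟩ := hx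
    refine ⟨(c : ℂ) • a, ?_⟩
    ext; simp

theorem ofReal_smul_matrix (s : ℝ) (X : Matrix (Fin n) (Fin n) ℂ) : (s : ℂ) • X = s • X := by
  ext; simp

variable {S}

/-- Differentiate the unitarity of exp(sX) at s = 0. -/
theorem conjTranspose_of_mem_𝔨 (hS : S.IsAdmissible) {X : Matrix (Fin n) (Fin n) ℂ} (hX : X ∈ S.𝔨) :
    Xᴴ = -X := by
  have hu : ∀ s : ℝ, (NormedSpace.exp ((s : ℂ) • X))ᴴ * NormedSpace.exp ((s : ℂ) • X) = 1 := by
    intro s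
    have hs : (s : ℂ) • X ∈ S.𝔨 := by
      rw [ofReal_smul_matrix]
      exact S.𝔨.smul_mem s hX
    exact hS.K_le ⟨_, S.det_exp ⟨_, S.mem_algebra_of_mem_𝔨 hs⟩⟩ (Subgroup.subset_closure ⟨_, hs, rfl⟩)
  have h1 : HasDerivAt (fun s : ℝ => (NormedSpace.exp ((s : ℂ) • Xᴴ))) (Xᴴ) 0 := by
    simpa [NormedSpace.exp_zero] using hasDerivAt_exp_smul Xᴴ 0
  have h2 : HasDerivAt (fun s : ℝ => (NormedSpace.exp ((s : ℂ) • X))) (X) 0 := by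
    simpa [NormedSpace.exp_zero] using hasDerivAt_exp_smul X 0
  have h3 := hasDerivAt_matrix_mul h1 h2
  have h4 : (fun s : ℝ => NormedSpace.exp ((s : ℂ) • Xᴴ) * NormedSpace.exp ((s : ℂ) • X)) =
      fun _ => 1 := by
    funext s
    rw [← hu s, ← Matrix.exp_conjTranspose, conjTranspose_smul]
    simp
  rw [h4] at h3
  have h5 := hasDerivAt_matrix_unique h3 (hasDerivAt_matrix_const _ _)
  simp only [Complex.ofReal_zero, zero_smul, NormedSpace.exp_zero, mul_one, one_mul] at h5
  exact eq_neg_of_add_eq_zero_left h5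

/-- The one-parameter group exp(sX) consists of positive diagonal matrices; differentiate at s = 0.
-/
theorem diagonal_of_mem_𝔞 (hS : S.IsAdmissible) {X : Matrix (Fin n) (Fin n) ℂ} (hX : X ∈ S.𝔞) :
    ∃ d : Fin n → ℝ, X = Matrix.diagonal fun i => (d i : ℂ) := by
  have hu : ∀ s : ℝ, IsPosDiagonal (NormedSpace.exp ((s : ℂ) • X)) := by
    intro s
    have hs : (s : ℂ) • X ∈ S.𝔞 := by
      rw [ofReal_smul_matrix]
      exact S.𝔞.smul_mem s hX
    obtain ⟨h, hh⟩ := S.mem_algebra_of_mem_𝔞 hs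
    exact hS.A_le ⟨_, by rw [hh]; exact S.det_exp h⟩ (Subgroup.subset_closure ⟨_, hs, rfl⟩)
  have h2 : ∀ i j, HasDerivAt (fun s : ℝ => (NormedSpace.exp ((s : ℂ) • X)) i j) (X i j) 0 := by
    have := hasDerivAt_matrix.1 (hasDerivAt_exp_smul X 0)
    simpa [NormedSpace.exp_zero] using this
  choose d hd hd' using hu
  refine ⟨fun i => (X i i).re, ?_⟩
  ext i j
  by_cases hij : i = j
  · subst hij
    rw [Matrix.diagonal_apply_eq]
    have h3 := (Complex.imCLM.hasFDerivAt.comp_hasDerivAt (0 : ℝ) (h2 i i))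
    have h4 : (Complex.imCLM ∘ fun s : ℝ => (NormedSpace.exp ((s : ℂ) • X)) i i) = fun _ => 0 := by
      funext s
      change (NormedSpace.exp ((s : ℂ) • X) i i).im = 0
      rw [hd' s]
      simp
    rw [h4] at h3
    have h5 := h3.unique (hasDerivAt_const _ _)
    exact Complex.ext (by simp) (by simpa using h5)
  · rw [Matrix.diagonal_apply_ne _ hij]
    have h4 : (fun s : ℝ => (NormedSpace.exp ((s : ℂ) • X)) i j) = fun _ => 0 := by
      funext s
      rw [hd' s, Matrix.diagonal_apply_ne _ hij]
    have h3 := h2 i j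
    rw [h4] at h3
    exact h3.unique (hasDerivAt_const _ _)

theorem conjTranspose_of_mem_𝔞 (hS : S.IsAdmissible) {X : Matrix (Fin n) (Fin n) ℂ} (hX : X ∈ S.𝔞) :
    Xᴴ = X := by
  obtain ⟨d, rfl⟩ := diagonal_of_mem_𝔞 hS hX
  rw [diagonal_conjTranspose]
  congr 1
  funext i
  simp

/-- Both E_α - E_{-α} and i(E_α + E_{-α}) lie in 𝔨 and are skew-Hermitian; solve for the conjugate
transpose of E_α. -/
theorem conjTranspose_Emat (hS : S.IsAdmissible) {α : S.Wt} (hα : α.IsNonZero) :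
    (S.Emat α)ᴴ = S.Emat (-α) := by
  have h1 := conjTranspose_of_mem_𝔨 hS (Submodule.subset_span ⟨α, hα, Or.inr (Or.inl rfl)⟩)
  have h2 := conjTranspose_of_mem_𝔨 hS (Submodule.subset_span ⟨α, hα, Or.inr (Or.inr rfl)⟩)
  rw [conjTranspose_smul, ← smul_neg] at h2
  simp only [RCLike.star_def, Complex.conj_I, neg_smul, ← smul_neg] at h2
  have h3 := smul_right_injective _ Complex.I_ne_zero h2
  simp only [conjTranspose_add, neg_inj, conjTranspose_sub] at h1 h3
  have h4 : (2 : ℂ) • (S.Emat α)ᴴ = (2 : ℂ) • S.Emat (-α) := by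
    rw [two_smul, two_smul]
    calc _ = ((S.Emat α)ᴴ - (S.Emat (-α))ᴴ) + ((S.Emat α)ᴴ + (S.Emat (-α))ᴴ) := by abel
      _ = _ := by rw [h1, h3]; abel
  exact smul_right_injective _ (two_ne_zero (α := ℂ)) h4

theorem conjTranspose_mem_cartan (hS : S.IsAdmissible) (h : S.𝔥) :
    ∃ h' : S.𝔥, ((h' : S.𝔤) : Matrix (Fin n) (Fin n) ℂ) = ((h : S.𝔤) : Matrix (Fin n) (Fin n) ℂ)ᴴ := by
  induction h using S.cartan_induction with
  | h0 => exact ⟨0, by simp⟩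
  | hadd x y hx hy =>
    obtain ⟨a, ha⟩ := hx
    obtain ⟨b, hb⟩ := hy
    exact ⟨a + b, by simp [ha, hb]⟩
  | hsmul c x hx =>
    obtain ⟨a, ha⟩ := hx
    exact ⟨star c • a, by simp [ha]⟩
  | hc α hα => exact ⟨_, (conjTranspose_of_mem_𝔞 hS (S.Hmat_mem_𝔞 hα)).symm⟩

theorem conjTranspose_mem (hS : S.IsAdmissible) (X : S.𝔤) :
    (X : Matrix (Fin n) (Fin n) ℂ)ᴴ ∈ S.𝔤 := by
  induction X using S.algebra_induction with
  | hadd x y hx hy =>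
    change ((x : Matrix (Fin n) (Fin n) ℂ) + (y : Matrix (Fin n) (Fin n) ℂ))ᴴ ∈ S.𝔤
    rw [conjTranspose_add]
    exact S.𝔤.add_mem hx hy
  | hsmul c x hx =>
    change (c • (x : Matrix (Fin n) (Fin n) ℂ))ᴴ ∈ S.𝔤
    rw [conjTranspose_smul]
    exact S.𝔤.smul_mem _ hx
  | hh h =>
    obtain ⟨h', hh'⟩ := conjTranspose_mem_cartan hS h
    rw [← hh']
    exact Subtype.mem _
  | hE α hα =>
    have := conjTranspose_Emat hS hα
    rw [Emat_eq] at this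
    rw [this]
    exact Subtype.mem _

/-- The conjugate transpose on `𝔤`. -/
def dag (hS : S.IsAdmissible) (X : S.𝔤) : S.𝔤 := ⟨_, conjTranspose_mem hS X⟩

theorem coe_dag (hS : S.IsAdmissible) (X : S.𝔤) : ((dag hS X : S.𝔤) : Matrix (Fin n) (Fin n) ℂ) =
    (X : Matrix (Fin n) (Fin n) ℂ)ᴴ := rfl

theorem dag_dag (hS : S.IsAdmissible) (X : S.𝔤) : dag hS (dag hS X) = X :=
  Subtype.ext (by simp [coe_dag])

/-- The conjugate transpose on `𝔥`. -/
def dagH (hS : S.IsAdmissible) (h : S.𝔥) : S.𝔥 := (conjTranspose_mem_cartan hS h).choose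

theorem coe_dagH (hS : S.IsAdmissible) (h : S.𝔥) : ((dagH hS h : S.𝔥) : S.𝔤) = dag hS h :=
  Subtype.ext (conjTranspose_mem_cartan hS h).choose_spec

theorem diagonal_of_mem_cartan (hS : S.IsAdmissible) (h : S.𝔥) :
    ∃ d : Fin n → ℂ, ((h : S.𝔤) : Matrix (Fin n) (Fin n) ℂ) = Matrix.diagonal d := by
  induction h using S.cartan_induction with
  | h0 => exact ⟨0, by simp⟩
  | hadd x y hx hy =>
    obtain ⟨a, ha⟩ := hx
    obtain ⟨b, hb⟩ := hy
    exact ⟨a + b, by simp [ha, hb]⟩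
  | hsmul c x hx =>
    obtain ⟨a, ha⟩ := hx
    exact ⟨c • a, by simp [ha, Matrix.diagonal_smul]⟩
  | hc α hα =>
    obtain ⟨d, hd⟩ := diagonal_of_mem_𝔞 hS (S.Hmat_mem_𝔞 hα)
    exact ⟨_, hd⟩

theorem I_smul_mem_𝔨 {X : Matrix (Fin n) (Fin n) ℂ} (hX : X ∈ S.𝔞) : Complex.I • X ∈ S.𝔨 := by
  unfold ChevalleyData.𝔞 at hX
  induction hX using Submodule.span_induction with
  | mem x h =>
    obtain ⟨α, hα, rfl⟩ := h
    exact Submodule.subset_span ⟨α, hα, Or.inl rfl⟩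
  | zero => rw [smul_zero]; exact S.𝔨.zero_mem
  | add x y _ _ hx hy => rw [smul_add]; exact S.𝔨.add_mem hx hy
  | smul c x _ hx => rw [smul_comm]; exact S.𝔨.smul_mem c hx

/-- The Killing form expressed by the Hilbert–Schmidt inner product. -/
theorem exists_killingForm_eq_sum (hS : S.IsAdmissible) : ∃ (N : ℕ) (b : Fin N → S.𝔤),
    (∀ X Y, killingForm ℂ S.𝔤 X Y = ∑ i, (((⁅dag hS X, b i⁆ : S.𝔤) : Matrix (Fin n) (Fin n) ℂ)ᴴ *
      ((⁅Y, b i⁆ : S.𝔤) : Matrix (Fin n) (Fin n) ℂ)).trace) ∧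
    ∀ X : S.𝔤, (∀ i, ⁅X, b i⁆ = 0) → X = 0 := by
  let core : InnerProductSpace.Core ℂ S.𝔤 :=
    { inner := fun X Y => ((X : Matrix (Fin n) (Fin n) ℂ)ᴴ * (Y : Matrix (Fin n) (Fin n) ℂ)).trace
      conj_inner_symm := fun X Y => by
        rw [starRingEnd_apply, ← trace_conjTranspose, conjTranspose_mul, conjTranspose_conjTranspose]
      re_inner_nonneg := fun X => by
        open scoped ComplexOrder in
        exact (Complex.le_def.1 (posSemidef_conjTranspose_mul_self
          (X : Matrix (Fin n) (Fin n) ℂ)).trace_nonneg).1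
      add_left := fun X Y Z => by
        simp [conjTranspose_add, add_mul]
      smul_left := fun X Y c => by
        simp [conjTranspose_smul]
      definite := fun X hX => Subtype.ext (by
        open scoped ComplexOrder in
        exact trace_conjTranspose_mul_self_eq_zero_iff.1 hX) }
  let i1 : NormedAddCommGroup S.𝔤 := core.toNormedAddCommGroup
  let i2 : InnerProductSpace ℂ S.𝔤 := InnerProductSpace.ofCore core.toCore
  have hin : ∀ X Y : S.𝔤, inner ℂ X Y =
    ((X : Matrix (Fin n) (Fin n) ℂ)ᴴ * (Y : Matrix (Fin n) (Fin n) ℂ)).trace := fun X Y => rfl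
  let b := stdOrthonormalBasis ℂ S.𝔤
  -- In the Hilbert–Schmidt inner product the adjoint of ad X is ad Xᴴ, so the trace of ad X ∘ ad Y
  -- in an orthonormal basis becomes a sum of inner products.
  have hadj : ∀ X A B : S.𝔤, ((A : Matrix (Fin n) (Fin n) ℂ)ᴴ * (⁅X, B⁆ : S.𝔤)).trace =
      (((⁅dag hS X, A⁆ : S.𝔤) : Matrix (Fin n) (Fin n) ℂ)ᴴ * B).trace := by
    intro X A B
    rw [coe_lie, coe_lie, coe_dag, conjTranspose_sub, conjTranspose_mul, conjTranspose_mul,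
      conjTranspose_conjTranspose, mul_sub, sub_mul, trace_sub, trace_sub, Matrix.mul_assoc,
      Matrix.mul_assoc, ← Matrix.mul_assoc, ← Matrix.mul_assoc,
      trace_mul_comm _ (X : Matrix (Fin n) (Fin n) ℂ), Matrix.mul_assoc]
  refine ⟨_, b, fun X Y => ?_, fun X hX => ?_⟩
  · rw [killingForm_apply_apply, LinearMap.trace_eq_sum_inner _ b]
    refine Finset.sum_congr rfl fun i _ => ?_
    rw [hin, ← hadj]
    rfl
  -- An element commuting with a basis is central, and the centre is trivial.
  · have h1 : LieAlgebra.ad ℂ S.𝔤 X = 0 := by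
      have : ((LieAlgebra.ad ℂ S.𝔤 X : S.𝔤 →ₗ[ℂ] S.𝔤)) = 0 := b.toBasis.ext fun i => by
        simpa using hX i
      exact this
    have h2 : X ∈ (LieAlgebra.ad ℂ S.𝔤).ker := h1
    rw [LieAlgebra.ad_ker_eq_self_module_ker, LieAlgebra.self_module_ker_eq_center,
      LieAlgebra.center_eq_bot] at h2
    simpa using h2

theorem killingForm_dag (hS : S.IsAdmissible) (X Y : S.𝔤) :
    killingForm ℂ S.𝔤 (dag hS X) (dag hS Y) = star (killingForm ℂ S.𝔤 X Y) := by
  obtain ⟨N, b, hb, -⟩ := exists_killingForm_eq_sum hS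
  rw [LieModule.traceForm_comm _ _ _ X Y, hb, hb, star_sum]
  refine Finset.sum_congr rfl fun i _ => ?_
  rw [dag_dag, ← trace_conjTranspose, conjTranspose_mul, conjTranspose_conjTranspose]

/-- The value is the sum of the squared norms of [Xᴴ, b_i] over the basis b, and Xᴴ is zero if all
these brackets are. -/
theorem killingForm_self_dag (hS : S.IsAdmissible) (X : S.𝔤) :
    0 ≤ (killingForm ℂ S.𝔤 X (dag hS X)).re ∧
      ((killingForm ℂ S.𝔤 X (dag hS X)).re = 0 → X = 0) := by
  obtain ⟨N, b, hb, hb'⟩ := exists_killingForm_eq_sum hS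
  have h1 : ∀ A : Matrix (Fin n) (Fin n) ℂ, 0 ≤ (Aᴴ * A).trace.re := fun A => by
    open scoped ComplexOrder in
    exact (Complex.le_def.1 (posSemidef_conjTranspose_mul_self A).trace_nonneg).1
  have h2 : ∀ A : Matrix (Fin n) (Fin n) ℂ, (Aᴴ * A).trace.re = 0 → A = 0 := fun A h => by
    open scoped ComplexOrder in
    refine trace_conjTranspose_mul_self_eq_zero_iff.1 (Complex.ext h ?_)
    exact (Complex.le_def.1 (posSemidef_conjTranspose_mul_self A).trace_nonneg).2.symm
  rw [hb, Complex.re_sum]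
  refine ⟨Finset.sum_nonneg fun i _ => h1 _, fun h => ?_⟩
  rw [Finset.sum_eq_zero_iff_of_nonneg fun i _ => h1 _] at h
  have h3 : dag hS X = 0 := hb' _ fun i => Subtype.ext (h2 _ (h i (Finset.mem_univ i)))
  rw [← dag_dag hS X, h3]
  exact Subtype.ext (by simp [coe_dag])

end ChevalleyData

/-! ### Conjugation by exponentials with a terminating series -/

section BanachAlgebra2

attribute [-instance] LieRing.ofAssociativeRing

/-- The third power of ad A kills X, so the exponential series of ad A stops after the quadratic
term. -/
theorem exp_conj_of_cube_eq_zero' {𝔸 : Type*} [NormedRing 𝔸] [NormedAlgebra ℂ 𝔸] [CompleteSpace 𝔸]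
    {A X Y Z : 𝔸} (h1 : A * X - X * A = Y) (h2 : A * Y - Y * A = Z) (h3 : A * Z - Z * A = 0) :
    NormedSpace.exp A * X * NormedSpace.exp (-A) = X + Y + (2 : ℂ)⁻¹ • Z := by
  rw [← exp_adCLM]
  have hs : HasSum (fun j : ℕ => (((j.factorial : ℂ)⁻¹) • (adCLM A) ^ j) X)
      (NormedSpace.exp (adCLM A) X) :=
    (NormedSpace.exp_series_hasSum_exp' (𝕂 := ℂ) (adCLM A)).mapL (ContinuousLinearMap.apply ℂ 𝔸 X)
  have e1 : (adCLM A) X = Y := h1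
  have e2 : (adCLM A) Y = Z := h2
  have e3 : (adCLM A) Z = 0 := h3
  have hp : ∀ j : ℕ, ((adCLM A) ^ (j + 3)) X = 0 := by
    intro j
    induction j with
    | zero => 
      have : ((adCLM A) ^ (0 + 3)) X = adCLM A (adCLM A (adCLM A X)) := rfl
      rw [this, e1, e2, e3]
    | succ j ih =>
      rw [show j + 1 + 3 = (j + 3) + 1 by ring, pow_succ']
      exact (congrArg (adCLM A) ih).trans (map_zero _)
  have hf : HasSum (fun j : ℕ => (((j.factorial : ℂ)⁻¹) • (adCLM A) ^ j) X)
      (∑ j ∈ Finset.range 3, (((j.factorial : ℂ)⁻¹) • (adCLM A) ^ j) X) :=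
    hasSum_sum_of_ne_finset_zero (by
      intro b hb
      obtain ⟨c, rfl⟩ := Nat.exists_eq_add_of_le (not_lt.1 fun h => hb (Finset.mem_range.2 h))
      rw [_root_.smul_apply, add_comm, hp, smul_zero])
  rw [hs.unique hf, Finset.sum_range_succ, Finset.sum_range_succ, Finset.sum_range_succ,
    Finset.sum_range_zero]
  have p1 : ((adCLM A) ^ 1) X = Y := by rw [pow_one, e1]
  have p2 : ((adCLM A) ^ 2) X = Z := by
    have : ((adCLM A) ^ 2) X = adCLM A (adCLM A X) := rfl
    rw [this, e1, e2]
  have p0 : ((adCLM A) ^ 0) X = X := rfl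
  simp only [_root_.smul_apply, p0, p1, p2]
  simp

open scoped Matrix.Norms.Operator in
theorem exp_conj_of_cube_eq_zero {m : Type*} [Fintype m] [DecidableEq m] {A X Y Z : Matrix m m ℂ}
    (h1 : A * X - X * A = Y) (h2 : A * Y - Y * A = Z) (h3 : A * Z - Z * A = 0) :
    NormedSpace.exp A * X * NormedSpace.exp (-A) = X + Y + (2 : ℂ)⁻¹ • Z :=
  exp_conj_of_cube_eq_zero' h1 h2 h3

end BanachAlgebra2

/-! ### Integrality of 𝔰𝔩₂ weights -/

section Sl2

/-- Apply e repeatedly. The eigenvalues μ₀ + 2n are distinct, so finite dimensionality kills some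
power; the last nonzero vector is primitive, and its eigenvalue is a natural number. -/
theorem IsSl2Triple.eigenvalue_int {L M : Type*} [LieRing L] [LieAlgebra ℂ L] [AddCommGroup M]
    [Module ℂ M] [LieRingModule L M] [LieModule ℂ L M] [Module.Finite ℂ M] {h e f : L}
    (t : IsSl2Triple h e f) {μ₀ : ℂ} {m₀ : M} (h0 : m₀ ≠ 0) (hm₀ : ⁅h, m₀⁆ = μ₀ • m₀) :
    ∃ k : ℤ, μ₀ = k := by
  let evals (n : ℕ) : ℂ := μ₀ + 2 * (n : ℂ)
  let e_vecs (n : ℕ) : M := ((LieModule.toEnd ℂ L M e) ^ n) m₀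
  have h_exists_zero : ∃ k, e_vecs k = 0 := by
    by_contra! contra
    have h_inj : Function.Injective evals := fun a b hab ↦ by
      simpa [evals, add_right_inj, mul_eq_mul_left_iff, Nat.cast_inj] using hab
    have aux (μ : Set.range evals) : (LieModule.toEnd ℂ L M h).HasEigenvector μ
        (e_vecs μ.property.choose) := by
      set n := μ.property.choose
      refine ⟨?_, contra n⟩
      rw [Module.End.mem_eigenspace_iff, LieModule.toEnd_apply_apply, ← μ.property.choose_spec]
      exact t.lie_h_pow_toEnd_e hm₀ n
    have _i := ((LieModule.toEnd ℂ L M h).eigenvectors_linearIndependent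
      (Set.range evals) _ aux).finite
    exact (Set.infinite_range_of_injective h_inj) (Set.toFinite _)
  obtain ⟨n, hn_ne, hn_zero⟩ := Nat.exists_not_and_succ_of_not_zero_of_exists h0 h_exists_zero
  have P : IsSl2Triple.HasPrimitiveVectorWith t (e_vecs n) (evals n) :=
    { ne_zero := hn_ne
      lie_h := t.lie_h_pow_toEnd_e hm₀ n
      lie_e := by rwa [IsSl2Triple.lie_e_pow_toEnd_e n] }
  obtain ⟨k, hk⟩ := P.exists_nat
  refine ⟨k - 2 * n, ?_⟩
  push_cast
  linear_combination hk

end Sl2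

/-! ### Integral coroots and root reflections -/

namespace ChevalleyData

variable {n l : ℕ} (S : ChevalleyData n l)

open Matrix

/-- The standard representation. -/
def stdRep : S.𝔤 →ₗ⁅ℂ⁆ Module.End ℂ (Fin n → ℂ) :=
  (lieEquivMatrix' : Module.End ℂ (Fin n → ℂ) ≃ₗ⁅ℂ⁆ _).symm.toLieHom.comp S.𝔤.incl

theorem stdRep_apply (X : S.𝔤) (v : Fin n → ℂ) :
    S.stdRep X v = (X : Matrix (Fin n) (Fin n) ℂ) *ᵥ v := by
  simp [stdRep]

/-- The diagonal entries are eigenvalues of the coroot in the standard representation, restricted to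
the 𝔰𝔩₂ triple of α. -/
theorem Hmat_diagonal_int (hS : S.IsAdmissible) {α : S.Wt} (hα : α.IsNonZero) :
    ∃ d : Fin n → ℤ, S.Hmat α = Matrix.diagonal fun i => (d i : ℂ) := by
  obtain ⟨d, hd⟩ := diagonal_of_mem_𝔞 hS (S.Hmat_mem_𝔞 hα)
  have t := S.isSl2Triple hα
  have t' : IsSl2Triple (S.stdRep ((LieAlgebra.IsKilling.coroot α : S.𝔥) : S.𝔤)) (S.stdRep (S.E α))
      (S.stdRep (S.E (-α))) :=
    { h_ne_zero := fun h => t.h_ne_zero (by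
        have h2 : ∀ X, S.stdRep X = 0 → X = 0 := fun X hX => by
          apply Subtype.ext
          have : (lieEquivMatrix' : Module.End ℂ (Fin n → ℂ) ≃ₗ⁅ℂ⁆ _).symm
            (X : Matrix (Fin n) (Fin n) ℂ) = 0 := hX
          exact (map_eq_zero_iff _ (LieEquiv.injective _)).1 this
        exact h2 _ h)
      lie_e_f := by rw [← LieHom.map_lie, t.lie_e_f]
      lie_h_e_nsmul := by rw [← LieHom.map_lie, t.lie_h_e_nsmul, map_nsmul]
      lie_h_f_nsmul := by rw [← LieHom.map_lie, t.lie_h_f_nsmul, map_neg, map_nsmul] }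
  have key : ∀ i, ∃ k : ℤ, (d i : ℂ) = k := by
    intro i
    refine IsSl2Triple.eigenvalue_int t' (m₀ := (Pi.single i 1 : Fin n → ℂ)) (by simp) ?_
    change S.stdRep _ _ = _
    rw [stdRep_apply]
    change S.Hmat α *ᵥ _ = _
    rw [hd]
    ext j
    simp [mulVec_diagonal, Pi.single_apply]
    split_ifs with h
    · rw [h]
    · rfl
  choose k hk using key
  exact ⟨k, by rw [hd]; congr 1; funext i; exact hk i⟩

/-- Integral diagonal entries become integral multiples of 2πi. Hence elements of 𝔥 whose coroot
coordinates agree modulo 2πiℤ have the same exponential. -/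
theorem exp_coroot_sum_eq_one (hS : S.IsAdmissible) {ι : Type*} (s : Finset ι) (α : ι → S.Wt)
    (hs : ∀ i, (α i).IsNonZero) (m : ι → ℤ) : S.expG ((∑ i ∈ s, ((m i : ℂ) * (2 * Real.pi * Complex.I)) •
      LieAlgebra.IsKilling.coroot (α i) : S.𝔥) : S.𝔤) = 1 := by
  classical
  have key : ∃ d : Fin n → ℤ, (((∑ i ∈ s, ((m i : ℂ) * (2 * Real.pi * Complex.I)) •
      LieAlgebra.IsKilling.coroot (α i) : S.𝔥) : S.𝔤) : Matrix (Fin n) (Fin n) ℂ) =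
      Matrix.diagonal fun i => (d i : ℂ) * (2 * Real.pi * Complex.I) := by
    induction s using Finset.induction_on with
    | empty => exact ⟨0, by simp⟩
    | insert a s ha ih =>
      obtain ⟨d, hd⟩ := ih
      obtain ⟨d', hd'⟩ := S.Hmat_diagonal_int hS (hs a)
      refine ⟨fun i => m a * d' i + d i, ?_⟩
      rw [Finset.sum_insert ha]
      have e1 : ∀ x y : S.𝔥, (((x + y : S.𝔥) : S.𝔤) : Matrix (Fin n) (Fin n) ℂ) =
        ((x : S.𝔤) : Matrix (Fin n) (Fin n) ℂ) + ((y : S.𝔤) : Matrix (Fin n) (Fin n) ℂ) :=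
          fun _ _ => rfl
      have e2 : ∀ (c : ℂ) (x : S.𝔥), (((c • x : S.𝔥) : S.𝔤) : Matrix (Fin n) (Fin n) ℂ) =
        c • ((x : S.𝔤) : Matrix (Fin n) (Fin n) ℂ) := fun _ _ => rfl
      rw [e1, hd, e2]
      change _ • S.Hmat (α a) + _ = _
      rw [hd', ← Matrix.diagonal_smul, Matrix.diagonal_add]
      congr 1
      funext i
      simp
      ring
  obtain ⟨d, hd⟩ := key
  apply S.mat_injective
  rw [mat_expG, hd, Matrix.exp_diagonal, mat_one, ← Matrix.diagonal_one]
  congr 1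
  funext i
  rw [Pi.coe_exp, ← Complex.exp_eq_exp_ℂ]
  exact Complex.exp_int_mul_two_pi_mul_I (d i)

theorem expG_add (x y : S.𝔥) : S.expG ((x + y : S.𝔥) : S.𝔤) = S.expG (x : S.𝔤) * S.expG (y : S.𝔤) := by
  apply S.mat_injective
  rw [mat_mul, mat_expG, mat_expG, mat_expG, ← Matrix.exp_add_of_commute _ _ (S.cartan_commute x y)]
  rfl

theorem Ad_expG_of_cube {X Y Z T : S.𝔤} (h1 : ⁅X, Y⁆ = Z) (h2 : ⁅X, Z⁆ = T) (h3 : ⁅X, T⁆ = 0) :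
    S.Ad (S.expG X) Y = Y + Z + (2 : ℂ)⁻¹ • T := by
  apply Subtype.ext
  rw [coe_Ad, ← expG_neg, mat_expG, mat_expG]
  refine exp_conj_of_cube_eq_zero ?_ ?_ ?_
  · rw [← coe_lie, h1]
  · rw [← coe_lie, h2]
  · rw [← coe_lie, h3]; rfl

theorem Ad_mul (g h : S.G) (X : S.𝔤) : S.Ad (g * h) X = S.Ad g (S.Ad h X) := by
  apply Subtype.ext
  rw [coe_Ad, coe_Ad, coe_Ad, _root_.mul_inv_rev, mat_mul, mat_mul]
  simp only [mul_assoc]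

theorem Ad_one (X : S.𝔤) : S.Ad 1 X = X := by
  apply Subtype.ext
  rw [coe_Ad, inv_one, mat_one, one_mul, mul_one]

theorem weight_sub {S : ChevalleyData n l} (α : S.Wt) (x y : S.𝔥) : α (x - y) = α x - α y :=
  map_sub (LieModule.Weight.toLinear ℂ S.𝔥 S.𝔤 α) x y

theorem weight_smul {S : ChevalleyData n l} (α : S.Wt) (c : ℂ) (x : S.𝔥) : α (c • x) = c * α x :=
  map_smul (LieModule.Weight.toLinear ℂ S.𝔥 S.𝔤 α) c x

theorem Ad_expG_cartan (x y : S.𝔥) : S.Ad (S.expG (x : S.𝔤)) (y : S.𝔤) = y := by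
  have h : ⁅(x : S.𝔤), (y : S.𝔤)⁆ = 0 := by
    apply Subtype.ext
    rw [coe_lie, (S.cartan_commute x y).eq, sub_self]
    rfl
  rw [S.Ad_expG_of_cube h (lie_zero _) (lie_zero _)]
  simp

/-- An element of `G` that induces the reflection in a root. -/
theorem exists_reflection {α : S.Wt} (hα : α.IsNonZero) : ∃ g : S.G, ∀ h : S.𝔥,
    S.Ad g (h : S.𝔤) = ((h - α h • LieAlgebra.IsKilling.coroot α : S.𝔥) : S.𝔤) := by
  set E := S.E α
  set F := S.E (-α)
  set H := ((LieAlgebra.IsKilling.coroot α : S.𝔥) : S.𝔤) with hH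
  have t : IsSl2Triple H E F := S.isSl2Triple hα
  have hHE : ⁅H, E⁆ = (2 : ℂ) • E := t.lie_h_e_smul ℂ
  have hHF : ⁅H, F⁆ = -((2 : ℂ) • F) := t.lie_lie_smul_f ℂ
  have hEF : ⁅E, F⁆ = H := t.lie_e_f
  have hhE : ∀ h : S.𝔥, ⁅E, (h : S.𝔤)⁆ = -(α h • E) := fun h => by
    rw [← lie_skew, S.lie_coroot_E h hα]
  have hhF : ∀ h : S.𝔥, ⁅-F, (h : S.𝔤)⁆ = -(α h • F) := fun h => by
    rw [neg_lie, lie_skew, S.lie_coroot_E h (LieModule.Weight.IsNonZero.neg hα)]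
    simp [F]
  have a1 : ∀ h : S.𝔥, S.Ad (S.expG E) (h : S.𝔤) = h - α h • E := fun h => by
    rw [S.Ad_expG_of_cube (hhE h) (T := 0) (by rw [lie_neg, lie_smul, lie_self, smul_zero, neg_zero])
      (lie_zero _)]
    simp [sub_eq_add_neg]
  have a2 : S.Ad (S.expG E) E = E := by
    rw [S.Ad_expG_of_cube (lie_self _) (lie_zero _) (lie_zero _)]
    simp
  have b1 : ∀ h : S.𝔥, S.Ad (S.expG (-F)) (h : S.𝔤) = h - α h • F := fun h => by
    rw [S.Ad_expG_of_cube (hhF h) (T := 0)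
      (by rw [lie_neg, lie_smul, neg_lie, lie_self, neg_zero, smul_zero, neg_zero])
      (lie_zero _)]
    simp [sub_eq_add_neg]
  have b2 : S.Ad (S.expG (-F)) E = E + H - F := by
    have e1 : ⁅-F, E⁆ = H := by rw [neg_lie, lie_skew, hEF]
    have e2 : ⁅-F, H⁆ = -((2 : ℂ) • F) := by rw [neg_lie, lie_skew, hHF]
    rw [S.Ad_expG_of_cube e1 e2 (by
      rw [lie_neg, lie_smul, neg_lie, lie_self, neg_zero, smul_zero, neg_zero])]
    module
  -- The classical representative of the reflection in SL₂. On 𝔥 and on E every series involved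
  -- stops by the quadratic term.
  refine ⟨S.expG E * S.expG (-F) * S.expG E, fun h => ?_⟩
  rw [Ad_mul, Ad_mul, a1, map_sub, map_smul, b1, b2]
  have e : (h : S.𝔤) - α h • F - α h • (E + H - F) =
      ((h - α h • LieAlgebra.IsKilling.coroot α : S.𝔥) : S.𝔤) - α h • E := by
    change _ = (h : S.𝔤) - α h • H - α h • E
    module
  rw [e, map_sub, map_smul, a1, a2]
  have e2 : α (h - α h • LieAlgebra.IsKilling.coroot α) = - α h := by
    rw [weight_sub, weight_smul, LieAlgebra.IsKilling.root_apply_coroot hα]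
    ring
  rw [e2]
  module

/-! ### The Weyl group -/

/-- The linear automorphisms of `𝔥` induced by elements of `G`. -/
def weyl : Subgroup (S.𝔥 ≃ₗ[ℂ] S.𝔥) where
  carrier := {w | ∃ g : S.G, ∀ h : S.𝔥, S.Ad g (h : S.𝔤) = (w h : S.𝔤)}
  mul_mem' := by
    rintro a b ⟨g, hg⟩ ⟨g', hg'⟩
    exact ⟨g * g', fun h => by rw [Ad_mul, hg', hg]; rfl⟩
  one_mem' := ⟨1, fun h => by rw [Ad_one]; rfl⟩
  inv_mem' := by
    rintro a ⟨g, hg⟩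
    refine ⟨g⁻¹, fun h => ?_⟩
    have h1 := hg (a⁻¹ h)
    have h2 : a (a⁻¹ h) = h := a.apply_symm_apply h
    rw [h2] at h1
    rw [← h1, ← Ad_mul, inv_mul_cancel, Ad_one]

/-- A group element inducing w⁻¹ carries the root space of α to that of α ∘ w. It also carries the
𝔰𝔩₂ triple of α to a triple for α ∘ w, whose middle element must be the coroot. -/
theorem exists_root_of_weyl {w : S.𝔥 ≃ₗ[ℂ] S.𝔥} (hw : w ∈ S.weyl) {α : S.Wt} (hα : α.IsNonZero) :
    ∃ β : S.Wt, β.IsNonZero ∧ (∀ h, β h = α (w h)) ∧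
      w (LieAlgebra.IsKilling.coroot β) = LieAlgebra.IsKilling.coroot α := by
  obtain ⟨g, hg⟩ := S.weyl.inv_mem hw
  have hg' : ∀ h : S.𝔥, (h : S.𝔤) = S.Ad g (w h : S.𝔥) := fun h => by
    rw [hg]
    exact congrArg Subtype.val (w.symm_apply_apply h).symm
  have hmem : ∀ {γ : S.Wt} (hγ : γ.IsNonZero), S.Ad g (S.E γ) ∈
      LieAlgebra.rootSpace S.𝔥 (fun h => γ (w h)) := by
    intro γ hγ
    refine LieModule.weightSpace_le_genWeightSpace S.𝔤 _ ?_
    rw [LieModule.mem_weightSpace]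
    intro h
    change ⁅(h : S.𝔤), _⁆ = _
    rw [hg' h, ← LieEquiv.map_lie, S.lie_coroot_E _ hγ, map_smul]
  have hne : ∀ {γ : S.Wt} (hγ : γ.IsNonZero), S.Ad g (S.E γ) ≠ 0 := fun hγ h =>
    S.E_ne_zero hγ ((map_eq_zero_iff _ (S.Ad g).injective).1 h)
  let β : S.Wt := ⟨fun h => α (w h), fun h => hne hα (by
    have := hmem hα
    rw [LieAlgebra.rootSpace, h] at this
    simpa using this)⟩
  have hβ : β.IsNonZero := by
    intro h
    apply hα
    ext x
    have : β (w.symm x) = 0 := by rw [h.eq]; rfl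
    change α (w (w.symm x)) = 0 at this
    rwa [w.apply_symm_apply] at this
  refine ⟨β, hβ, fun _ => rfl, ?_⟩
  have t := S.isSl2Triple hα
  have t' : IsSl2Triple (S.Ad g ((LieAlgebra.IsKilling.coroot α : S.𝔥) : S.𝔤)) (S.Ad g (S.E α))
      (S.Ad g (S.E (-α))) :=
    { h_ne_zero := fun h => t.h_ne_zero ((map_eq_zero_iff _ (S.Ad g).injective).1 h)
      lie_e_f := by rw [← LieEquiv.map_lie, t.lie_e_f]
      lie_h_e_nsmul := by rw [← LieEquiv.map_lie, t.lie_h_e_nsmul, map_nsmul]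
      lie_h_f_nsmul := by rw [← LieEquiv.map_lie, t.lie_h_f_nsmul, map_neg, map_nsmul] }
  have hneg := hmem (LieModule.Weight.IsNonZero.neg hα)
  have h3 := IsSl2Triple.h_eq_coroot hβ t' (hmem hα) hneg
  rw [hg] at h3
  have h4 := Subtype.ext h3
  rw [← h4]
  exact w.apply_symm_apply _

theorem root_ext {x : S.𝔥} (h : ∀ α : S.Wt, α.IsNonZero → α x = 0) : x = 0 := by
  have h1 : ∀ f : Module.Dual ℂ S.𝔥, f x = 0 := by
    intro f
    have hf : f ∈ Submodule.span ℂ (Set.range (LieAlgebra.IsKilling.rootSystem S.𝔥).root) := by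
      rw [RootPairing.IsRootSystem.span_root_eq_top]; trivial
    induction hf using Submodule.span_induction with
    | mem f hf => 
      obtain ⟨α, rfl⟩ := hf
      exact h α.1 (LieSubalgebra.isNonZero_coe_root α)
    | zero => rfl
    | add f g _ _ hf hg => simp [hf, hg]
    | smul c f _ hf => simp [hf]
  exact (Module.forall_dual_apply_eq_zero_iff ℂ x).1 h1

/-- Each w is determined by the map α ↦ α ∘ w on the finite set of roots, because the roots separate
the points of 𝔥. -/
instance finite_weyl : Finite S.weyl := by
  have key : ∀ (w : S.weyl) (α : {α : S.Wt // α.IsNonZero}), ∃ β : S.Wt, ∀ h, β h = α.1 (w.1 h) :=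
    fun w α => by
      obtain ⟨β, _, h, _⟩ := S.exists_root_of_weyl w.2 α.2
      exact ⟨β, h⟩
  choose f hf using key
  refine Finite.of_injective f fun w w' hw => ?_
  apply Subtype.ext
  ext1 x
  rw [← sub_eq_zero]
  refine S.root_ext fun α hα => ?_
  have h1 := hf w ⟨α, hα⟩ x
  have h2 := hf w' ⟨α, hα⟩ x
  rw [hw, h2] at h1
  rw [weight_sub, sub_eq_zero]
  exact h1.symm

/-- The reflection in a root. -/
theorem exists_weyl_reflection {α : S.Wt} (hα : α.IsNonZero) :
    ∃ w ∈ S.weyl, ∀ h, w h = h - α h • LieAlgebra.IsKilling.coroot α := by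
  let f : S.𝔥 →ₗ[ℂ] S.𝔥 := LinearMap.id - (LieModule.Weight.toLinear ℂ S.𝔥 S.𝔤 α).smulRight (LieAlgebra.IsKilling.coroot α)
  have hf : ∀ h, f h = h - α h • LieAlgebra.IsKilling.coroot α := fun h => rfl
  have hff : ∀ h, f (f h) = h := fun h => by
    have e3 : α (h - α h • LieAlgebra.IsKilling.coroot α) = - α h := by
      rw [weight_sub, weight_smul, LieAlgebra.IsKilling.root_apply_coroot hα]
      ring
    rw [hf, hf, e3]
    module
  obtain ⟨g, hg⟩ := S.exists_reflection hα
  exact ⟨LinearEquiv.ofInvolutive f hff, ⟨g, fun h => hg h⟩, fun h => rfl⟩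

end ChevalleyData

namespace ChevalleyData

variable {n l : ℕ} (S : ChevalleyData n l)

/-! ### Simple roots and the positive cone -/

theorem simpleRoot_isNonZero (j : Fin l) : (S.simpleRoot j).IsNonZero :=
  LieSubalgebra.isNonZero_coe_root _

/-- The simple coroots. -/
def simpleCoroot (j : Fin l) : S.𝔥 := LieAlgebra.IsKilling.coroot (S.simpleRoot j)

/-- A root as a linear functional. -/
def lin (α : S.Wt) : Module.Dual ℂ S.𝔥 := LieModule.Weight.toLinear ℂ S.𝔥 S.𝔤 α

theorem lin_apply (α : S.Wt) (h : S.𝔥) : S.lin α h = α h := rfl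

theorem lin_neg (α : S.Wt) : S.lin (-α) = - S.lin α := by
  ext h
  simp [lin_apply]

theorem lin_injective : Function.Injective S.lin := fun α β h => by
  ext x
  exact DFunLike.congr_fun h x

theorem lin_ne_zero {α : S.Wt} (hα : α.IsNonZero) : S.lin α ≠ 0 := fun h => by
  apply hα
  ext x
  exact DFunLike.congr_fun h x

theorem lin_simpleRoot_mem (j : Fin l) : S.lin (S.simpleRoot j) ∈ S.positiveCone :=
  AddSubmonoid.subset_closure ⟨j, rfl⟩

theorem linearIndependent_simpleRoot : LinearIndependent ℂ fun j => S.lin (S.simpleRoot j) := by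
  have h := S.base.linearIndepOn_root
  exact (LinearIndependent.comp h S.enum S.enum.injective :)

theorem linearIndependent_simpleCoroot : LinearIndependent ℂ S.simpleCoroot := by
  have h := S.base.linearIndepOn_coroot
  exact (LinearIndependent.comp h S.enum S.enum.injective :)

theorem image_root_support : (LieAlgebra.IsKilling.rootSystem S.𝔥).root '' S.base.support =
    Set.range fun j => S.lin (S.simpleRoot j) := by
  ext f
  constructor
  · rintro ⟨i, hi, rfl⟩
    refine ⟨S.enum.symm ⟨i, hi⟩, ?_⟩
    simp only [simpleRoot, Equiv.apply_symm_apply]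
    rfl
  · rintro ⟨j, rfl⟩
    exact ⟨_, (S.enum j).2, rfl⟩

theorem image_coroot_support : (LieAlgebra.IsKilling.rootSystem S.𝔥).coroot '' S.base.support =
    Set.range S.simpleCoroot := by
  ext f
  constructor
  · rintro ⟨i, hi, rfl⟩
    refine ⟨S.enum.symm ⟨i, hi⟩, ?_⟩
    simp only [simpleCoroot, simpleRoot, Equiv.apply_symm_apply]
    rfl
  · rintro ⟨j, rfl⟩
    exact ⟨_, (S.enum j).2, rfl⟩

theorem span_simpleCoroot : Submodule.span ℂ (Set.range S.simpleCoroot) = ⊤ := by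
  rw [← image_coroot_support, RootPairing.Base.span_coroot_support]
  exact RootPairing.IsRootSystem.span_coroot_eq_top

theorem span_simpleRoot : Submodule.span ℂ (Set.range fun j => S.lin (S.simpleRoot j)) = ⊤ := by
  rw [← image_root_support, RootPairing.Base.span_root_support]
  exact RootPairing.IsRootSystem.span_root_eq_top

/-- The basis of simple coroots. -/
def corootBasis : Module.Basis (Fin l) ℂ S.𝔥 :=
  Module.Basis.mk S.linearIndependent_simpleCoroot S.span_simpleCoroot.ge

theorem corootBasis_apply (j : Fin l) : S.corootBasis j = S.simpleCoroot j := by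
  rw [corootBasis, Module.Basis.mk_apply]

/-- The basis of simple roots. -/
def rootBasis : Module.Basis (Fin l) ℂ (Module.Dual ℂ S.𝔥) :=
  Module.Basis.mk S.linearIndependent_simpleRoot S.span_simpleRoot.ge

theorem rootBasis_apply (j : Fin l) : S.rootBasis j = S.lin (S.simpleRoot j) := by
  rw [rootBasis, Module.Basis.mk_apply]

/-- The fundamental weights. -/
def fundWeight (j : Fin l) : Module.Dual ℂ S.𝔥 := S.corootBasis.coord j

theorem fundWeight_simpleCoroot (i j : Fin l) :
    S.fundWeight j (S.simpleCoroot i) = if i = j then 1 else 0 := by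
  rw [← corootBasis_apply, fundWeight, Module.Basis.coord_apply, Module.Basis.repr_self,
    Finsupp.single_apply]

theorem eq_sum_fundWeight (f : Module.Dual ℂ S.𝔥) :
    f = ∑ j, f (S.simpleCoroot j) • S.fundWeight j := by
  refine S.corootBasis.ext fun i => ?_
  rw [corootBasis_apply]
  simp [fundWeight_simpleCoroot]

theorem eq_sum_simpleCoroot (x : S.𝔥) : x = ∑ j, S.fundWeight j x • S.simpleCoroot j := by
  conv_lhs => rw [← S.corootBasis.sum_repr x]
  simp only [corootBasis_apply]
  rfl

theorem positive_or_neg {α : S.Wt} (hα : α.IsNonZero) :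
    S.IsPositiveRoot α ∨ S.IsPositiveRoot (-α) := by
  have hm : α ∈ LieSubalgebra.root (H := S.𝔥) := by simpa using hα
  have h := S.base.root_mem_or_neg_mem ⟨α, hm⟩
  rw [image_root_support] at h
  rcases h with h | h
  · exact Or.inl ⟨hα, h⟩
  · refine Or.inr ⟨LieModule.Weight.IsNonZero.neg hα, ?_⟩
    change S.lin (-α) ∈ _
    rw [lin_neg]
    exact h

/-- The element of `𝔥` on which all simple roots take the value `1`. -/
theorem exists_height : ∃ δ : S.𝔥, ∀ j, S.simpleRoot j δ = 1 := by
  obtain ⟨δ, hδ⟩ := (Module.evalEquiv ℂ S.𝔥).surjective (S.rootBasis.constr ℂ fun _ => (1 : ℂ))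
  refine ⟨δ, fun j => ?_⟩
  have h : Module.evalEquiv ℂ S.𝔥 δ (S.rootBasis j) = 1 := by
    rw [hδ, Module.Basis.constr_basis]
  rwa [rootBasis_apply] at h

/-- The element of `𝔥` on which all simple roots take the value `1`. -/
def height : S.𝔥 := S.exists_height.choose

theorem simpleRoot_height (j : Fin l) : S.simpleRoot j S.height = 1 := S.exists_height.choose_spec j

/-- The height counts the simple roots in a sum, so only the empty sum has height zero. The cone is
therefore pointed, and nonzero differences of weights are visible in the height. -/
theorem cone_height {γ : Module.Dual ℂ S.𝔥} (hγ : γ ∈ S.positiveCone) :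
    ∃ m : ℕ, γ S.height = m ∧ (m = 0 → γ = 0) := by
  induction hγ using AddSubmonoid.closure_induction with
  | mem γ h =>
    obtain ⟨j, rfl⟩ := h
    exact ⟨1, by simpa using S.simpleRoot_height j, by simp⟩
  | zero => exact ⟨0, by simp, fun _ => rfl⟩
  | add γ γ' _ _ h h' =>
    obtain ⟨m, h1, h2⟩ := h
    obtain ⟨m', h1', h2'⟩ := h'
    refine ⟨m + m', by simp [h1, h1'], fun h => ?_⟩
    rw [h2 (by omega), h2' (by omega), add_zero]

theorem cone_pointed {γ : Module.Dual ℂ S.𝔥} (h : γ ∈ S.positiveCone) (h' : -γ ∈ S.positiveCone) :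
    γ = 0 := by
  obtain ⟨m, h1, h2⟩ := S.cone_height h
  obtain ⟨m', h1', h2'⟩ := S.cone_height h'
  apply h2
  rw [LinearMap.neg_apply, h1] at h1'
  have h3 : (m' : ℂ) + m = 0 := by rw [← h1']; ring
  have h4 : m' + m = 0 := by exact_mod_cast h3
  omega

theorem one_le_height_of_cone {γ : Module.Dual ℂ S.𝔥} (h : γ ∈ S.positiveCone) (h0 : γ ≠ 0) :
    1 ≤ (γ S.height).re := by
  obtain ⟨m, h1, h2⟩ := S.cone_height h
  rw [h1, Complex.natCast_re]
  have : m ≠ 0 := fun h => h0 (h2 h)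
  exact_mod_cast Nat.one_le_iff_ne_zero.2 this

/-! ### Highest weight vectors -/

section HighestWeight

variable {M : Type*} [AddCommGroup M] [Module ℂ M] (δ : S.𝔤 →ₗ⁅ℂ⁆ Module.End ℂ M)

/-- `x` is a (possibly zero) vector of weight `lam`. -/
def IsWeightVec (lam : Module.Dual ℂ S.𝔥) (x : M) : Prop := ∀ h : S.𝔥, δ (h : S.𝔤) x = lam h • x

/-- `v` is a nonzero vector of weight `ω` killed by all positive root vectors. -/
structure IsHighestVec (ω : Module.Dual ℂ S.𝔥) (v : M) : Prop where
  ne_zero : v ≠ 0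
  weight : S.IsWeightVec δ ω v
  kill : ∀ α, S.IsPositiveRoot α → δ (S.E α) v = 0

variable {S δ}

theorem map_lie_apply (X Y : S.𝔤) (x : M) : δ X (δ Y x) = δ ⁅X, Y⁆ x + δ Y (δ X x) := by
  rw [LieHom.map_lie]
  simp [Ring.lie_def]

theorem IsWeightVec.root {lam : Module.Dual ℂ S.𝔥} {x : M} (hx : S.IsWeightVec δ lam x) {α : S.Wt}
    (hα : α.IsNonZero) : S.IsWeightVec δ (lam + S.lin α) (δ (S.E α) x) := fun h => by
  rw [map_lie_apply, S.lie_coroot_E h hα, hx h]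
  simp only [map_smul, LinearMap.smul_apply, LinearMap.add_apply, lin_apply]
  module

variable (S δ) in
/-- The smallest subspace containing `v` that is stable under all negative root vectors. -/
def lowerSpan (v : M) : Submodule ℂ M :=
  sInf {V | v ∈ V ∧ ∀ α, S.IsPositiveRoot α → ∀ u ∈ V, δ (S.E (-α)) u ∈ V}

theorem mem_lowerSpan (v : M) : v ∈ S.lowerSpan δ v := by
  rw [lowerSpan, Submodule.mem_sInf]
  exact fun V hV => hV.1

theorem lower_mem_lowerSpan {v : M} {α : S.Wt} (hα : S.IsPositiveRoot α) {u : M}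
    (hu : u ∈ S.lowerSpan δ v) : δ (S.E (-α)) u ∈ S.lowerSpan δ v := by
  rw [lowerSpan, Submodule.mem_sInf] at *
  exact fun V hV => hV.2 α hα u (hu V hV)

theorem lowerSpan_le {v : M} {V : Submodule ℂ M} (h1 : v ∈ V)
    (h2 : ∀ α, S.IsPositiveRoot α → ∀ u ∈ V, δ (S.E (-α)) u ∈ V) : S.lowerSpan δ v ≤ V :=
  sInf_le ⟨h1, h2⟩

/-- The vectors whose whole 𝔤-image stays in the span form a subspace. It contains v, and it is
stable under lowering because X E_{-α} u = [X, E_{-α}] u + E_{-α} X u. -/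
theorem lowerSpan_stable {ω : Module.Dual ℂ S.𝔥} {v : M} (hv : S.IsHighestVec δ ω v) (X : S.𝔤) {u : M}
    (hu : u ∈ S.lowerSpan δ v) : δ X u ∈ S.lowerSpan δ v := by
  let U : Submodule ℂ M :=
    { carrier := {u | u ∈ S.lowerSpan δ v ∧ ∀ X, δ X u ∈ S.lowerSpan δ v}
      zero_mem' := ⟨Submodule.zero_mem _, fun X => by rw [map_zero]; exact Submodule.zero_mem _⟩
      add_mem' := fun {a b} ha hb => ⟨Submodule.add_mem _ ha.1 hb.1, fun X => by
        rw [map_add]; exact Submodule.add_mem _ (ha.2 X) (hb.2 X)⟩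
      smul_mem' := fun c a ha => ⟨Submodule.smul_mem _ c ha.1, fun X => by
        rw [map_smul]; exact Submodule.smul_mem _ c (ha.2 X)⟩ }
  have hU : S.lowerSpan δ v ≤ U := by
    refine lowerSpan_le ⟨mem_lowerSpan v, fun X => ?_⟩ fun α hα u hu => ⟨lower_mem_lowerSpan hα hu.1, fun X => ?_⟩
    · induction X using S.algebra_induction with
      | hadd X Y hX hY => rw [map_add]; exact Submodule.add_mem _ hX hY
      | hsmul c X hX => rw [map_smul]; exact Submodule.smul_mem _ c hX
      | hh h => rw [hv.weight h]; exact Submodule.smul_mem _ _ (mem_lowerSpan v)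
      | hE α hα =>
        rcases S.positive_or_neg hα with h | h
        · rw [hv.kill α h]; exact Submodule.zero_mem _
        · have := lower_mem_lowerSpan h (mem_lowerSpan (S := S) (δ := δ) v)
          rwa [neg_neg] at this
    · rw [map_lie_apply]
      exact Submodule.add_mem _ (hu.2 _) (lower_mem_lowerSpan hα (hu.2 X))
  exact (hU hu).2 X

variable (S δ) in
/-- The span of all vectors whose weight is strictly below `ω`. -/
def belowSpan (ω : Module.Dual ℂ S.𝔥) : Submodule ℂ M :=
  Submodule.span ℂ {x | ∃ lam, S.IsWeightVec δ lam x ∧ ω - lam ∈ S.positiveCone ∧ lam ≠ ω}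

/-- Lowering strictly decreases weights and the cone is pointed, so v alone accounts for the weight
ω. This is the multiplicity one of the highest weight. -/
theorem lowerSpan_le_sup {ω : Module.Dual ℂ S.𝔥} {v : M} (hv : S.IsHighestVec δ ω v) :
    S.lowerSpan δ v ≤ Submodule.span ℂ {v} ⊔ S.belowSpan δ ω := by
  refine lowerSpan_le (Submodule.mem_sup_left (Submodule.mem_span_singleton_self v)) fun α hα u hu => ?_
  apply Submodule.mem_sup_right
  have hn := LieModule.Weight.IsNonZero.neg hα.1
  have hne : ∀ γ ∈ S.positiveCone, S.lin α + γ ≠ 0 := fun γ hγ h => by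
    have h1 : S.lin α = -γ := eq_neg_of_add_eq_zero_left h
    have h2 := S.cone_pointed hα.2 (by
      change -S.lin α ∈ _
      rw [h1, neg_neg]; exact hγ)
    exact S.lin_ne_zero hα.1 h2
  rw [Submodule.mem_sup] at hu
  obtain ⟨y, hy, z, hz, rfl⟩ := hu
  rw [map_add]
  refine Submodule.add_mem _ ?_ ?_
  · rw [Submodule.mem_span_singleton] at hy
    obtain ⟨c, rfl⟩ := hy
    rw [map_smul]
    refine Submodule.smul_mem _ _ (Submodule.subset_span ⟨_, hv.weight.root hn, ?_, ?_⟩)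
    · rw [lin_neg, show ω - (ω + -S.lin α) = S.lin α by abel]
      exact hα.2
    · rw [lin_neg]
      intro h
      exact S.lin_ne_zero hα.1 (by simpa using h)
  · induction hz using Submodule.span_induction with
    | mem x h =>
      obtain ⟨lam, h1, h2, h3⟩ := h
      refine Submodule.subset_span ⟨_, h1.root hn, ?_, ?_⟩
      · rw [lin_neg]
        have : ω - (lam + -S.lin α) = (ω - lam) + S.lin α := by abel
        rw [this]
        exact S.positiveCone.add_mem h2 hα.2
      · rw [lin_neg]
        intro h
        refine hne _ h2 ?_
        rw [← h]
        abel
    | zero => rw [map_zero]; exact Submodule.zero_mem _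
    | add x y _ _ hx hy => rw [map_add]; exact Submodule.add_mem _ hx hy
    | smul c x _ hx => rw [map_smul]; exact Submodule.smul_mem _ c hx

/-- The height element of 𝔥 acts on lower weight vectors with eigenvalues different from that of ω,
and its eigenspaces are independent. -/
theorem eq_zero_of_mem_belowSpan {ω : Module.Dual ℂ S.𝔥} {x : M} (hx : S.IsWeightVec δ ω x)
    (hx' : x ∈ S.belowSpan δ ω) : x = 0 := by
  let T : Module.End ℂ M := δ (S.height : S.𝔤)
  have h1 : x ∈ T.eigenspace (ω S.height) := by
    rw [Module.End.mem_eigenspace_iff]; exact hx _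
  have h2 : S.belowSpan δ ω ≤ ⨆ μ, ⨆ (_ : μ ≠ ω S.height), T.eigenspace μ := by
    rw [belowSpan, Submodule.span_le]
    rintro y ⟨lam, h1, h2, h3⟩
    refine Submodule.mem_iSup_of_mem (lam S.height) (Submodule.mem_iSup_of_mem ?_ ?_)
    · intro h
      have h4 := S.one_le_height_of_cone h2 (fun h => h3 (sub_eq_zero.1 h).symm)
      rw [LinearMap.sub_apply, h, sub_self] at h4
      norm_num at h4
    · rw [Module.End.mem_eigenspace_iff]; exact h1 _
  exact (Submodule.disjoint_def.1 (Module.End.eigenspaces_iSupIndep T (ω S.height))) x h1 (h2 hx')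

end HighestWeight

end ChevalleyData

/-! ### Matrix representations of G and their weights -/

namespace ChevalleyData

variable {n l : ℕ} (S : ChevalleyData n l)

open Matrix

theorem expG_Ad (g : S.G) (Y : S.𝔤) : S.expG (S.Ad g Y) = g * S.expG Y * g⁻¹ := by
  rw [eq_mul_inv_iff_mul_eq]
  apply S.mat_injective
  rw [mat_mul, mat_mul, mat_expG, mat_expG]
  apply exp_mul_of_intertwine
  rw [coe_Ad, mul_assoc, mat_inv_mul, mul_one]

/-- A representation of `G` by matrices, together with its differential. -/
structure Rep (d : ℕ) where
  ρ : S.G →* Matrix (Fin d) (Fin d) ℂ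
  dρ : S.𝔤 →ₗ⁅ℂ⁆ Matrix (Fin d) (Fin d) ℂ
  map_exp : ∀ X, ρ (S.expG X) = NormedSpace.exp (dρ X)

namespace Rep

variable {S} {d : ℕ} (R : S.Rep d)

/-- The differential as a map to endomorphisms. -/
def act : S.𝔤 →ₗ⁅ℂ⁆ Module.End ℂ (Fin d → ℂ) :=
  (lieEquivMatrix' : Module.End ℂ (Fin d → ℂ) ≃ₗ⁅ℂ⁆ _).symm.toLieHom.comp R.dρ

theorem act_apply (X : S.𝔤) (v : Fin d → ℂ) : R.act X v = R.dρ X *ᵥ v := by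
  simp [act]

theorem ρ_mul_inv (g : S.G) : R.ρ g * R.ρ g⁻¹ = 1 := by rw [← map_mul, mul_inv_cancel, map_one]

theorem ρ_inv_mul (g : S.G) : R.ρ g⁻¹ * R.ρ g = 1 := by rw [← map_mul, inv_mul_cancel, map_one]

theorem hasDerivAt_exp_dρ (X : S.𝔤) :
    HasDerivAt (fun u : ℝ => NormedSpace.exp (R.dρ ((u : ℂ) • X))) (R.dρ X) 0 := by
  have h := hasDerivAt_exp_smul (R.dρ X) 0
  simp only [Complex.ofReal_zero, zero_smul, NormedSpace.exp_zero, one_mul] at h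
  have e : ∀ u : ℝ, R.dρ ((u : ℂ) • X) = (u : ℂ) • R.dρ X := fun u => map_smul R.dρ _ _
  simp only [e]
  exact h

/-- Apply ρ to g exp(tX) g⁻¹ = exp(t Ad(g)X) and differentiate at t = 0. -/
theorem conj_dρ (g : S.G) (X : S.𝔤) : R.ρ g * R.dρ X * R.ρ g⁻¹ = R.dρ (S.Ad g X) := by
  have key : ∀ Y : S.𝔤, R.ρ g * NormedSpace.exp (R.dρ Y) * R.ρ g⁻¹ =
      NormedSpace.exp (R.dρ (S.Ad g Y)) := fun Y => by
    rw [← R.map_exp, ← R.map_exp, ← map_mul, ← map_mul, expG_Ad]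
  have h1 := hasDerivAt_matrix_mul (hasDerivAt_matrix_mul (hasDerivAt_matrix_const (R.ρ g) 0)
    (R.hasDerivAt_exp_dρ X)) (hasDerivAt_matrix_const (R.ρ g⁻¹) 0)
  have h2 := R.hasDerivAt_exp_dρ (S.Ad g X)
  simp only [← map_smul, ← key] at h2
  have h3 := hasDerivAt_matrix_unique h1 h2
  rw [← h3]
  simp

/-- Irreducibility, in terms of the Lie algebra. -/
def Irreducible : Prop :=
  ∀ V : Submodule ℂ (Fin d → ℂ), (∀ X, ∀ v ∈ V, R.act X v ∈ V) → V = ⊥ ∨ V = ⊤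

theorem exp_mulVec_mem {A : Matrix (Fin d) (Fin d) ℂ} {V : Submodule ℂ (Fin d → ℂ)}
    (h : ∀ v ∈ V, A *ᵥ v ∈ V) {v : Fin d → ℂ} (hv : v ∈ V) : NormedSpace.exp A *ᵥ v ∈ V := by
  have hs : HasSum (fun k : ℕ => ((k.factorial : ℂ)⁻¹ • A ^ k) *ᵥ v) (NormedSpace.exp A *ᵥ v) := by
    let f : Matrix (Fin d) (Fin d) ℂ →+ (Fin d → ℂ) :=
      AddMonoidHom.mk' (fun X => X *ᵥ v) (fun X Y => Matrix.add_mulVec X Y v)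
    have hf : Continuous f := Continuous.matrix_mulVec continuous_id continuous_const
    exact (hasSum_exp_matrix A).map f hf
  refine V.closed_of_finiteDimensional.mem_of_tendsto hs (Filter.Eventually.of_forall fun t => ?_)
  refine Submodule.sum_mem _ fun k hk => ?_
  rw [smul_mulVec]
  refine Submodule.smul_mem _ _ ?_
  clear hk
  induction k with
  | zero => rwa [pow_zero, one_mulVec]
  | succ k ih => rw [pow_succ', ← mulVec_mulVec]; exact h _ ih

/-- G is generated by exponentials, so a subspace stable under 𝔤 is stable under G. -/
theorem irreducible_of_group (h : ∀ V : Submodule ℂ (Fin d → ℂ),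
    (∀ g, ∀ v ∈ V, (R.ρ g) *ᵥ v ∈ V) → V = ⊥ ∨ V = ⊤) : R.Irreducible := by
  refine fun V hV => h V fun g => ?_
  induction g using S.G_induction with
  | hexp X =>
    intro v hv
    rw [R.map_exp]
    exact exp_mulVec_mem (fun v hv => by rw [← act_apply]; exact hV X v hv) hv
  | hmul g g' hg hg' =>
    intro v hv
    rw [map_mul, ← mulVec_mulVec]
    exact hg _ (hg' _ hv)

/-- A basis of weight vectors, as the columns of an invertible matrix. -/
structure IsWeightBasis (P : Matrix (Fin d) (Fin d) ℂ) (lam : Fin d → Module.Dual ℂ S.𝔥) : Prop where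
  isUnit : IsUnit P
  eq : ∀ h : S.𝔥, R.dρ (h : S.𝔤) * P = P * Matrix.diagonal fun k => lam k h

variable {R}

theorem exists_isWeightBasis {s : Set (Fin d → ℂ)} (hs : ⊤ ≤ Submodule.span ℂ s)
    (hw : ∀ x ∈ s, ∃ lam, S.IsWeightVec R.act lam x) : ∃ P lam, R.IsWeightBasis P lam ∧
      ∀ k, P.col k ∈ s ∧ S.IsWeightVec R.act (lam k) (P.col k) := by
  let b := Module.Basis.ofSpan hs
  have : Fintype (((linearIndepOn_empty ℂ id).extend (Set.empty_subset s) : Set (Fin d → ℂ))) :=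
    FiniteDimensional.fintypeBasisIndex b
  let e := b.indexEquiv (Pi.basisFun ℂ (Fin d))
  let b' := b.reindex e
  have hb : ∀ k, b' k ∈ s := fun k => by
    apply Module.Basis.ofSpan_subset hs
    rw [Module.Basis.reindex_apply]
    exact ⟨_, rfl⟩
  choose lam hlam using fun k => hw _ (hb k)
  refine ⟨(Pi.basisFun ℂ (Fin d)).toMatrix b', lam, ⟨?_, fun h => ?_⟩, fun k => ?_⟩
  · exact ⟨⟨_, _, Module.Basis.toMatrix_mul_toMatrix_flip _ _,
      Module.Basis.toMatrix_mul_toMatrix_flip _ _⟩, rfl⟩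
  · ext i k
    rw [Matrix.mul_diagonal]
    have h1 := congrFun (hlam k h) i
    rw [act_apply, Pi.smul_apply, smul_eq_mul, mul_comm] at h1
    exact h1
  · exact ⟨hb k, hlam k⟩

theorem IsWeightBasis.exists_inv {P lam} (hP : R.IsWeightBasis P lam) : ∃ Q, P * Q = 1 ∧ Q * P = 1 := by
  obtain ⟨u, hu⟩ := hP.isUnit
  exact ⟨u⁻¹.1, by rw [← hu]; exact u.mul_inv, by rw [← hu]; exact u.inv_mul⟩

theorem IsWeightBasis.col_ne_zero {P lam} (hP : R.IsWeightBasis P lam) (k : Fin d) : P.col k ≠ 0 :=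
  fun h => by
  obtain ⟨Q, -, hQ⟩ := hP.exists_inv
  have h2 : (Q * P) k k = 0 := by
    rw [Matrix.mul_apply]
    refine Finset.sum_eq_zero fun j _ => ?_
    have : P j k = 0 := congrFun h j
    rw [this, mul_zero]
  rw [hQ] at h2
  simp at h2

theorem IsWeightBasis.isWeightVec {P lam} (hP : R.IsWeightBasis P lam) (k : Fin d) :
    S.IsWeightVec R.act (lam k) (P.col k) := fun h => by
  rw [act_apply]
  ext i
  have h1 := congrFun (congrFun (hP.eq h) i) k
  rw [Matrix.mul_diagonal] at h1
  rw [Pi.smul_apply, smul_eq_mul, mul_comm]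
  exact h1

/-- Expand x in the weight basis: a nonzero coordinate forces the corresponding weight to be μ. -/
theorem IsWeightBasis.exists_eq {P lam} (hP : R.IsWeightBasis P lam) {μ : Module.Dual ℂ S.𝔥}
    {x : Fin d → ℂ} (hx : x ≠ 0) (hμ : S.IsWeightVec R.act μ x) : ∃ k, lam k = μ := by
  obtain ⟨Q, hQ, hQ'⟩ : ∃ Q, P * Q = 1 ∧ Q * P = 1 := hP.exists_inv
  have hc : Q *ᵥ x ≠ 0 := fun h => hx (by
    rw [← one_mulVec x, ← hQ, ← mulVec_mulVec, h, mulVec_zero])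
  obtain ⟨k, hk⟩ := Function.ne_iff.1 hc
  refine ⟨k, LinearMap.ext fun h => ?_⟩
  have h1 : Matrix.diagonal (fun k => lam k h) *ᵥ (Q *ᵥ x) = μ h • (Q *ᵥ x) := by
    have h2 : Q * R.dρ (h : S.𝔤) = Matrix.diagonal (fun k => lam k h) * Q := by
      calc Q * R.dρ (h : S.𝔤) = Q * (R.dρ (h : S.𝔤) * P) * Q := by
            rw [mul_assoc, mul_assoc, hQ, mul_one]
        _ = _ := by rw [hP.eq, ← mul_assoc, hQ', one_mul]
    rw [mulVec_mulVec, ← h2, ← mulVec_mulVec, ← act_apply, hμ h, mulVec_smul]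
  have h3 := congrFun h1 k
  rw [mulVec_diagonal, Pi.smul_apply, smul_eq_mul] at h3
  exact mul_right_cancel₀ hk h3

theorem IsWeightBasis.trace_exp {P lam} (hP : R.IsWeightBasis P lam) (h : S.𝔥) :
    (R.ρ (S.expG (h : S.𝔤))).trace = ∑ k, Complex.exp (lam k h) := by
  obtain ⟨Q, hQ, hQ'⟩ : ∃ Q, P * Q = 1 ∧ Q * P = 1 := hP.exists_inv
  have h1 := exp_mul_of_intertwine (hP.eq h)
  have h2 : NormedSpace.exp (R.dρ (h : S.𝔤)) =
      P * NormedSpace.exp (Matrix.diagonal fun k => lam k h) * Q := by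
    rw [← h1, mul_assoc, hQ, mul_one]
  rw [R.map_exp, h2, Matrix.trace_mul_comm, ← mul_assoc, hQ', one_mul, Matrix.exp_diagonal,
    Matrix.trace_diagonal]
  refine Finset.sum_congr rfl fun k _ => ?_
  rw [Pi.coe_exp, ← Complex.exp_eq_exp_ℂ]

/-- If g induces w, then ρ(g⁻¹) turns a vector of weight λ into one of weight λ ∘ w. -/
theorem IsWeightBasis.weyl {P lam} (hP : R.IsWeightBasis P lam) {w : S.𝔥 ≃ₗ[ℂ] S.𝔥} (hw : w ∈ S.weyl)
    (k : Fin d) : ∃ m, ∀ h, lam m h = lam k (w h) := by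
  obtain ⟨g, hg⟩ := hw
  have hne := hP.col_ne_zero k
  have hv := hP.isWeightVec k
  have hne' : R.ρ g⁻¹ *ᵥ P.col k ≠ 0 := fun h => hne (by
    rw [← one_mulVec (P.col k), ← R.ρ_mul_inv g, ← mulVec_mulVec, h, mulVec_zero])
  obtain ⟨m, hm⟩ := hP.exists_eq (μ := (lam k).comp w.toLinearMap) hne' (fun h => by
    rw [act_apply, mulVec_mulVec]
    have h1 : R.dρ (h : S.𝔤) * R.ρ g⁻¹ = R.ρ g⁻¹ * R.dρ ((w h : S.𝔥) : S.𝔤) := by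
      rw [← hg h, ← R.conj_dρ, ← mul_assoc, ← mul_assoc, R.ρ_inv_mul, one_mul]
    rw [h1, ← mulVec_mulVec, ← act_apply, hv (w h), mulVec_smul]
    rfl)
  exact ⟨m, fun h => by rw [hm]; rfl⟩

theorem isWeightVec_int {lam : Module.Dual ℂ S.𝔥} {x : Fin d → ℂ} (hx : x ≠ 0)
    (hl : S.IsWeightVec R.act lam x) {α : S.Wt} (hα : α.IsNonZero) :
    ∃ k : ℤ, lam (LieAlgebra.IsKilling.coroot α) = k := by
  have t := S.isSl2Triple hα
  by_cases h0 : R.act ((LieAlgebra.IsKilling.coroot α : S.𝔥) : S.𝔤) = 0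
  · refine ⟨0, ?_⟩
    have := hl (LieAlgebra.IsKilling.coroot α)
    rw [h0, LinearMap.zero_apply] at this
    rw [(smul_eq_zero.1 this.symm).resolve_right hx, Int.cast_zero]
  · have t' : IsSl2Triple (R.act ((LieAlgebra.IsKilling.coroot α : S.𝔥) : S.𝔤)) (R.act (S.E α))
        (R.act (S.E (-α))) :=
      { h_ne_zero := h0
        lie_e_f := by rw [← LieHom.map_lie, t.lie_e_f]
        lie_h_e_nsmul := by rw [← LieHom.map_lie, t.lie_h_e_nsmul, map_nsmul]
        lie_h_f_nsmul := by rw [← LieHom.map_lie, t.lie_h_f_nsmul, map_neg, map_nsmul] }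
    exact IsSl2Triple.eigenvalue_int t' hx (hl _)

theorem Irreducible.lowerSpan_eq_top (hR : R.Irreducible) {ω : Module.Dual ℂ S.𝔥} {v : Fin d → ℂ}
    (hv : S.IsHighestVec R.act ω v) : S.lowerSpan R.act v = ⊤ :=
  (hR _ fun X _ hu => lowerSpan_stable hv X hu).resolve_left fun h => hv.ne_zero (by
    have := mem_lowerSpan (S := S) (δ := R.act) v
    rwa [h, Submodule.mem_bot] at this)

/-- By irreducibility, lowering the highest weight vector spans everything, so a basis can be chosen
among weight vectors of weight at most ω. -/
theorem Irreducible.exists_weights (hR : R.Irreducible) {ω : Module.Dual ℂ S.𝔥} {v : Fin d → ℂ}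
    (hv : S.IsHighestVec R.act ω v) : ∃ P lam, R.IsWeightBasis P lam ∧
      (∀ k, ω - lam k ∈ S.positiveCone) ∧ ∃ k, lam k = ω := by
  let s : Set (Fin d → ℂ) := {x | ∃ lam, S.IsWeightVec R.act lam x ∧ ω - lam ∈ S.positiveCone}
  have hs : ⊤ ≤ Submodule.span ℂ s := by
    rw [← hR.lowerSpan_eq_top hv]
    refine (lowerSpan_le_sup hv).trans (sup_le ?_ ?_)
    · rw [Submodule.span_singleton_le_iff_mem]
      exact Submodule.subset_span ⟨ω, hv.weight, by rw [sub_self]; exact zero_mem _⟩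
    · exact Submodule.span_mono fun x ⟨lam, h1, h2, _⟩ => ⟨lam, h1, h2⟩
  obtain ⟨P, lam, hP, h⟩ := exists_isWeightBasis hs fun x ⟨lam, h, _⟩ => ⟨lam, h⟩
  refine ⟨P, lam, hP, fun k => ?_, hP.exists_eq hv.ne_zero hv.weight⟩
  obtain ⟨⟨μ, h1, h2⟩, h3⟩ := h k
  have hne : P.col k ≠ 0 := hP.col_ne_zero k
  have : lam k = μ := by
    ext x
    exact smul_left_injective ℂ hne ((h3 x).symm.trans (h1 x))
  rwa [this]

end Rep

/-- The `j`-th fundamental representation of `G` has character `Ψ`. -/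
theorem IsFundamentalCharacter.exists_rep {S : ChevalleyData n l} {j : Fin l} {Ψ : S.G → ℂ}
    (h : S.IsFundamentalCharacter j Ψ) : ∃ (d : ℕ) (R : S.Rep d) (v : Fin d → ℂ), R.Irreducible ∧
      S.IsHighestVec R.act (S.fundWeight j) v ∧ ∀ g, Ψ g = (R.ρ g).trace := by
  obtain ⟨d, ρ, dρ, h1, h2, ⟨v, hv, h3, h4⟩, h5⟩ := h
  let R : S.Rep d := ⟨ρ, dρ, fun X => h1 _ _ (S.mat_expG X)⟩
  refine ⟨d, R, v, R.irreducible_of_group h2, ⟨hv, fun h => ?_, fun α hα => ?_⟩, h5⟩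
  · have h6 : ∀ i, R.act ((S.simpleCoroot i : S.𝔥) : S.𝔤) v =
        S.fundWeight j (S.simpleCoroot i) • v := fun i => by
      rw [Rep.act_apply, fundWeight_simpleCoroot, ite_smul, one_smul, zero_smul]
      exact h4 i
    have h7 : ((R.act : S.𝔤 →ₗ[ℂ] Module.End ℂ (Fin d → ℂ)).flip v).comp S.𝔥.toSubmodule.subtype =
        (S.fundWeight j).smulRight v := by
      refine S.corootBasis.ext fun i => ?_
      rw [corootBasis_apply]
      exact h6 i
    exact LinearMap.congr_fun h7 h
  · rw [Rep.act_apply]; exact h3 α hα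

end ChevalleyData

/-! ### Linear independence of characters with additive coefficients -/

/-- Dedekind independence is used twice: averaging translates of the relation turns its i-th term
into a combination with constant coefficients, and additivity of c_i then gives a relation whose
i-th coefficient is c_i(a) χ_i(a). -/
theorem eq_zero_of_sum_additive_mul_char {ι A : Type*} [Fintype ι] [AddCommGroup A]
    (χ : ι → Multiplicative A →* ℂ) (hχ : Function.Injective χ) (c : ι → A →+ ℂ)
    (h : ∀ a, ∑ i, c i a * χ i (Multiplicative.ofAdd a) = 0) (i : ι) (a : A) : c i a = 0 := by
  classical
  have hind : ∀ f : ι → ℂ, (∀ a, ∑ i, f i * χ i (Multiplicative.ofAdd a) = 0) → f = 0 := by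
    intro f hf
    have h1 := (linearIndependent_monoidHom (Multiplicative A) ℂ).comp χ hχ
    rw [Fintype.linearIndependent_iff] at h1
    funext i
    refine h1 f ?_ i
    funext a
    simpa using hf (Multiplicative.toAdd a)
  have hmul : ∀ i (a b : A), χ i (Multiplicative.ofAdd (a + b)) =
      χ i (Multiplicative.ofAdd a) * χ i (Multiplicative.ofAdd b) := fun i a b => by
    rw [ofAdd_add, map_mul]
  have hne : ∀ i (a : A), χ i (Multiplicative.ofAdd a) ≠ 0 := fun i a h0 => by
    have := hmul i a (-a)
    rw [h0, zero_mul, add_neg_cancel, ofAdd_zero, map_one] at this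
    exact one_ne_zero this
  have hspan : Submodule.span ℂ (Set.range fun (a : A) i => χ i (Multiplicative.ofAdd a)) = ⊤ := by
    by_contra hlt
    obtain ⟨f, hf, hle⟩ := Submodule.exists_le_ker_of_lt_top _ (lt_top_iff_ne_top.2 hlt)
    apply hf
    have h1 := hind (fun i => f (Pi.single i 1)) fun a => by
      have h2 : f (fun i => χ i (Multiplicative.ofAdd a)) = 0 :=
        hle (Submodule.subset_span ⟨a, rfl⟩)
      rw [LinearMap.pi_apply_eq_sum_univ f] at h2
      rw [← h2]
      refine Finset.sum_congr rfl fun i _ => ?_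
      rw [smul_eq_mul, mul_comm]
      congr 2
      funext j
      simp [Pi.single_apply, eq_comm]
    refine LinearMap.pi_ext' fun i => LinearMap.ext_ring ?_
    exact congrFun h1 i
  -- Independence makes the vectors (χ_j(a))_j span, so some finite combination over a isolates the
  -- index i.
  have hg : (Pi.single i 1 : ι → ℂ) ∈
      Submodule.span ℂ (Set.range fun (a : A) i => χ i (Multiplicative.ofAdd a)) := by
    rw [hspan]; trivial
  obtain ⟨g, hg⟩ := Finsupp.mem_span_range_iff_exists_finsupp.1 hg
  have hg' : ∀ j, ∑ b ∈ g.support, g b * χ j (Multiplicative.ofAdd b) = if j = i then 1 else 0 := by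
    intro j
    have := congrFun hg j
    rw [Finsupp.sum, Finset.sum_apply] at this
    simpa [Pi.single_apply] using this
  -- Sum the relation at a + b with the weights g b. The terms containing c_j(a) collapse to j = i;
  -- those containing c_j(b) have coefficients independent of a.
  obtain ⟨e, he⟩ : ∃ e : ι → ℂ, ∀ a, c i a * χ i (Multiplicative.ofAdd a) =
      ∑ j, e j * χ j (Multiplicative.ofAdd a) := by
    refine ⟨fun j => -∑ b ∈ g.support, g b * c j b * χ j (Multiplicative.ofAdd b), fun a => ?_⟩
    have h1 : ∑ b ∈ g.support, g b * ∑ j, c j (a + b) * χ j (Multiplicative.ofAdd (a + b)) = 0 :=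
      Finset.sum_eq_zero fun b _ => by rw [h, mul_zero]
    simp only [Finset.mul_sum] at h1
    rw [Finset.sum_comm] at h1
    have h2 : ∀ j, ∑ b ∈ g.support, g b * (c j (a + b) * χ j (Multiplicative.ofAdd (a + b))) =
        (if j = i then c j a * χ j (Multiplicative.ofAdd a) else 0) +
        (∑ b ∈ g.support, g b * c j b * χ j (Multiplicative.ofAdd b)) * χ j (Multiplicative.ofAdd a) := by
      intro j
      have h3 : (if j = i then c j a * χ j (Multiplicative.ofAdd a) else 0) =
          (∑ b ∈ g.support, g b * χ j (Multiplicative.ofAdd b)) * (c j a * χ j (Multiplicative.ofAdd a)) := by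
        rw [hg']; split_ifs <;> simp
      rw [h3, Finset.sum_mul, Finset.sum_mul, ← Finset.sum_add_distrib]
      refine Finset.sum_congr rfl fun b _ => ?_
      rw [hmul, map_add]
      ring
    simp only [h2, Finset.sum_add_distrib] at h1
    rw [Finset.sum_ite_eq' Finset.univ i, if_pos (Finset.mem_univ i)] at h1
    simp only [neg_mul, Finset.sum_neg_distrib]
    linear_combination h1
  -- Compare the formula at a + b with χ_i(a) times the formula at b. Additivity leaves c_i(a)
  -- χ_i(a) χ_i(b), and the coefficient of e_i is χ_i(a) - χ_i(a) = 0.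
  have h4 := hind (fun j => (if j = i then c i a * χ i (Multiplicative.ofAdd a) else 0) -
      e j * (χ j (Multiplicative.ofAdd a) - χ i (Multiplicative.ofAdd a))) fun b => by
    have h5 := he (a + b)
    have h6 := he b
    simp only [sub_mul, Finset.sum_sub_distrib, ite_mul, zero_mul]
    rw [Finset.sum_ite_eq' Finset.univ i, if_pos (Finset.mem_univ i)]
    have h7 : ∑ j, e j * χ j (Multiplicative.ofAdd (a + b)) = ∑ j, e j * χ j (Multiplicative.ofAdd a) *
      χ j (Multiplicative.ofAdd b) := Finset.sum_congr rfl fun j _ => by rw [hmul]; ring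
    have h8 : ∑ j, e j * (χ j (Multiplicative.ofAdd a) - χ i (Multiplicative.ofAdd a)) *
        χ j (Multiplicative.ofAdd b) = ∑ j, e j * χ j (Multiplicative.ofAdd a) *
      χ j (Multiplicative.ofAdd b) - χ i (Multiplicative.ofAdd a) * ∑ j, e j * χ j (Multiplicative.ofAdd b) := by
      rw [Finset.mul_sum, ← Finset.sum_sub_distrib]
      exact Finset.sum_congr rfl fun j _ => by ring
    rw [h8, ← h7, ← h5, ← h6, hmul, map_add]
    ring
  have h9 := congrFun h4 i
  simp only [if_true, sub_self, mul_zero, sub_zero, Pi.zero_apply] at h9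
  exact (mul_eq_zero.1 h9).resolve_right (hne i a)

/-! ### Directions stationary for all fundamental characters -/

namespace ChevalleyData

variable {n l : ℕ} (S : ChevalleyData n l)

/-- The integral functionals on `𝔥`. -/
def weightLattice : AddSubgroup (Module.Dual ℂ S.𝔥) where
  carrier := {lam | ∀ α : S.Wt, α.IsNonZero → ∃ k : ℤ, lam (LieAlgebra.IsKilling.coroot α) = k}
  zero_mem' := fun α _ => ⟨0, by simp⟩
  add_mem' := fun {a b} ha hb α hα => by
    obtain ⟨k, hk⟩ := ha α hα
    obtain ⟨m, hm⟩ := hb α hα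
    exact ⟨k + m, by simp [hk, hm]⟩
  neg_mem' := fun {a} ha α hα => by
    obtain ⟨k, hk⟩ := ha α hα
    exact ⟨-k, by simp [hk]⟩

variable {S} in
theorem comp_mem_weightLattice {lam : Module.Dual ℂ S.𝔥} (hl : lam ∈ S.weightLattice)
    {w : S.𝔥 ≃ₗ[ℂ] S.𝔥} (hw : w ∈ S.weyl) : lam.comp w.toLinearMap ∈ S.weightLattice := fun α hα => by
  obtain ⟨β, hβ, -, h2⟩ := S.exists_root_of_weyl (S.weyl.inv_mem hw) hα
  obtain ⟨k, hk⟩ := hl β hβ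
  refine ⟨k, ?_⟩
  rw [← hk, LinearMap.comp_apply, ← h2]
  congr 1
  exact w.apply_symm_apply _

/-- Every coroot is an integral combination of simple coroots. -/
theorem fundWeight_mem (j : Fin l) : S.fundWeight j ∈ S.weightLattice := fun α hα => by
  have hm : α ∈ LieSubalgebra.root (H := S.𝔥) := by simpa using hα
  have key : ∀ x ∈ AddSubmonoid.closure (Set.range S.simpleCoroot), ∃ k : ℤ, S.fundWeight j x = k := by
    intro x hx
    induction hx using AddSubmonoid.closure_induction with
    | mem x h =>
      obtain ⟨i, rfl⟩ := h
      exact ⟨if i = j then 1 else 0, by rw [fundWeight_simpleCoroot]; split_ifs <;> simp⟩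
    | zero => exact ⟨0, by simp⟩
    | add x y _ _ hx hy =>
      obtain ⟨k, hk⟩ := hx
      obtain ⟨m, hm⟩ := hy
      exact ⟨k + m, by simp [hk, hm]⟩
  have h := S.base.coroot_mem_or_neg_mem ⟨α, hm⟩
  rw [image_coroot_support] at h
  rcases h with h | h
  · exact key _ h
  · obtain ⟨k, hk⟩ := key _ h
    refine ⟨-k, ?_⟩
    rw [map_neg] at hk
    rw [Int.cast_neg, ← hk, neg_neg]
    rfl

/-- A vector fixed by the reflection in α is killed by α, and the roots separate points. -/
theorem weyl_fixed_eq_zero {x : S.𝔥} (hx : ∀ w ∈ S.weyl, w x = x) : x = 0 := by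
  refine S.root_ext fun α hα => ?_
  obtain ⟨w, hw, h⟩ := S.exists_weyl_reflection hα
  have h1 := h x
  rw [hx w hw] at h1
  have h2 : α x • LieAlgebra.IsKilling.coroot α = 0 := by
    have := sub_eq_self.1 h1.symm
    exact this
  exact (smul_eq_zero.1 h2).resolve_right fun h => S.coroot_ne_zero hα (congrArg Subtype.val h)

instance : Fintype S.weyl := Fintype.ofFinite _

theorem exists_weyl_max (f : S.𝔥 → ℝ) (x : S.𝔥) : ∃ w ∈ S.weyl, ∀ w' ∈ S.weyl, f (w' x) ≤ f (w x) := by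
  obtain ⟨w, hw⟩ := Finite.exists_max fun w : S.weyl => f (w.1 x)
  exact ⟨w.1, w.2, fun w' hw' => hw ⟨w', hw'⟩⟩

/-- The functional is the highest term of an exponential sum that is invariant under the Weyl
group and stationary at `x₀` in the direction `ξ`. -/
def IsTop (x₀ ξ : S.𝔥) (lam : Module.Dual ℂ S.𝔥) : Prop :=
  ∃ (ι : Type) (_ : Fintype ι) (μ : ι → Module.Dual ℂ S.𝔥),
    (∀ i, μ i ∈ S.weightLattice) ∧ (∃ i, μ i = lam) ∧
    (∀ i, ∀ w ∈ S.weyl, lam - (μ i).comp w.toLinearMap ∈ S.positiveCone) ∧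
    (∀ w ∈ S.weyl, ∀ x, ∑ i, Complex.exp (μ i (w x)) = ∑ i, Complex.exp (μ i x)) ∧
    ∑ i, μ i ξ * Complex.exp (μ i x₀) = 0

variable {S}

theorem IsTop.zero (x₀ ξ : S.𝔥) : S.IsTop x₀ ξ 0 :=
  ⟨Unit, inferInstance, fun _ => 0, fun _ => zero_mem _, ⟨(), rfl⟩,
    fun _ _ _ => by simp, fun _ _ _ => by simp, by simp⟩

/-- Multiply the two exponential sums; the product rule keeps the product stationary. -/
theorem IsTop.add {x₀ ξ : S.𝔥} {lam lam' : Module.Dual ℂ S.𝔥} (h : S.IsTop x₀ ξ lam)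
    (h' : S.IsTop x₀ ξ lam') : S.IsTop x₀ ξ (lam + lam') := by
  obtain ⟨ι, _, μ, h1, ⟨i, h2⟩, h3, h4, h5⟩ := h
  obtain ⟨ι', _, μ', h1', ⟨i', h2'⟩, h3', h4', h5'⟩ := h'
  have hs : ∀ x, ∑ p : ι × ι', Complex.exp ((μ p.1 + μ' p.2) x) =
      (∑ i, Complex.exp (μ i x)) * ∑ i, Complex.exp (μ' i x) := fun x => by
    rw [Finset.sum_mul_sum, ← Finset.univ_product_univ, Finset.sum_product]
    simp [Complex.exp_add]
  refine ⟨ι × ι', inferInstance, fun p => μ p.1 + μ' p.2, fun p => add_mem (h1 _) (h1' _),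
    ⟨(i, i'), by simp only [h2, h2']⟩, fun p w hw => ?_, fun w hw x => ?_, ?_⟩
  · have := S.positiveCone.add_mem (h3 p.1 w hw) (h3' p.2 w hw)
    rw [LinearMap.add_comp, add_sub_add_comm]
    exact this
  · rw [hs, hs, h4 w hw, h4' w hw]
  · have h6 : ∑ p : ι × ι', (μ p.1 + μ' p.2) ξ * Complex.exp ((μ p.1 + μ' p.2) x₀) =
        (∑ i, μ i ξ * Complex.exp (μ i x₀)) * (∑ i, Complex.exp (μ' i x₀)) +
        (∑ i, Complex.exp (μ i x₀)) * (∑ i, μ' i ξ * Complex.exp (μ' i x₀)) := by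
      rw [Finset.sum_mul_sum, Finset.sum_mul_sum, ← Finset.sum_add_distrib,
        ← Finset.univ_product_univ, Finset.sum_product]
      refine Finset.sum_congr rfl fun i _ => ?_
      rw [← Finset.sum_add_distrib]
      refine Finset.sum_congr rfl fun j _ => ?_
      rw [LinearMap.add_apply, LinearMap.add_apply, Complex.exp_add]
      ring
    rw [h6, h5, h5']
    simp

theorem hasDerivAt_sum_exp {ι : Type*} [Fintype ι] (μ : ι → Module.Dual ℂ S.𝔥) (x ξ : S.𝔥) :
    HasDerivAt (fun t : ℝ => ∑ i, Complex.exp (μ i (x + (t : ℂ) • ξ)))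
      (∑ i, μ i ξ * Complex.exp (μ i x)) 0 := by
  refine HasDerivAt.fun_sum fun i _ => ?_
  have h1 : HasDerivAt (fun t : ℝ => μ i x + (t : ℂ) * μ i ξ) (1 * μ i ξ) 0 :=
    ((Complex.ofRealCLM.hasDerivAt (x := 0)).mul_const _).const_add _
  have h2 := h1.cexp
  have e : ∀ t : ℝ, μ i (x + (t : ℂ) • ξ) = μ i x + (t : ℂ) * μ i ξ := fun t => by
    rw [map_add, map_smul, smul_eq_mul]
  have h3 : HasDerivAt (fun t : ℝ => Complex.exp (μ i (x + (t : ℂ) • ξ)))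
      (Complex.exp (μ i x + ((0 : ℝ) : ℂ) * μ i ξ) * (1 * μ i ξ)) 0 :=
    h2.congr_of_eventuallyEq (Filter.Eventually.of_forall fun t => congrArg Complex.exp (e t))
  rw [Complex.ofReal_zero, zero_mul, add_zero, one_mul, mul_comm] at h3
  exact h3

/-- Induction on a bound for the heights of the Weyl translates of the weight. For a dominant
weight, a monomial in the fundamental characters is stationary and has it as top term. Its orbit
expansion consists of this orbit and of orbits of smaller height, which vanish by induction. -/
theorem IsTop.orbit_zero {x₀ ξ : S.𝔥} (H : ∀ j, S.IsTop x₀ ξ (S.fundWeight j))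
    {lam : Module.Dual ℂ S.𝔥} (hl : lam ∈ S.weightLattice) :
    ∑ w : S.weyl, lam (w.1 ξ) * Complex.exp (lam (w.1 x₀)) = 0 := by
  have hcomp : ∀ (lam : Module.Dual ℂ S.𝔥) {w : S.𝔥 ≃ₗ[ℂ] S.𝔥} (_ : w ∈ S.weyl),
      ∑ v : S.weyl, (lam.comp w.toLinearMap) (v.1 ξ) * Complex.exp ((lam.comp w.toLinearMap) (v.1 x₀)) =
      ∑ v : S.weyl, lam (v.1 ξ) * Complex.exp (lam (v.1 x₀)) := fun lam w hw =>
    Fintype.sum_equiv (Equiv.mulLeft (⟨w, hw⟩ : S.weyl)) _ _ fun _ => rfl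
  have key : ∀ (N : ℕ) (lam : Module.Dual ℂ S.𝔥), lam ∈ S.weightLattice →
      (∀ w ∈ S.weyl, (lam (w S.height)).re < N) →
      ∑ w : S.weyl, lam (w.1 ξ) * Complex.exp (lam (w.1 x₀)) = 0 := by
    intro N
    induction N with
    | zero =>
      intro lam hl hN
      exfalso
      -- The Weyl orbit of the height element sums to zero, so the translates of a weight cannot all
      -- have negative height.
      have h0 : (∑ w : S.weyl, w.1 S.height) = 0 := by
        refine S.weyl_fixed_eq_zero fun w hw => ?_
        rw [map_sum]
        exact Fintype.sum_equiv (Equiv.mulLeft (⟨w, hw⟩ : S.weyl)) _ _ fun _ => rfl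
      have h1 : ∑ w : S.weyl, (lam (w.1 S.height)).re = 0 := by
        rw [← Complex.re_sum, ← map_sum, h0, map_zero, Complex.zero_re]
      have h2 : ∑ w : S.weyl, (lam (w.1 S.height)).re < 0 := by
        refine Finset.sum_neg (fun w _ => ?_) ⟨1, Finset.mem_univ _⟩
        simpa using hN w.1 w.2
      exact h2.ne h1
    | succ N ih =>
      intro lam₀ hl₀ hN₀
      -- The translate of greatest height is dominant: a simple reflection changes its height by
      -- minus its value on the simple coroot. Orbit sums do not see the replacement.
      obtain ⟨w₀, hw₀, hmax₀⟩ := S.exists_weyl_max (fun x => (lam₀ x).re) S.height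
      set lam := lam₀.comp w₀.toLinearMap with hlam
      have hl : lam ∈ S.weightLattice := comp_mem_weightLattice hl₀ hw₀
      have hN : (lam S.height).re < N + 1 := by exact_mod_cast hN₀ w₀ hw₀
      have hmax : ∀ w ∈ S.weyl, (lam (w S.height)).re ≤ (lam S.height).re := fun w hw =>
        hmax₀ (w₀ * w) (S.weyl.mul_mem hw₀ hw)
      rw [← hcomp lam₀ hw₀]
      change ∑ v : S.weyl, lam (v.1 ξ) * Complex.exp (lam (v.1 x₀)) = 0
      have hdom : ∀ j, ∃ k : ℕ, lam (S.simpleCoroot j) = k := by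
        intro j
        obtain ⟨k, hk⟩ := hl _ (S.simpleRoot_isNonZero j)
        obtain ⟨w, hw, h⟩ := S.exists_weyl_reflection (S.simpleRoot_isNonZero j)
        have h1 := hmax w hw
        rw [h, simpleRoot_height, one_smul, map_sub, hk, Complex.sub_re, Complex.intCast_re] at h1
        have h2 : (0 : ℝ) ≤ k := by linarith
        have h3 : 0 ≤ k := by exact_mod_cast h2
        refine ⟨k.toNat, ?_⟩
        rw [simpleCoroot, hk]
        exact_mod_cast (Int.toNat_of_nonneg h3).symm
      have htop : S.IsTop x₀ ξ lam := by
        choose k hk using hdom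
        rw [S.eq_sum_fundWeight lam]
        simp only [hk]
        refine Finset.sum_induction _ _ (fun _ _ => IsTop.add) (IsTop.zero _ _) fun j _ => ?_
        rw [Nat.cast_smul_eq_nsmul]
        induction k j with
        | zero => rw [zero_nsmul]; exact IsTop.zero _ _
        | succ m ih => rw [succ_nsmul]; exact ih.add (H j)
      obtain ⟨ι, _, μ, h1, ⟨i₀, h2⟩, h3, h4, h5⟩ := htop
      -- Weyl invariance of the sum makes every wξ stationary at w x₀ as well; summing over w groups
      -- the terms into orbit sums.
      have h6 : ∑ i, ∑ w : S.weyl, μ i (w.1 ξ) * Complex.exp (μ i (w.1 x₀)) = 0 := by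
        rw [Finset.sum_comm]
        refine Finset.sum_eq_zero fun w _ => ?_
        have e1 := hasDerivAt_sum_exp (fun i => (μ i).comp w.1.toLinearMap) x₀ ξ
        have e2 := hasDerivAt_sum_exp μ x₀ ξ
        rw [h5] at e2
        refine e1.unique ?_
        have e3 := funext fun t : ℝ => h4 w.1 w.2 (x₀ + (t : ℂ) • ξ)
        rw [← e3] at e2
        exact e2
      have h7 : ∀ i, (∃ w ∈ S.weyl, lam = (μ i).comp w.toLinearMap) ∨
          ∑ w : S.weyl, μ i (w.1 ξ) * Complex.exp (μ i (w.1 x₀)) = 0 := by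
        intro i
        by_cases hi : ∃ w ∈ S.weyl, lam = (μ i).comp w.toLinearMap
        · exact Or.inl hi
        · refine Or.inr (ih _ (h1 i) fun w hw => ?_)
          have h8 := S.one_le_height_of_cone (h3 i w hw) fun h => hi ⟨w, hw, sub_eq_zero.1 h⟩
          rw [LinearMap.sub_apply, Complex.sub_re] at h8
          have h9 : (μ i (w S.height)).re = (((μ i).comp w.toLinearMap) S.height).re := rfl
          rw [h9]
          linarith
      -- Each orbit sum is zero or equals that of the top weight. The top term itself counts once,
      -- so the total multiplicity is positive.
      have h8 : ∀ i, ∃ c : ℕ, (i = i₀ → c = 1) ∧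
          ∑ w : S.weyl, μ i (w.1 ξ) * Complex.exp (μ i (w.1 x₀)) =
          c * ∑ v : S.weyl, lam (v.1 ξ) * Complex.exp (lam (v.1 x₀)) := by
        intro i
        by_cases hi : i = i₀
        · refine ⟨1, fun _ => rfl, ?_⟩
          rw [hi, h2, Nat.cast_one, one_mul]
        · rcases h7 i with ⟨w, hw, h⟩ | h
          · refine ⟨1, fun _ => rfl, ?_⟩
            rw [h, hcomp _ hw, Nat.cast_one, one_mul]
          · exact ⟨0, fun h => absurd h hi, by rw [h, Nat.cast_zero, zero_mul]⟩
      choose c hc hc' using h8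
      simp only [hc', ← Finset.sum_mul] at h6
      refine (mul_eq_zero.1 h6).resolve_left ?_
      rw [← Nat.cast_sum, Nat.cast_eq_zero]
      have : c i₀ ≤ ∑ i, c i := Finset.single_le_sum (fun _ _ => Nat.zero_le _) (Finset.mem_univ i₀)
      have := hc i₀ rfl
      omega
  obtain ⟨N, hN⟩ := exists_nat_gt (∑ w : S.weyl, |(lam (w.1 S.height)).re|)
  refine key N lam hl fun w hw => lt_of_le_of_lt ?_ hN
  exact (le_abs_self _).trans (Finset.single_le_sum (f := fun w : S.weyl => |(lam (w.1 S.height)).re|)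
    (fun _ _ => abs_nonneg _) (Finset.mem_univ ⟨w, hw⟩))

/-- Regularity of `exp x₀`: only the Cartan subgroup commutes with it. -/
def IsRegular (S : ChevalleyData n l) (x₀ : S.𝔥) : Prop :=
  ∀ g : S.G, Commute g (S.expG (x₀ : S.𝔤)) → g ∈ S.cartanSubgroup

/-- The vanishing orbit sums are a relation with additive coefficients λ(wξ) between the characters
λ ↦ exp(λ(w x₀)) of the weight lattice. Its coefficient at w = 1 gives ξ = 0. -/
theorem IsRegular.eq_zero (hS : S.IsAdmissible) {x₀ ξ : S.𝔥} (hx : S.IsRegular x₀)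
    (H : ∀ j, S.IsTop x₀ ξ (S.fundWeight j)) : ξ = 0 := by
  let χ : S.weyl → Multiplicative S.weightLattice →* ℂ := fun w =>
    { toFun := fun a => Complex.exp ((Multiplicative.toAdd a).1 (w.1 x₀))
      map_one' := by simp
      map_mul' := fun a b => by simp [Complex.exp_add] }
  -- If two characters agree, w x₀ and w' x₀ differ by 2πi times integral coroots and have equal
  -- exponentials. So g'⁻¹g commutes with exp(x₀), lies in the Cartan subgroup by regularity, and
  -- acts trivially on 𝔥.
  have hχ : Function.Injective χ := by
    intro w w' h
    have h1 : ∀ j, ∃ m : ℤ, S.fundWeight j (w.1 x₀) = S.fundWeight j (w'.1 x₀) +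
        m * (2 * Real.pi * Complex.I) := fun j =>
      Complex.exp_eq_exp_iff_exists_int.1
        (DFunLike.congr_fun h (Multiplicative.ofAdd ⟨S.fundWeight j, S.fundWeight_mem j⟩))
    choose m hm using h1
    obtain ⟨g, hg⟩ := w.2
    obtain ⟨g', hg'⟩ := w'.2
    have h2 : S.expG ((w.1 x₀ : S.𝔥) : S.𝔤) = S.expG ((w'.1 x₀ : S.𝔥) : S.𝔤) := by
      have e1 : w.1 x₀ = w'.1 x₀ + ∑ j, ((m j : ℂ) * (2 * Real.pi * Complex.I)) • S.simpleCoroot j := by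
        rw [S.eq_sum_simpleCoroot (w.1 x₀)]
        conv_rhs => rw [S.eq_sum_simpleCoroot (w'.1 x₀)]
        rw [← Finset.sum_add_distrib]
        exact Finset.sum_congr rfl fun j _ => by rw [hm, add_smul]
      rw [e1, expG_add]
      have e2 := S.exp_coroot_sum_eq_one hS Finset.univ S.simpleRoot S.simpleRoot_isNonZero m
      simp only [simpleCoroot]
      rw [e2, mul_one]
    rw [← hg, ← hg', expG_Ad, expG_Ad] at h2
    have h3 : Commute (g'⁻¹ * g) (S.expG (x₀ : S.𝔤)) := by
      rw [Commute, SemiconjBy]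
      have h4 := congrArg (fun y => g'⁻¹ * y * g) h2
      simp only [mul_assoc, inv_mul_cancel, mul_one, inv_mul_cancel_left] at h4
      rw [mul_assoc, h4]
    obtain ⟨y, hy⟩ := S.mem_cartanSubgroup.1 (hx _ h3)
    apply Subtype.ext
    ext1 z
    apply Subtype.ext
    rw [← hg, ← hg', ← mul_inv_cancel_left g' g, hy, Ad_mul, Ad_expG_cartan]
  have h1 := eq_zero_of_sum_additive_mul_char χ hχ
    (fun w => ((LinearMap.applyₗ (w.1 ξ) : Module.Dual ℂ S.𝔥 →ₗ[ℂ] ℂ).toAddMonoidHom).comp S.weightLattice.subtype)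
    (fun a => IsTop.orbit_zero H a.2) 1
  rw [S.eq_sum_simpleCoroot ξ]
  refine Finset.sum_eq_zero fun j _ => ?_
  have h2 : S.fundWeight j ξ = 0 := h1 ⟨_, S.fundWeight_mem j⟩
  rw [h2, zero_smul]

theorem IsFundamentalCharacter.isTop {j : Fin l} {Ψ : S.G → ℂ} (h : S.IsFundamentalCharacter j Ψ)
    {x₀ ξ : S.𝔥} (hd : HasDerivAt (fun t : ℝ => Ψ (S.expG ((x₀ + (t : ℂ) • ξ : S.𝔥) : S.𝔤))) 0 0) :
    S.IsTop x₀ ξ (S.fundWeight j) := by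
  obtain ⟨d, R, v, hR, hv, hΨ⟩ := h.exists_rep
  obtain ⟨P, lam, hP, h1, h2⟩ := hR.exists_weights hv
  refine ⟨Fin d, inferInstance, lam, fun k α hα => Rep.isWeightVec_int (hP.col_ne_zero k)
    (hP.isWeightVec k) hα, h2, fun k w hw => ?_, fun w hw x => ?_, ?_⟩
  · obtain ⟨m, hm⟩ := hP.weyl hw k
    have : (lam k).comp w.toLinearMap = lam m := LinearMap.ext fun x => (hm x).symm
    rw [this]
    exact h1 m
  · obtain ⟨g, hg⟩ := hw
    rw [← hP.trace_exp, ← hP.trace_exp, ← hg, expG_Ad, map_mul, map_mul, Matrix.trace_mul_comm,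
      ← mul_assoc, R.ρ_inv_mul, one_mul]
  · refine (hasDerivAt_sum_exp lam x₀ ξ).unique ?_
    simpa only [hΨ, hP.trace_exp] using hd

end ChevalleyData

namespace ChevalleyData

variable {n l : ℕ} (S : ChevalleyData n l)

open Matrix

/-! ### Uniqueness of irreducible representations -/

namespace Rep

variable {S} {d d' : ℕ}

/-- The action of the Lie algebra on the direct sum of two representations. -/
def prodAct (R : S.Rep d) (R' : S.Rep d') : S.𝔤 →ₗ⁅ℂ⁆ Module.End ℂ ((Fin d → ℂ) × (Fin d' → ℂ)) where
  toFun X := (R.act X).prodMap (R'.act X)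
  map_add' X Y := by
    rw [map_add, map_add]
    rfl
  map_smul' c X := by
    rw [map_smul, map_smul]
    rfl
  map_lie' {X Y} := by
    rw [LieHom.map_lie, LieHom.map_lie]
    rfl

theorem prodAct_apply (R : S.Rep d) (R' : S.Rep d') (X : S.𝔤) (x : (Fin d → ℂ) × (Fin d' → ℂ)) :
    prodAct R R' X x = (R.act X x.1, R'.act X x.2) := rfl

theorem trace_eq_of_intertwine {R : S.Rep d} {R' : S.Rep d'} (T : (Fin d → ℂ) ≃ₗ[ℂ] (Fin d' → ℂ))
    (hT : ∀ X x, T (R.act X x) = R'.act X (T x)) (g : S.G) : (R.ρ g).trace = (R'.ρ g).trace := by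
  let A : Matrix (Fin d') (Fin d) ℂ := LinearMap.toMatrix' T.toLinearMap
  let B : Matrix (Fin d) (Fin d') ℂ := LinearMap.toMatrix' T.symm.toLinearMap
  have hBA : B * A = 1 := by
    rw [← LinearMap.toMatrix'_comp, T.symm_comp]
    exact LinearMap.toMatrix'_id
  have hAB : A * B = 1 := by
    rw [← LinearMap.toMatrix'_comp, T.comp_symm]
    exact LinearMap.toMatrix'_id
  have hA : ∀ x, A *ᵥ x = T x := fun x => LinearMap.toMatrix'_mulVec T.toLinearMap x
  have h1 : ∀ g, R'.ρ g * A = A * R.ρ g := by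
    intro g
    induction g using S.G_induction with
    | hexp X =>
      rw [R.map_exp, R'.map_exp]
      apply exp_mul_of_intertwine
      refine Matrix.ext_of_mulVec_single fun i => ?_
      rw [← mulVec_mulVec, ← mulVec_mulVec, hA, hA, ← act_apply, ← act_apply, hT]
    | hmul g g' hg hg' =>
      rw [map_mul, map_mul, Matrix.mul_assoc, hg', ← Matrix.mul_assoc, hg, Matrix.mul_assoc]
  calc (R.ρ g).trace = ((B * A) * R.ρ g).trace := by rw [hBA, Matrix.one_mul]
    _ = (B * (R'.ρ g * A)).trace := by rw [h1, Matrix.mul_assoc]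
    _ = (R'.ρ g * (A * B)).trace := by rw [Matrix.trace_mul_comm, Matrix.mul_assoc]
    _ = (R'.ρ g).trace := by rw [hAB, Matrix.mul_one]

/-- The submodule of the direct sum generated by (v, v') is the graph of an isomorphism: both
projections are onto by irreducibility, and neither kernel can be a whole summand. -/
theorem trace_eq_of_highest {R : S.Rep d} {R' : S.Rep d'} (hR : R.Irreducible) (hR' : R'.Irreducible)
    {ω : Module.Dual ℂ S.𝔥} {v : Fin d → ℂ} {v' : Fin d' → ℂ} (hv : S.IsHighestVec R.act ω v)
    (hv' : S.IsHighestVec R'.act ω v') (g : S.G) : (R.ρ g).trace = (R'.ρ g).trace := by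
  have hw : S.IsHighestVec (prodAct R R') ω (v, v') :=
    { ne_zero := fun h => hv.ne_zero (congrArg Prod.fst h)
      weight := fun h => by
        rw [prodAct_apply, hv.weight h, hv'.weight h]
        rfl
      kill := fun α hα => by
        rw [prodAct_apply, hv.kill α hα, hv'.kill α hα]
        rfl }
  set D := S.lowerSpan (prodAct R R') (v, v') with hD
  have hst : ∀ X, ∀ x ∈ D, prodAct R R' X x ∈ D := fun X x hx => lowerSpan_stable hw X hx
  have hmem : (v, v') ∈ D := mem_lowerSpan _
  -- The weight ω occurs in D only along (v, v'), which excludes (0, v') and (v, 0).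
  have aux : ∀ y ∈ D, S.IsWeightVec (prodAct R R') ω y → ∃ c : ℂ, y = c • (v, v') := by
    intro y hy hyw
    have h1 := lowerSpan_le_sup hw hy
    rw [Submodule.mem_sup] at h1
    obtain ⟨a, ha, b, hb, hab⟩ := h1
    obtain ⟨c, rfl⟩ := Submodule.mem_span_singleton.1 ha
    have h2 : b = y - c • (v, v') := by rw [← hab]; abel
    have h3 : b = 0 := by
      refine eq_zero_of_mem_belowSpan (fun h => ?_) hb
      rw [h2, map_sub, map_smul, hyw h, hw.weight h]
      module
    exact ⟨c, by rw [← hab, h3, add_zero]⟩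
  have b1 : Function.Bijective ((LinearMap.fst ℂ _ _).comp D.subtype) := by
    constructor
    · rw [← LinearMap.ker_eq_bot, LinearMap.ker_eq_bot']
      rintro ⟨⟨x, y⟩, hxy⟩ hx
      change x = 0 at hx
      subst hx
      let V : Submodule ℂ (Fin d' → ℂ) := D.comap (LinearMap.inr ℂ _ _)
      rcases hR' V (fun X y hy => by
        have := hst X _ hy
        rw [prodAct_apply] at this
        simpa [V] using this) with h | h
      · have : y ∈ V := hxy
        rw [h, Submodule.mem_bot] at this
        subst this
        rfl
      · exfalso
        have h3 : v' ∈ V := by rw [h]; trivial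
        obtain ⟨c, hc⟩ := aux (0, v') h3 fun k => by
          rw [prodAct_apply, map_zero, hv'.weight k]
          simp
        have h4 : c • v = 0 := (congrArg Prod.fst hc).symm
        have h5 : v' = c • v' := congrArg Prod.snd hc
        have h6 := (smul_eq_zero.1 h4).resolve_right hv.ne_zero
        rw [h6, zero_smul] at h5
        exact hv'.ne_zero h5
    · rw [← LinearMap.range_eq_top]
      refine (hR _ ?_).resolve_left fun h => hv.ne_zero ?_
      · rintro X _ ⟨⟨x, hx⟩, rfl⟩
        exact ⟨⟨_, hst X x hx⟩, rfl⟩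
      · have : v ∈ LinearMap.range ((LinearMap.fst ℂ _ _).comp D.subtype) := ⟨⟨_, hmem⟩, rfl⟩
        rwa [h, Submodule.mem_bot] at this
  have b2 : Function.Bijective ((LinearMap.snd ℂ _ _).comp D.subtype) := by
    constructor
    · rw [← LinearMap.ker_eq_bot, LinearMap.ker_eq_bot']
      rintro ⟨⟨x, y⟩, hxy⟩ hx
      change y = 0 at hx
      subst hx
      let V : Submodule ℂ (Fin d → ℂ) := D.comap (LinearMap.inl ℂ _ _)
      rcases hR V (fun X y hy => by
        have := hst X _ hy
        rw [prodAct_apply] at this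
        simpa [V] using this) with h | h
      · have : x ∈ V := hxy
        rw [h, Submodule.mem_bot] at this
        subst this
        rfl
      · exfalso
        have h3 : v ∈ V := by rw [h]; trivial
        obtain ⟨c, hc⟩ := aux (v, 0) h3 fun k => by
          rw [prodAct_apply, map_zero, hv.weight k]
          simp
        have h4 : c • v' = 0 := (congrArg Prod.snd hc).symm
        have h5 : v = c • v := congrArg Prod.fst hc
        have h6 := (smul_eq_zero.1 h4).resolve_right hv'.ne_zero
        rw [h6, zero_smul] at h5
        exact hv.ne_zero h5
    · rw [← LinearMap.range_eq_top]
      refine (hR' _ ?_).resolve_left fun h => hv'.ne_zero ?_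
      · rintro X _ ⟨⟨x, hx⟩, rfl⟩
        exact ⟨⟨_, hst X x hx⟩, rfl⟩
      · have : v' ∈ LinearMap.range ((LinearMap.snd ℂ _ _).comp D.subtype) := ⟨⟨_, hmem⟩, rfl⟩
        rwa [h, Submodule.mem_bot] at this
  let e1 := LinearEquiv.ofBijective _ b1
  let e2 := LinearEquiv.ofBijective _ b2
  refine trace_eq_of_intertwine (e1.symm.trans e2) (fun X x => ?_) g
  obtain ⟨⟨y, hy⟩, rfl⟩ := e1.surjective x
  have h1 : R.act X (e1 ⟨y, hy⟩) = e1 ⟨_, hst X y hy⟩ := rfl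
  rw [h1, LinearEquiv.trans_apply, LinearEquiv.trans_apply, e1.symm_apply_apply, e1.symm_apply_apply]
  rfl

/-- The dual representation. -/
def dual (R : S.Rep d) : S.Rep d where
  ρ :=
    { toFun := fun g => (R.ρ g⁻¹)ᵀ
      map_one' := by rw [inv_one, map_one, Matrix.transpose_one]
      map_mul' := fun g h => by rw [_root_.mul_inv_rev, map_mul, Matrix.transpose_mul] }
  dρ :=
    { toFun := fun X => -(R.dρ X)ᵀ
      map_add' := fun X Y => by rw [map_add, Matrix.transpose_add, neg_add]
      map_smul' := fun c X => by rw [map_smul, Matrix.transpose_smul, ← smul_neg]; rfl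
      map_lie' := fun {X Y} => by
        rw [LieHom.map_lie, Ring.lie_def, Ring.lie_def, Matrix.transpose_sub, Matrix.transpose_mul,
          Matrix.transpose_mul]
        noncomm_ring }
  map_exp X := by
    change (R.ρ (S.expG X)⁻¹)ᵀ = NormedSpace.exp (-(R.dρ X)ᵀ)
    rw [← expG_neg, R.map_exp, ← Matrix.exp_transpose, map_neg, Matrix.transpose_neg]

theorem dual_act (R : S.Rep d) (X : S.𝔤) (v : Fin d → ℂ) : R.dual.act X v = -(v ᵥ* R.dρ X) := by
  rw [act_apply]
  change (-(R.dρ X)ᵀ) *ᵥ v = _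
  rw [neg_mulVec, mulVec_transpose]

/-- The annihilator of an invariant subspace of the dual is invariant, hence trivial or everything.
-/
theorem Irreducible.dual {R : S.Rep d} (hR : R.Irreducible) : R.dual.Irreducible := by
  intro V hV
  let U : Submodule ℂ (Fin d → ℂ) :=
    { carrier := {x | ∀ v ∈ V, v ⬝ᵥ x = 0}
      zero_mem' := fun v _ => dotProduct_zero v
      add_mem' := fun {a b} ha hb v hv => by rw [dotProduct_add, ha v hv, hb v hv, add_zero]
      smul_mem' := fun c a ha v hv => by rw [dotProduct_smul, ha v hv, smul_zero] }
  rcases hR U (fun X x hx v hv => by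
    rw [act_apply, dotProduct_mulVec]
    have h1 := hx _ (hV X v hv)
    rw [dual_act, neg_dotProduct, neg_eq_zero] at h1
    exact h1) with h | h
  · right
    by_contra hlt
    obtain ⟨f, hf, hle⟩ := Submodule.exists_le_ker_of_lt_top _ (lt_top_iff_ne_top.2 hlt)
    have h1 : (fun i => f (Pi.single i 1)) ∈ U := fun v hv => by
      have h2 : f v = 0 := hle hv
      rw [LinearMap.pi_apply_eq_sum_univ f] at h2
      rw [← h2, dotProduct]
      refine Finset.sum_congr rfl fun i _ => ?_
      rw [smul_eq_mul]
      congr 2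
      funext j
      simp [Pi.single_apply, eq_comm]
    rw [h, Submodule.mem_bot] at h1
    exact hf (LinearMap.pi_ext' fun i => LinearMap.ext_ring (congrFun h1 i))
  · left
    rw [eq_bot_iff]
    intro v hv
    rw [Submodule.mem_bot]
    funext i
    have h1 : (Pi.single i 1 : Fin d → ℂ) ∈ U := by rw [h]; trivial
    simpa using h1 v hv

end Rep

/-! ### The longest element of the Weyl group -/

/-- Applied with the height relative to a Weyl translate of the base: a positive root of value 1
must be simple. -/
theorem cone_trichotomy (H : Module.Dual ℂ S.𝔥 →+ ℝ) (hH : ∀ k, 1 ≤ H (S.lin (S.simpleRoot k)))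
    {γ : Module.Dual ℂ S.𝔥} (hγ : γ ∈ S.positiveCone) :
    γ = 0 ∨ (1 ≤ H γ ∧ ∃ k, γ = S.lin (S.simpleRoot k)) ∨ 2 ≤ H γ := by
  induction hγ using AddSubmonoid.closure_induction with
  | mem γ h => obtain ⟨k, rfl⟩ := h; exact Or.inr (Or.inl ⟨hH k, k, rfl⟩)
  | zero => exact Or.inl rfl
  | add γ γ' _ _ h h' =>
    rcases h with rfl | h
    · rwa [zero_add]
    · rcases h' with rfl | h'
      · rw [add_zero]; exact Or.inr h
      · refine Or.inr (Or.inr ?_)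
        have h1 : 1 ≤ H γ := by
          rcases h with h | h
          · exact h.1
          · linarith
        have h2 : 1 ≤ H γ' := by
          rcases h' with h | h
          · exact h.1
          · linarith
        rw [map_add]
        linarith

theorem exists_longest : ∃ w ∈ S.weyl, (∀ α, S.IsPositiveRoot α → ∃ β, S.IsPositiveRoot β ∧
    ∀ h, β (w h) = - α h) ∧ ∃ θ : Fin l → Fin l, Function.Bijective θ ∧
      ∀ i, w (S.simpleCoroot (θ i)) = - S.simpleCoroot i := by
  -- Maximality under simple reflections makes every simple root nonnegative on w(-height), so w
  -- reverses the sign of all roots.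
  obtain ⟨w, hw, hmax⟩ := S.exists_weyl_max (fun x => (∑ i, S.fundWeight i x).re) (-S.height)
  have h1 : ∀ i, 0 ≤ (S.simpleRoot i (w (-S.height))).re := by
    intro i
    obtain ⟨s, hs, hs'⟩ := S.exists_weyl_reflection (S.simpleRoot_isNonZero i)
    have h2 := hmax (s * w) (S.weyl.mul_mem hs hw)
    have h3 : (s * w) (-S.height) = w (-S.height) - S.simpleRoot i (w (-S.height)) • S.simpleCoroot i :=
      hs' _
    rw [h3] at h2
    have h4 : ∑ j, S.fundWeight j (w (-S.height) - S.simpleRoot i (w (-S.height)) • S.simpleCoroot i) =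
        ∑ j, S.fundWeight j (w (-S.height)) - S.simpleRoot i (w (-S.height)) := by
      simp only [map_sub, map_smul, fundWeight_simpleCoroot, Finset.sum_sub_distrib, smul_eq_mul]
      simp
    rw [h4, Complex.sub_re] at h2
    linarith
  have h2 : ∀ f ∈ S.positiveCone, (f (w S.height)).re ≤ 0 := by
    intro f hf
    induction hf using AddSubmonoid.closure_induction with
    | mem f h =>
      obtain ⟨i, rfl⟩ := h
      have h3 := h1 i
      rw [map_neg, ← lin_apply, map_neg, Complex.neg_re] at h3
      change (S.lin (S.simpleRoot i) _).re ≤ 0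
      linarith
    | zero => simp
    | add f g _ _ hf hg =>
      rw [LinearMap.add_apply, Complex.add_re]
      linarith
  have hpos : ∀ α, S.IsPositiveRoot α → ∃ β, S.IsPositiveRoot β ∧ (∀ h, α (w h) = - β h) ∧
      w (LieAlgebra.IsKilling.coroot β) = - LieAlgebra.IsKilling.coroot α := by
    intro α hα
    obtain ⟨β, hβ, hβ1, hβ2⟩ := S.exists_root_of_weyl hw hα.1
    have h3 : ¬ S.IsPositiveRoot β := fun h => by
      have h4 := S.one_le_height_of_cone h.2 (S.lin_ne_zero hβ)
      have h5 := h2 _ hα.2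
      have h6 : (LieModule.Weight.toLinear ℂ S.𝔥 S.𝔤 β) S.height =
        (LieModule.Weight.toLinear ℂ S.𝔥 S.𝔤 α) (w S.height) := hβ1 _
      rw [h6] at h4
      linarith
    refine ⟨-β, (S.positive_or_neg hβ).resolve_left h3, fun h => ?_, ?_⟩
    · rw [← hβ1]; simp
    · rw [LieAlgebra.IsKilling.coroot_neg, map_neg, hβ2]
  have hpos' : ∀ α, S.IsPositiveRoot α → ∃ β, S.IsPositiveRoot β ∧ ∀ h, β (w h) = - α h := by
    intro α hα
    obtain ⟨β, hβ, hβ1, -⟩ := S.exists_root_of_weyl (S.weyl.inv_mem hw) hα.1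
    have hβ2 : ∀ h, β (w h) = α h := fun h => by
      rw [hβ1]; congr 1; exact w.symm_apply_apply h
    have h3 : ¬ S.IsPositiveRoot β := fun h => by
      obtain ⟨γ, hγ, hγ1, -⟩ := hpos β h
      have h4 : S.lin α = - S.lin γ := LinearMap.ext fun x => (hβ2 x).symm.trans (hγ1 x)
      exact S.lin_ne_zero hα.1 (S.cone_pointed hα.2 (by
        change - S.lin α ∈ _
        rw [h4, neg_neg]; exact hγ.2))
    refine ⟨-β, (S.positive_or_neg hβ).resolve_left h3, fun h => ?_⟩
    rw [← hβ2]; simp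
  have hsimple : ∀ i, ∃ k, w (S.simpleCoroot k) = - S.simpleCoroot i := by
    intro i
    obtain ⟨β, hβ, hβ1, hβ2⟩ := hpos (S.simpleRoot i) ⟨S.simpleRoot_isNonZero i, S.lin_simpleRoot_mem i⟩
    -- This height takes values at least 1 on simple roots and exactly 1 on β, so β is simple.
    let H : Module.Dual ℂ S.𝔥 →+ ℝ :=
      { toFun := fun f => -(f (w.symm S.height)).re
        map_zero' := by simp
        map_add' := fun f g => by rw [LinearMap.add_apply, Complex.add_re, neg_add] }
    have hH : ∀ k, 1 ≤ H (S.lin (S.simpleRoot k)) := by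
      intro k
      obtain ⟨γ, hγ, hγ1⟩ := hpos' (S.simpleRoot k) ⟨S.simpleRoot_isNonZero k, S.lin_simpleRoot_mem k⟩
      have h4 := S.one_le_height_of_cone hγ.2 (S.lin_ne_zero hγ.1)
      have h5 : (LieModule.Weight.toLinear ℂ S.𝔥 S.𝔤 γ) S.height = - S.simpleRoot k (w.symm S.height) := by
        rw [← hγ1, w.apply_symm_apply]; rfl
      rw [h5, Complex.neg_re] at h4
      exact h4
    have hβH : H (S.lin β) = 1 := by
      change -(β (w.symm S.height)).re = 1
      have h5 := hβ1 (w.symm S.height)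
      rw [w.apply_symm_apply, simpleRoot_height] at h5
      rw [← Complex.neg_re, ← h5, Complex.one_re]
    rcases S.cone_trichotomy H hH hβ.2 with h | ⟨-, k, hk⟩ | h
    · exact absurd h (S.lin_ne_zero hβ.1)
    · have : β = S.simpleRoot k := S.lin_injective hk
      refine ⟨k, ?_⟩
      rw [this] at hβ2
      exact hβ2
    · change 2 ≤ H (S.lin β) at h
      rw [hβH] at h
      norm_num at h
  choose θ hθ using hsimple
  have hinj : Function.Injective θ := fun i i' h => by
    have h1 := hθ i
    rw [h, hθ i'] at h1
    exact (S.linearIndependent_simpleCoroot.injective (neg_injective h1)).symm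
  exact ⟨w, hw, hpos', θ, Finite.injective_iff_bijective.1 hinj, hθ⟩

/-- The dual of a fundamental representation is fundamental. -/
theorem exists_dual_index {Ψ : Fin l → S.G → ℂ} (hΨ : ∀ j, S.IsFundamentalCharacter j (Ψ j)) (j : Fin l) :
    ∃ i, ∀ x, Ψ j x⁻¹ = Ψ i x := by
  obtain ⟨w, hw, hneg, θ, hθ, hθ'⟩ := S.exists_longest
  obtain ⟨d, R, v, hR, hv, hΨj⟩ := (hΨ j).exists_rep
  obtain ⟨d', R', v', hR', hv', hΨi⟩ := (hΨ (θ j)).exists_rep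
  obtain ⟨P, lam, hP, h1, k₀, h2⟩ := hR.exists_weights hv
  obtain ⟨k, hk⟩ := hP.weyl hw k₀
  -- The weight λ_k = ω_j ∘ w is the lowest one, and its negative is fundamental because w permutes
  -- the simple coroots up to sign.
  have hk' : S.fundWeight (θ j) = - lam k := by
    rw [h2] at hk
    refine S.corootBasis.ext fun i => ?_
    obtain ⟨i, rfl⟩ := hθ.2 i
    rw [corootBasis_apply, LinearMap.neg_apply, hk, hθ', map_neg, neg_neg, fundWeight_simpleCoroot,
      fundWeight_simpleCoroot]
    simp only [hθ.1.eq_iff]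
  obtain ⟨Q, hQ, hQ'⟩ := hP.exists_inv
  have hrow : ∀ m, S.IsWeightVec R.dual.act (-lam m) (Q.row m) := by
    intro m h
    have h3 : Q * R.dρ (h : S.𝔤) = Matrix.diagonal (fun k => lam k h) * Q := by
      calc Q * R.dρ (h : S.𝔤) = Q * (R.dρ (h : S.𝔤) * P) * Q := by
            rw [mul_assoc, mul_assoc, hQ, mul_one]
        _ = _ := by rw [hP.eq, ← mul_assoc, hQ', one_mul]
    rw [Rep.dual_act]
    have h4 : Q.row m ᵥ* R.dρ (h : S.𝔤) = lam m h • Q.row m := by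
      funext i
      have h5 := congrFun (congrFun h3 m) i
      rw [Matrix.diagonal_mul] at h5
      exact h5
    rw [h4, LinearMap.neg_apply, neg_smul]
  have hbasis : R.dual.IsWeightBasis Qᵀ fun m => -lam m := by
    refine ⟨⟨⟨Qᵀ, Pᵀ, ?_, ?_⟩, rfl⟩, fun h => ?_⟩
    · rw [← Matrix.transpose_mul, hQ, Matrix.transpose_one]
    · rw [← Matrix.transpose_mul, hQ', Matrix.transpose_one]
    · ext i m
      rw [Matrix.mul_diagonal]
      have h5 := congrFun (hrow m h) i
      rw [Rep.act_apply, Pi.smul_apply, smul_eq_mul, mul_comm] at h5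
      exact h5
  have hhigh : S.IsHighestVec R.dual.act (S.fundWeight (θ j)) (Q.row k) := by
    refine ⟨hbasis.col_ne_zero k, by rw [hk']; exact hrow k, fun α hα => ?_⟩
    -- Raising the vector by α would make λ_k - α a weight of the original representation;
    -- transporting by w⁻¹ gives a weight ω_j + β above the highest one.
    by_contra hne
    obtain ⟨m, hm⟩ := hbasis.exists_eq hne ((hrow k).root hα.1)
    obtain ⟨β, hβ, hβ'⟩ := hneg α hα
    obtain ⟨m', hm'⟩ := hP.weyl (S.weyl.inv_mem hw) m
    have h6 : S.lin β = -(S.fundWeight j - lam m') := by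
      ext x
      obtain ⟨y, rfl⟩ := w.surjective x
      have e1 : lam m' (w y) = lam m y := by
        rw [hm']; congr 1; exact w.symm_apply_apply y
      have e2 := LinearMap.congr_fun hm y
      rw [LinearMap.neg_apply, LinearMap.add_apply, LinearMap.neg_apply, hk, h2, lin_apply] at e2
      rw [lin_apply, hβ', LinearMap.neg_apply, LinearMap.sub_apply, e1]
      linear_combination e2
    exact S.lin_ne_zero hβ.1 (S.cone_pointed hβ.2 (by
      change - S.lin β ∈ _
      rw [h6, neg_neg]; exact h1 m'))
  refine ⟨θ j, fun x => ?_⟩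
  rw [hΨi, hΨj, ← Rep.trace_eq_of_highest hR.dual hR' hhigh hv' x]
  exact (Matrix.trace_transpose _).symm

end ChevalleyData

/-! ### Characters on the compact torus and independence of the χ_j -/

namespace ChevalleyData

variable {n l : ℕ} (S : ChevalleyData n l)

/-- The compact part of the element of `𝔥` with given coordinates in the basis of coroots. -/
def compactPart (s : Fin l → ℂ) : S.𝔥 := ∑ i, (Complex.I * ((s i).im : ℂ)) • S.simpleCoroot i

variable {S}

theorem apply_compactPart (lam : Module.Dual ℂ S.𝔥) (s : Fin l → ℂ) :
    lam (S.compactPart s) = ∑ i, (Complex.I * ((s i).im : ℂ)) * lam (S.simpleCoroot i) := by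
  rw [compactPart, map_sum]
  exact Finset.sum_congr rfl fun i _ => by rw [map_smul, smul_eq_mul]

/-- An integral weight takes imaginary values on imaginary combinations of coroots. -/
theorem conj_apply_compactPart {lam : Module.Dual ℂ S.𝔥} (hl : lam ∈ S.weightLattice) (s : Fin l → ℂ) :
    (starRingEnd ℂ) (lam (S.compactPart s)) = - lam (S.compactPart s) := by
  rw [apply_compactPart, map_sum, ← Finset.sum_neg_distrib]
  refine Finset.sum_congr rfl fun i _ => ?_
  obtain ⟨k, hk⟩ := hl _ (S.simpleRoot_isNonZero i)
  rw [simpleCoroot, hk]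
  simp

theorem compactPart_line (s : Fin l → ℂ) (i : Fin l) (t : ℝ) :
    S.compactPart s + (t : ℂ) • (Complex.I • S.simpleCoroot i) =
      S.compactPart (s + Pi.single i (t * Complex.I)) := by
  have h : ∀ j, S.fundWeight j (S.compactPart s + (t : ℂ) • (Complex.I • S.simpleCoroot i)) =
      S.fundWeight j (S.compactPart (s + Pi.single i (t * Complex.I))) := by
    intro j
    rw [map_add, apply_compactPart, apply_compactPart]
    simp only [map_smul, fundWeight_simpleCoroot, smul_eq_mul, mul_ite, mul_one, mul_zero,
      Finset.sum_ite_eq', Finset.mem_univ, if_true, Pi.add_apply, Complex.add_im]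
    by_cases hij : i = j
    · subst hij
      simp
      ring
    · rw [if_neg hij, Pi.single_eq_of_ne (Ne.symm hij)]
      simp
  rw [S.eq_sum_simpleCoroot (S.compactPart s + _), S.eq_sum_simpleCoroot (S.compactPart (s + _))]
  simp only [h]

theorem IsFundamentalCharacter.exists_sum {j : Fin l} {Ψ : S.G → ℂ} (h : S.IsFundamentalCharacter j Ψ) :
    ∃ (d : ℕ) (R : S.Rep d) (P : _) (lam : Fin d → Module.Dual ℂ S.𝔥), R.IsWeightBasis P lam ∧
      (∀ k, lam k ∈ S.weightLattice) ∧ (∀ g, Ψ g = (R.ρ g).trace) ∧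
      ∀ x : S.𝔥, Ψ (S.expG (x : S.𝔤)) = ∑ k, Complex.exp (lam k x) := by
  obtain ⟨d, R, v, hR, hv, hΨ⟩ := h.exists_rep
  obtain ⟨P, lam, hP, -, -⟩ := hR.exists_weights hv
  exact ⟨d, R, P, lam, hP, fun k α hα => Rep.isWeightVec_int (hP.col_ne_zero k) (hP.isWeightVec k) hα,
    hΨ, fun x => by rw [hΨ, hP.trace_exp]⟩

theorem IsFundamentalCharacter.conj {j : Fin l} {Ψ : S.G → ℂ} (h : S.IsFundamentalCharacter j Ψ)
    (s : Fin l → ℂ) : (starRingEnd ℂ) (Ψ (S.expG (S.compactPart s : S.𝔤))) =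
      Ψ (S.expG (S.compactPart s : S.𝔤))⁻¹ := by
  obtain ⟨d, R, P, lam, -, h1, -, h2⟩ := h.exists_sum
  rw [← expG_neg, h2, map_sum]
  have h3 : -(S.compactPart s : S.𝔤) = ((-S.compactPart s : S.𝔥) : S.𝔤) := rfl
  rw [h3, h2]
  refine Finset.sum_congr rfl fun k _ => ?_
  rw [← Complex.exp_conj, conj_apply_compactPart (h1 k), map_neg]

theorem IsFundamentalCharacter.exists_deriv {j : Fin l} {Ψ : S.G → ℂ} (h : S.IsFundamentalCharacter j Ψ)
    (x₀ : S.𝔥) : ∃ D : Module.Dual ℂ S.𝔥, ∀ ξ,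
      HasDerivAt (fun t : ℝ => Ψ (S.expG ((x₀ + (t : ℂ) • ξ : S.𝔥) : S.𝔤))) (D ξ) 0 := by
  obtain ⟨d, R, P, lam, -, -, -, h2⟩ := h.exists_sum
  refine ⟨∑ k, Complex.exp (lam k x₀) • lam k, fun ξ => ?_⟩
  have h3 := hasDerivAt_sum_exp lam x₀ ξ
  simp only [h2]
  convert h3 using 1
  rw [LinearMap.sum_apply]
  exact Finset.sum_congr rfl fun k _ => mul_comm _ _

theorem IsFundamentalCharacter.differentiable {j : Fin l} {Ψ : S.G → ℂ}
    (h : S.IsFundamentalCharacter j Ψ) :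
    Differentiable ℝ fun s : Fin l → ℂ => Ψ (S.expG (S.compactPart s : S.𝔤)) := by
  obtain ⟨d, R, P, lam, -, -, -, h2⟩ := h.exists_sum
  simp only [h2, apply_compactPart]
  have h1 : ∀ i : Fin l, Differentiable ℝ fun s : Fin l → ℂ => ((s i).im : ℂ) := fun i =>
    (Complex.ofRealCLM.comp (Complex.imCLM.comp
      (ContinuousLinearMap.proj (R := ℝ) (φ := fun _ : Fin l => ℂ) i))).differentiable
  fun_prop

/-- The common kernel of the l differentials on the l-dimensional 𝔥 is zero, so jointly they form a
bijection onto ℂ^l. -/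
theorem linearIndependent_deriv (hS : S.IsAdmissible) {Ψ : Fin l → S.G → ℂ}
    (hΨ : ∀ j, S.IsFundamentalCharacter j (Ψ j)) {x₀ : S.𝔥} (hx : S.IsRegular x₀)
    {D : Fin l → Module.Dual ℂ S.𝔥} (hD : ∀ j ξ,
      HasDerivAt (fun t : ℝ => Ψ j (S.expG ((x₀ + (t : ℂ) • ξ : S.𝔥) : S.𝔤))) (D j ξ) 0) :
    LinearIndependent ℂ D := by
  have hinj : Function.Injective (LinearMap.pi D) := by
    rw [← LinearMap.ker_eq_bot, LinearMap.ker_eq_bot']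
    intro ξ hξ
    refine hx.eq_zero hS fun j => (hΨ j).isTop ?_
    have := hD j ξ
    rwa [show D j ξ = 0 from congrFun hξ j] at this
  have hsurj : Function.Surjective (LinearMap.pi D) :=
    (LinearMap.injective_iff_surjective_of_finrank_eq_finrank (by
      rw [Module.finrank_eq_card_basis S.corootBasis, Module.finrank_fintype_fun_eq_card])).1 hinj
  rw [Fintype.linearIndependent_iff]
  intro e he i
  obtain ⟨ξ, hξ⟩ := hsurj (Pi.single i 1)
  have h1 := LinearMap.congr_fun he ξ
  rw [LinearMap.sum_apply] at h1
  have h2 : ∀ j, D j ξ = (Pi.single i 1 : Fin l → ℂ) j := fun j => congrFun hξ j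
  simpa [h2, Pi.single_apply] using h1

open Classical in
-- Both cases become twice a real part, since Im z = Re(-iz); this allows one computation for both.
theorem chi_eq {Ψ : Fin l → S.G → ℂ} (j : Fin l) (g : S.G) : chi Ψ j g =
    2 * ((if ∃ i < j, ∀ x, Ψ i x⁻¹ = Ψ j x then -(Complex.I / 2) else 1 / 2) * Ψ j g).re := by
  rw [chi]
  split_ifs <;> simp <;> ring

/-- The function depends only on the imaginary coordinates. Writing real parts as half sums with
conjugates, and conjugation as the duality permutation σ, turns vanishing of its differential into a
relation between the independent dΨ_j. -/
theorem exists_hasFDerivAt_chi (hS : S.IsAdmissible) {Ψ : Fin l → S.G → ℂ}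
    (hΨ : ∀ j, S.IsFundamentalCharacter j (Ψ j)) (c : Fin l → ℝ) (s₀ : Fin l → ℂ)
    (hx : S.IsRegular (S.compactPart s₀)) : ∃ L : Fin l → ℝ,
      HasFDerivAt (fun s => ∑ j, c j * chi Ψ j (S.expG (S.compactPart s : S.𝔤)))
        (∑ i, L i • (Complex.imCLM.comp (ContinuousLinearMap.proj (R := ℝ) i) : (Fin l → ℂ) →L[ℝ] ℝ)) s₀ ∧
      ((∀ i, L i = 0) ↔ ∀ j, c j = 0) := by
  classical
  choose D hD using fun j => (hΨ j).exists_deriv (S.compactPart s₀)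
  choose σ hσ using S.exists_dual_index hΨ
  have hind := linearIndependent_deriv hS hΨ hx hD
  set u : Fin l → ℂ := fun j => if ∃ i < j, ∀ x, Ψ i x⁻¹ = Ψ j x then -(Complex.I / 2) else 1 / 2 with hu
  set f : (Fin l → ℂ) → ℝ := fun s => ∑ j, c j * chi Ψ j (S.expG (S.compactPart s : S.𝔤)) with hf
  have hfeq : f = fun s => ∑ j, c j * (2 * (u j * Ψ j (S.expG (S.compactPart s : S.𝔤))).re) := by
    funext s
    exact Finset.sum_congr rfl fun j _ => by rw [chi_eq]
  have hdiff : DifferentiableAt ℝ f s₀ := by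
    rw [hfeq]
    have h1 := fun j => (hΨ j).differentiable
    have h2 : ∀ j, Differentiable ℝ fun s => (u j * Ψ j (S.expG (S.compactPart s : S.𝔤))).re :=
      fun j => Complex.reCLM.differentiable.comp ((h1 j).const_mul (u j))
    have h3 : Differentiable ℝ fun s => ∑ j, c j * (2 * (u j * Ψ j (S.expG (S.compactPart s : S.𝔤))).re) := by
      refine Differentiable.fun_sum fun j _ => ?_
      exact ((h2 j).const_mul 2).const_mul (c j)
    exact h3 s₀
  set B : Fin l → Fin l → ℂ := fun j i => D j (Complex.I • S.simpleCoroot i) with hB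
  have hline : ∀ j i, HasDerivAt (fun t : ℝ => Ψ j (S.expG (S.compactPart
      (s₀ + Pi.single i (t * Complex.I)) : S.𝔤))) (B j i) 0 := fun j i => by
    have h1 := hD j (Complex.I • S.simpleCoroot i)
    simp only [compactPart_line] at h1
    exact h1
  -- On the compact torus the conjugate of Ψ_j is Ψ_j of the inverse, which is the dual character
  -- Ψ_{σ j}.
  have hconj : ∀ j i, (starRingEnd ℂ) (B j i) = B (σ j) i := fun j i => by
    have h1 : HasDerivAt (fun t : ℝ => (starRingEnd ℂ) (Ψ j (S.expG (S.compactPart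
      (s₀ + Pi.single i (t * Complex.I)) : S.𝔤)))) ((starRingEnd ℂ) (B j i)) 0 := (hline j i).star
    simp only [(hΨ j).conj, hσ] at h1
    exact h1.unique (hline (σ j) i)
  have hI : ∀ i, HasDerivAt (fun t : ℝ => f (s₀ + Pi.single i (t * Complex.I)))
      (∑ j, c j * (2 * (u j * B j i).re)) 0 := fun i => by
    rw [hfeq]
    refine HasDerivAt.fun_sum fun j _ => ?_
    have h1 := Complex.reCLM.hasFDerivAt.comp_hasDerivAt (0 : ℝ) ((hline j i).const_mul (u j))
    exact (h1.const_mul 2).const_mul (c j)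
  have hR : ∀ i, HasDerivAt (fun t : ℝ => f (s₀ + Pi.single i (t : ℂ))) 0 0 := fun i => by
    have h1 : ∀ t : ℝ, S.compactPart (s₀ + Pi.single i (t : ℂ)) = S.compactPart s₀ := fun t => by
      rw [compactPart, compactPart]
      refine Finset.sum_congr rfl fun j _ => ?_
      by_cases hij : j = i
      · subst hij; simp
      · simp [Pi.single_eq_of_ne hij]
    simp only [hf, h1]
    exact hasDerivAt_const _ _
  have hlin : ∀ v : Fin l → ℂ, HasDerivAt (fun t : ℝ => s₀ + (t : ℝ) • v) v 0 := fun v => by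
    have := ((hasDerivAt_id (0 : ℝ)).smul_const v).const_add s₀
    simpa using this
  have happ : ∀ v, HasDerivAt (fun t : ℝ => f (s₀ + t • v)) (fderiv ℝ f s₀ v) 0 := fun v => by
    have h1 : HasFDerivAt f (fderiv ℝ f s₀) (s₀ + (0 : ℝ) • v) := by simpa using hdiff.hasFDerivAt
    exact h1.comp_hasDerivAt (0 : ℝ) (hlin v)
  have e1 : ∀ i, fderiv ℝ f s₀ (Pi.single i Complex.I) = ∑ j, c j * (2 * (u j * B j i).re) := fun i => by
    have h1 := happ (Pi.single i Complex.I)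
    simp only [← Pi.single_smul, Complex.real_smul] at h1
    exact h1.unique (hI i)
  have e2 : ∀ i, fderiv ℝ f s₀ (Pi.single i 1) = 0 := fun i => by
    have h1 := happ (Pi.single i 1)
    simp only [← Pi.single_smul, Complex.real_smul, mul_one] at h1
    exact h1.unique (hR i)
  refine ⟨fun i => ∑ j, c j * (2 * (u j * B j i).re), ?_, ?_, ?_⟩
  · convert hdiff.hasFDerivAt using 1
    ext v
    have hv : v = ∑ i, ((v i).re • (Pi.single i 1 : Fin l → ℂ) + (v i).im • (Pi.single i Complex.I : Fin l → ℂ)) := by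
      funext k
      simp [Finset.sum_apply, Pi.single_apply, Finset.sum_add_distrib]
    conv_rhs => rw [hv]
    rw [map_sum, ContinuousLinearMap.sum_apply]
    refine Finset.sum_congr rfl fun i _ => ?_
    rw [map_add, map_smul, map_smul, e1, e2]
    simp [mul_comm]
  · intro h0
    have h1 : ∑ j, ((c j : ℂ) • (u j • D j + (starRingEnd ℂ) (u j) • D (σ j))) = 0 := by
      refine S.corootBasis.ext fun i => ?_
      rw [corootBasis_apply]
      have h2 : ∑ j, (c j : ℂ) * (u j * B j i + (starRingEnd ℂ) (u j) * B (σ j) i) = 0 := by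
        have h3 : ∑ j, c j * (2 * (u j * B j i).re) = 0 := h0 i
        have h4 : ((∑ j, c j * (2 * (u j * B j i).re) : ℝ) : ℂ) = 0 := by rw [h3]; simp
        rw [← h4, Complex.ofReal_sum]
        refine Finset.sum_congr rfl fun j _ => ?_
        rw [← hconj, ← map_mul, Complex.add_conj]
        push_cast
        ring
      have h5 : ∀ j, B j i = Complex.I * D j (S.simpleCoroot i) := fun j => by
        simp only [hB, map_smul, smul_eq_mul]
      simp only [h5] at h2
      rw [LinearMap.sum_apply, LinearMap.zero_apply]
      refine mul_left_cancel₀ Complex.I_ne_zero ?_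
      rw [mul_zero, ← h2, Finset.mul_sum]
      refine Finset.sum_congr rfl fun j _ => ?_
      simp only [LinearMap.smul_apply, LinearMap.add_apply, smul_eq_mul]
      ring
    -- Independent differentials make the characters distinct, so σ is an involution and the
    -- condition selecting imaginary parts reads σ j < j.
    have hDinj : ∀ {i j : Fin l}, (∀ x, Ψ i x = Ψ j x) → i = j := fun {i j} h => by
      refine hind.injective (LinearMap.ext fun ξ => ?_)
      have h2 := hD i ξ
      simp only [h] at h2
      exact h2.unique (hD j ξ)
    have hσσ : ∀ j, σ (σ j) = j := fun j => hDinj fun x => by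
      rw [← hσ, ← hσ, inv_inv]
    have hcond : ∀ j, (∃ i < j, ∀ x, Ψ i x⁻¹ = Ψ j x) ↔ σ j < j := fun j => by
      constructor
      · rintro ⟨i, hi, h⟩
        have : σ i = j := hDinj fun x => by rw [← hσ, h]
        rw [← this, hσσ, this]
        exact hi
      · intro h
        exact ⟨σ j, h, fun x => by rw [hσ, hσσ]⟩
    have h2 : ∑ j, ((c j : ℂ) * u j + (c (σ j) : ℂ) * (starRingEnd ℂ) (u (σ j))) • D j = 0 := by
      rw [← h1]
      simp only [add_smul, smul_add, Finset.sum_add_distrib, smul_smul]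
      congr 1
      refine Fintype.sum_equiv ⟨σ, σ, hσσ, hσσ⟩ _ _ fun j => ?_
      simp only [Equiv.coe_fn_mk, hσσ]
    have h3 := Fintype.linearIndependent_iff.1 hind _ h2
    intro j
    have h4 := h3 j
    have k1 : (starRingEnd ℂ) (-(Complex.I / 2)) = Complex.I / 2 := by
      rw [map_neg, map_div₀, Complex.conj_I, Complex.conj_ofNat]; ring
    have k2 : (starRingEnd ℂ) (1 / 2) = 1 / 2 := by
      rw [map_div₀, map_one, Complex.conj_ofNat]
    simp only [hu, hcond, hσσ] at h4
    -- The coefficient is c_{σj}/2 - i c_j/2 for σ j < j, c_j for σ j = j, and c_j/2 + i c_{σj}/2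
    -- for σ j > j. One component always isolates c_j.
    rcases lt_trichotomy (σ j) j with h | h | h
    · rw [if_pos h, if_neg (not_lt.2 h.le)] at h4
      simp only [k1, k2] at h4
      have := congrArg Complex.im h4
      simp at this
      exact this
    · rw [h] at h4
      rw [if_neg (lt_irrefl _), k2] at h4
      have := congrArg Complex.re h4
      simp at this
      linarith
    · rw [if_pos h, if_neg (not_lt.2 h.le)] at h4
      simp only [k1, k2] at h4
      have := congrArg Complex.re h4
      simp at this
      exact this
  · intro h i
    simp [h]

end ChevalleyData

/-! ### The K-factor on the Cartan subgroup -/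

theorem charpoly_conj_of_mul_eq_one {d : ℕ} {P Q : Matrix (Fin d) (Fin d) ℂ} (h : P * Q = 1)
    (A : Matrix (Fin d) (Fin d) ℂ) : (P * A * Q).charpoly = A.charpoly := by
  rw [← Matrix.inv_eq_right_inv h]
  have hP : IsUnit P := IsUnit.of_mul_eq_one Q h
  exact Matrix.charpoly_units_conj hP.unit A

namespace ChevalleyData

variable {n l : ℕ} {S : ChevalleyData n l}

variable (S) in
/-- The coordinates in the basis of simple coroots. -/
def coords : S.𝔥 ≃ₗ[ℂ] (Fin l → ℂ) := S.corootBasis.equivFun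

theorem coords_apply (x : S.𝔥) (i : Fin l) : S.coords x i = S.fundWeight i x := rfl

theorem coe_sum_simpleCoroot (s : Fin l → ℂ) : (((∑ i, s i • S.simpleCoroot i : S.𝔥) : S.𝔤) :
    Matrix (Fin n) (Fin n) ℂ) = ∑ i, s i • S.Hmat (S.simpleRoot i) := by
  let f : S.𝔥 →ₗ[ℂ] Matrix (Fin n) (Fin n) ℂ := S.𝔤.toSubmodule.subtype.comp S.𝔥.toSubmodule.subtype
  change f _ = _
  rw [map_sum]
  exact Finset.sum_congr rfl fun i _ => map_smul f _ _

theorem real_sum_mem_𝔞 (r : Fin l → ℝ) : ∑ i, (r i : ℂ) • S.Hmat (S.simpleRoot i) ∈ S.𝔞 :=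
  Submodule.sum_mem _ fun i _ => by
    rw [ofReal_smul_matrix]
    exact Submodule.smul_mem _ _ (S.Hmat_mem_𝔞 (S.simpleRoot_isNonZero i))

/-- Imaginary coroot coordinates exponentiate into K and real ones to a positive Hermitian matrix.
Uniqueness of the polar decomposition identifies the chosen K-factor. -/
theorem cartanK_expG (hS : S.IsAdmissible) (x : S.𝔥) :
    S.cartanK (S.expG (x : S.𝔤)) = S.expG (S.compactPart (S.coords x) : S.𝔤) := by
  set a : Matrix (Fin n) (Fin n) ℂ := ∑ i, ((S.coords x i).im : ℂ) • S.Hmat (S.simpleRoot i) with ha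
  set b : Matrix (Fin n) (Fin n) ℂ := ∑ i, ((S.coords x i).re : ℂ) • S.Hmat (S.simpleRoot i) with hb
  set y : S.𝔥 := ∑ i, ((S.coords x i).re : ℂ) • S.simpleCoroot i with hy
  have hyb : ((y : S.𝔤) : Matrix (Fin n) (Fin n) ℂ) = b := coe_sum_simpleCoroot _
  have hxa : ((S.compactPart (S.coords x) : S.𝔤) : Matrix (Fin n) (Fin n) ℂ) = Complex.I • a := by
    rw [compactPart, coe_sum_simpleCoroot, ha, Finset.smul_sum]
    exact Finset.sum_congr rfl fun i _ => by rw [smul_smul]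
  have ha' : a ∈ S.𝔞 := real_sum_mem_𝔞 _
  have hb' : b ∈ S.𝔞 := real_sum_mem_𝔞 _
  have hx : x = S.compactPart (S.coords x) + y := by
    conv_lhs => rw [S.eq_sum_simpleCoroot x]
    rw [compactPart, hy, ← Finset.sum_add_distrib]
    refine Finset.sum_congr rfl fun i _ => ?_
    rw [← add_smul, coords_apply]
    congr 1
    conv_lhs => rw [← Complex.re_add_im (S.fundWeight i x)]
    ring
  have hK : (S.expG (S.compactPart (S.coords x) : S.𝔤)).1 ∈ S.K := by
    refine Subgroup.subset_closure ⟨Complex.I • a, S.I_smul_mem_𝔨 ha', ?_⟩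
    rw [← hxa]
    exact S.mat_expG _
  have hex : ∃ k : S.G, k.1 ∈ S.K ∧ ∃ X ∈ S.𝔨, S.mat (S.expG (x : S.𝔤)) =
      S.mat k * NormedSpace.exp (Complex.I • X) := by
    refine ⟨_, hK, -(Complex.I • b), S.𝔨.neg_mem (S.I_smul_mem_𝔨 hb'), ?_⟩
    conv_lhs => rw [hx, expG_add, mat_mul]
    rw [S.mat_expG (y : S.𝔤), hyb, smul_neg, smul_smul, Complex.I_mul_I, neg_one_smul, neg_neg]
  rw [cartanK, dif_pos hex]
  obtain ⟨h1, X, hX, h2⟩ := hex.choose_spec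
  have hH : ∀ X ∈ S.𝔨, (Complex.I • X).conjTranspose = Complex.I • X := fun X hX => by
    rw [Matrix.conjTranspose_smul, conjTranspose_of_mem_𝔨 hS hX]
    simp
  apply S.mat_injective
  refine polar_unique (S := Complex.I • X) (T := b) (hS.K_le _ h1) (hS.K_le _ hK) (hH X hX)
    (conjTranspose_of_mem_𝔞 hS hb') ?_
  change S.mat hex.choose * _ = _
  rw [← h2]
  conv_lhs => rw [hx, expG_add, mat_mul]
  rw [S.mat_expG (y : S.𝔤), hyb]

theorem apply_compactPart_coords {lam : Module.Dual ℂ S.𝔥} (hl : lam ∈ S.weightLattice) (x : S.𝔥) :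
    lam (S.compactPart (S.coords x)) = Complex.I * ((lam x).im : ℂ) := by
  rw [apply_compactPart]
  conv_rhs => rw [S.eq_sum_simpleCoroot x]
  rw [map_sum, Complex.im_sum, Complex.ofReal_sum, Finset.mul_sum]
  refine Finset.sum_congr rfl fun i _ => ?_
  obtain ⟨k, hk⟩ := hl _ (S.simpleRoot_isNonZero i)
  rw [map_smul, simpleCoroot, hk, coords_apply]
  simp
  ring

/-- Weights are integral on coroots, so the compact part of exp(x) has the eigenvalues z/|z|, where
z runs over the eigenvalues of ρ(exp(x)). The character value is thus read off from a characteristic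
polynomial. -/
theorem IsFundamentalCharacter.compact_eq_of_conj {j : Fin l} {Ψ : S.G → ℂ}
    (h : S.IsFundamentalCharacter j Ψ) {x y : S.𝔥} {g : S.G}
    (hg : S.expG (x : S.𝔤) = g * S.expG (y : S.𝔤) * g⁻¹) :
    Ψ (S.expG (S.compactPart (S.coords x) : S.𝔤)) = Ψ (S.expG (S.compactPart (S.coords y) : S.𝔤)) := by
  obtain ⟨d, R, P, lam, hP, h1, h2, h3⟩ := h.exists_sum
  have key : ∀ x : S.𝔥, Ψ (S.expG (S.compactPart (S.coords x) : S.𝔤)) =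
      ((R.ρ (S.expG (x : S.𝔤))).charpoly.roots.map fun z => z / (‖z‖ : ℂ)).sum := by
    intro x
    obtain ⟨Q, hQ, hQ'⟩ := hP.exists_inv
    have e1 : R.ρ (S.expG (x : S.𝔤)) = P * Matrix.diagonal (fun k => Complex.exp (lam k x)) * Q := by
      have e2 := exp_mul_of_intertwine (hP.eq x)
      have e3 : NormedSpace.exp (fun k => lam k x) = fun k => Complex.exp (lam k x) := by
        funext k
        rw [Pi.coe_exp, ← Complex.exp_eq_exp_ℂ]
      rw [R.map_exp, ← e3, ← Matrix.exp_diagonal, ← e2, mul_assoc, hQ, mul_one]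
    have e4 : (R.ρ (S.expG (x : S.𝔤))).charpoly.roots =
        Finset.univ.val.map fun k => Complex.exp (lam k x) := by
      rw [e1, charpoly_conj_of_mul_eq_one hQ, Matrix.charpoly_diagonal,
        ← Polynomial.roots_multiset_prod_X_sub_C (Finset.univ.val.map fun k => Complex.exp (lam k x)),
        Multiset.map_map]
      rfl
    rw [e4, h3, Multiset.map_map]
    change _ = ∑ k, _
    refine Finset.sum_congr rfl fun k _ => ?_
    rw [apply_compactPart_coords (h1 k), Function.comp_apply, Complex.norm_exp, Complex.ofReal_exp,
      ← Complex.exp_sub]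
    congr 1
    linear_combination (Complex.re_add_im (lam k x))
  rw [key, key, hg, map_mul, map_mul]
  rw [charpoly_conj_of_mul_eq_one (R.ρ_mul_inv g)]

theorem chi_cartanK_eq_of_conj (hS : S.IsAdmissible) {Ψ : Fin l → S.G → ℂ}
    (hΨ : ∀ j, S.IsFundamentalCharacter j (Ψ j)) (j : Fin l) {x y : S.𝔥} {g : S.G}
    (hg : S.expG (x : S.𝔤) = g * S.expG (y : S.𝔤) * g⁻¹) :
    chi Ψ j (S.cartanK (S.expG (x : S.𝔤))) = chi Ψ j (S.cartanK (S.expG (y : S.𝔤))) := by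
  rw [cartanK_expG hS, cartanK_expG hS, chi_eq, chi_eq, (hΨ j).compact_eq_of_conj hg]

end ChevalleyData

/-! ### The weighted Wiener algebra -/

section Wiener

attribute [-instance] LieRing.ofAssociativeRing

/-- Rapid growth gives log w(k) ≥ k^{1/r} ≥ 2 log k for large k; the constant N² + 1 takes care of
|k| < N, as w ≥ 1. -/
theorem LoopWeight.exists_sq_le (W : LoopWeight) : ∃ C : ℝ, 0 < C ∧ ∀ k : ℤ, (k : ℝ) ^ 2 ≤ C * W.w k := by
  obtain ⟨r, hr1, hr2, h⟩ := W.rapid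
  have hr0 : 0 < r := by linarith
  have h1 := h.eventually_ge_atTop 1
  have h2 : ∀ᶠ x : ℝ in Filter.atTop, ‖Real.log x‖ ≤ (1 / 2) * ‖x ^ (1 / r)‖ :=
    (isLittleO_log_rpow_atTop (one_div_pos.2 hr0)).bound (by norm_num)
  have h3 := tendsto_natCast_atTop_atTop.eventually h2
  obtain ⟨N, hN⟩ := Filter.eventually_atTop.1 ((h1.and h3).and (Filter.eventually_ge_atTop 1))
  have key : ∀ k : ℕ, N ≤ k → (k : ℝ) ^ 2 ≤ W.w k := by
    intro k hk
    obtain ⟨⟨e1, e2⟩, e3⟩ := hN k hk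
    have hk0 : (0 : ℝ) < k := by exact_mod_cast e3
    rw [Real.norm_of_nonneg (Real.log_nonneg (by exact_mod_cast e3)),
      Real.norm_of_nonneg (Real.rpow_nonneg hk0.le _)] at e2
    have e4 : (k : ℝ) ^ (1 / r) ≤ Real.log (W.w k) := by
      have e5 := mul_le_mul_of_nonneg_left e1 (Real.rpow_nonneg hk0.le (1 / r))
      rw [mul_one, ← mul_assoc, ← Real.rpow_add hk0] at e5
      have e6 : 1 / r + -1 / r = 0 := by ring
      rwa [e6, Real.rpow_zero, one_mul] at e5
    have e7 : Real.log ((k : ℝ) ^ 2) ≤ Real.log (W.w k) := by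
      rw [Real.log_pow]; push_cast; linarith
    exact (Real.log_le_log_iff (by positivity) (W.pos _)).1 e7
  refine ⟨(N : ℝ) ^ 2 + 1, by positivity, fun k => ?_⟩
  have hw : W.w k = W.w (k.natAbs : ℤ) := by
    rcases Int.natAbs_eq k with h | h
    · rw [← h]
    · conv_lhs => rw [h, W.symm]
  have hk : (k : ℝ) ^ 2 = (k.natAbs : ℝ) ^ 2 := by
    rw [Nat.cast_natAbs, Int.cast_abs, sq_abs]
  have h5 := W.one_le k
  rw [hk]
  by_cases hkN : N ≤ k.natAbs
  · have := key _ hkN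
    rw [← hw] at this
    nlinarith [sq_nonneg (N : ℝ)]
  · have h6 : (k.natAbs : ℝ) ≤ N := by exact_mod_cast (not_le.1 hkN).le
    have h7 : (k.natAbs : ℝ) ^ 2 ≤ (N : ℝ) ^ 2 := by gcongr
    nlinarith [sq_nonneg (N : ℝ)]

theorem LoopWeight.exists_abs_le (W : LoopWeight) : ∃ C : ℝ, 0 < C ∧ ∀ k : ℤ, |(k : ℝ)| ≤ C * W.w k := by
  obtain ⟨C, hC, h⟩ := W.exists_sq_le
  refine ⟨C, hC, fun k => le_trans ?_ (h k)⟩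
  rcases eq_or_ne k 0 with rfl | hk
  · simp
  · have : (1 : ℝ) ≤ |(k : ℝ)| := by exact_mod_cast Int.one_le_abs hk
    rw [← sq_abs]
    nlinarith

/-- Compare with C/k². The regularity argument below needs this to make truncated norms finite. -/
theorem LoopWeight.summable_inv (W : LoopWeight) : Summable fun k => (W.w k)⁻¹ := by
  obtain ⟨C, hC, h⟩ := W.exists_sq_le
  have h1 : Summable fun k : ℤ => C * (1 / (k : ℝ) ^ 2) :=
    (Real.summable_one_div_int_pow.2 (by norm_num)).mul_left C
  refine Summable.of_norm_bounded_eventually h1 ?_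
  have h2 : ∀ᶠ k : ℤ in Filter.cofinite, k ≠ 0 := (Set.finite_singleton (0 : ℤ)).compl_mem_cofinite
  filter_upwards [h2] with k hk
  rw [norm_inv, Real.norm_of_nonneg (W.pos k).le]
  have hk' : (0 : ℝ) < (k : ℝ) ^ 2 := by
    have : (k : ℝ) ≠ 0 := by exact_mod_cast hk
    positivity
  rw [mul_one_div, inv_eq_one_div, div_le_div_iff₀ (W.pos k) hk', one_mul]
  exact h k

namespace Aw

variable {W : LoopWeight}

/-- An element of `A_w` with given coefficients. -/
def mk (a : ℤ → ℂ) (h : Summable fun k => ‖a k‖ * W.w k) : Aw W := ⟨a, h⟩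

theorem norm_coeff_mul_le (f : Aw W) (k : ℤ) : ‖f.coeff k‖ * W.w k ≤ ‖f‖ :=
  f.summable.le_tsum k fun j _ => mul_nonneg (norm_nonneg _) (W.pos j).le

theorem norm_coeff_le (f : Aw W) (k : ℤ) : ‖f.coeff k‖ ≤ ‖f‖ :=
  (le_mul_of_one_le_right (norm_nonneg _) (W.one_le k)).trans (f.norm_coeff_mul_le k)

theorem summable_norm_coeff (f : Aw W) : Summable fun k => ‖f.coeff k‖ :=
  Summable.of_nonneg_of_le (fun _ => norm_nonneg _)
    (fun k => le_mul_of_one_le_right (norm_nonneg _) (W.one_le k)) f.summable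

/-- The isometry of `A_w` with `ℓ¹`. -/
def toLp (f : Aw W) : lp (fun _ : ℤ => ℂ) 1 :=
  ⟨fun k => f.coeff k * (W.w k : ℂ), by
    change Memℓp _ 1
    refine memℓp_gen ?_
    simpa [abs_of_pos (W.pos _)] using f.summable⟩

theorem toLp_isometry : Isometry (toLp (W := W)) := by
  refine Isometry.of_dist_eq fun f g => ?_
  rw [dist_eq_norm, dist_eq_norm, lp.norm_eq_tsum_rpow (by simp)]
  simp only [ENNReal.toReal_one, Real.rpow_one, div_one]
  rw [Aw.norm_def]
  refine tsum_congr fun k => ?_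
  have : (toLp f - toLp g : lp (fun _ : ℤ => ℂ) 1) k = (f - g).coeff k * (W.w k : ℂ) := by
    rw [sub_eq_add_neg f g, coeff_add, coeff_neg, ← sub_eq_add_neg, sub_mul]
    rfl
  rw [this, norm_mul, Complex.norm_real, Real.norm_of_nonneg (W.pos k).le]

theorem toLp_surjective : Function.Surjective (toLp (W := W)) := by
  intro x
  have hx := (lp.memℓp x).summable (by simp)
  simp only [ENNReal.toReal_one, Real.rpow_one] at hx
  refine ⟨mk (fun k => x k / (W.w k : ℂ)) (hx.congr fun k => ?_), Subtype.ext (funext fun k => ?_)⟩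
  · rw [norm_div, Complex.norm_real, Real.norm_of_nonneg (W.pos k).le, div_mul_cancel₀ _ (W.pos k).ne']
  · change x k / (W.w k : ℂ) * (W.w k : ℂ) = x k
    rw [div_mul_cancel₀]
    exact Complex.ofReal_ne_zero.2 (W.pos k).ne'

instance : CompleteSpace (Aw W) :=
  (IsometryEquiv.mk (Equiv.ofBijective _ ⟨toLp_isometry.injective, toLp_surjective⟩)
    (toLp_isometry (W := W))).completeSpace

/-- Fourier coefficients as continuous functionals. -/
def coeffCLM (k : ℤ) : Aw W →L[ℂ] ℂ :=
  LinearMap.mkContinuous ⟨⟨fun f => f.coeff k, fun _ _ => rfl⟩, fun _ _ => rfl⟩ 1 fun f => by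
    rw [one_mul]; exact f.norm_coeff_le k

theorem coeffCLM_apply (k : ℤ) (f : Aw W) : coeffCLM k f = f.coeff k := rfl

theorem norm_eval_le (f : Aw W) (z : Circle) : ‖f.eval z‖ ≤ ‖f‖ := by
  refine tsum_of_norm_bounded f.summable.hasSum fun k => ?_
  rw [norm_mul, norm_zpow, Circle.norm_coe, one_zpow, mul_one]
  exact le_mul_of_one_le_right (norm_nonneg _) (W.one_le k)

/-- Evaluation at a point as a continuous functional. -/
def evalCLM (z : Circle) : Aw W →L[ℂ] ℂ :=
  LinearMap.mkContinuous ⟨⟨fun f => f.eval z, fun f g => eval_add f g z⟩, fun c f => eval_smul c f z⟩ 1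
    fun f => by rw [one_mul]; exact f.norm_eval_le z

theorem evalCLM_apply (z : Circle) (f : Aw W) : evalCLM z f = f.eval z := rfl

theorem hasSum_eval (f : Aw W) (z : Circle) : HasSum (fun k : ℤ => f.coeff k * (z : ℂ) ^ k) (f.eval z) :=
  (f.summable_eval z).hasSum

/-- Multiplication by `z ^ m`. -/
def shift (m : ℤ) : Aw W →L[ℂ] Aw W :=
  LinearMap.mkContinuous
    { toFun := fun f => mk (fun k => f.coeff (k - m)) (by
        have h1 : Summable fun k => W.w m * (‖f.coeff (k - m)‖ * W.w (k - m)) :=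
          ((Equiv.subRight m).summable_iff.2 f.summable).mul_left (W.w m)
        refine Summable.of_nonneg_of_le (fun k => mul_nonneg (norm_nonneg _) (W.pos k).le) (fun k => ?_) h1
        have := W.submul m (k - m)
        rw [add_sub_cancel] at this
        nlinarith [norm_nonneg (f.coeff (k - m))])
      map_add' := fun _ _ => rfl
      map_smul' := fun _ _ => rfl } (W.w m) fun f => by
    rw [norm_def, norm_def, ← tsum_mul_left, ← (Equiv.subRight m).tsum_eq fun k => W.w m * (‖f.coeff k‖ * W.w k)]
    have h1 : Summable fun k => W.w m * (‖f.coeff (k - m)‖ * W.w (k - m)) :=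
      ((Equiv.subRight m).summable_iff.2 f.summable).mul_left (W.w m)
    have h2 : ∀ k, ‖f.coeff (k - m)‖ * W.w k ≤ W.w m * (‖f.coeff (k - m)‖ * W.w (k - m)) := fun k => by
      have := W.submul m (k - m)
      rw [add_sub_cancel] at this
      nlinarith [norm_nonneg (f.coeff (k - m))]
    exact Summable.tsum_le_tsum h2
      (Summable.of_nonneg_of_le (fun k => mul_nonneg (norm_nonneg _) (W.pos k).le) h2 h1) h1

theorem coeff_shift (m k : ℤ) (f : Aw W) : (shift m f).coeff k = f.coeff (k - m) := rfl

theorem norm_shift_le (m : ℤ) : ‖(shift m : Aw W →L[ℂ] Aw W)‖ ≤ W.w m :=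
  LinearMap.mkContinuous_norm_le _ (W.pos m).le _

theorem eval_shift (m : ℤ) (f : Aw W) (z : Circle) : (shift m f).eval z = (z : ℂ) ^ m * f.eval z := by
  have h1 : HasSum (fun k : ℤ => (shift m f).coeff k * (z : ℂ) ^ k) ((z : ℂ) ^ m * f.eval z) := by
    rw [← (Equiv.addRight m).hasSum_iff]
    have h2 := (f.hasSum_eval z).mul_left ((z : ℂ) ^ m)
    have h3 : ((fun k : ℤ => (shift m f).coeff k * (z : ℂ) ^ k) ∘ Equiv.addRight m) =
        fun k => (z : ℂ) ^ m * (f.coeff k * (z : ℂ) ^ k) := by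
      funext k
      simp only [Function.comp_apply, Equiv.coe_addRight, coeff_shift, add_sub_cancel_right,
        zpow_add₀ (Circle.coe_ne_zero z)]
      ring
    rw [h3]
    exact h2
  exact (hasSum_eval _ z).unique h1

/-- Multiplication by z^m has norm at most w(m) by submultiplicativity, so multiplication by f is a
norm-convergent series of shifts. -/
theorem summable_mul_shift (f : Aw W) : Summable fun m => f.coeff m • (shift m : Aw W →L[ℂ] Aw W) := by
  refine Summable.of_norm_bounded f.summable fun m => ?_
  rw [norm_smul]
  exact mul_le_mul_of_nonneg_left (norm_shift_le m) (norm_nonneg _)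

/-- Multiplication in the Wiener algebra. -/
def mulCLM : Aw W →L[ℂ] Aw W →L[ℂ] Aw W :=
  LinearMap.mkContinuous
    { toFun := fun f => ∑' m, f.coeff m • (shift m : Aw W →L[ℂ] Aw W)
      map_add' := fun f g => by
        rw [← Summable.tsum_add f.summable_mul_shift g.summable_mul_shift]
        simp only [coeff_add, add_smul]
      map_smul' := fun c f => by
        rw [RingHom.id_apply, ← f.summable_mul_shift.tsum_const_smul]
        simp only [coeff_smul, mul_smul] } 1 fun f => by
    rw [one_mul]
    refine tsum_of_norm_bounded f.summable.hasSum fun m => ?_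
    rw [norm_smul]
    exact mul_le_mul_of_nonneg_left (norm_shift_le m) (norm_nonneg _)

theorem eval_mul (f g : Aw W) (z : Circle) : (mulCLM f g).eval z = f.eval z * g.eval z := by
  have h1 : HasSum (fun m => f.coeff m • (shift m : Aw W →L[ℂ] Aw W)) (mulCLM f) :=
    f.summable_mul_shift.hasSum
  have h2 := (h1.mapL (ContinuousLinearMap.apply ℂ (Aw W) g)).mapL (evalCLM z)
  refine h2.unique ?_
  have h3 := (f.hasSum_eval z).mul_right (g.eval z)
  have h4 : (fun m => evalCLM z (ContinuousLinearMap.apply ℂ (Aw W) g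
      (f.coeff m • (shift m : Aw W →L[ℂ] Aw W)))) = fun m => f.coeff m * (z : ℂ) ^ m * g.eval z := by
    funext m
    change (f.coeff m • shift m g : Aw W).eval z = _
    rw [eval_smul, eval_shift, mul_assoc]
  rw [h4]
  exact h3

/-- Bounded Fourier multipliers. -/
def multiplier (r : ℤ → ℂ) (C : ℝ) (hC : ∀ k, ‖r k‖ ≤ C) : Aw W →L[ℂ] Aw W :=
  have hb : ∀ (f : Aw W) k, ‖r k * f.coeff k‖ * W.w k ≤ C * (‖f.coeff k‖ * W.w k) := fun f k => by
    rw [norm_mul, mul_assoc]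
    exact mul_le_mul_of_nonneg_right (hC k) (mul_nonneg (norm_nonneg _) (W.pos k).le)
  have hs : ∀ f : Aw W, Summable fun k => ‖r k * f.coeff k‖ * W.w k := fun f =>
    Summable.of_nonneg_of_le (fun k => mul_nonneg (norm_nonneg _) (W.pos k).le) (hb f) (f.summable.mul_left C)
  LinearMap.mkContinuous
    { toFun := fun f => mk (fun k => r k * f.coeff k) (hs f)
      map_add' := fun f g => ext_coeff fun k => mul_add _ _ _
      map_smul' := fun c f => ext_coeff fun k => mul_left_comm _ _ _ } C fun f => by
    rw [norm_def, norm_def, ← tsum_mul_left]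
    exact Summable.tsum_le_tsum (hb f) (hs f) (f.summable.mul_left C)

/-- The constant functions. -/
def const (c : ℂ) : Aw W := mk (fun k => if k = 0 then c else 0) (by
  refine summable_of_ne_finset_zero (s := {0}) fun k hk => ?_
  rw [Finset.mem_singleton] at hk
  simp [hk])

theorem coeff_const (c : ℂ) (k : ℤ) : (const c : Aw W).coeff k = if k = 0 then c else 0 := rfl

theorem eval_const (c : ℂ) (z : Circle) : (const c : Aw W).eval z = c := by
  rw [eval, tsum_eq_single 0 fun k hk => by simp [coeff_const, hk]]
  simp [coeff_const]

theorem hasDerivAt_zpow_exp (k : ℤ) (t : ℝ) :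
    HasDerivAt (fun s : ℝ => (Circle.exp s : ℂ) ^ k) (Complex.I * k * (Circle.exp t : ℂ) ^ k) t := by
  have h : ∀ s : ℝ, (Circle.exp s : ℂ) ^ k = Complex.exp ((s : ℂ) * (Complex.I * k)) := fun s => by
    rw [Circle.coe_exp, ← Complex.exp_int_mul]
    congr 1
    ring
  simp only [h]
  have h1 : HasDerivAt (fun s : ℝ => (s : ℂ) * (Complex.I * k)) (1 * (Complex.I * k)) t :=
    (Complex.ofRealCLM.hasDerivAt (x := t)).mul_const _
  convert h1.cexp using 1
  ring

/-- The bound |k| ≤ C w(k) permits differentiation term by term. -/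
theorem hasDerivAt_eval (f : Aw W) (t : ℝ) : HasDerivAt (fun s : ℝ => f.eval (Circle.exp s))
    (∑' k : ℤ, f.coeff k * (Complex.I * k * (Circle.exp t : ℂ) ^ k)) t := by
  obtain ⟨C, hC, h⟩ := W.exists_abs_le
  refine hasDerivAt_tsum (u := fun k => C * (‖f.coeff k‖ * W.w k)) (f.summable.mul_left C)
    (fun k y => (hasDerivAt_zpow_exp k y).const_mul _) (fun k y => ?_)
    (f.summable_eval (Circle.exp 0)) t
  rw [norm_mul, norm_mul, norm_mul, norm_zpow, Circle.norm_coe, one_zpow, mul_one, Complex.norm_I, one_mul,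
    Complex.norm_intCast]
  have := h k
  nlinarith [norm_nonneg (f.coeff k)]

theorem hasDerivAt_eval_of_coeff {f g : Aw W} (h : ∀ k : ℤ, g.coeff k = k * f.coeff k) (t : ℝ) :
    HasDerivAt (fun s : ℝ => f.eval (Circle.exp s)) (Complex.I * g.eval (Circle.exp t)) t := by
  convert f.hasDerivAt_eval t using 1
  rw [eval, ← tsum_mul_left]
  refine tsum_congr fun k => ?_
  rw [h]
  ring

end Aw

/-! ### Fourier coefficients of functions on the line -/

/-- The Fourier coefficients of a function of period `2π`. -/
def fourierC (g : ℝ → ℂ) (k : ℤ) : ℂ :=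
  (2 * Real.pi : ℂ)⁻¹ * ∫ θ in (0 : ℝ)..(2 * Real.pi), (Circle.exp θ : ℂ) ^ (-k) * g θ

theorem continuous_zpow_exp (k : ℤ) : Continuous fun θ : ℝ => (Circle.exp θ : ℂ) ^ k :=
  continuous_iff_continuousAt.2 fun t => (Aw.hasDerivAt_zpow_exp k t).continuousAt

theorem norm_fourierC_le {g : ℝ → ℂ} {C : ℝ} (h : ∀ θ, ‖g θ‖ ≤ C) (k : ℤ) : ‖fourierC g k‖ ≤ C := by
  have h1 := intervalIntegral.norm_integral_le_of_norm_le_const (a := (0 : ℝ)) (b := 2 * Real.pi)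
    (f := fun θ => (Circle.exp θ : ℂ) ^ (-k) * g θ) (C := C) fun θ _ => by
    rw [norm_mul, norm_zpow, Circle.norm_coe, one_zpow, one_mul]; exact h θ
  rw [sub_zero, abs_of_pos Real.two_pi_pos] at h1
  have h2 : ‖(2 * Real.pi : ℂ)⁻¹‖ = (2 * Real.pi)⁻¹ := by
    rw [norm_inv]
    simp [abs_of_pos Real.pi_pos]
  rw [fourierC, norm_mul, h2, inv_mul_le_iff₀ Real.two_pi_pos, mul_comm _ C]
  exact h1

theorem fourierC_sum {ι : Type*} (s : Finset ι) (g : ι → ℝ → ℂ) (hg : ∀ i ∈ s, Continuous (g i)) (k : ℤ) :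
    fourierC (fun θ => ∑ i ∈ s, g i θ) k = ∑ i ∈ s, fourierC (g i) k := by
  unfold fourierC
  have h1 := intervalIntegral.integral_finsetSum (μ := MeasureTheory.volume) (a := (0 : ℝ))
    (b := 2 * Real.pi) (s := s)
    (f := fun i θ => (Circle.exp θ : ℂ) ^ (-k) * g i θ) fun i hi =>
    ((continuous_zpow_exp (-k)).mul (hg i hi)).intervalIntegrable _ _
  rw [← Finset.mul_sum, ← h1]
  simp only [Finset.mul_sum]

theorem fourierC_one (k : ℤ) : fourierC (fun _ => 1) k = if k = 0 then 1 else 0 := by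
  unfold fourierC
  have hpi : (2 * Real.pi : ℂ) ≠ 0 := by exact_mod_cast Real.two_pi_pos.ne'
  simp only [mul_one]
  split_ifs with hk
  · subst hk
    simp only [neg_zero, zpow_zero, intervalIntegral.integral_const, sub_zero]
    rw [Complex.real_smul]
    push_cast
    rw [mul_one, inv_mul_cancel₀ hpi]
  · have h1 : ∀ θ : ℝ, HasDerivAt (fun s : ℝ => (Complex.I * (-k : ℤ))⁻¹ * (Circle.exp s : ℂ) ^ (-k))
        ((Circle.exp θ : ℂ) ^ (-k)) θ := fun θ => by
      have h2 := (Aw.hasDerivAt_zpow_exp (-k) θ).const_mul (Complex.I * (-k : ℤ))⁻¹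
      have : (Complex.I * (-k : ℤ) : ℂ) ≠ 0 := mul_ne_zero Complex.I_ne_zero (by simpa using hk)
      rwa [← mul_assoc, inv_mul_cancel₀ this, one_mul] at h2
    rw [intervalIntegral.integral_eq_sub_of_hasDerivAt (fun θ _ => h1 θ)
      ((continuous_zpow_exp _).intervalIntegrable _ _)]
    simp

/-- Integrate the absolutely convergent series of f term by term. The second factor need only be
continuous and bounded, as nothing more is known yet of solutions of differential equations. -/
theorem hasSum_fourierC_mul {W : LoopWeight} (f : Aw W) {g : ℝ → ℂ} (hg : Continuous g) {C : ℝ}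
    (hC : ∀ θ, ‖g θ‖ ≤ C) (k : ℤ) : HasSum (fun m => f.coeff m * fourierC g (k - m))
      (fourierC (fun θ => f.eval (Circle.exp θ) * g θ) k) := by
  unfold fourierC
  have hC0 : 0 ≤ C := (norm_nonneg _).trans (hC 0)
  have h1 : HasSum (fun m : ℤ => ∫ θ in (0 : ℝ)..(2 * Real.pi),
      f.coeff m * ((Circle.exp θ : ℂ) ^ (-(k - m)) * g θ))
      (∫ θ in (0 : ℝ)..(2 * Real.pi), (Circle.exp θ : ℂ) ^ (-k) * (f.eval (Circle.exp θ) * g θ)) := by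
    refine intervalIntegral.hasSum_integral_of_dominated_convergence (fun m _ => ‖f.coeff m‖ * C)
      (fun m => ?_) (fun m => ?_) ?_ ?_ ?_
    · exact (continuous_const.mul ((continuous_zpow_exp _).mul hg)).aestronglyMeasurable
    · refine Filter.Eventually.of_forall fun θ _ => ?_
      rw [norm_mul, norm_mul, norm_zpow, Circle.norm_coe, one_zpow, one_mul]
      exact mul_le_mul_of_nonneg_left (hC θ) (norm_nonneg _)
    · exact Filter.Eventually.of_forall fun θ _ => f.summable_norm_coeff.mul_right C
    · exact continuous_const.intervalIntegrable _ _
    · refine Filter.Eventually.of_forall fun θ _ => ?_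
      have h2 := ((f.hasSum_eval (Circle.exp θ)).mul_right (g θ)).mul_left ((Circle.exp θ : ℂ) ^ (-k))
      have h3 : (fun m : ℤ => f.coeff m * ((Circle.exp θ : ℂ) ^ (-(k - m)) * g θ)) =
          fun m => (Circle.exp θ : ℂ) ^ (-k) * (f.coeff m * (Circle.exp θ : ℂ) ^ m * g θ) := by
        funext m
        rw [neg_sub, sub_eq_add_neg, zpow_add₀ (Circle.coe_ne_zero _)]
        ring
      rw [h3]
      exact h2
  have h4 : (fun m => f.coeff m * ((2 * Real.pi : ℂ)⁻¹ * ∫ θ in (0 : ℝ)..(2 * Real.pi),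
      (Circle.exp θ : ℂ) ^ (-(k - m)) * g θ)) = fun m => (2 * Real.pi : ℂ)⁻¹ *
        ∫ θ in (0 : ℝ)..(2 * Real.pi), f.coeff m * ((Circle.exp θ : ℂ) ^ (-(k - m)) * g θ) := by
    funext m
    rw [intervalIntegral.integral_const_mul]
    ring
  rw [h4]
  exact h1.mul_left (2 * Real.pi : ℂ)⁻¹

theorem continuous_eval {W : LoopWeight} (f : Aw W) : Continuous fun θ : ℝ => f.eval (Circle.exp θ) :=
  continuous_iff_continuousAt.2 fun t => (f.hasDerivAt_eval t).continuousAt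

theorem fourierC_eval {W : LoopWeight} (f : Aw W) (k : ℤ) :
    fourierC (fun θ => f.eval (Circle.exp θ)) k = f.coeff k := by
  have h1 := hasSum_fourierC_mul f (g := fun _ => 1) continuous_const (C := 1) (by simp) k
  simp only [mul_one, fourierC_one] at h1
  refine h1.unique ?_
  convert hasSum_single k fun m hm => ?_ using 1
  · simp
  · rw [if_neg (sub_ne_zero.2 (Ne.symm hm)), mul_zero]

theorem Aw.ext_eval {W : LoopWeight} {f g : Aw W} (h : ∀ z, f.eval z = g.eval z) : f = g :=
  Aw.ext_coeff fun k => by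
    rw [← fourierC_eval, ← fourierC_eval]
    simp only [h]

/-- Integration by parts; periodicity removes the boundary terms. -/
theorem fourierC_deriv {g g' : ℝ → ℂ} (hg : ∀ θ, HasDerivAt g (g' θ) θ) (hc : Continuous g')
    (hp : Function.Periodic g (2 * Real.pi)) (k : ℤ) : fourierC g' k = Complex.I * k * fourierC g k := by
  have hgc : Continuous g := continuous_iff_continuousAt.2 fun t => (hg t).continuousAt
  have h1 : ∀ θ : ℝ, HasDerivAt (fun s : ℝ => (Circle.exp s : ℂ) ^ (-k) * g s)
      (Complex.I * (-k : ℤ) * (Circle.exp θ : ℂ) ^ (-k) * g θ + (Circle.exp θ : ℂ) ^ (-k) * g' θ) θ :=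
    fun θ => (Aw.hasDerivAt_zpow_exp (-k) θ).mul (hg θ)
  have h2 := intervalIntegral.integral_eq_sub_of_hasDerivAt (a := (0 : ℝ)) (b := 2 * Real.pi)
    (fun θ _ => h1 θ) ((((continuous_const.mul (continuous_zpow_exp (-k))).mul hgc).add
      ((continuous_zpow_exp (-k)).mul hc)).intervalIntegrable _ _)
  have h3 : g (2 * Real.pi) = g 0 := by simpa using hp 0
  have h4 := intervalIntegral.integral_add (μ := MeasureTheory.volume) (a := (0 : ℝ)) (b := 2 * Real.pi)
    (f := fun θ => Complex.I * (-k : ℤ) * (Circle.exp θ : ℂ) ^ (-k) * g θ)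
    (g := fun θ => (Circle.exp θ : ℂ) ^ (-k) * g' θ)
    ((((continuous_const.mul (continuous_zpow_exp (-k))).mul hgc)).intervalIntegrable _ _)
    (((continuous_zpow_exp (-k)).mul hc).intervalIntegrable _ _)
  rw [h4, h3] at h2
  simp only [mul_assoc, intervalIntegral.integral_const_mul] at h2
  simp only [Circle.exp_two_pi, Circle.exp_zero, sub_self] at h2
  unfold fourierC
  rw [Int.cast_neg] at h2
  linear_combination (2 * Real.pi : ℂ)⁻¹ * h2

theorem hasSum_fourierC {g : ℝ → ℂ} (hg : Continuous g) (hp : Function.Periodic g (2 * Real.pi))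
    (hs : Summable fun k => ‖fourierC g k‖) (θ : ℝ) :
    HasSum (fun k : ℤ => fourierC g k * (Circle.exp θ : ℂ) ^ k) (g θ) := by
  haveI : Fact (0 < 2 * Real.pi) := ⟨Real.two_pi_pos⟩
  have hGc : Continuous hp.lift := continuous_coinduced_dom.2 hg
  let G : C(AddCircle (2 * Real.pi), ℂ) := ⟨hp.lift, hGc⟩
  have hf : ∀ (k : ℤ) (x : ℝ), fourier k (x : AddCircle (2 * Real.pi)) = (Circle.exp x : ℂ) ^ k := by
    intro k x
    rw [fourier_coe_apply, Circle.coe_exp, ← Complex.exp_int_mul]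
    congr 1
    have : (Real.pi : ℂ) ≠ 0 := Complex.ofReal_ne_zero.2 Real.pi_ne_zero
    push_cast
    field_simp
  have hG : ∀ k, fourierCoeff (⇑G) k = fourierC g k := by
    intro k
    rw [fourierCoeff_eq_intervalIntegral _ _ 0, zero_add, fourierC, Complex.real_smul]
    have h0 : ∀ x : ℝ, G (x : AddCircle (2 * Real.pi)) = g x := fun x => hp.lift_coe x
    simp only [hf, h0, smul_eq_mul]
    push_cast
    rw [one_div]
  have h1 : Summable (fourierCoeff ⇑G) := by
    refine Summable.of_norm ?_
    simpa only [hG] using hs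
  have h2 := has_pointwise_sum_fourier_series_of_summable h1 (θ : AddCircle (2 * Real.pi))
  have h3 : G (θ : AddCircle (2 * Real.pi)) = g θ := hp.lift_coe θ
  rw [h3] at h2
  simpa only [hG, hf, smul_eq_mul] using h2

end Wiener

/-! ### Regularity of solutions of linear differential equations over the Wiener algebra -/

section Bootstrap

attribute [-instance] LieRing.ofAssociativeRing

open scoped ENNReal

/-- Replace w by ω = min(w, N/w), for which T = Σ zω is finite because z is bounded and Σ 1/w
converges. The convolution inequality gives Σ |k| zω ≤ A T, and |k| ≥ A + 1 outside a finite set, so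
T is bounded independently of N. -/
theorem tsum_mul_lt_top_of_convolution_le {w a z : ℤ → ℝ≥0∞} {C : ℝ≥0∞} (hw1 : ∀ k, 1 ≤ w k)
    (hwt : ∀ k, w k ≠ ∞) (hsub : ∀ k m, w (k + m) ≤ w k * w m) (hsymm : ∀ k, w (-k) = w k)
    (hinv : ∑' k, (w k)⁻¹ ≠ ∞) (hC : C ≠ ∞) (hz : ∀ k, z k ≤ C) (ha : ∑' m, a m * w m ≠ ∞)
    (h : ∀ k, (k.natAbs : ℝ≥0∞) * z k ≤ ∑' m, a m * z (k - m)) : ∑' k, z k * w k ≠ ∞ := by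
  set A := ∑' m, a m * w m with hA
  -- Beyond B the factor |k| exceeds A + 1, so those terms can be absorbed.
  obtain ⟨B, hB⟩ := ENNReal.exists_nat_gt (ENNReal.add_ne_top.2 ⟨ha, ENNReal.one_ne_top⟩)
  set D := ∑ k ∈ Finset.Icc (-(B : ℤ)) B, z k * w k with hD
  have hDt : D ≠ ∞ := ENNReal.sum_ne_top.2 fun k _ => ENNReal.mul_ne_top (ne_top_of_le_ne_top hC (hz k)) (hwt k)
  have hw0 : ∀ k, w k ≠ 0 := fun k => (lt_of_lt_of_le one_pos (hw1 k)).ne'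
  have main : ∀ N : ℝ≥0∞, N ≠ ∞ → ∑' k, z k * min (w k) (N * (w k)⁻¹) ≤ (A + 1) * D := by
    intro N hN
    set ω : ℤ → ℝ≥0∞ := fun k => min (w k) (N * (w k)⁻¹) with hω
    -- Symmetry and submultiplicativity of w bound N/w in the same way as w, so truncation keeps the
    -- inequality under shifts.
    have hωs : ∀ k m, ω k ≤ w m * ω (k - m) := by
      intro k m
      have e1 : w k ≤ w m * w (k - m) := by
        have := hsub m (k - m)
        rwa [add_sub_cancel] at this
      have e2 : w (k - m) ≤ w m * w k := by
        have := hsub (-m) k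
        rwa [hsymm, neg_add_eq_sub] at this
      have e3 : (w k)⁻¹ ≤ w m * (w (k - m))⁻¹ := by
        rw [← div_eq_mul_inv, ENNReal.le_div_iff_mul_le (Or.inl (hw0 _)) (Or.inl (hwt _)), mul_comm,
          ← div_eq_mul_inv]
        exact ENNReal.div_le_of_le_mul e2
      have e4 : N * (w k)⁻¹ ≤ w m * (N * (w (k - m))⁻¹) := by
        rw [mul_left_comm]
        exact mul_le_mul_right e3 N
      change min _ _ ≤ w m * min _ _
      rw [mul_min]
      exact min_le_min e1 e4
    set T := ∑' k, z k * ω k with hT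
    have hTt : T ≠ ∞ := by
      have e1 : T ≤ ∑' k, C * N * (w k)⁻¹ := ENNReal.tsum_le_tsum fun k => by
        rw [mul_assoc]
        exact mul_le_mul' (hz k) (min_le_right _ _)
      rw [ENNReal.tsum_mul_left] at e1
      exact ne_top_of_le_ne_top (ENNReal.mul_ne_top (ENNReal.mul_ne_top hC hN) hinv) e1
    have hAT : ∑' k : ℤ, (k.natAbs : ℝ≥0∞) * z k * ω k ≤ A * T := by
      calc ∑' k : ℤ, (k.natAbs : ℝ≥0∞) * z k * ω k
          ≤ ∑' k, ∑' m, a m * w m * (z (k - m) * ω (k - m)) := ENNReal.tsum_le_tsum fun k => by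
            refine (mul_le_mul_left (h k) _).trans ?_
            rw [← ENNReal.tsum_mul_right]
            refine ENNReal.tsum_le_tsum fun m => ?_
            calc a m * z (k - m) * ω k ≤ a m * z (k - m) * (w m * ω (k - m)) := mul_le_mul_right (hωs k m) _
              _ = _ := by ring
        _ = ∑' m, a m * w m * T := by
            rw [ENNReal.tsum_comm]
            refine tsum_congr fun m => ?_
            rw [ENNReal.tsum_mul_left, hT, ← (Equiv.subRight m).tsum_eq fun k => z k * ω k]
            rfl
        _ = A * T := by rw [ENNReal.tsum_mul_right]
    have hk : ∀ k, (A + 1) * (z k * ω k) ≤ (A + 1) * (if k ∈ Finset.Icc (-(B : ℤ)) B then z k * w k else 0) +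
        (k.natAbs : ℝ≥0∞) * z k * ω k := by
      intro k
      split_ifs with hkB
      · exact le_add_right (mul_le_mul_right (mul_le_mul_right (min_le_left _ _) _) _)
      · refine le_add_left ?_
        rw [mul_assoc]
        refine mul_le_mul_left (hB.le.trans ?_) _
        rw [Finset.mem_Icc] at hkB
        have : B ≤ k.natAbs := by omega
        exact_mod_cast this
    have h1 := ENNReal.tsum_le_tsum hk
    rw [ENNReal.tsum_add, ENNReal.tsum_mul_left, ENNReal.tsum_mul_left, ← hT,
      tsum_eq_sum (s := Finset.Icc (-(B : ℤ)) B) (fun k hk => if_neg hk),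
      Finset.sum_congr rfl fun k hk => if_pos hk, ← hD] at h1
    have h2 : A * T + T ≤ A * T + (A + 1) * D := by
      calc A * T + T = (A + 1) * T := by ring
        _ ≤ _ := h1
        _ ≤ (A + 1) * D + A * T := add_le_add_right hAT _
        _ = _ := add_comm _ _
    exact (ENNReal.add_le_add_iff_left (ENNReal.mul_ne_top ha hTt)).1 h2
  refine ne_top_of_le_ne_top (b := (A + 1) * D)
    (ENNReal.mul_ne_top (ENNReal.add_ne_top.2 ⟨ha, ENNReal.one_ne_top⟩) hDt) ?_
  rw [ENNReal.tsum_eq_iSup_sum]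
  refine iSup_le fun s => ?_
  -- With N at least w(k)² on the finite set s, the truncation is invisible there.
  have hN : ∑ k ∈ s, w k * w k ≠ ∞ := ENNReal.sum_ne_top.2 fun k _ => ENNReal.mul_ne_top (hwt k) (hwt k)
  refine le_trans ?_ (main _ hN)
  refine le_trans (Finset.sum_le_sum fun k hk => ?_) (ENNReal.sum_le_tsum s)
  refine mul_le_mul_right (le_min le_rfl ?_) _
  rw [← div_eq_mul_inv, ENNReal.le_div_iff_mul_le (Or.inl (hw0 _)) (Or.inl (hwt _))]
  exact Finset.single_le_sum (f := fun k => w k * w k) (fun _ _ => zero_le) hk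

theorem summable_mul_of_convolution_le (W : LoopWeight) {a z : ℤ → ℝ} (ha0 : ∀ k, 0 ≤ a k)
    (hz0 : ∀ k, 0 ≤ z k) {C : ℝ} (hz : ∀ k, z k ≤ C) (ha : Summable fun k => a k * W.w k)
    (hs : ∀ k, Summable fun m => a m * z (k - m))
    (h : ∀ k : ℤ, |(k : ℝ)| * z k ≤ ∑' m, a m * z (k - m)) : Summable fun k => z k * W.w k := by
  have hof : ∀ {f : ℤ → ℝ}, (∀ k, 0 ≤ f k) → Summable f → ∑' k, ENNReal.ofReal (f k) ≠ ∞ := fun h0 hf => by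
    rw [← ENNReal.ofReal_tsum_of_nonneg h0 hf]
    exact ENNReal.ofReal_ne_top
  have key := tsum_mul_lt_top_of_convolution_le (w := fun k => ENNReal.ofReal (W.w k))
    (a := fun k => ENNReal.ofReal (a k)) (z := fun k => ENNReal.ofReal (z k)) (C := ENNReal.ofReal C)
    (fun k => by rw [← ENNReal.ofReal_one]; exact ENNReal.ofReal_le_ofReal (W.one_le k))
    (fun k => ENNReal.ofReal_ne_top)
    (fun k m => by
      rw [← ENNReal.ofReal_mul (W.pos k).le]; exact ENNReal.ofReal_le_ofReal (W.submul k m))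
    (fun k => by rw [W.symm])
    (by
      have := hof (fun k => (inv_pos.2 (W.pos k)).le) W.summable_inv
      simpa only [ENNReal.ofReal_inv_of_pos (W.pos _)] using this)
    ENNReal.ofReal_ne_top (fun k => ENNReal.ofReal_le_ofReal (hz k))
    (by
      have := hof (fun k => mul_nonneg (ha0 k) (W.pos k).le) ha
      simpa only [ENNReal.ofReal_mul (ha0 _)] using this)
    (fun k => by
      have h1 := ENNReal.ofReal_le_ofReal (h k)
      rw [ENNReal.ofReal_tsum_of_nonneg (fun m => mul_nonneg (ha0 m) (hz0 _)) (hs k),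
        ENNReal.ofReal_mul (abs_nonneg _)] at h1
      simp only [ENNReal.ofReal_mul (ha0 _)] at h1
      refine le_trans (le_of_eq ?_) h1
      rw [← Int.cast_abs, Int.abs_eq_natAbs, Int.cast_natCast, ENNReal.ofReal_natCast])
  have h2 : ∑' k, ENNReal.ofReal (z k * W.w k) ≠ ∞ := by
    simpa only [ENNReal.ofReal_mul (hz0 _)] using key
  have h3 := ENNReal.summable_toReal h2
  refine h3.congr fun k => ?_
  rw [ENNReal.toReal_ofReal (mul_nonneg (hz0 k) (W.pos k).le)]

/-- In Fourier coefficients the equation reads k y(k) = Σ_m (P_m y(k-m) + y(k-m) Q_m). The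
coefficients y are bounded and P, Q lie in A_w, so the convolution estimate puts y in A_w. -/
theorem exists_matAw_of_ode {W : LoopWeight} {n : ℕ} (P Q : MatAw W n) (Z : ℝ → Matrix (Fin n) (Fin n) ℂ)
    (hZ : ∀ t i j, HasDerivAt (fun s => Z s i j)
      (Complex.I * (P.eval (Circle.exp t) * Z t + Z t * Q.eval (Circle.exp t)) i j) t)
    (hp : ∀ t, Z (t + 2 * Real.pi) = Z t) : ∃ T : MatAw W n, ∀ t, T.eval (Circle.exp t) = Z t := by
  have hc : ∀ i j, Continuous fun s => Z s i j := fun i j =>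
    continuous_iff_continuousAt.2 fun t => (hZ t i j).continuousAt
  have hper : ∀ i j, Function.Periodic (fun s => Z s i j) (2 * Real.pi) := fun i j t => by
    change Z (t + 2 * Real.pi) i j = _
    rw [hp]
  have hb : ∃ C : ℝ, ∀ i j t, ‖Z t i j‖ ≤ C := by
    have h1 : ∀ ij : Fin n × Fin n, ∃ C : ℝ, ∀ t, ‖Z t ij.1 ij.2‖ ≤ C := fun ij => by
      obtain ⟨C, hC⟩ := (isCompact_Icc (a := (0 : ℝ)) (b := 0 + 2 * Real.pi)).exists_bound_of_continuousOn
        (hc ij.1 ij.2).continuousOn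
      refine ⟨C, fun t => ?_⟩
      obtain ⟨y, hy, hty⟩ := (hper ij.1 ij.2).exists_mem_Ico₀ Real.two_pi_pos t
      have hty' : Z t ij.1 ij.2 = Z y ij.1 ij.2 := hty
      rw [hty']
      exact hC y ⟨hy.1, by linarith [hy.2]⟩
    choose C hC using h1
    exact ⟨∑ ij, |C ij|, fun i j t => (hC (i, j) t).trans ((le_abs_self _).trans
      (Finset.single_le_sum (f := fun ij => |C ij|) (fun _ _ => abs_nonneg _) (Finset.mem_univ (i, j))))⟩
  obtain ⟨C, hC⟩ := hb
  set y : Fin n → Fin n → ℤ → ℂ := fun i j => fourierC fun s => Z s i j with hy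
  have hrec : ∀ i j (k : ℤ), HasSum (fun m => ∑ l, (P (i, l)).coeff m * y l j (k - m) +
      ∑ l, (Q (l, j)).coeff m * y i l (k - m)) (k * y i j k) := by
    intro i j k
    have hcont1 : ∀ l, Continuous fun θ => (P (i, l)).eval (Circle.exp θ) * Z θ l j := fun l =>
      (continuous_eval _).mul (hc l j)
    have hcont2 : ∀ l, Continuous fun θ => (Q (l, j)).eval (Circle.exp θ) * Z θ i l := fun l =>
      (continuous_eval _).mul (hc i l)
    have e1 : ∀ θ, (P.eval (Circle.exp θ) * Z θ + Z θ * Q.eval (Circle.exp θ)) i j =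
        ∑ l ∈ Finset.univ.disjSum Finset.univ, Sum.elim
          (fun l => fun θ => (P (i, l)).eval (Circle.exp θ) * Z θ l j)
          (fun l => fun θ => (Q (l, j)).eval (Circle.exp θ) * Z θ i l) l θ := by
      intro θ
      rw [Finset.sum_disjSum, Matrix.add_apply, Matrix.mul_apply, Matrix.mul_apply]
      congr 1
      exact Finset.sum_congr rfl fun l _ => mul_comm _ _
    have e2 : k * y i j k = fourierC (fun θ => ∑ l ∈ Finset.univ.disjSum Finset.univ, Sum.elim
          (fun l => fun θ => (P (i, l)).eval (Circle.exp θ) * Z θ l j)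
          (fun l => fun θ => (Q (l, j)).eval (Circle.exp θ) * Z θ i l) l θ) k := by
      simp only [← e1]
      have hcont : Continuous fun θ => (P.eval (Circle.exp θ) * Z θ + Z θ * Q.eval (Circle.exp θ)) i j := by
        simp only [Matrix.add_apply, Matrix.mul_apply]
        exact (continuous_finsetSum _ fun l _ => (continuous_eval (P (i, l))).mul (hc l j)).add
          (continuous_finsetSum _ fun l _ => (hc i l).mul (continuous_eval (Q (l, j))))
      have e3 := fourierC_deriv (fun θ => hZ θ i j) (continuous_const.mul hcont) (hper i j) k
      have e4 : fourierC (fun θ => Complex.I * (P.eval (Circle.exp θ) * Z θ + Z θ * Q.eval (Circle.exp θ)) i j) k =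
          Complex.I * fourierC (fun θ => (P.eval (Circle.exp θ) * Z θ + Z θ * Q.eval (Circle.exp θ)) i j) k := by
        unfold fourierC
        simp only [mul_left_comm _ Complex.I, intervalIntegral.integral_const_mul]
      rw [e4, mul_assoc] at e3
      exact (mul_left_cancel₀ Complex.I_ne_zero e3).symm
    rw [e2, fourierC_sum, Finset.sum_disjSum]
    · exact (hasSum_sum fun l _ => hasSum_fourierC_mul (P (i, l)) (hc l j) (hC l j) k).add
        (hasSum_sum fun l _ => hasSum_fourierC_mul (Q (l, j)) (hc i l) (hC i l) k)
    · rintro (l | l) _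
      · exact hcont1 l
      · exact hcont2 l
  set z : ℤ → ℝ := fun k => ∑ i, ∑ j, ‖y i j k‖ with hz
  set a : ℤ → ℝ := fun m => ∑ i, ∑ j, (∑ l, ‖(P (i, l)).coeff m‖ + ∑ l, ‖(Q (l, j)).coeff m‖) with ha
  have hyz : ∀ i j k, ‖y i j k‖ ≤ z k := fun i j k =>
    (Finset.single_le_sum (f := fun j => ‖y i j k‖) (fun _ _ => norm_nonneg _) (Finset.mem_univ j)).trans
      (Finset.single_le_sum (f := fun i => ∑ j, ‖y i j k‖)
        (fun _ _ => Finset.sum_nonneg fun _ _ => norm_nonneg _) (Finset.mem_univ i))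
  have hz0 : ∀ k, 0 ≤ z k := fun k => Finset.sum_nonneg fun _ _ => Finset.sum_nonneg fun _ _ => norm_nonneg _
  have ha0 : ∀ k, 0 ≤ a k := fun k => Finset.sum_nonneg fun _ _ => Finset.sum_nonneg fun _ _ =>
    add_nonneg (Finset.sum_nonneg fun _ _ => norm_nonneg _) (Finset.sum_nonneg fun _ _ => norm_nonneg _)
  have hzC : ∀ k, z k ≤ ∑ _i : Fin n, ∑ _j : Fin n, C := fun k =>
    Finset.sum_le_sum fun i _ => Finset.sum_le_sum fun j _ => norm_fourierC_le (hC i j) k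
  have haW : Summable fun k => a k * W.w k := by
    simp only [ha, Finset.sum_mul, add_mul]
    exact summable_sum fun i _ => summable_sum fun j _ =>
      (summable_sum fun l _ => (P (i, l)).summable).add (summable_sum fun l _ => (Q (l, j)).summable)
  have haS : Summable a := Summable.of_nonneg_of_le ha0
    (fun k => le_mul_of_one_le_right (ha0 k) (W.one_le k)) haW
  have hsum : ∀ k, Summable fun m => a m * z (k - m) := fun k =>
    Summable.of_nonneg_of_le (fun m => mul_nonneg (ha0 m) (hz0 _))
      (fun m => mul_le_mul_of_nonneg_left (hzC (k - m)) (ha0 m)) (haS.mul_right _)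
  have hsumP : ∀ i j, Summable fun m => (∑ l, ‖(P (i, l)).coeff m‖ + ∑ l, ‖(Q (l, j)).coeff m‖) :=
    fun i j => (summable_sum fun l _ => (P (i, l)).summable_norm_coeff).add
      (summable_sum fun l _ => (Q (l, j)).summable_norm_coeff)
  have hsumPz : ∀ i j k, Summable fun m =>
      (∑ l, ‖(P (i, l)).coeff m‖ + ∑ l, ‖(Q (l, j)).coeff m‖) * z (k - m) := fun i j k =>
    Summable.of_nonneg_of_le (fun m => mul_nonneg (add_nonneg (Finset.sum_nonneg fun _ _ => norm_nonneg _)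
      (Finset.sum_nonneg fun _ _ => norm_nonneg _)) (hz0 _))
      (fun m => mul_le_mul_of_nonneg_left (hzC (k - m)) (add_nonneg (Finset.sum_nonneg fun _ _ => norm_nonneg _)
      (Finset.sum_nonneg fun _ _ => norm_nonneg _))) ((hsumP i j).mul_right _)
  have hle : ∀ k : ℤ, |(k : ℝ)| * z k ≤ ∑' m, a m * z (k - m) := by
    intro k
    have e1 : ∀ i j, |(k : ℝ)| * ‖y i j k‖ ≤
        ∑' m, (∑ l, ‖(P (i, l)).coeff m‖ + ∑ l, ‖(Q (l, j)).coeff m‖) * z (k - m) := by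
      intro i j
      rw [← Complex.norm_intCast, ← norm_mul, ← (hrec i j k).tsum_eq]
      refine tsum_of_norm_bounded (hsumPz i j k).hasSum fun m => ?_
      rw [add_mul, Finset.sum_mul, Finset.sum_mul]
      refine (norm_add_le _ _).trans (add_le_add ?_ ?_)
      · refine (norm_sum_le _ _).trans (Finset.sum_le_sum fun l _ => ?_)
        rw [norm_mul]
        exact mul_le_mul_of_nonneg_left (hyz _ _ _) (norm_nonneg _)
      · refine (norm_sum_le _ _).trans (Finset.sum_le_sum fun l _ => ?_)
        rw [norm_mul]
        exact mul_le_mul_of_nonneg_left (hyz _ _ _) (norm_nonneg _)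
    have e2 : ∀ m, a m * z (k - m) =
        ∑ i, ∑ j, (∑ l, ‖(P (i, l)).coeff m‖ + ∑ l, ‖(Q (l, j)).coeff m‖) * z (k - m) := fun m => by
      rw [ha, Finset.sum_mul]
      exact Finset.sum_congr rfl fun i _ => Finset.sum_mul _ _ _
    have e3 := hasSum_sum (s := Finset.univ) fun i _ =>
      hasSum_sum (s := Finset.univ) fun j _ => (hsumPz i j k).hasSum
    simp only [e2]
    rw [e3.tsum_eq, hz, Finset.mul_sum]
    refine Finset.sum_le_sum fun i _ => ?_
    rw [Finset.mul_sum]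
    exact Finset.sum_le_sum fun j _ => e1 i j
  have hfin := summable_mul_of_convolution_le W ha0 hz0 hzC haW hsum hle
  have hyW : ∀ i j, Summable fun k => ‖y i j k‖ * W.w k := fun i j =>
    Summable.of_nonneg_of_le (fun k => mul_nonneg (norm_nonneg _) (W.pos k).le)
      (fun k => mul_le_mul_of_nonneg_right (hyz i j k) (W.pos k).le) hfin
  refine ⟨WithLp.toLp 2 fun ij => Aw.mk (y ij.1 ij.2) (hyW ij.1 ij.2), fun t => ?_⟩
  ext i j
  have hy1 : Summable fun k => ‖fourierC (fun s => Z s i j) k‖ :=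
    Aw.summable_norm_coeff (Aw.mk (y i j) (hyW i j))
  exact (hasSum_fourierC (hc i j) (hper i j) hy1 t).tsum_eq

end Bootstrap

/-! ### Matrices over the Wiener algebra -/

namespace MatAw

variable {W : LoopWeight} {n : ℕ}

/-- The entries of a matrix loop. -/
def entryCLM (ij : Fin n × Fin n) : MatAw W n →L[ℂ] Aw W :=
  PiLp.proj (𝕜 := ℂ) 2 (fun _ : Fin n × Fin n => Aw W) ij

theorem entryCLM_apply (ij : Fin n × Fin n) (T : MatAw W n) : entryCLM ij T = T ij := rfl

/-- Assembling a matrix loop from its entries. -/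
def ofEntries {E : Type*} [NormedAddCommGroup E] [NormedSpace ℂ E] (T : Fin n × Fin n → E →L[ℂ] Aw W) :
    E →L[ℂ] MatAw W n :=
  (PiLp.continuousLinearEquiv 2 ℂ (fun _ : Fin n × Fin n => Aw W)).symm.toContinuousLinearMap.comp
    (ContinuousLinearMap.pi T)

theorem ofEntries_apply {E : Type*} [NormedAddCommGroup E] [NormedSpace ℂ E]
    (T : Fin n × Fin n → E →L[ℂ] Aw W) (x : E) (ij : Fin n × Fin n) : ofEntries T x ij = T ij x := rfl

theorem ext_entry {S T : MatAw W n} (h : ∀ ij, S ij = T ij) : S = T := PiLp.ext h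

theorem ext_eval {S T : MatAw W n} (h : ∀ z, S.eval z = T.eval z) : S = T :=
  ext_entry fun ij => Aw.ext_eval fun z => congrFun (congrFun (h z) ij.1) ij.2

/-- Evaluation as a linear map. -/
def evalₗ (z : Circle) : MatAw W n →ₗ[ℂ] Matrix (Fin n) (Fin n) ℂ where
  toFun T := T.eval z
  map_add' S T := eval_add S T z
  map_smul' c T := eval_smul c T z

theorem continuous_evalₗ (z : Circle) : Continuous (evalₗ z : MatAw W n →ₗ[ℂ] Matrix (Fin n) (Fin n) ℂ) :=
  continuous_pi fun i => continuous_pi fun j => ((Aw.evalCLM z).comp (entryCLM (i, j))).continuous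

theorem eval_sub (S T : MatAw W n) (z : Circle) : (S - T).eval z = S.eval z - T.eval z :=
  map_sub (evalₗ z) S T

theorem eval_zero (z : Circle) : (0 : MatAw W n).eval z = 0 := map_zero (evalₗ z)

/-- Fourier coefficients as a linear map. -/
def coeffₗ (k : ℤ) : MatAw W n →ₗ[ℂ] Matrix (Fin n) (Fin n) ℂ where
  toFun T := T.coeff k
  map_add' _ _ := rfl
  map_smul' _ _ := rfl

theorem continuous_coeffₗ (k : ℤ) : Continuous (coeffₗ k : MatAw W n →ₗ[ℂ] Matrix (Fin n) (Fin n) ℂ) :=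
  continuous_pi fun i => continuous_pi fun j => ((Aw.coeffCLM k).comp (entryCLM (i, j))).continuous

theorem hasSum_eval (T : MatAw W n) (z : Circle) :
    HasSum (fun k : ℤ => (z : ℂ) ^ k • T.coeff k) (T.eval z) := by
  refine Pi.hasSum.2 fun i => Pi.hasSum.2 fun j => ?_
  have h : (fun k : ℤ => ((z : ℂ) ^ k • T.coeff k) i j) = fun k => (T (i, j)).coeff k * (z : ℂ) ^ k :=
    funext fun k => mul_comm _ _
  exact h ▸ (T (i, j)).hasSum_eval z

/-- Constant matrix loops. -/
def const (A : Matrix (Fin n) (Fin n) ℂ) : MatAw W n := WithLp.toLp 2 fun ij => Aw.const (A ij.1 ij.2)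

theorem eval_const (A : Matrix (Fin n) (Fin n) ℂ) (z : Circle) : (const A : MatAw W n).eval z = A := by
  ext i j
  exact Aw.eval_const _ _

/-- Multiplication of matrix loops. -/
def mulCLM : MatAw W n →L[ℂ] MatAw W n →L[ℂ] MatAw W n :=
  ∑ ij : Fin n × Fin n, ∑ k : Fin n,
    (ContinuousLinearMap.compL ℂ (MatAw W n) (Aw W) (MatAw W n)
      (ofEntries fun ij' => if ij' = ij then ContinuousLinearMap.id ℂ (Aw W) else 0)).comp
    (Aw.mulCLM.bilinearComp (entryCLM (ij.1, k)) (entryCLM (k, ij.2)))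

theorem mulCLM_apply (S T : MatAw W n) (i j : Fin n) :
    mulCLM S T (i, j) = ∑ k, Aw.mulCLM (S (i, k)) (T (k, j)) := by
  have h : mulCLM S T = ∑ ij : Fin n × Fin n, ∑ k : Fin n,
      (ofEntries fun ij' => if ij' = ij then ContinuousLinearMap.id ℂ (Aw W) else 0)
        (Aw.mulCLM (S (ij.1, k)) (T (k, ij.2))) := by
    simp only [mulCLM, sum_apply]
    rfl
  rw [h, ← entryCLM_apply, map_sum, Finset.sum_eq_single (i, j)]
  · rw [map_sum]
    refine Finset.sum_congr rfl fun k _ => ?_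
    rw [entryCLM_apply, ofEntries_apply, if_pos rfl]
    rfl
  · intro ij _ hij
    rw [map_sum]
    refine Finset.sum_eq_zero fun k _ => ?_
    rw [entryCLM_apply, ofEntries_apply, if_neg (Ne.symm hij)]
    rfl
  · exact fun h => absurd (Finset.mem_univ _) h

theorem eval_mul (S T : MatAw W n) (z : Circle) : (mulCLM S T).eval z = S.eval z * T.eval z := by
  ext i j
  change (mulCLM S T (i, j)).eval z = _
  rw [mulCLM_apply, ← Aw.evalCLM_apply, map_sum, Matrix.mul_apply]
  exact Finset.sum_congr rfl fun k _ => Aw.eval_mul _ _ _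

theorem hasDerivAt_eval_of_coeff {S T : MatAw W n} (h : ∀ k : ℤ, T.coeff k = (k : ℂ) • S.coeff k) (t : ℝ) :
    HasDerivAt (fun s : ℝ => S.eval (Circle.exp s)) (Complex.I • T.eval (Circle.exp t)) t :=
  hasDerivAt_matrix.2 fun i j =>
    Aw.hasDerivAt_eval_of_coeff (fun k => congrFun (congrFun (h k) i) j) t

theorem exists_hasDerivAt_eval (S : MatAw W n) (t : ℝ) :
    ∃ S' : Matrix (Fin n) (Fin n) ℂ, HasDerivAt (fun s : ℝ => S.eval (Circle.exp s)) S' t :=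
  ⟨Matrix.of fun _ _ => _, hasDerivAt_matrix.2 fun i j => (S (i, j)).hasDerivAt_eval t⟩

/-- Entrywise Fourier multipliers depending on the eigenvalues of the commutator with a diagonal
matrix. -/
def multiplier (d : Fin n → ℂ) (ρ : ℂ → ℤ → ℂ) (C : ℝ) (hC : ∀ i j k, ‖ρ (d j - d i) k‖ ≤ C) :
    MatAw W n →L[ℂ] MatAw W n :=
  ofEntries fun ij => (Aw.multiplier (ρ (d ij.2 - d ij.1)) C (hC ij.1 ij.2)).comp (entryCLM ij)

theorem coeff_multiplier (d : Fin n → ℂ) (ρ : ℂ → ℤ → ℂ) (C : ℝ) (hC : ∀ i j k, ‖ρ (d j - d i) k‖ ≤ C)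
    (T : MatAw W n) (k : ℤ) : (multiplier d ρ C hC T).coeff k =
      Matrix.of fun i j => ρ (d j - d i) k * T.coeff k i j := rfl

end MatAw

/-- The commutator with the diagonal matrix multiplies the (i, j) entry by d_j - d_i. Polynomials in
it preserve V, and Lagrange interpolation produces any function of the finitely many differences. -/
theorem entrywise_mem {n : ℕ} (V : Submodule ℂ (Matrix (Fin n) (Fin n) ℂ)) (d : Fin n → ℂ)
    (hV : ∀ A ∈ V, A * Matrix.diagonal d - Matrix.diagonal d * A ∈ V) (g : ℂ → ℂ)
    {A : Matrix (Fin n) (Fin n) ℂ} (hA : A ∈ V) : Matrix.of (fun i j => g (d j - d i) * A i j) ∈ V := by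
  have h1 : ∀ (m : ℕ) (c : ℂ), ∀ A ∈ V, Matrix.of (fun i j => c * (d j - d i) ^ m * A i j) ∈ V := by
    intro m c
    induction m with
    | zero =>
      intro A hA
      have : Matrix.of (fun i j => c * (d j - d i) ^ 0 * A i j) = c • A := by
        ext i j; simp
      rw [this]
      exact V.smul_mem c hA
    | succ m ih =>
      intro A hA
      have : Matrix.of (fun i j => c * (d j - d i) ^ (m + 1) * A i j) =
          Matrix.of (fun i j => c * (d j - d i) ^ m * (A * Matrix.diagonal d - Matrix.diagonal d * A) i j) := by
        ext i j
        simp only [Matrix.of_apply, Matrix.sub_apply, Matrix.mul_diagonal, Matrix.diagonal_mul]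
        ring
      rw [this]
      exact ih _ (hV A hA)
  have h2 : ∀ p : Polynomial ℂ, Matrix.of (fun i j => p.eval (d j - d i) * A i j) ∈ V := by
    intro p
    induction p using Polynomial.induction_on' with
    | add p q hp hq =>
      have : Matrix.of (fun i j => (p + q).eval (d j - d i) * A i j) =
          Matrix.of (fun i j => p.eval (d j - d i) * A i j) + Matrix.of (fun i j => q.eval (d j - d i) * A i j) := by
        ext i j
        simp only [Matrix.of_apply, Matrix.add_apply, Polynomial.eval_add, add_mul]
      rw [this]
      exact V.add_mem hp hq
    | monomial m c =>
      simp only [Polynomial.eval_monomial]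
      exact h1 m c A hA
  classical
  let s : Finset ℂ := Finset.univ.image fun ij : Fin n × Fin n => d ij.2 - d ij.1
  have h3 := h2 (Lagrange.interpolate s id g)
  have h4 : Matrix.of (fun i j => (Lagrange.interpolate s id g).eval (d j - d i) * A i j) =
      Matrix.of (fun i j => g (d j - d i) * A i j) := by
    ext i j
    simp only [Matrix.of_apply]
    have := Lagrange.eval_interpolate_at_node (s := s) (v := id) g Function.injective_id.injOn
      (i := d j - d i) (Finset.mem_image.2 ⟨(i, j), Finset.mem_univ _, rfl⟩)
    rw [id] at this
    rw [this]
  rwa [h4] at h3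

/-- A functional vanishing on V turns the loop into a scalar function that vanishes on the circle,
whose Fourier coefficients are zero. -/
theorem MatAw.eval_mem_iff_coeff_mem {W : LoopWeight} {n : ℕ} (V : Submodule ℂ (Matrix (Fin n) (Fin n) ℂ))
    (T : MatAw W n) : (∀ z, T.eval z ∈ V) ↔ ∀ k, T.coeff k ∈ V := by
  constructor
  · intro h k
    by_contra hk
    obtain ⟨f, hf, hV⟩ := V.exists_le_ker_of_notMem hk
    let a : Aw W := ∑ ij : Fin n × Fin n, f (Matrix.single ij.1 ij.2 1) • T ij
    have hsum : ∀ A : Matrix (Fin n) (Fin n) ℂ, f A =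
        ∑ ij : Fin n × Fin n, f (Matrix.single ij.1 ij.2 1) * A ij.1 ij.2 := by
      intro A
      conv_lhs => rw [Matrix.matrix_eq_sum_single A]
      rw [Fintype.sum_prod_type, map_sum]
      refine Finset.sum_congr rfl fun i _ => ?_
      rw [map_sum]
      refine Finset.sum_congr rfl fun j _ => ?_
      have : Matrix.single i j (A i j) = A i j • Matrix.single i j 1 := by
        rw [Matrix.smul_single, smul_eq_mul, mul_one]
      rw [this, map_smul, smul_eq_mul, mul_comm]
    have ha : a = 0 := Aw.ext_eval fun z => by
      rw [← Aw.evalCLM_apply, ← Aw.evalCLM_apply, map_zero, map_sum]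
      simp only [map_smul, smul_eq_mul]
      exact (hsum (T.eval z)).symm.trans (hV (h z))
    have h2 : Aw.coeffCLM k a = f (T.coeff k) := by
      rw [map_sum]
      simp only [map_smul, smul_eq_mul]
      exact (hsum (T.coeff k)).symm
    rw [ha, map_zero] at h2
    exact hf h2.symm
  · intro h z
    exact V.closed_of_finiteDimensional.mem_of_tendsto (T.hasSum_eval z)
      (Filter.Eventually.of_forall fun s => V.sum_mem fun k _ => V.smul_mem _ (h k))

namespace ChevalleyData

variable {n l : ℕ} (S : ChevalleyData n l) {W : LoopWeight}

theorem mem_loopAlg_iff_coeff {T : MatAw W n} : T ∈ S.LoopAlg W ↔ ∀ k, T.coeff k ∈ S.𝔤 :=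
  T.eval_mem_iff_coeff_mem S.𝔤.toSubmodule

theorem isClosed_loopAlg : IsClosed (S.LoopAlg W : Set (MatAw W n)) := by
  have : (S.LoopAlg W : Set (MatAw W n)) =
      ⋂ z, (MatAw.evalₗ z : MatAw W n →ₗ[ℂ] Matrix (Fin n) (Fin n) ℂ) ⁻¹' (S.𝔤.toSubmodule : Set _) := by
    ext T
    simp only [Set.mem_iInter]
    rfl
  rw [this]
  exact isClosed_iInter fun z => S.𝔤.toSubmodule.closed_of_finiteDimensional.preimage (MatAw.continuous_evalₗ z)

instance : CompleteSpace (S.LoopAlg W) := S.isClosed_loopAlg.completeSpace_coe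

/-- Constant loops in `𝔤`. -/
def constLoop (X : S.𝔤) : S.LoopAlg W :=
  ⟨MatAw.const X, fun z => by rw [MatAw.eval_const]; exact X.2⟩

/-- The bracket of the loop algebra. -/
def loopBracket : S.LoopAlg W →L[ℂ] S.LoopAlg W →L[ℂ] S.LoopAlg W :=
  LinearMap.mkContinuous₂
    (LinearMap.mk₂ ℂ (fun φ ψ => ⟨MatAw.mulCLM φ.1 ψ.1 - MatAw.mulCLM ψ.1 φ.1, fun z => by
        rw [MatAw.eval_sub, MatAw.eval_mul, MatAw.eval_mul]
        exact (⁅S.evalAlg φ z, S.evalAlg ψ z⁆ : S.𝔤).2⟩)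
      (fun a b c => Subtype.ext (by
        change MatAw.mulCLM (a.1 + b.1) c.1 - MatAw.mulCLM c.1 (a.1 + b.1) =
          (MatAw.mulCLM a.1 c.1 - MatAw.mulCLM c.1 a.1) + (MatAw.mulCLM b.1 c.1 - MatAw.mulCLM c.1 b.1)
        rw [map_add, map_add, add_apply]; abel))
      (fun r a c => Subtype.ext (by
        change MatAw.mulCLM (r • a.1) c.1 - MatAw.mulCLM c.1 (r • a.1) =
          r • (MatAw.mulCLM a.1 c.1 - MatAw.mulCLM c.1 a.1)
        rw [map_smul, map_smul, smul_apply, smul_sub]))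
      (fun c a b => Subtype.ext (by
        change MatAw.mulCLM c.1 (a.1 + b.1) - MatAw.mulCLM (a.1 + b.1) c.1 =
          (MatAw.mulCLM c.1 a.1 - MatAw.mulCLM a.1 c.1) + (MatAw.mulCLM c.1 b.1 - MatAw.mulCLM b.1 c.1)
        rw [map_add, map_add, add_apply]; abel))
      (fun r c a => Subtype.ext (by
        change MatAw.mulCLM c.1 (r • a.1) - MatAw.mulCLM (r • a.1) c.1 =
          r • (MatAw.mulCLM c.1 a.1 - MatAw.mulCLM a.1 c.1)
        rw [map_smul, map_smul, smul_apply, smul_sub])))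
    (2 * ‖(MatAw.mulCLM : MatAw W n →L[ℂ] MatAw W n →L[ℂ] MatAw W n)‖) fun φ ψ => by
      change ‖MatAw.mulCLM φ.1 ψ.1 - MatAw.mulCLM ψ.1 φ.1‖ ≤ _
      refine (norm_sub_le _ _).trans ?_
      have h1 := (MatAw.mulCLM : MatAw W n →L[ℂ] MatAw W n →L[ℂ] MatAw W n).le_opNorm₂ φ.1 ψ.1
      have h2 := (MatAw.mulCLM : MatAw W n →L[ℂ] MatAw W n →L[ℂ] MatAw W n).le_opNorm₂ ψ.1 φ.1
      have h3 : ‖φ.1‖ = ‖φ‖ := rfl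
      have h4 : ‖ψ.1‖ = ‖ψ‖ := rfl
      rw [h3, h4] at h1 h2
      nlinarith

/-- Fourier multipliers on the loop algebra built from the eigenvalues of a diagonal element. -/
def loopMultiplier {μ : S.𝔤} {d : Fin n → ℂ} (hd : (μ : Matrix (Fin n) (Fin n) ℂ) = Matrix.diagonal d)
    (ρ : ℂ → ℤ → ℂ) (C : ℝ) (hC : ∀ i j k, ‖ρ (d j - d i) k‖ ≤ C) : S.LoopAlg W →L[ℂ] S.LoopAlg W :=
  ((MatAw.multiplier d ρ C hC).comp (S.LoopAlg W).subtypeL).codRestrict (S.LoopAlg W) fun ψ => by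
    refine S.mem_loopAlg_iff_coeff.2 fun k => ?_
    change (MatAw.multiplier d ρ C hC ψ.1).coeff k ∈ S.𝔤.toSubmodule
    rw [MatAw.coeff_multiplier]
    refine entrywise_mem S.𝔤.toSubmodule d (fun A hA => ?_) (fun x => ρ x k) (S.mem_loopAlg_iff_coeff.1 ψ.2 k)
    rw [← hd]
    exact (⁅(⟨A, hA⟩ : S.𝔤), μ⁆ : S.𝔤).2

end ChevalleyData

/-! ### The gauge action -/

section InvDeriv

open scoped Matrix.Norms.Operator

theorem hasDerivAt_matrix_inv {m : Type*} [Fintype m] [DecidableEq m] {Z : ℝ → Matrix m m ℂ}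
    {Z' : Matrix m m ℂ} {t : ℝ} (h : HasDerivAt Z Z' t) (hu : ∀ s, IsUnit (Z s)) :
    HasDerivAt (fun s => (Z s)⁻¹) (-((Z t)⁻¹ * Z' * (Z t)⁻¹)) t := by
  obtain ⟨u, hut⟩ := hu t
  have h1 : HasFDerivAt (𝕜 := ℝ) Ring.inverse _ (Z t) := hut ▸ hasFDerivAt_ringInverse (𝕜 := ℝ) u
  have h2 := h1.comp_hasDerivAt t h
  have h3 : (fun s => (Z s)⁻¹) = Ring.inverse ∘ Z := funext fun s => Matrix.nonsing_inv_eq_ringInverse (Z s)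
  have h4 : (↑u⁻¹ : Matrix m m ℂ) = (Z t)⁻¹ := by rw [← hut, Matrix.coe_units_inv]
  rw [h3]
  simp [h4] at h2
  exact h2

end InvDeriv

section ExpCLM

attribute [-instance] LieRing.ofAssociativeRing

variable {E : Type*} [NormedAddCommGroup E] [NormedSpace ℂ E] [CompleteSpace E]

/-- The exponential of a bounded operator. -/
def expCLM (T : E →L[ℂ] E) : E →L[ℂ] E := NormedSpace.exp T

theorem map_expCLM_eq_self {T : E →L[ℂ] E} (L : E →L[ℂ] ℂ) (h : ∀ x, L (T x) = 0) (x : E) :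
    L (expCLM T x) = L x := by
  refine (exp_clm_intertwine T (0 : ℂ →L[ℂ] ℂ) L h x).trans ?_
  rw [NormedSpace.exp_zero]
  rfl

theorem map_expCLM_eq_conj {m : Type*} [Fintype m] [DecidableEq m] (T : E →L[ℂ] E) (L : E →ₗ[ℂ] Matrix m m ℂ)
    (hL : Continuous L) (A : Matrix m m ℂ) (h : ∀ x, L (T x) = A * L x - L x * A) (x : E) :
    L (expCLM T x) = NormedSpace.exp A * L x * NormedSpace.exp (-A) :=
  map_exp_clm_eq_conj T L hL A h x

theorem map_expCLM_eq_mul {m : Type*} [Fintype m] [DecidableEq m] (T : E →L[ℂ] E) (L : E →ₗ[ℂ] Matrix m m ℂ)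
    (hL : Continuous L) (A : Matrix m m ℂ) (h : ∀ x, L (T x) = A * L x) (x : E) :
    L (expCLM T x) = NormedSpace.exp A * L x :=
  map_exp_clm_eq_mul T L hL A h x

/-- The derivative of exp at 0 is the identity, so where T y = 0 the exponential contributes just
the generator applied to v y. -/
theorem hasStrictFDerivAt_expCLM_apply {F : Type*} [NormedAddCommGroup F] [NormedSpace ℂ F]
    (T : F →L[ℂ] E →L[ℂ] E) {v : F → E} {v' : F →L[ℂ] E} {y : F} (hy : T y = 0)
    (hv : HasStrictFDerivAt v v' y) :
    HasStrictFDerivAt (fun x => expCLM (T x) (v x)) (v' + T.flip (v y)) y := by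
  have h1 : HasStrictFDerivAt (fun A : E →L[ℂ] E => NormedSpace.exp A)
      (1 : (E →L[ℂ] E) →L[ℂ] (E →L[ℂ] E)) (T y) := by
    rw [hy]
    exact hasStrictFDerivAt_exp_zero
  have h2 := (h1.comp y T.hasStrictFDerivAt).clm_apply hv
  refine h2.congr_fderiv ?_
  ext x
  simp [hy, NormedSpace.exp_zero]

end ExpCLM

/-- Two solutions of f' = cφf differ by a constant right factor. This gives uniqueness of monodromy
and its behaviour under gauge changes and translation. -/
theorem hasDerivAt_inv_mul_of_ode {n : ℕ} {f₁ f₂ φ : ℝ → Matrix (Fin n) (Fin n) ℂ} {c : ℂ} {t : ℝ}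
    (hu : ∀ s, IsUnit (f₁ s)) (h₁ : HasDerivAt f₁ (c • (φ t * f₁ t)) t)
    (h₂ : HasDerivAt f₂ (c • (φ t * f₂ t)) t) : HasDerivAt (fun s => (f₁ s)⁻¹ * f₂ s) 0 t := by
  have h1 := hasDerivAt_matrix_mul (hasDerivAt_matrix_inv h₁ hu) h₂
  have h3 : f₁ t * (f₁ t)⁻¹ = 1 :=
    Matrix.mul_nonsing_inv _ ((Matrix.isUnit_iff_isUnit_det _).1 (hu t))
  have h2 : -((f₁ t)⁻¹ * (c • (φ t * f₁ t)) * (f₁ t)⁻¹) * f₂ t + (f₁ t)⁻¹ * (c • (φ t * f₂ t)) = 0 := by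
    rw [Matrix.mul_smul, Matrix.smul_mul, ← Matrix.mul_assoc, Matrix.mul_assoc _ (f₁ t), h3, Matrix.mul_one,
      Matrix.neg_mul, Matrix.smul_mul, Matrix.mul_smul, ← Matrix.mul_assoc, neg_add_cancel]
  rwa [h2] at h1

open Matrix in
-- Conjugation by diag(c, 1) would rescale the corner; stating it as an intertwining relation also
-- covers c = 0.
theorem toBlocks_exp_smul {m : Type*} [Fintype m] [DecidableEq m] (A B : Matrix m m ℂ) (c : ℂ) :
    (NormedSpace.exp (fromBlocks A (c • B) 0 A)).toBlocks₁₂ =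
      c • (NormedSpace.exp (fromBlocks A B 0 A)).toBlocks₁₂ := by
  have h : NormedSpace.exp (fromBlocks A (c • B) 0 A) * fromBlocks (c • (1 : Matrix m m ℂ)) 0 0 1 =
      fromBlocks (c • (1 : Matrix m m ℂ)) 0 0 1 * NormedSpace.exp (fromBlocks A B 0 A) := by
    apply exp_mul_of_intertwine
    simp [fromBlocks_multiply]
  rw [exp_fromBlocks_diag A (c • B), exp_fromBlocks_diag A B] at h
  simp only [fromBlocks_multiply] at h
  have h2 := congrArg toBlocks₁₂ h
  simp only [toBlocks_fromBlocks₁₂] at h2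
  simpa using h2

namespace ChevalleyData

variable {n l : ℕ} (S : ChevalleyData n l) {W : LoopWeight}

theorem isUnit_of_isLoop {S : ChevalleyData n l} {γ : MatAw W n} (h : S.IsLoop γ) (z : Circle) :
    IsUnit (γ.eval z) := by
  obtain ⟨g, hg⟩ := h z
  exact hg ▸ S.isUnit_mat g

/-- Insert (γ⁻¹)' = -γ⁻¹γ'γ⁻¹ and D = -i d/dθ. -/
theorem gaugeAct_eq {S : ChevalleyData n l} {γ : MatAw W n} (h : S.IsLoop γ) (φ : ℝ → Matrix (Fin n) (Fin n) ℂ)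
    (p : ℂ) {θ : ℝ} {γ' : Matrix (Fin n) (Fin n) ℂ}
    (hγ : HasDerivAt (fun s : ℝ => γ.eval (Circle.exp s)) γ' θ) :
    gaugeAct γ φ p θ = γ.eval (Circle.exp θ) * φ θ * (γ.eval (Circle.exp θ))⁻¹ +
      (p * Complex.I) • (γ' * (γ.eval (Circle.exp θ))⁻¹) := by
  have h1 := hasDerivAt_matrix_inv hγ fun s => isUnit_of_isLoop h (Circle.exp s)
  have h2 : (Matrix.of fun i j => deriv (fun s : ℝ => (γ.eval (Circle.exp s))⁻¹ i j) θ) =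
      -((γ.eval (Circle.exp θ))⁻¹ * γ' * (γ.eval (Circle.exp θ))⁻¹) := by
    ext i j
    exact (hasDerivAt_matrix.1 h1 i j).deriv
  have h3 : γ.eval (Circle.exp θ) * (γ.eval (Circle.exp θ))⁻¹ = 1 :=
    Matrix.mul_nonsing_inv _ ((Matrix.isUnit_iff_isUnit_det _).1 (isUnit_of_isLoop h _))
  unfold gaugeAct
  rw [h2, smul_neg, Matrix.mul_neg, neg_smul, Matrix.mul_neg, neg_neg, Matrix.mul_smul, smul_smul]
  congr 2
  rw [← Matrix.mul_assoc, ← Matrix.mul_assoc, h3, Matrix.one_mul]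

theorem IsLoop.mul {S : ChevalleyData n l} {γ γ' : MatAw W n} (h : S.IsLoop γ) (h' : S.IsLoop γ') :
    S.IsLoop (MatAw.mulCLM γ γ') := fun z => by
  obtain ⟨g, hg⟩ := h z
  obtain ⟨g', hg'⟩ := h' z
  exact ⟨g * g', by rw [mat_mul, hg, hg', MatAw.eval_mul]⟩

theorem gaugeAct_mul {S : ChevalleyData n l} {γ η : MatAw W n} (h : S.IsLoop γ) (h' : S.IsLoop η)
    (φ : ℝ → Matrix (Fin n) (Fin n) ℂ) (p : ℂ) (θ : ℝ) :
    gaugeAct (MatAw.mulCLM γ η) φ p θ = gaugeAct γ (gaugeAct η φ p) p θ := by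
  obtain ⟨γ', hγ⟩ := γ.exists_hasDerivAt_eval θ
  obtain ⟨η', hη⟩ := η.exists_hasDerivAt_eval θ
  have h1 : HasDerivAt (fun s : ℝ => (MatAw.mulCLM γ η).eval (Circle.exp s))
      (γ' * η.eval (Circle.exp θ) + γ.eval (Circle.exp θ) * η') θ := by
    simp only [MatAw.eval_mul]
    exact hasDerivAt_matrix_mul hγ hη
  have h3 : η.eval (Circle.exp θ) * (η.eval (Circle.exp θ))⁻¹ = 1 :=
    Matrix.mul_nonsing_inv _ ((Matrix.isUnit_iff_isUnit_det _).1 (isUnit_of_isLoop h' _))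
  rw [gaugeAct_eq (h.mul h') _ _ h1, gaugeAct_eq h _ _ hγ, gaugeAct_eq h' _ _ hη, MatAw.eval_mul,
    Matrix.mul_inv_rev]
  generalize η.eval (Circle.exp θ) = b at *
  generalize γ.eval (Circle.exp θ) = a at *
  have h4 : γ' * b * (b⁻¹ * a⁻¹) = γ' * a⁻¹ := by
    rw [Matrix.mul_assoc, ← Matrix.mul_assoc b, h3, Matrix.one_mul]
  rw [Matrix.add_mul, h4]
  simp only [Matrix.mul_add, Matrix.add_mul, smul_add, Matrix.mul_smul, Matrix.smul_mul, Matrix.mul_assoc]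
  abel

/-- A loop gauging a constant gives a fundamental matrix. -/
theorem hasDerivAt_of_gaugeAct {S : ChevalleyData n l} {γ : MatAw W n} (h : S.IsLoop γ)
    {μ : Matrix (Fin n) (Fin n) ℂ} {p : ℂ} (hp : p ≠ 0) {x : ℝ → Matrix (Fin n) (Fin n) ℂ}
    (hx : ∀ θ, x θ = gaugeAct γ (fun _ => μ) p θ) (θ : ℝ) :
    HasDerivAt (fun s : ℝ => γ.eval (Circle.exp s) * NormedSpace.exp ((s : ℂ) • (1 / (Complex.I * p)) • μ))
      ((1 / (Complex.I * p)) • (x θ * (γ.eval (Circle.exp θ) *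
        NormedSpace.exp ((θ : ℂ) • (1 / (Complex.I * p)) • μ)))) θ := by
  obtain ⟨γ', hγ⟩ := γ.exists_hasDerivAt_eval θ
  have h1 := hasDerivAt_matrix_mul hγ (hasDerivAt_exp_smul' ((1 / (Complex.I * p)) • μ) θ)
  have h3 : (γ.eval (Circle.exp θ))⁻¹ * γ.eval (Circle.exp θ) = 1 :=
    Matrix.nonsing_inv_mul _ ((Matrix.isUnit_iff_isUnit_det _).1 (isUnit_of_isLoop h _))
  have h4 : (1 / (Complex.I * p)) • (x θ * (γ.eval (Circle.exp θ) *
        NormedSpace.exp ((θ : ℂ) • (1 / (Complex.I * p)) • μ))) =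
      γ' * NormedSpace.exp ((θ : ℂ) • (1 / (Complex.I * p)) • μ) + γ.eval (Circle.exp θ) *
        ((1 / (Complex.I * p)) • μ * NormedSpace.exp ((θ : ℂ) • (1 / (Complex.I * p)) • μ)) := by
    rw [hx, gaugeAct_eq h _ _ hγ]
    generalize NormedSpace.exp ((θ : ℂ) • (1 / (Complex.I * p)) • μ) = e
    generalize γ.eval (Circle.exp θ) = a at *
    have e1 : ∀ X : Matrix (Fin n) (Fin n) ℂ, X * a⁻¹ * (a * e) = X * e := fun X => by
      rw [Matrix.mul_assoc, ← Matrix.mul_assoc a⁻¹, h3, Matrix.one_mul]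
    rw [Matrix.add_mul, Matrix.smul_mul, e1, e1, smul_add, smul_smul, add_comm]
    have e2 : 1 / (Complex.I * p) * (p * Complex.I) = 1 := by
      have := Complex.I_ne_zero
      field_simp
    rw [e2, one_smul, Matrix.smul_mul, Matrix.mul_smul, Matrix.mul_assoc]
  rw [h4]
  exact h1

/-- Constant connections in the same gauge orbit have conjugate monodromies. -/
theorem exists_conj_of_gauge {x : S.ExtLoopAlg W} (hp : x.2 ≠ 0) {μ₁ μ₂ : S.𝔥}
    (h₁ : S.IsGaugeConjConst μ₁ x) (h₂ : S.IsGaugeConjConst μ₂ x) : ∃ g : S.G,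
    S.expG (((2 * Real.pi / (Complex.I * x.2) : ℂ) • μ₁ : S.𝔥) : S.𝔤) =
      g * S.expG (((2 * Real.pi / (Complex.I * x.2) : ℂ) • μ₂ : S.𝔥) : S.𝔤) * g⁻¹ := by
  obtain ⟨γ₁, hl₁, hx₁⟩ := h₁
  obtain ⟨γ₂, hl₂, hx₂⟩ := h₂
  set p := x.2
  set f₁ := fun s : ℝ => γ₁.eval (Circle.exp s) *
    NormedSpace.exp ((s : ℂ) • (1 / (Complex.I * p)) • ((μ₁ : S.𝔤) : Matrix (Fin n) (Fin n) ℂ)) with hf₁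
  set f₂ := fun s : ℝ => γ₂.eval (Circle.exp s) *
    NormedSpace.exp ((s : ℂ) • (1 / (Complex.I * p)) • ((μ₂ : S.𝔤) : Matrix (Fin n) (Fin n) ℂ)) with hf₂
  have hu : ∀ s, IsUnit (f₁ s) := fun s =>
    (isUnit_of_isLoop hl₁ _).mul ⟨⟨_, _, exp_mul_exp_neg _, exp_neg_mul_exp _⟩, rfl⟩
  have hconst : ∀ t, HasDerivAt (fun s => (f₁ s)⁻¹ * f₂ s) 0 t := fun t =>
    hasDerivAt_inv_mul_of_ode (φ := fun θ => x.1.1.eval (Circle.exp θ)) hu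
      (hasDerivAt_of_gaugeAct hl₁ hp hx₁ t) (hasDerivAt_of_gaugeAct hl₂ hp hx₂ t)
  have hC := eq_of_hasDerivAt_matrix_zero hconst (2 * Real.pi) 0
  obtain ⟨g₁, hg₁⟩ := hl₁ 1
  obtain ⟨g₂, hg₂⟩ := hl₂ 1
  have e0 : ∀ (μ : S.𝔥), S.mat (S.expG (((2 * Real.pi / (Complex.I * p) : ℂ) • μ : S.𝔥) : S.𝔤)) =
      NormedSpace.exp (((2 * Real.pi : ℝ) : ℂ) • (1 / (Complex.I * p)) • ((μ : S.𝔤) : Matrix (Fin n) (Fin n) ℂ)) := by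
    intro μ
    rw [mat_expG, smul_smul]
    have : ((2 * Real.pi : ℝ) : ℂ) * (1 / (Complex.I * p)) = 2 * Real.pi / (Complex.I * p) := by
      push_cast; ring
    rw [this]
    rfl
  have hz₁ : f₁ 0 = S.mat g₁ := by simp [hf₁, hg₁, NormedSpace.exp_zero]
  have hz₂ : f₂ 0 = S.mat g₂ := by simp [hf₂, hg₂, NormedSpace.exp_zero]
  have ht₁ : f₁ (2 * Real.pi) = S.mat (g₁ * S.expG (((2 * Real.pi / (Complex.I * p) : ℂ) • μ₁ : S.𝔥) : S.𝔤)) := by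
    rw [mat_mul, e0, hg₁, hf₁]
    simp only [Circle.exp_two_pi]
  have ht₂ : f₂ (2 * Real.pi) = S.mat (g₂ * S.expG (((2 * Real.pi / (Complex.I * p) : ℂ) • μ₂ : S.𝔥) : S.𝔤)) := by
    rw [mat_mul, e0, hg₂, hf₂]
    simp only [Circle.exp_two_pi]
  rw [hz₁, hz₂, ht₁, ht₂, ← mat_inv, ← mat_inv, ← mat_mul, ← mat_mul] at hC
  have hC' := S.mat_injective hC
  refine ⟨g₁⁻¹ * g₂, ?_⟩
  rw [eq_mul_inv_iff_mul_eq]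
  conv_lhs => rw [← hC']
  group

/-- The monodromy is determined by any solution. -/
theorem monodromy_eq {φ : ℝ → Matrix (Fin n) (Fin n) ℂ} {p : ℂ} {f : ℝ → S.G}
    (hf : S.IsMonodromySolution φ p f) : S.monodromy φ p = f (2 * Real.pi) := by
  have hex : ∃ f, S.IsMonodromySolution φ p f := ⟨f, hf⟩
  unfold monodromy
  rw [dif_pos hex]
  have hg := hex.choose_spec
  set g := hex.choose
  have hconst : ∀ t, HasDerivAt (fun s => (S.mat (f s))⁻¹ * S.mat (g s)) 0 t := fun t =>
    hasDerivAt_inv_mul_of_ode (fun s => S.isUnit_mat _) (hasDerivAt_matrix.2 (hf.2 t))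
      (hasDerivAt_matrix.2 (hg.2 t))
  have hC := eq_of_hasDerivAt_matrix_zero hconst (2 * Real.pi) 0
  rw [hf.1, hg.1, ← mat_inv, ← mat_inv, ← mat_mul, ← mat_mul] at hC
  have hC' := S.mat_injective hC
  rw [inv_one, one_mul] at hC'
  exact (inv_mul_eq_one.1 hC').symm

theorem monodromy_const (μ : S.𝔥) (p : ℂ) :
    S.monodromy (fun _ => ((μ : S.𝔤) : Matrix (Fin n) (Fin n) ℂ)) p =
      S.expG (((2 * Real.pi / (Complex.I * p) : ℂ) • μ : S.𝔥) : S.𝔤) := by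
  have hsol : S.IsMonodromySolution (fun _ => ((μ : S.𝔤) : Matrix (Fin n) (Fin n) ℂ)) p
      fun t => S.expG (((t / (Complex.I * p) : ℂ) • μ : S.𝔥) : S.𝔤) := by
    have e0 : ∀ t : ℝ, S.mat (S.expG (((t / (Complex.I * p) : ℂ) • μ : S.𝔥) : S.𝔤)) =
        NormedSpace.exp ((t : ℂ) • (1 / (Complex.I * p)) • ((μ : S.𝔤) : Matrix (Fin n) (Fin n) ℂ)) := by
      intro t
      rw [mat_expG, smul_smul, mul_one_div]
      rfl
    refine ⟨?_, fun t i j => ?_⟩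
    · apply S.mat_injective
      rw [e0, mat_one]
      simp [NormedSpace.exp_zero]
    · have h1 := hasDerivAt_exp_smul' ((1 / (Complex.I * p)) • ((μ : S.𝔤) : Matrix (Fin n) (Fin n) ℂ)) t
      rw [Matrix.smul_mul] at h1
      simp only [e0]
      exact hasDerivAt_matrix.1 h1 i j
  rw [S.monodromy_eq hsol]
  push_cast
  rfl

/-- Another constant in the gauge class has a conjugate monodromy, and the character of the K-factor
is insensitive to that. So the chosen μ in the definition may be replaced by any other. -/
theorem F_eq {S : ChevalleyData n l} (hS : S.IsAdmissible) {Ψ : Fin l → S.G → ℂ}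
    (hΨ : ∀ j, S.IsFundamentalCharacter j (Ψ j)) (j : Fin l) {x : S.ExtLoopAlg W} (hp : x.2 ≠ 0) {μ : S.𝔥}
    (hμ : S.IsGaugeConjConst μ x) : S.F Ψ j x = chi Ψ j (S.expG (S.compactPart
      (S.coords ((2 * Real.pi / (Complex.I * x.2) : ℂ) • μ)) : S.𝔤)) := by
  have hex : x.2 ≠ 0 ∧ ∃ μ : S.𝔥, S.IsGaugeConjConst μ x := ⟨hp, μ, hμ⟩
  unfold F
  rw [dif_pos hex, monodromy_const]
  obtain ⟨g, hg⟩ := S.exists_conj_of_gauge hp hex.2.choose_spec hμ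
  rw [chi_cartanK_eq_of_conj hS hΨ j hg, cartanK_expG hS]

/-- The infinitesimal gauge action of a loop `η` with derivative `δ`. -/
def gaugeGen (η δ : S.LoopAlg W) : S.ExtLoopAlg W →L[ℂ] S.ExtLoopAlg W :=
  (ContinuousLinearMap.inl ℂ (S.LoopAlg W) ℂ).comp
    ((S.loopBracket η).comp (ContinuousLinearMap.fst ℂ (S.LoopAlg W) ℂ) -
      (ContinuousLinearMap.snd ℂ (S.LoopAlg W) ℂ).smulRight δ)

open Matrix in
-- At each point encode (φ, p) as the block matrix with first row (p, φ) and second row zero. The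
-- infinitesimal action becomes the commutator with the upper triangular block matrix (η, δ; 0, η),
-- so its exponential is a conjugation. The corner of the inverse exponential is the derivative of
-- exp(-η), because δ = Dη.
theorem exp_gaugeGen (η δ : S.LoopAlg W) (h : ∀ k : ℤ, δ.1.coeff k = (k : ℂ) • η.1.coeff k)
    (x : S.ExtLoopAlg W) : (expCLM (S.gaugeGen η δ) x).2 = x.2 ∧ ∃ γ : MatAw W n, S.IsLoop γ ∧
      ∀ θ : ℝ, (expCLM (S.gaugeGen η δ) x).1.1.eval (Circle.exp θ) =
        gaugeAct γ (fun s => x.1.1.eval (Circle.exp s)) x.2 θ := by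
  let Lz : Circle → S.ExtLoopAlg W →ₗ[ℂ] Matrix (Fin n ⊕ Fin n) (Fin n ⊕ Fin n) ℂ := fun z =>
    { toFun := fun y => fromBlocks (y.2 • 1) (y.1.1.eval z) 0 0
      map_add' := fun a b => by
        rw [fromBlocks_add]
        congr 1
        · exact add_smul _ _ _
        · exact MatAw.eval_add _ _ _
        · simp
        · simp
      map_smul' := fun c a => by
        rw [RingHom.id_apply, fromBlocks_smul]
        congr 1
        · exact mul_smul _ _ _
        · exact MatAw.eval_smul _ _ _
        · simp
        · simp }
  have hLc : ∀ z, Continuous (Lz z) := fun z =>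
    Continuous.matrix_fromBlocks (continuous_snd.smul continuous_const)
      ((MatAw.continuous_evalₗ z).comp (continuous_subtype_val.comp continuous_fst)) continuous_const
      continuous_const
  have hLT : ∀ z y, Lz z (S.gaugeGen η δ y) =
      fromBlocks (η.1.eval z) (δ.1.eval z) 0 (η.1.eval z) * Lz z y -
        Lz z y * fromBlocks (η.1.eval z) (δ.1.eval z) 0 (η.1.eval z) := by
    intro z y
    change fromBlocks ((0 : ℂ) • 1) ((S.loopBracket η y.1 - y.2 • δ).1.eval z) 0 0 =
      _ * fromBlocks (y.2 • 1) (y.1.1.eval z) 0 0 - fromBlocks (y.2 • 1) (y.1.1.eval z) 0 0 * _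
    have e1 : (S.loopBracket η y.1 - y.2 • δ).1.eval z =
        η.1.eval z * y.1.1.eval z - y.1.1.eval z * η.1.eval z - y.2 • δ.1.eval z := by
      change (MatAw.mulCLM η.1 y.1.1 - MatAw.mulCLM y.1.1 η.1 - y.2 • δ.1).eval z = _
      rw [MatAw.eval_sub, MatAw.eval_sub, MatAw.eval_mul, MatAw.eval_mul, MatAw.eval_smul]
    rw [e1, fromBlocks_multiply, fromBlocks_multiply, sub_eq_add_neg (fromBlocks _ _ _ _), fromBlocks_neg,
      fromBlocks_add]
    congr 1
    · simp
    · simp only [Matrix.mul_zero, add_zero, Matrix.smul_mul, Matrix.one_mul]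
      abel
    · simp
    · simp
  have key : ∀ z, Lz z (expCLM (S.gaugeGen η δ) x) =
      NormedSpace.exp (fromBlocks (η.1.eval z) (δ.1.eval z) 0 (η.1.eval z)) * Lz z x *
        NormedSpace.exp (-fromBlocks (η.1.eval z) (δ.1.eval z) 0 (η.1.eval z)) := fun z =>
    map_expCLM_eq_conj (S.gaugeGen η δ) (Lz z) (hLc z) _ (hLT z) x
  have key2 : ∀ z, (expCLM (S.gaugeGen η δ) x).1.1.eval z =
        NormedSpace.exp (η.1.eval z) * (x.2 • (NormedSpace.exp (fromBlocks (-η.1.eval z) (-δ.1.eval z) 0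
          (-η.1.eval z))).toBlocks₁₂ + x.1.1.eval z * NormedSpace.exp (-η.1.eval z)) := by
    intro z
    have h1 := key z
    rw [fromBlocks_neg, neg_zero, exp_fromBlocks_diag (η.1.eval z), exp_fromBlocks_diag (-η.1.eval z)] at h1
    change fromBlocks ((expCLM (S.gaugeGen η δ) x).2 • 1)
      ((expCLM (S.gaugeGen η δ) x).1.1.eval z) 0 0 =
      _ * fromBlocks (x.2 • 1) (x.1.1.eval z) 0 0 * _ at h1
    rw [fromBlocks_multiply, fromBlocks_multiply] at h1
    have h3 := congrArg toBlocks₁₂ h1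
    simp only [toBlocks_fromBlocks₁₂] at h3
    rw [h3]
    simp [Matrix.mul_add, Matrix.mul_assoc]
  refine ⟨map_expCLM_eq_self (T := S.gaugeGen η δ) (ContinuousLinearMap.snd ℂ (S.LoopAlg W) ℂ) (fun _ => rfl) x, ?_⟩
  -- Exponentiating multiplication by η and applying it to 1 produces the loop exp(η) inside the
  -- Wiener algebra.
  · let γ : MatAw W n := expCLM (MatAw.mulCLM η.1) (MatAw.const 1)
    have hγ : ∀ z, γ.eval z = NormedSpace.exp (η.1.eval z) := fun z => by
      have := map_expCLM_eq_mul (MatAw.mulCLM η.1) (MatAw.evalₗ z) (MatAw.continuous_evalₗ z) (η.1.eval z)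
        (fun T => MatAw.eval_mul _ _ z) (MatAw.const 1)
      refine this.trans ?_
      change _ * (MatAw.const 1 : MatAw W n).eval z = _
      rw [MatAw.eval_const, Matrix.mul_one]
    have hγinv : ∀ z, (γ.eval z)⁻¹ = NormedSpace.exp (-η.1.eval z) := fun z => by
      rw [hγ]
      exact Matrix.inv_eq_right_inv (exp_mul_exp_neg _)
    refine ⟨γ, fun z => ⟨S.expG (S.evalAlg η z), (hγ z).symm⟩, fun θ => ?_⟩
    have h1 : HasDerivAt (fun s : ℝ => -η.1.eval (Circle.exp s)) (Complex.I • -δ.1.eval (Circle.exp θ)) θ := by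
      have := MatAw.hasDerivAt_eval_of_coeff h θ
      refine hasDerivAt_matrix.2 fun i j => ?_
      have h2 := (hasDerivAt_matrix.1 this i j).neg
      rw [smul_neg]
      exact h2
    have h2 := hasDerivAt_exp_comp h1
    rw [toBlocks_exp_smul] at h2
    have h3 : (Matrix.of fun i j => deriv (fun s : ℝ => (γ.eval (Circle.exp s))⁻¹ i j) θ) =
        Complex.I • (NormedSpace.exp (fromBlocks (-η.1.eval (Circle.exp θ)) (-δ.1.eval (Circle.exp θ)) 0
          (-η.1.eval (Circle.exp θ)))).toBlocks₁₂ := by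
      ext i j
      simp only [hγinv]
      exact (hasDerivAt_matrix.1 h2 i j).deriv
    unfold gaugeAct
    rw [h3, key2, hγinv, hγ, smul_smul]
    have h4 : -Complex.I * Complex.I = 1 := by rw [neg_mul, Complex.I_mul_I, neg_neg]
    rw [h4, one_smul, Matrix.mul_add, Matrix.mul_smul, Matrix.mul_assoc, add_comm]

end ChevalleyData

/-! ### The normal form of connections near a regular constant one -/

section ExtGenerator

attribute [-instance] LieRing.ofAssociativeRing

variable {E : Type*} [NormedAddCommGroup E] [NormedSpace ℂ E]

/-- The operators `(φ, p) ↦ (B (R ψ) φ - p D ψ, 0)`, depending linearly on `(ψ, q)`. -/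
def extGenerator (B : E →L[ℂ] E →L[ℂ] E) (R D : E →L[ℂ] E) : E × ℂ →L[ℂ] E × ℂ →L[ℂ] E × ℂ :=
  (ContinuousLinearMap.compL ℂ (E × ℂ) E (E × ℂ) (ContinuousLinearMap.inl ℂ E ℂ)).comp
    (((((ContinuousLinearMap.compL ℂ (E × ℂ) E E).flip (ContinuousLinearMap.fst ℂ E ℂ)).comp B).comp R -
      (ContinuousLinearMap.smulRightL ℂ (E × ℂ) E (ContinuousLinearMap.snd ℂ E ℂ)).comp D).comp
      (ContinuousLinearMap.fst ℂ E ℂ))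

theorem extGenerator_apply (B : E →L[ℂ] E →L[ℂ] E) (R D : E →L[ℂ] E) (x y : E × ℂ) :
    extGenerator B R D x y = (B (R x.1) y.1 - y.2 • D x.1, 0) := rfl

theorem extGenerator_zero (B : E →L[ℂ] E →L[ℂ] E) (R D : E →L[ℂ] E) (p : ℂ) :
    extGenerator B R D (0, p) = 0 := by
  ext y <;> simp [extGenerator_apply]

end ExtGenerator

theorem expCLM_zero {E : Type*} [NormedAddCommGroup E] [NormedSpace ℂ E] [CompleteSpace E] (x : E) :
    expCLM (0 : E →L[ℂ] E) x = x := by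
  rw [expCLM, NormedSpace.exp_zero]
  rfl

/-- Only ⌊x⌋ and ⌊x⌋ + 1 can be closer to x than 1. If x is an integer, the convention 0⁻¹ = 0 keeps
the bound finite. -/
theorem exists_bound_inv_sub_int (x : ℝ) : ∃ C : ℝ, ∀ k : ℤ, |(x - k)⁻¹| ≤ C := by
  refine ⟨1 + |(x - ⌊x⌋)⁻¹| + |(x - (⌊x⌋ + 1 : ℤ))⁻¹|, fun k => ?_⟩
  rcases lt_trichotomy k ⌊x⌋ with h | rfl | h
  · have h1 : (k : ℝ) + 1 ≤ ⌊x⌋ := by exact_mod_cast h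
    have h2 := Int.floor_le x
    have h3 : (x - k)⁻¹ ≤ 1 := inv_le_one_of_one_le₀ (by linarith)
    rw [abs_of_nonneg (inv_nonneg.2 (by linarith))]
    linarith [abs_nonneg (x - ⌊x⌋)⁻¹, abs_nonneg (x - (⌊x⌋ + 1 : ℤ))⁻¹]
  · linarith [abs_nonneg (x - (⌊x⌋ + 1 : ℤ))⁻¹]
  · rcases (Int.add_one_le_iff.2 h).eq_or_lt with rfl | h'
    · linarith [abs_nonneg (x - ⌊x⌋)⁻¹]
    · have h1 : (⌊x⌋ : ℝ) + 1 + 1 ≤ k := by exact_mod_cast h'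
      have h2 := Int.lt_floor_add_one x
      have h3 : (k - x)⁻¹ ≤ 1 := inv_le_one_of_one_le₀ (by linarith)
      rw [abs_inv, abs_sub_comm, ← abs_inv, abs_of_nonneg (inv_nonneg.2 (by linarith))]
      linarith [abs_nonneg (x - ⌊x⌋)⁻¹, abs_nonneg (x - (⌊x⌋ + 1 : ℤ))⁻¹]

/-- For the second bound write k/(x - k) = x/(x - k) - 1. -/
theorem exists_bound_symbols {n : ℕ} (d : Fin n → ℝ) : ∃ C : ℝ,
    (∀ i j (k : ℤ), ‖(((d j : ℂ) - d i) - k)⁻¹‖ ≤ C) ∧ ∀ i j (k : ℤ), ‖k * (((d j : ℂ) - d i) - k)⁻¹‖ ≤ C := by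
  have h1 : ∀ ij : Fin n × Fin n, ∃ C : ℝ, ∀ k : ℤ, |((d ij.2 - d ij.1) - k)⁻¹| ≤ C := fun ij =>
    exists_bound_inv_sub_int _
  choose C hC using h1
  have e : ∀ i j (k : ℤ), ‖(((d j : ℂ) - d i) - k)⁻¹‖ ≤ C (i, j) := fun i j k => by
    have := hC (i, j) k
    rw [← Real.norm_eq_abs, ← Complex.norm_real] at this
    push_cast at this
    exact this
  have hC0 : ∀ ij, 0 ≤ C ij := fun ij => (abs_nonneg _).trans (hC ij 0)
  have e2 : ∀ i j (k : ℤ), ‖k * (((d j : ℂ) - d i) - k)⁻¹‖ ≤ |d j - d i| * C (i, j) + 1 := fun i j k => by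
    have h2 : (k : ℂ) * (((d j : ℂ) - d i) - k)⁻¹ = ((d j - d i : ℝ) : ℂ) * (((d j : ℂ) - d i) - k)⁻¹ -
        (((d j : ℂ) - d i) - k) * (((d j : ℂ) - d i) - k)⁻¹ := by push_cast; ring
    rw [h2]
    refine (norm_sub_le _ _).trans (add_le_add ?_ ?_)
    · rw [norm_mul, Complex.norm_real, Real.norm_eq_abs]
      exact mul_le_mul_of_nonneg_left (e i j k) (abs_nonneg _)
    · rcases eq_or_ne (((d j : ℂ) - d i) - k) 0 with h | h
      · rw [h, zero_mul, norm_zero]; exact zero_le_one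
      · rw [mul_inv_cancel₀ h, norm_one]
  have hterm : ∀ ij, 0 ≤ C ij + (|d ij.2 - d ij.1| * C ij + 1) := fun ij => by
    have := hC0 ij; positivity
  refine ⟨∑ ij, (C ij + (|d ij.2 - d ij.1| * C ij + 1)), fun i j k => ?_, fun i j k => ?_⟩
  · refine le_trans ?_ (Finset.single_le_sum (fun ij _ => hterm ij) (Finset.mem_univ (i, j)))
    have := hC0 (i, j)
    refine (e i j k).trans (le_add_of_nonneg_right (by positivity))
  · refine le_trans ?_ (Finset.single_le_sum (fun ij _ => hterm ij) (Finset.mem_univ (i, j)))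
    exact (e2 i j k).trans (le_add_of_nonneg_left (hC0 (i, j)))

namespace MatAw

variable {W : LoopWeight} {n : ℕ}

theorem mul_const_diagonal (T : MatAw W n) (d : Fin n → ℂ) (i j : Fin n) :
    mulCLM T (const (Matrix.diagonal d)) (i, j) = d j • T (i, j) :=
  Aw.ext_eval fun z => by
    have h := congrFun (congrFun (eval_mul T (const (Matrix.diagonal d)) z) i) j
    rw [eval_const, Matrix.mul_diagonal] at h
    rw [Aw.eval_smul, mul_comm]
    exact h

theorem const_diagonal_mul (T : MatAw W n) (d : Fin n → ℂ) (i j : Fin n) :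
    mulCLM (const (Matrix.diagonal d)) T (i, j) = d i • T (i, j) :=
  Aw.ext_eval fun z => by
    have h := congrFun (congrFun (eval_mul (const (Matrix.diagonal d)) T z) i) j
    rw [eval_const, Matrix.diagonal_mul] at h
    rw [Aw.eval_smul]
    exact h

theorem eval_eq_of_coeff {T : MatAw W n} (h : ∀ k, k ≠ 0 → T.coeff k = 0) (z : Circle) :
    T.eval z = T.coeff 0 := by
  refine (T.hasSum_eval z).unique ?_
  have := hasSum_single (f := fun k : ℤ => (z : ℂ) ^ k • T.coeff k) 0 fun k hk => by rw [h k hk, smul_zero]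
  simpa using this

end MatAw

namespace ChevalleyData

variable {n l : ℕ} {S : ChevalleyData n l} {W : LoopWeight}

/-- All exp(sA) commute with exp(x₀), hence lie in the Cartan subgroup and commute with 𝔥;
differentiate. -/
theorem IsRegular.mem_cartan_of_commute {x₀ : S.𝔥} (hx : S.IsRegular x₀) {A : S.𝔤}
    (hA : Commute (A : Matrix (Fin n) (Fin n) ℂ) (NormedSpace.exp ((x₀ : S.𝔤) : Matrix (Fin n) (Fin n) ℂ))) :
    A ∈ S.𝔥 := by
  refine S.mem_cartan_of_commute fun h => commute_of_commute_exp fun s => ?_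
  have h1 : Commute (S.expG ((s : ℂ) • A)) (S.expG (x₀ : S.𝔤)) := by
    apply S.mat_injective
    rw [mat_mul, mat_mul, mat_expG, mat_expG]
    refine exp_mul_of_intertwine ?_
    exact (hA.smul_left (s : ℂ)).eq
  obtain ⟨y, hy⟩ := S.mem_cartanSubgroup.1 (hx _ h1)
  have h2 : NormedSpace.exp ((s : ℂ) • (A : Matrix (Fin n) (Fin n) ℂ)) =
      NormedSpace.exp ((y : S.𝔤) : Matrix (Fin n) (Fin n) ℂ) := congrArg S.mat hy
  rw [h2]
  exact exp_mul_of_intertwine (S.cartan_commute y h).eq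

/-- Where d_j - d_i is an integer, the eigenvalues exp(-2πi d) agree, so A commutes with
exp((2π/i)μ) and lies in 𝔥. Then [A, μ] = kA must vanish. -/
theorem IsRegular.resonant {μ : S.𝔥} (hx : S.IsRegular ((2 * Real.pi / Complex.I : ℂ) • μ)) {d : Fin n → ℝ}
    (hd : ((μ : S.𝔤) : Matrix (Fin n) (Fin n) ℂ) = Matrix.diagonal fun i => (d i : ℂ)) {A : S.𝔤} {k : ℤ}
    (hA : ∀ i j, (d j : ℂ) - d i ≠ k → (A : Matrix (Fin n) (Fin n) ℂ) i j = 0) :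
    A ∈ S.𝔥 ∧ (k ≠ 0 → A = 0) := by
  have h1 : A ∈ S.𝔥 := by
    refine hx.mem_cartan_of_commute ?_
    have e1 : (((((2 * Real.pi / Complex.I : ℂ) • μ : S.𝔥) : S.𝔤)) : Matrix (Fin n) (Fin n) ℂ) =
        Matrix.diagonal fun i => (2 * Real.pi / Complex.I : ℂ) * d i := by
      change (2 * Real.pi / Complex.I : ℂ) • ((μ : S.𝔤) : Matrix (Fin n) (Fin n) ℂ) = _
      rw [hd, ← Matrix.diagonal_smul]
      rfl
    rw [e1, Matrix.exp_diagonal]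
    change _ * _ = _ * _
    ext i j
    rw [Matrix.mul_diagonal, Matrix.diagonal_mul, mul_comm, Pi.coe_exp, Pi.coe_exp]
    by_cases h : (d j : ℂ) - d i = k
    · congr 1
      rw [← Complex.exp_eq_exp_ℂ, Complex.exp_eq_exp_iff_exists_int]
      refine ⟨-k, ?_⟩
      have : (d j : ℂ) = d i + k := by rw [← h]; ring
      rw [this, Complex.div_I]
      push_cast
      ring
    · rw [hA i j h, mul_zero, mul_zero]
  refine ⟨h1, fun hk => Subtype.ext ?_⟩
  have h2 := S.cartan_commute ⟨A, h1⟩ μ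
  rw [hd] at h2
  ext i j
  by_cases h : (d j : ℂ) - d i = k
  · have h3 := congrFun (congrFun h2.eq i) j
    rw [Matrix.mul_diagonal, Matrix.diagonal_mul, mul_comm] at h3
    have h4 : (k : ℂ) * (A : Matrix (Fin n) (Fin n) ℂ) i j = 0 := by
      rw [← h, sub_mul, sub_eq_zero]
      exact h3
    exact (mul_eq_zero.1 h4).resolve_left (by exact_mod_cast hk)
  · exact hA i j h

/-- Apply the inverse function theorem to (ψ, p) ↦ exp(gauge generator of Rψ) applied to (μ + Pψ,
p). P projects to the resonant modes and R inverts ψ ↦ [ψ, μ] - Dψ on the others. By regularity the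
resonant modes are constants in 𝔥. -/
theorem exists_normal_form {μ : S.𝔥} (hx : S.IsRegular ((2 * Real.pi / Complex.I : ℂ) • μ)) {d : Fin n → ℝ}
    (hd : ((μ : S.𝔤) : Matrix (Fin n) (Fin n) ℂ) = Matrix.diagonal fun i => (d i : ℂ)) :
    ∃ (q : S.LoopAlg W →ₗ[ℂ] S.𝔥) (Ξ : S.ExtLoopAlg W → S.ExtLoopAlg W),
      (Continuous fun ψ => ((q ψ : S.𝔤) : Matrix (Fin n) (Fin n) ℂ)) ∧
      HasFDerivAt Ξ (ContinuousLinearMap.id ℂ (S.ExtLoopAlg W)) (S.constLoop μ, 1) ∧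
      Ξ (S.constLoop μ, 1) = (0, 1) ∧
      (∀ (h : S.𝔥) (ψ : S.LoopAlg W), killingForm ℂ S.𝔤 h ⟨ψ.1.coeff 0, S.mem_loopAlg_iff_coeff.1 ψ.2 0⟩ =
        killingForm ℂ S.𝔤 h (q ψ)) ∧
      ∀ᶠ x in 𝓝 (S.constLoop μ, 1), (Ξ x).2 = x.2 ∧ S.IsGaugeConjConst (μ + q (Ξ x).1) x := by
  obtain ⟨C, hC1, hC2⟩ := exists_bound_symbols d
  have hC3 : ∀ i j (k : ℤ), ‖(if (d j : ℂ) - d i = k then 1 else 0 : ℂ)‖ ≤ 1 := fun i j k => by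
    split_ifs <;> simp
  -- On resonant modes the symbol is 0⁻¹ = 0, so R annihilates them. The composite DR is a separate
  -- bounded multiplier, since D itself is unbounded.
  let R : S.LoopAlg W →L[ℂ] S.LoopAlg W := S.loopMultiplier hd (fun x k => (x - k)⁻¹) C hC1
  let DR : S.LoopAlg W →L[ℂ] S.LoopAlg W := S.loopMultiplier hd (fun x k => k * (x - k)⁻¹) C hC2
  let P : S.LoopAlg W →L[ℂ] S.LoopAlg W := S.loopMultiplier hd (fun x k => if x = k then 1 else 0) 1 hC3
  have hP : ∀ ψ k, (⟨(P ψ).1.coeff k, S.mem_loopAlg_iff_coeff.1 (P ψ).2 k⟩ : S.𝔤) ∈ S.𝔥 ∧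
      (k ≠ 0 → (P ψ).1.coeff k = 0) := by
    intro ψ k
    have h1 := hx.resonant hd (A := ⟨(P ψ).1.coeff k, S.mem_loopAlg_iff_coeff.1 (P ψ).2 k⟩) (k := k)
      fun i j hij => by
        change (if (d j : ℂ) - d i = k then (1 : ℂ) else 0) * _ = 0
        rw [if_neg hij, zero_mul]
    exact ⟨h1.1, fun hk => congrArg Subtype.val (h1.2 hk)⟩
  let q : S.LoopAlg W →ₗ[ℂ] S.𝔥 :=
    { toFun := fun ψ => ⟨_, (hP ψ 0).1⟩
      map_add' := fun a b => by
        refine Subtype.ext (Subtype.ext ?_)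
        change (P (a + b)).1.coeff 0 = _
        rw [map_add]
        rfl
      map_smul' := fun c a => by
        refine Subtype.ext (Subtype.ext ?_)
        change (P (c • a)).1.coeff 0 = _
        rw [map_smul]
        rfl }
  have hPq : ∀ ψ z, (P ψ).1.eval z = ((q ψ : S.𝔤) : Matrix (Fin n) (Fin n) ℂ) := fun ψ z =>
    MatAw.eval_eq_of_coeff (fun k hk => (hP ψ k).2 hk) z
  let E := S.ExtLoopAlg W
  let T : E →L[ℂ] E →L[ℂ] E := extGenerator S.loopBracket R DR
  have hT : ∀ x, T x = S.gaugeGen (R x.1) (DR x.1) := fun x => rfl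
  let v : E → E := fun x => (S.constLoop μ + P x.1, x.2)
  have hv : HasStrictFDerivAt v
      ((P.comp (ContinuousLinearMap.fst ℂ (S.LoopAlg W) ℂ)).prod (ContinuousLinearMap.snd ℂ (S.LoopAlg W) ℂ))
      (0, 1) :=
    ((P.comp (ContinuousLinearMap.fst ℂ (S.LoopAlg W) ℂ)).hasStrictFDerivAt.const_add _).prodMk
      (ContinuousLinearMap.snd ℂ (S.LoopAlg W) ℂ).hasStrictFDerivAt
  have hT0 : T (0, 1) = 0 := extGenerator_zero _ _ _ _
  have hv0 : v (0, 1) = (S.constLoop μ, 1) := by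
    change (S.constLoop μ + P 0, (1 : ℂ)) = _
    rw [map_zero, add_zero]
  have hΦ := hasStrictFDerivAt_expCLM_apply T hT0 hv
  -- The derivative at the base point is P + [R·, μ] - DR, whose symbol is 1 on resonant modes and
  -- (d_j - d_i - k)/(d_j - d_i - k) elsewhere.
  have hid : ((P.comp (ContinuousLinearMap.fst ℂ (S.LoopAlg W) ℂ)).prod
      (ContinuousLinearMap.snd ℂ (S.LoopAlg W) ℂ)) + T.flip (v (0, 1)) =
      ((ContinuousLinearEquiv.refl ℂ E : E ≃L[ℂ] E) : E →L[ℂ] E) := by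
    rw [hv0]
    refine ContinuousLinearMap.ext fun x => Prod.ext ?_ ?_
    · change P x.1 + (S.loopBracket (R x.1) (S.constLoop μ) - (1 : ℂ) • DR x.1) = x.1
      rw [one_smul]
      refine Subtype.ext (MatAw.ext_entry fun ij => Aw.ext_coeff fun k => ?_)
      change ((P x.1).1 ij + ((MatAw.mulCLM (R x.1).1 (MatAw.const ((μ : S.𝔤) : Matrix (Fin n) (Fin n) ℂ))) ij -
        (MatAw.mulCLM (MatAw.const ((μ : S.𝔤) : Matrix (Fin n) (Fin n) ℂ)) (R x.1).1) ij -
        (DR x.1).1 ij)).coeff k = _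
      rw [hd, MatAw.mul_const_diagonal, MatAw.const_diagonal_mul, sub_eq_add_neg, sub_eq_add_neg]
      simp only [Aw.coeff_add, Aw.coeff_neg, Aw.coeff_smul]
      change (if (d ij.2 : ℂ) - d ij.1 = k then (1 : ℂ) else 0) * (x.1.1 ij).coeff k +
        ((d ij.2 : ℂ) * ((((d ij.2 : ℂ) - d ij.1) - k)⁻¹ * (x.1.1 ij).coeff k) +
        -((d ij.1 : ℂ) * ((((d ij.2 : ℂ) - d ij.1) - k)⁻¹ * (x.1.1 ij).coeff k)) +
        -((k * (((d ij.2 : ℂ) - d ij.1) - k)⁻¹) * (x.1.1 ij).coeff k)) = (x.1.1 ij).coeff k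
      split_ifs with h
      · rw [h]; simp
      · have h' := sub_ne_zero.2 h
        field_simp
        ring
    · change x.2 + 0 = x.2
      exact add_zero _
  rw [hid] at hΦ
  have hΦ0 : expCLM (T (0, 1)) (v (0, 1)) = (S.constLoop μ, 1) := by
    rw [hT0, hv0]
    exact expCLM_zero _
  have hinv := hΦ.to_localInverse
  have hright := hΦ.eventually_right_inverse
  have himg := hΦ.localInverse_apply_image
  simp only [hΦ0] at hinv hright himg
  refine ⟨q, hΦ.localInverse _ _ _, ?_, hinv.hasFDerivAt, himg, ?_, ?_⟩
  · exact (MatAw.continuous_coeffₗ 0).comp (continuous_subtype_val.comp P.continuous)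
  · intro h ψ
    -- The zeroth coefficient differs from its 𝔥-part by the bracket [B, μ], which is
    -- Killing-orthogonal to 𝔥 by invariance.
    let B : S.𝔤 := ⟨(R ψ).1.coeff 0, S.mem_loopAlg_iff_coeff.1 (R ψ).2 0⟩
    have h1 : (⟨ψ.1.coeff 0, S.mem_loopAlg_iff_coeff.1 ψ.2 0⟩ : S.𝔤) = q ψ + ⁅B, (μ : S.𝔤)⁆ := by
      apply Subtype.ext
      change ψ.1.coeff 0 = ((q ψ : S.𝔤) : Matrix (Fin n) (Fin n) ℂ) + ((⁅B, (μ : S.𝔤)⁆ : S.𝔤) : Matrix (Fin n) (Fin n) ℂ)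
      rw [coe_lie, hd]
      ext i j
      rw [Matrix.add_apply, Matrix.sub_apply, Matrix.mul_diagonal, Matrix.diagonal_mul]
      change ψ.1.coeff 0 i j = (if (d j : ℂ) - d i = (0 : ℤ) then (1 : ℂ) else 0) * ψ.1.coeff 0 i j +
        ((((d j : ℂ) - d i) - (0 : ℤ))⁻¹ * ψ.1.coeff 0 i j * d j -
          d i * ((((d j : ℂ) - d i) - (0 : ℤ))⁻¹ * ψ.1.coeff 0 i j))
      rw [Int.cast_zero, sub_zero]
      split_ifs with h
      · rw [h]; simp
      · field_simp
        ring
    have h2 : killingForm ℂ S.𝔤 h ⁅B, (μ : S.𝔤)⁆ = 0 := by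
      have h3 : ⁅(h : S.𝔤), (μ : S.𝔤)⁆ = 0 := by
        apply Subtype.ext
        rw [coe_lie, (S.cartan_commute h μ).eq, sub_self]
        rfl
      rw [← lie_skew, map_neg, killingForm, ← LieModule.traceForm_apply_lie_apply, h3, map_zero]
      simp
    rw [h1, map_add, h2, add_zero]
  · filter_upwards [hright] with x hxr
    set y := hΦ.localInverse _ _ _ x with hy
    have h1 := S.exp_gaugeGen (R y.1) (DR y.1) (fun k => by
      ext i j
      change ((k : ℂ) * (((d j : ℂ) - d i) - k)⁻¹) * y.1.1.coeff k i j =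
        k * ((((d j : ℂ) - d i) - k)⁻¹ * y.1.1.coeff k i j)
      ring) (v y)
    rw [← hT, hxr] at h1
    refine ⟨h1.1.symm, ?_⟩
    obtain ⟨γ, hγ, hγ2⟩ := h1.2
    refine ⟨γ, hγ, fun θ => ?_⟩
    rw [hγ2 θ, h1.1]
    have h3 : (fun s : ℝ => (v y).1.1.eval (Circle.exp s)) =
        fun _ => (((μ + q y.1 : S.𝔥) : S.𝔤) : Matrix (Fin n) (Fin n) ℂ) := by
      funext s
      change ((S.constLoop μ).1 + (P y.1).1).eval (Circle.exp s) = _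
      rw [MatAw.eval_add, hPq]
      change (MatAw.const _ : MatAw W n).eval _ + _ = _
      rw [MatAw.eval_const]
      rfl
    rw [h3]

end ChevalleyData

open Matrix

/-! ### The pairing on the loop algebra -/

namespace MatAw

variable {W : LoopWeight} {n : ℕ}

/-- The pointwise conjugate transpose of a matrix loop. -/
def dag (T : MatAw W n) : MatAw W n := WithLp.toLp 2 fun ij =>
  Aw.mk (fun k => star ((T (ij.2, ij.1)).coeff (-k))) (by
    refine ((Equiv.neg ℤ).summable_iff.2 (T (ij.2, ij.1)).summable).congr fun k => ?_
    rw [Function.comp_apply, Equiv.neg_apply, W.symm, norm_star])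

theorem eval_dag (T : MatAw W n) (z : Circle) : (dag T).eval z = (T.eval z)ᴴ := by
  ext i j
  have h1 : HasSum (fun k : ℤ => star ((T (j, i)).coeff k * (z : ℂ) ^ k)) (star ((T (j, i)).eval z)) :=
    ((T (j, i)).hasSum_eval z).star
  rw [← (Equiv.neg ℤ).hasSum_iff] at h1
  have h2 : ((fun k : ℤ => star ((T (j, i)).coeff k * (z : ℂ) ^ k)) ∘ Equiv.neg ℤ) =
      fun k : ℤ => (Aw.coeff (dag T (i, j)) k) * (z : ℂ) ^ k := by
    funext k
    change star ((T (j, i)).coeff (-k) * (z : ℂ) ^ (-k)) = star ((T (j, i)).coeff (-k)) * (z : ℂ) ^ k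
    have hz : (starRingEnd ℂ) (z : ℂ) = (z : ℂ)⁻¹ := by rw [← Circle.coe_inv, Circle.coe_inv_eq_conj]
    rw [star_mul', star_zpow₀, Complex.star_def, hz, _root_.inv_zpow', neg_neg]
  rw [h2] at h1
  exact ((dag T (i, j)).hasSum_eval z).unique h1

end MatAw

namespace ChevalleyData

variable {n l : ℕ} {S : ChevalleyData n l} {W : LoopWeight}

theorem exists_aw (f : S.𝔤 →ₗ[ℂ] ℂ) (χ : S.LoopAlg W) : ∃ a : Aw W, (∀ z, a.eval z = f (S.evalAlg χ z)) ∧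
    ∀ k, a.coeff k = f ⟨χ.1.coeff k, S.mem_loopAlg_iff_coeff.1 χ.2 k⟩ := by
  obtain ⟨F, hF⟩ := LinearMap.exists_extend (p := S.𝔤.toSubmodule) f
  have hF' : ∀ X : S.𝔤, F (X : Matrix (Fin n) (Fin n) ℂ) = f X := fun X => LinearMap.congr_fun hF X
  have hsum : ∀ A : Matrix (Fin n) (Fin n) ℂ, F A =
      ∑ ij : Fin n × Fin n, F (Matrix.single ij.1 ij.2 1) * A ij.1 ij.2 := by
    intro A
    conv_lhs => rw [Matrix.matrix_eq_sum_single A]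
    rw [Fintype.sum_prod_type, map_sum]
    refine Finset.sum_congr rfl fun i _ => ?_
    rw [map_sum]
    refine Finset.sum_congr rfl fun j _ => ?_
    have : Matrix.single i j (A i j) = A i j • Matrix.single i j 1 := by
      rw [Matrix.smul_single, smul_eq_mul, mul_one]
    rw [this, map_smul, smul_eq_mul, mul_comm]
  refine ⟨∑ ij : Fin n × Fin n, F (Matrix.single ij.1 ij.2 1) • χ.1 ij, fun z => ?_, fun k => ?_⟩
  · rw [← Aw.evalCLM_apply, map_sum, ← hF', hsum]
    simp only [map_smul, smul_eq_mul]
    rfl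
  · rw [← Aw.coeffCLM_apply, map_sum, ← hF', hsum]
    simp only [map_smul, smul_eq_mul]
    rfl

theorem continuous_killingForm (φ ψ : S.LoopAlg W) : Continuous fun θ : ℝ =>
    killingForm ℂ S.𝔤 (S.evalAlg φ (Circle.exp θ)) (S.evalAlg ψ (Circle.exp θ)) := by
  let b := Module.finBasis ℂ S.𝔤
  have h : (fun θ : ℝ => killingForm ℂ S.𝔤 (S.evalAlg φ (Circle.exp θ)) (S.evalAlg ψ (Circle.exp θ))) =
      fun θ : ℝ => ∑ i, b.coord i (S.evalAlg φ (Circle.exp θ)) *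
        killingForm ℂ S.𝔤 (b i) (S.evalAlg ψ (Circle.exp θ)) := by
    funext θ
    conv_lhs => rw [← b.sum_repr (S.evalAlg φ (Circle.exp θ))]
    rw [map_sum, LinearMap.sum_apply]
    refine Finset.sum_congr rfl fun i _ => ?_
    rw [map_smul]
    rfl
  rw [h]
  refine continuous_finsetSum _ fun i _ => Continuous.mul ?_ ?_
  · obtain ⟨a, ha, -⟩ := exists_aw (b.coord i) φ
    simp only [← ha]
    exact continuous_eval a
  · obtain ⟨a, ha, -⟩ := exists_aw (killingForm ℂ S.𝔤 (b i)) ψ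
    simp only [← ha]
    exact continuous_eval a

theorem evalAlg_add (φ ψ : S.LoopAlg W) (z : Circle) : S.evalAlg (φ + ψ) z = S.evalAlg φ z + S.evalAlg ψ z :=
  Subtype.ext (MatAw.eval_add _ _ z)

theorem evalAlg_smul (c : ℂ) (φ : S.LoopAlg W) (z : Circle) : S.evalAlg (c • φ) z = c • S.evalAlg φ z :=
  Subtype.ext (MatAw.eval_smul _ _ z)

theorem loopForm_add_left (φ φ' ψ : S.LoopAlg W) :
    S.loopForm (φ + φ') ψ = S.loopForm φ ψ + S.loopForm φ' ψ := by
  unfold loopForm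
  rw [← mul_add, ← intervalIntegral.integral_add ((continuous_killingForm φ ψ).intervalIntegrable _ _)
    ((continuous_killingForm φ' ψ).intervalIntegrable _ _)]
  simp only [evalAlg_add, map_add, LinearMap.add_apply]

theorem loopForm_smul_left (c : ℂ) (φ ψ : S.LoopAlg W) : S.loopForm (c • φ) ψ = c * S.loopForm φ ψ := by
  unfold loopForm
  simp only [evalAlg_smul, map_smul, LinearMap.smul_apply, smul_eq_mul, intervalIntegral.integral_const_mul]
  ring

theorem loopForm_comm (φ ψ : S.LoopAlg W) : S.loopForm φ ψ = S.loopForm ψ φ := by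
  unfold loopForm
  simp only [LieModule.traceForm_comm ℂ S.𝔤 S.𝔤 (S.evalAlg φ _)]

theorem loopForm_congr {φ ψ φ' ψ' : S.LoopAlg W} (h : ∀ z, killingForm ℂ S.𝔤 (S.evalAlg φ z) (S.evalAlg ψ z) =
    killingForm ℂ S.𝔤 (S.evalAlg φ' z) (S.evalAlg ψ' z)) : S.loopForm φ ψ = S.loopForm φ' ψ' := by
  unfold loopForm
  simp only [h]

theorem evalAlg_constLoop (X : S.𝔤) (z : Circle) : S.evalAlg (S.constLoop X : S.LoopAlg W) z = X :=
  Subtype.ext (MatAw.eval_const _ _)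

theorem loopForm_constLoop (φ : S.LoopAlg W) (X : S.𝔤) : S.loopForm φ (S.constLoop X) =
    killingForm ℂ S.𝔤 X ⟨φ.1.coeff 0, S.mem_loopAlg_iff_coeff.1 φ.2 0⟩ := by
  obtain ⟨a, ha, hk⟩ := exists_aw (killingForm ℂ S.𝔤 X) φ
  rw [← hk, ← fourierC_eval]
  unfold loopForm fourierC
  simp only [evalAlg_constLoop, neg_zero, zpow_zero, one_mul, ha]
  simp only [LieModule.traceForm_comm ℂ S.𝔤 S.𝔤 X]

/-- The pointwise conjugate transpose on the loop algebra. -/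
def loopDag (hS : S.IsAdmissible) (φ : S.LoopAlg W) : S.LoopAlg W :=
  ⟨MatAw.dag φ.1, fun z => by rw [MatAw.eval_dag]; exact conjTranspose_mem hS (S.evalAlg φ z)⟩

theorem evalAlg_loopDag (hS : S.IsAdmissible) (φ : S.LoopAlg W) (z : Circle) :
    S.evalAlg (loopDag hS φ) z = dag hS (S.evalAlg φ z) := Subtype.ext (MatAw.eval_dag _ z)

theorem loopForm_loopDag (hS : S.IsAdmissible) (φ ψ : S.LoopAlg W) :
    S.loopForm (loopDag hS φ) (loopDag hS ψ) = star (S.loopForm φ ψ) := by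
  unfold loopForm
  have h1 : ∀ g : ℝ → ℂ, ∫ θ in (0 : ℝ)..(2 * Real.pi), star (g θ) = star (∫ θ in (0 : ℝ)..(2 * Real.pi), g θ) :=
    fun g => by
      rw [intervalIntegral.integral_of_le Real.two_pi_pos.le, intervalIntegral.integral_of_le Real.two_pi_pos.le]
      exact integral_conj
  simp only [evalAlg_loopDag, killingForm_dag, h1]
  rw [star_mul', star_inv₀, star_mul', Complex.star_def, Complex.conj_ofReal, Complex.conj_ofNat]

/-- The integrand κ(φ, φᴴ) is continuous, nonnegative, and zero only where φ vanishes. -/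
theorem eq_zero_of_loopForm_dag (hS : S.IsAdmissible) {φ : S.LoopAlg W}
    (h : (S.loopForm φ (loopDag hS φ)).re ≤ 0) : φ = 0 := by
  set g : ℝ → ℝ := fun θ => (killingForm ℂ S.𝔤 (S.evalAlg φ (Circle.exp θ))
    (S.evalAlg (loopDag hS φ) (Circle.exp θ))).re with hg
  have hgc : Continuous g := Complex.continuous_re.comp (continuous_killingForm φ (loopDag hS φ))
  have hg0 : ∀ θ, 0 ≤ g θ := fun θ => by
    simp only [hg, evalAlg_loopDag]
    exact (killingForm_self_dag hS _).1
  have h1 : (S.loopForm φ (loopDag hS φ)).re = (2 * Real.pi)⁻¹ * ∫ θ in (0 : ℝ)..(2 * Real.pi), g θ := by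
    unfold loopForm
    have h2 : (2 * Real.pi : ℂ)⁻¹ = ((2 * Real.pi)⁻¹ : ℝ) := by push_cast; ring
    rw [h2, Complex.re_ofReal_mul, ← Complex.reCLM_apply,
      ← Complex.reCLM.intervalIntegral_comp_comm ((continuous_killingForm φ (loopDag hS φ)).intervalIntegrable _ _)]
    rfl
  have h2 : ∫ θ in (0 : ℝ)..(2 * Real.pi), g θ ≤ 0 := by
    rw [h1] at h
    by_contra hc
    have := mul_pos (inv_pos.2 Real.two_pi_pos) (not_le.1 hc)
    linarith
  have h3 : ∀ θ ∈ Set.Ico 0 (2 * Real.pi), g θ = 0 := by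
    intro θ hθ
    by_contra hne
    have hpos : 0 < g θ := lt_of_le_of_ne (hg0 θ) (Ne.symm hne)
    have := intervalIntegral.integral_pos Real.two_pi_pos hgc.continuousOn (fun x _ => hg0 x)
      ⟨θ, ⟨hθ.1, hθ.2.le⟩, hpos⟩
    linarith
  refine Subtype.ext (MatAw.ext_eval fun z => ?_)
  have hz : ∃ θ ∈ Set.Ico 0 (2 * Real.pi), Circle.exp θ = z := by
    have hper : Function.Periodic (fun θ : ℝ => Circle.exp θ) (2 * Real.pi) := Circle.periodic_exp
    obtain ⟨y, hy, hzy⟩ := hper.exists_mem_Ico₀ Real.two_pi_pos (Complex.arg z)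
    exact ⟨y, hy, hzy.symm.trans (Circle.exp_arg z)⟩
  obtain ⟨θ, hθ, rfl⟩ := hz
  have h4 := h3 θ hθ
  simp only [hg, evalAlg_loopDag] at h4
  have h5 := (killingForm_self_dag hS _).2 h4
  have h6 : φ.1.eval (Circle.exp θ) = 0 := congrArg Subtype.val h5
  rw [h6]
  exact (MatAw.eval_zero _).symm

/-- Test against the conjugate transpose of the loop component and the conjugate of the central
component. -/
theorem pairing_eq_zero (hS : S.IsAdmissible) {v : S.ExtLoopAlg W} (h : ∀ y, S.pairing y v = 0) : v = 0 := by
  have h1 := h (loopDag hS v.1, 0)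
  have h2 := h (0, star v.2)
  have h0 : S.loopForm 0 v.1 = 0 := by
    have := loopForm_smul_left (S := S) (0 : ℂ) (0 : S.LoopAlg W) v.1
    rwa [zero_smul, zero_mul] at this
  unfold pairing at h1 h2
  simp only [zero_mul, add_zero, h0, zero_add] at h1 h2
  rw [loopForm_comm] at h1
  refine Prod.ext (eq_zero_of_loopForm_dag hS h1.le) ?_
  rw [Complex.star_def, ← Complex.normSq_eq_conj_mul_self, Complex.ofReal_re] at h2
  exact Complex.normSq_eq_zero.1 h2

/-- The skew-Hermitian loop ψ = φ - φᴴ belongs to `kHat`, so it is orthogonal to φ and, by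
conjugation, to φᴴ. Hence the real part of ⟨ψ, ψᴴ⟩ is zero, and ψ = 0 by definiteness. -/
theorem conjTranspose_of_mem_perp (hS : S.IsAdmissible) {φ : S.LoopAlg W} {p : ℂ}
    (h : (φ, p) ∈ S.perp (S.kHat W)) (z : Circle) : (φ.1.eval z)ᴴ = φ.1.eval z := by
  let ψ : S.LoopAlg W := φ + (-1 : ℂ) • loopDag hS φ
  have hψ : loopDag hS ψ = (-1 : ℂ) • ψ := by
    refine Subtype.ext (MatAw.ext_eval fun z => ?_)
    change (MatAw.dag (φ.1 + (-1 : ℂ) • MatAw.dag φ.1)).eval z = ((-1 : ℂ) • (φ.1 + (-1 : ℂ) • MatAw.dag φ.1)).eval z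
    simp only [MatAw.eval_dag, MatAw.eval_add, MatAw.eval_smul]
    rw [conjTranspose_add, conjTranspose_smul, conjTranspose_conjTranspose]
    simp [add_comm]
  have hk : (ψ, (0 : ℂ)) ∈ S.kHat W := by
    refine ⟨fun z => ⟨?_, S.trace_eq_zero (S.evalAlg ψ z)⟩, rfl⟩
    have := congrArg (fun χ : S.LoopAlg W => χ.1.eval z) hψ
    change (MatAw.dag ψ.1).eval z = ((-1 : ℂ) • ψ.1).eval z at this
    rw [MatAw.eval_dag, MatAw.eval_smul, neg_one_smul] at this
    exact this
  have h1 := h _ hk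
  unfold pairing at h1
  rw [zero_mul, add_zero] at h1
  change (S.loopForm ψ φ).re = 0 at h1
  have h2 : (S.loopForm ψ (loopDag hS φ)).re = 0 := by
    have h3 := loopForm_loopDag hS ψ φ
    rw [hψ, loopForm_smul_left] at h3
    have h4 := congrArg Complex.re h3
    rw [Complex.star_def, Complex.conj_re, h1] at h4
    simpa using h4
  have h3 : (S.loopForm ψ (loopDag hS ψ)).re ≤ 0 := by
    rw [hψ, loopForm_comm, loopForm_smul_left, loopForm_comm]
    have h5 : S.loopForm ψ ψ = S.loopForm ψ φ + (-1 : ℂ) * S.loopForm ψ (loopDag hS φ) := by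
      conv_lhs => rw [loopForm_comm]
      change S.loopForm (φ + (-1 : ℂ) • loopDag hS φ) ψ = _
      rw [loopForm_add_left, loopForm_smul_left, loopForm_comm φ, loopForm_comm (loopDag hS φ)]
    rw [h5]
    simp [h1, h2]
  have h4 := eq_zero_of_loopForm_dag hS h3
  have h5 : φ = loopDag hS φ := by
    have : φ + (-1 : ℂ) • loopDag hS φ = 0 := h4
    rwa [neg_one_smul, ← sub_eq_add_neg, sub_eq_zero] at this
  have h6 := congrArg (fun χ : S.LoopAlg W => χ.1.eval z) h5
  exact ((MatAw.eval_dag φ.1 z).symm.trans h6.symm)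

end ChevalleyData

open Matrix
open scoped ComplexOrder

/-! ### Floquet theory at a loop-regular Hermitian connection -/

/-- The eigenvalue exponents of a unitary matrix are imaginary. -/
theorem re_eq_zero_of_unitary {n : ℕ} {M P : Matrix (Fin n) (Fin n) ℂ} {x : Fin n → ℂ} (hM : Mᴴ * M = 1)
    (hP : IsUnit P) (h : M * P = P * diagonal fun i => Complex.exp (x i)) (i : Fin n) : (x i).re = 0 := by
  have h1 : (P * diagonal fun i => Complex.exp (x i))ᴴ * (P * diagonal fun i => Complex.exp (x i)) = Pᴴ * P := by
    rw [← h, conjTranspose_mul, Matrix.mul_assoc, ← Matrix.mul_assoc Mᴴ, hM, Matrix.one_mul]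
  have h2 := congrFun (congrFun h1 i) i
  rw [conjTranspose_mul, diagonal_conjTranspose, Matrix.mul_assoc, diagonal_mul, ← Matrix.mul_assoc, mul_diagonal]
    at h2
  have h3 : (Pᴴ * P) i i ≠ 0 := by
    intro h0
    have h4 : star (P.col i) ⬝ᵥ P.col i = 0 := by rw [← h0, Matrix.mul_apply]; rfl
    rw [dotProduct_star_self_eq_zero] at h4
    obtain ⟨u, rfl⟩ := hP
    have h5 := congrFun (congrFun (Units.inv_mul u) i) i
    rw [Matrix.mul_apply, Matrix.one_apply_eq] at h5
    refine zero_ne_one (α := ℂ) (Eq.trans (Finset.sum_eq_zero fun k _ => ?_).symm h5)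
    have h6 : (u : Matrix (Fin n) (Fin n) ℂ) k i = 0 := congrFun h4 k
    rw [h6, mul_zero]
  rw [mul_left_comm, mul_eq_left₀ h3, Pi.star_apply, Complex.star_def, ← Complex.normSq_eq_conj_mul_self,
    Complex.normSq_eq_norm_sq, Complex.norm_exp] at h2
  have h4 : Real.exp (x i).re ^ 2 = 1 := by exact_mod_cast h2
  exact (Real.exp_eq_one_iff _).1 ((pow_eq_one_iff_of_nonneg (Real.exp_pos _).le two_ne_zero).1 h4)

namespace ChevalleyData

variable {n l : ℕ} {S : ChevalleyData n l} {W : LoopWeight}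

/-- Since exp(0) is central, regularity would force 𝔤 = 𝔥, contradicting simplicity. -/
theorem not_isRegular_zero : ¬ S.IsRegular 0 := by
  intro h
  refine LieAlgebra.IsSimple.non_abelian (R := ℂ) (L := S.𝔤) ⟨fun X Y => ?_⟩
  have hm : ∀ A : S.𝔤, A ∈ S.𝔥 := fun A => h.mem_cartan_of_commute (by
    change Commute _ (NormedSpace.exp (0 : Matrix (Fin n) (Fin n) ℂ))
    rw [NormedSpace.exp_zero]
    exact Commute.one_right _)
  apply Subtype.ext
  rw [coe_lie, (S.cartan_commute ⟨X, hm X⟩ ⟨Y, hm Y⟩).eq, sub_self]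
  rfl

theorem LoopRegular.exists_solution {x : S.ExtLoopAlg W} (h : S.LoopRegular x) :
    ∃ (f : ℝ → S.G) (g : S.G) (x₀ : S.𝔥), S.IsMonodromySolution (fun θ => x.1.1.eval (Circle.exp θ)) x.2 f ∧
      f (2 * Real.pi) = g * S.expG (x₀ : S.𝔤) * g⁻¹ ∧ S.IsRegular x₀ := by
  obtain ⟨-, g, hg⟩ := h
  have hcent : ∀ h : S.G, g * h * g⁻¹ ∈ Subgroup.centralizer
      {S.monodromy (fun θ => x.1.1.eval (Circle.exp θ)) x.2} → h ∈ S.cartanSubgroup := by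
    intro h hh
    rw [hg] at hh
    obtain ⟨c, hc, hce⟩ := hh
    have : g * c * g⁻¹ = g * h * g⁻¹ := hce
    rwa [← mul_left_cancel (mul_right_cancel this)]
  by_cases hex : ∃ f, S.IsMonodromySolution (fun θ => x.1.1.eval (Circle.exp θ)) x.2 f
  · obtain ⟨f, hf⟩ := hex
    rw [S.monodromy_eq hf] at hg hcent
    -- The monodromy lies in its own centralizer, hence in a conjugate of the Cartan subgroup.
    have hmem : f (2 * Real.pi) ∈ Subgroup.centralizer {f (2 * Real.pi)} :=
      Subgroup.mem_centralizer_singleton_iff.2 rfl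
    rw [hg] at hmem
    obtain ⟨c, hc, hce⟩ := hmem
    obtain ⟨x₀, rfl⟩ := S.mem_cartanSubgroup.1 hc
    have hce' : f (2 * Real.pi) = g * S.expG (x₀ : S.𝔤) * g⁻¹ := hce.symm
    refine ⟨f, g, x₀, hf, hce', fun h hh => hcent h ?_⟩
    rw [Subgroup.mem_centralizer_singleton_iff, hce']
    calc g * h * g⁻¹ * (g * S.expG (x₀ : S.𝔤) * g⁻¹) = g * (h * S.expG (x₀ : S.𝔤)) * g⁻¹ := by group
      _ = g * (S.expG (x₀ : S.𝔤) * h) * g⁻¹ := by rw [hh.eq]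
      _ = _ := by group
  -- Without a solution the monodromy takes its default value 1, whose centralizer is all of G.
  · exfalso
    refine S.not_isRegular_zero fun h _ => hcent h ?_
    unfold monodromy
    rw [dif_neg hex, Subgroup.mem_centralizer_singleton_iff]
    simp

/-- The generator φ/i is skew-Hermitian, so fᴴf is constant. -/
theorem IsMonodromySolution.unitary {φ : ℝ → Matrix (Fin n) (Fin n) ℂ} {f : ℝ → S.G}
    (hf : S.IsMonodromySolution φ 1 f) (hφ : ∀ t, (φ t)ᴴ = φ t) (t : ℝ) : (S.mat (f t))ᴴ * S.mat (f t) = 1 := by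
  have h1 : ∀ t, HasDerivAt (fun s => S.mat (f s)) ((1 / (Complex.I * 1)) • (φ t * S.mat (f t))) t := fun t =>
    hasDerivAt_matrix.2 (hf.2 t)
  have h2 : ∀ t, HasDerivAt (fun s => (S.mat (f s))ᴴ) ((1 / (Complex.I * 1)) • (φ t * S.mat (f t)))ᴴ t := fun t =>
    hasDerivAt_matrix.2 fun i j => (hf.2 t j i).star
  have h3 : ∀ t, HasDerivAt (fun s => (S.mat (f s))ᴴ * S.mat (f s)) 0 t := fun t => by
    have h4 := hasDerivAt_matrix_mul (h2 t) (h1 t)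
    have h5 : ((1 / (Complex.I * 1)) • (φ t * S.mat (f t)))ᴴ * S.mat (f t) +
        (S.mat (f t))ᴴ * ((1 / (Complex.I * 1)) • (φ t * S.mat (f t))) = 0 := by
      rw [conjTranspose_smul, conjTranspose_mul, hφ, Matrix.smul_mul, Matrix.mul_smul, Matrix.mul_assoc, ← add_smul]
      simp
    rwa [h5] at h4
  rw [eq_of_hasDerivAt_matrix_zero h3 t 0, hf.1]
  change (1 : Matrix (Fin n) (Fin n) ℂ)ᴴ * 1 = 1
  simp

theorem IsMonodromySolution.add_two_pi {φ : ℝ → Matrix (Fin n) (Fin n) ℂ} {p : ℂ} {f : ℝ → S.G}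
    (hf : S.IsMonodromySolution φ p f) (hφ : ∀ t, φ (t + 2 * Real.pi) = φ t) (t : ℝ) :
    f (t + 2 * Real.pi) = f t * f (2 * Real.pi) := by
  have h1 : ∀ t, HasDerivAt (fun s => S.mat (f s)) ((1 / (Complex.I * p)) • (φ t * S.mat (f t))) t := fun t =>
    hasDerivAt_matrix.2 (hf.2 t)
  have h2 : ∀ t, HasDerivAt (fun s => S.mat (f (s + 2 * Real.pi)))
      ((1 / (Complex.I * p)) • (φ t * S.mat (f (t + 2 * Real.pi)))) t := fun t => by
    rw [← hφ]
    exact hasDerivAt_matrix.2 fun i j => (hf.2 (t + 2 * Real.pi) i j).comp_add_const t (2 * Real.pi)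
  have h3 := eq_of_hasDerivAt_matrix_zero
    (fun t => hasDerivAt_inv_mul_of_ode (fun s => S.isUnit_mat _) (h1 t) (h2 t)) t 0
  rw [hf.1, zero_add, ← mat_inv, ← mat_inv, ← mat_mul, ← mat_mul] at h3
  have h4 := S.mat_injective h3
  rw [inv_one, one_mul] at h4
  rw [← h4]
  group

/-- Conjugates of Hermitian Cartan elements that centralize a unitary regular element are Hermitian. -/
theorem IsRegular.conj_hermitian (hS : S.IsAdmissible) {x₀ : S.𝔥} (hx : S.IsRegular x₀) {g m : S.G}
    (hm : m = g * S.expG (x₀ : S.𝔤) * g⁻¹) (hu : (S.mat m)ᴴ * S.mat m = 1) (h : S.𝔥) {d : Fin n → ℝ}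
    (hd : ((h : S.𝔤) : Matrix (Fin n) (Fin n) ℂ) = diagonal fun i => (d i : ℂ)) :
    ((S.Ad g h : S.𝔤) : Matrix (Fin n) (Fin n) ℂ)ᴴ = (S.Ad g h : S.𝔤) := by
  set A : S.𝔤 := S.Ad g h with hA
  have hcomm : Commute (A : Matrix (Fin n) (Fin n) ℂ) (S.mat m) := by
    have h1 : S.Ad m A = A := by
      rw [hA, ← Ad_mul, hm, mul_assoc, inv_mul_cancel, mul_one, Ad_mul, Ad_expG_cartan]
    have h2 := congrArg Subtype.val h1
    rw [coe_Ad] at h2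
    change _ * _ = _ * _
    conv_lhs => rw [← h2]
    rw [Matrix.mul_assoc, mat_inv_mul, Matrix.mul_one]
  have huinv : (S.mat m)ᴴ = S.mat m⁻¹ := by
    rw [mat_inv]
    exact (Matrix.inv_eq_left_inv hu).symm
  have hcomm' : Commute (A : Matrix (Fin n) (Fin n) ℂ)ᴴ (S.mat m) := by
    have h1 := congrArg conjTranspose hcomm.eq
    rw [conjTranspose_mul, conjTranspose_mul, huinv] at h1
    change _ * _ = _ * _
    have h2 : S.mat m * (S.mat m⁻¹ * (A : Matrix (Fin n) (Fin n) ℂ)ᴴ) * S.mat m =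
        S.mat m * ((A : Matrix (Fin n) (Fin n) ℂ)ᴴ * S.mat m⁻¹) * S.mat m := by rw [h1]
    rw [← Matrix.mul_assoc, mat_mul_inv, Matrix.one_mul, Matrix.mul_assoc, Matrix.mul_assoc, mat_inv_mul,
      Matrix.mul_one] at h2
    exact h2
  -- Both A and Aᴴ commute with m, so Ad(g⁻¹) takes them to 𝔥, which is abelian. Thus A is normal,
  -- and it is similar to a real diagonal matrix.
  let B : S.𝔤 := S.Ad g⁻¹ (dag hS A)
  have hB : S.Ad g B = dag hS A := by rw [← Ad_mul, mul_inv_cancel, Ad_one]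
  have hBmem : B ∈ S.𝔥 := by
    refine hx.mem_cartan_of_commute ?_
    have h1 : S.Ad m (dag hS A) = dag hS A := by
      apply Subtype.ext
      rw [coe_Ad, coe_dag, ← hcomm'.eq, Matrix.mul_assoc, mat_mul_inv, Matrix.mul_one]
    have h2 : S.Ad (S.expG (x₀ : S.𝔤)) B = B := by
      have h3 : S.expG (x₀ : S.𝔤) = g⁻¹ * m * g := by rw [hm]; group
      rw [h3, Ad_mul, hB, Ad_mul, h1]
    have h4 := congrArg Subtype.val h2
    rw [coe_Ad] at h4
    change _ * _ = _ * _
    rw [← mat_expG]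
    conv_lhs => rw [← h4]
    rw [Matrix.mul_assoc, mat_inv_mul, Matrix.mul_one]
  refine conjTranspose_eq_of_normal (P := S.mat g) (d := d) (S.isUnit_mat g) ?_ ?_
  · rw [hA, coe_Ad, Matrix.mul_assoc, mat_inv_mul, Matrix.mul_one, hd]
  · have h1 : Commute (h : S.𝔤).1 B.1 := S.cartan_commute h ⟨B, hBmem⟩
    have h2 : (A : Matrix (Fin n) (Fin n) ℂ)ᴴ = S.mat g * B.1 * S.mat g⁻¹ :=
      (congrArg Subtype.val hB).symm
    rw [h2]
    change S.mat g * (h : S.𝔤).1 * S.mat g⁻¹ * (S.mat g * B.1 * S.mat g⁻¹) =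
      S.mat g * B.1 * S.mat g⁻¹ * (S.mat g * (h : S.𝔤).1 * S.mat g⁻¹)
    have h3 : ∀ X Y : Matrix (Fin n) (Fin n) ℂ, S.mat g * X * S.mat g⁻¹ * (S.mat g * Y * S.mat g⁻¹) =
        S.mat g * (X * Y) * S.mat g⁻¹ := fun X Y => by
      rw [Matrix.mul_assoc (S.mat g * X), ← Matrix.mul_assoc (S.mat g⁻¹), ← Matrix.mul_assoc (S.mat g⁻¹),
        mat_inv_mul, Matrix.one_mul]
      simp only [Matrix.mul_assoc]
    rw [h3, h3, h1.eq]

theorem exists_floquet (hS : S.IsAdmissible) {φ : S.LoopAlg W} (hφ : ∀ z, (φ.1.eval z)ᴴ = φ.1.eval z)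
    (hreg : S.LoopRegular ((φ, (1 : ℂ)) : S.ExtLoopAlg W)) :
    ∃ (μ : S.𝔥) (d : Fin n → ℝ) (γ γi : MatAw W n),
      ((μ : S.𝔤) : Matrix (Fin n) (Fin n) ℂ) = (diagonal fun i => (d i : ℂ)) ∧
      S.IsRegular ((2 * Real.pi / Complex.I : ℂ) • μ) ∧ S.IsLoop γ ∧ (∀ z, γi.eval z = (γ.eval z)⁻¹) ∧
      (∀ θ : ℝ, φ.1.eval (Circle.exp θ) = gaugeAct γ (fun _ => ((μ : S.𝔤) : Matrix (Fin n) (Fin n) ℂ)) 1 θ) ∧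
      ∀ (h : S.𝔥) (d : Fin n → ℝ), ((h : S.𝔤) : Matrix (Fin n) (Fin n) ℂ) = (diagonal fun i => (d i : ℂ)) →
        ∀ z, (γ.eval z * ((h : S.𝔤) : Matrix (Fin n) (Fin n) ℂ) * γi.eval z)ᴴ =
          γ.eval z * ((h : S.𝔤) : Matrix (Fin n) (Fin n) ℂ) * γi.eval z := by
  obtain ⟨f, g, x₀, hf, hm, hx⟩ := hreg.exists_solution
  have hper : ∀ t : ℝ, φ.1.eval (Circle.exp (t + 2 * Real.pi)) = φ.1.eval (Circle.exp t) := fun t => by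
    rw [Circle.periodic_exp t]
  have hu : ∀ t, (S.mat (f t))ᴴ * S.mat (f t) = 1 := hf.unitary fun t => hφ _
  obtain ⟨x, hxd⟩ := diagonal_of_mem_cartan hS x₀
  have hxre : ∀ i, (x i).re = 0 := by
    refine re_eq_zero_of_unitary (hu (2 * Real.pi)) (S.isUnit_mat g) ?_
    have h1 : S.mat (S.expG (x₀ : S.𝔤)) = diagonal fun i => Complex.exp (x i) := by
      rw [mat_expG, hxd, Matrix.exp_diagonal]
      congr 1
      funext i
      rw [Pi.coe_exp, ← Complex.exp_eq_exp_ℂ]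
    rw [hm, mat_mul, mat_mul, Matrix.mul_assoc, mat_inv_mul, Matrix.mul_one, h1]
  -- Chosen so that the constant connection (μ, 1) has monodromy exp((2π/i)μ) = exp(x₀).
  let μ : S.𝔥 := (Complex.I / (2 * Real.pi)) • x₀
  have hpi : (Real.pi : ℂ) ≠ 0 := Complex.ofReal_ne_zero.2 Real.pi_ne_zero
  have hμx : (2 * Real.pi / Complex.I : ℂ) • μ = x₀ := by
    rw [smul_smul]
    have : (2 * Real.pi / Complex.I : ℂ) * (Complex.I / (2 * Real.pi)) = 1 := by
      have := Complex.I_ne_zero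
      field_simp
    rw [this, one_smul]
  let X : Matrix (Fin n) (Fin n) ℂ := (((-(2 * Real.pi : ℂ)⁻¹ • x₀ : S.𝔥) : S.𝔤) : Matrix (Fin n) (Fin n) ℂ)
  -- The Floquet factor: the exponential exactly compensates the monodromy, so Z is 2π-periodic.
  let Z : ℝ → Matrix (Fin n) (Fin n) ℂ := fun t => S.mat (f t * g) * NormedSpace.exp ((t : ℂ) • X)
  have hZG : ∀ t, ∃ k : S.G, S.mat k = Z t := fun t =>
    ⟨f t * g * S.expG ((t : ℂ) • ((-(2 * Real.pi : ℂ)⁻¹ • x₀ : S.𝔥) : S.𝔤)), by rw [mat_mul]; rfl⟩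
  have hZu : ∀ t, IsUnit (Z t) := fun t => by
    obtain ⟨k, hk⟩ := hZG t
    exact hk ▸ S.isUnit_mat k
  have hXμ : X = Complex.I • ((μ : S.𝔤) : Matrix (Fin n) (Fin n) ℂ) := by
    change -(2 * Real.pi : ℂ)⁻¹ • ((x₀ : S.𝔤) : Matrix (Fin n) (Fin n) ℂ) =
      Complex.I • (Complex.I / (2 * Real.pi)) • ((x₀ : S.𝔤) : Matrix (Fin n) (Fin n) ℂ)
    rw [smul_smul, ← mul_div_assoc, Complex.I_mul_I, neg_div, one_div]
  let e : ℝ → S.G := fun t => S.expG (((t : ℂ) • (-(2 * Real.pi : ℂ)⁻¹ • x₀) : S.𝔥) : S.𝔤)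
  have hZe : ∀ t, Z t = S.mat (f t * g * e t) := fun t => rfl
  have he : ∀ t, e (t + 2 * Real.pi) = (S.expG (x₀ : S.𝔤))⁻¹ * e t := by
    intro t
    have h1 : (((t + 2 * Real.pi : ℝ) : ℂ) • (-(2 * Real.pi : ℂ)⁻¹ • x₀) : S.𝔥) =
        -x₀ + (t : ℂ) • (-(2 * Real.pi : ℂ)⁻¹ • x₀) := by
      rw [smul_smul, smul_smul, ← neg_one_smul ℂ x₀, ← add_smul]
      congr 1
      push_cast
      field_simp
      ring
    change S.expG _ = _
    rw [h1, expG_add, ← expG_neg]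
    rfl
  have hZd : ∀ t, HasDerivAt Z (Complex.I • ((-φ.1).eval (Circle.exp t) * Z t +
      Z t * (MatAw.const ((μ : S.𝔤) : Matrix (Fin n) (Fin n) ℂ) : MatAw W n).eval (Circle.exp t))) t := by
    intro t
    have h1 : HasDerivAt (fun s => S.mat (f s)) ((1 / (Complex.I * 1)) • (φ.1.eval (Circle.exp t) * S.mat (f t))) t :=
      hasDerivAt_matrix.2 (hf.2 t)
    have h2 := hasDerivAt_matrix_mul (hasDerivAt_matrix_mul h1 (hasDerivAt_matrix_const (S.mat g) t))
      (hasDerivAt_exp_smul X t)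
    have h3 : Complex.I • ((-φ.1).eval (Circle.exp t) * Z t +
        Z t * (MatAw.const ((μ : S.𝔤) : Matrix (Fin n) (Fin n) ℂ) : MatAw W n).eval (Circle.exp t)) =
        ((1 / (Complex.I * 1)) • (φ.1.eval (Circle.exp t) * S.mat (f t)) * S.mat g + S.mat (f t) * 0) *
          NormedSpace.exp ((t : ℂ) • X) + S.mat (f t) * S.mat g * (NormedSpace.exp ((t : ℂ) • X) * X) := by
      have e1 : (-φ.1).eval (Circle.exp t) = -φ.1.eval (Circle.exp t) := map_neg (MatAw.evalₗ _) φ.1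
      have e2 : (1 / (Complex.I * 1) : ℂ) = -Complex.I := by rw [mul_one, one_div, Complex.inv_I]
      have e3 : Z t = S.mat (f t) * S.mat g * NormedSpace.exp ((t : ℂ) • X) := rfl
      rw [e1, e2, MatAw.eval_const, e3]
      generalize NormedSpace.exp ((t : ℂ) • X) = E
      rw [hXμ]
      simp only [Matrix.mul_zero, add_zero, smul_add, Matrix.neg_mul, smul_neg, neg_smul, Matrix.smul_mul,
        Matrix.mul_smul, Matrix.mul_assoc]
    rw [h3]
    exact h2
  have hZp : ∀ t, Z (t + 2 * Real.pi) = Z t := by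
    intro t
    rw [hZe, hZe, he, hf.add_two_pi hper, hm]
    congr 1
    group
  have hZi : ∀ t, HasDerivAt (fun t => (Z t)⁻¹) (Complex.I •
      ((MatAw.const (-((μ : S.𝔤) : Matrix (Fin n) (Fin n) ℂ)) : MatAw W n).eval (Circle.exp t) * (Z t)⁻¹ +
        (Z t)⁻¹ * φ.1.eval (Circle.exp t))) t := by
    intro t
    have h1 := hasDerivAt_matrix_inv (hZd t) hZu
    have h2 : Z t * (Z t)⁻¹ = 1 := Matrix.mul_nonsing_inv _ ((Matrix.isUnit_iff_isUnit_det _).1 (hZu t))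
    have h3 : (Z t)⁻¹ * Z t = 1 := Matrix.nonsing_inv_mul _ ((Matrix.isUnit_iff_isUnit_det _).1 (hZu t))
    have h4 : (-φ.1).eval (Circle.exp t) = -φ.1.eval (Circle.exp t) := map_neg (MatAw.evalₗ _) φ.1
    have h5 : -((Z t)⁻¹ * Complex.I • ((-φ.1).eval (Circle.exp t) * Z t +
        Z t * (MatAw.const ((μ : S.𝔤) : Matrix (Fin n) (Fin n) ℂ) : MatAw W n).eval (Circle.exp t)) * (Z t)⁻¹) =
        Complex.I • ((MatAw.const (-((μ : S.𝔤) : Matrix (Fin n) (Fin n) ℂ)) : MatAw W n).eval (Circle.exp t) *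
          (Z t)⁻¹ + (Z t)⁻¹ * φ.1.eval (Circle.exp t)) := by
      rw [h4, MatAw.eval_const, MatAw.eval_const, Matrix.mul_smul, Matrix.smul_mul, Matrix.mul_add,
        ← Matrix.mul_assoc (Z t)⁻¹ (Z t), h3, Matrix.one_mul, Matrix.add_mul, ← Matrix.mul_assoc,
        Matrix.mul_assoc _ (Z t), h2, Matrix.mul_one, ← smul_neg]
      congr 1
      rw [Matrix.mul_neg, Matrix.neg_mul]
      abel
    rw [← h5]
    exact h1
  obtain ⟨γ, hγ⟩ := exists_matAw_of_ode _ _ Z (fun t i j => hasDerivAt_matrix.1 (hZd t) i j) hZp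
  -- The inverse satisfies an equation of the same type, so it too has entries in A_w.
  obtain ⟨γi, hγi⟩ := exists_matAw_of_ode (MatAw.const (-((μ : S.𝔤) : Matrix (Fin n) (Fin n) ℂ)) : MatAw W n) φ.1
    (fun t => (Z t)⁻¹) (fun t i j => hasDerivAt_matrix.1 (hZi t) i j) fun t => by rw [hZp]
  have hloop : S.IsLoop γ := fun z => by
    obtain ⟨t, rfl⟩ := Circle.exp_surjective z
    rw [hγ]
    exact hZG t
  have hinv : ∀ z, γi.eval z = (γ.eval z)⁻¹ := fun z => by
    obtain ⟨t, rfl⟩ := Circle.exp_surjective z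
    rw [hγ, hγi]
  refine ⟨μ, fun i => -((x i).im / (2 * Real.pi)), γ, γi, ?_, ?_, hloop, hinv, fun θ => ?_, fun h d hd z => ?_⟩
  · change (Complex.I / (2 * Real.pi) : ℂ) • ((x₀ : S.𝔤) : Matrix (Fin n) (Fin n) ℂ) = _
    rw [hxd, ← diagonal_smul]
    congr 1
    funext i
    rw [Pi.smul_apply, smul_eq_mul]
    have : x i = Complex.I * (x i).im := by
      apply Complex.ext <;> simp [hxre i]
    conv_lhs => rw [this]
    push_cast
    linear_combination ((x i).im / (2 * Real.pi) : ℂ) * Complex.I_mul_I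
  · rw [hμx]
    exact hx
  · have hd := hZd θ
    have hd' : HasDerivAt (fun s : ℝ => γ.eval (Circle.exp s)) (Complex.I • ((-φ.1).eval (Circle.exp θ) * Z θ +
      Z θ * (MatAw.const ((μ : S.𝔤) : Matrix (Fin n) (Fin n) ℂ) : MatAw W n).eval (Circle.exp θ))) θ := by
      simp only [hγ]
      exact hd
    rw [gaugeAct_eq hloop _ _ hd', hγ, MatAw.eval_const]
    have h1 : Z θ * (Z θ)⁻¹ = 1 := Matrix.mul_nonsing_inv _ ((Matrix.isUnit_iff_isUnit_det _).1 (hZu θ))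
    have h2 : (-φ.1).eval (Circle.exp θ) = -φ.1.eval (Circle.exp θ) := map_neg (MatAw.evalₗ _) φ.1
    rw [h2, Matrix.smul_mul, Matrix.add_mul, Matrix.mul_assoc (-φ.1.eval (Circle.exp θ)), h1, Matrix.mul_one, smul_smul,
      one_mul, Complex.I_mul_I, neg_one_smul]
    abel
  · obtain ⟨t, rfl⟩ := Circle.exp_surjective z
    have h1 := hx.conj_hermitian hS hm (hu _) h hd
    have h2 : γ.eval (Circle.exp t) * ((h : S.𝔤) : Matrix (Fin n) (Fin n) ℂ) * γi.eval (Circle.exp t) =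
        S.mat (f t) * ((S.Ad g h : S.𝔤) : Matrix (Fin n) (Fin n) ℂ) * (S.mat (f t))ᴴ := by
      have h3 : S.Ad (f t * g * e t) h = S.Ad (f t) (S.Ad g h) := by rw [Ad_mul, Ad_mul, Ad_expG_cartan]
      have h4 := congrArg Subtype.val h3
      rw [coe_Ad, coe_Ad] at h4
      rw [hinv, hγ, hZe, ← mat_inv]
      refine h4.trans ?_
      rw [mat_inv, Matrix.inv_eq_left_inv (hu t)]
    rw [h2, conjTranspose_mul, conjTranspose_mul, conjTranspose_conjTranspose, h1, Matrix.mul_assoc]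

end ChevalleyData

open Matrix
open scoped ComplexOrder

/-! ### The gradient of the gauge-invariant functions -/

namespace ChevalleyData

variable {n l : ℕ} {S : ChevalleyData n l} {W : LoopWeight}

/-- Coroots are Hermitian, integral weights are real on them, and both sides are conjugate-linear.
-/
theorem weightLattice_dagH (hS : S.IsAdmissible) {lam : Module.Dual ℂ S.𝔥} (hl : lam ∈ S.weightLattice)
    (h : S.𝔥) : lam (dagH hS h) = (starRingEnd ℂ) (lam h) := by
  have hinj : ∀ {x y : S.𝔥}, ((x : S.𝔤) : Matrix (Fin n) (Fin n) ℂ) = (y : S.𝔤) → x = y := fun h =>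
    Subtype.ext (Subtype.ext h)
  have hc : ∀ x : S.𝔥, ((dagH hS x : S.𝔤) : Matrix (Fin n) (Fin n) ℂ) =
      ((x : S.𝔤) : Matrix (Fin n) (Fin n) ℂ)ᴴ := fun x => by rw [coe_dagH, coe_dag]
  induction h using S.cartan_induction with
  | h0 =>
    have : dagH hS (0 : S.𝔥) = 0 := hinj (by
      rw [hc]
      exact conjTranspose_zero)
    rw [this, map_zero, map_zero]
  | hadd x y hx hy =>
    have : dagH hS (x + y) = dagH hS x + dagH hS y := hinj (by
      rw [hc]
      change (((x : S.𝔤) : Matrix (Fin n) (Fin n) ℂ) + ((y : S.𝔤) : Matrix (Fin n) (Fin n) ℂ))ᴴ =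
        ((dagH hS x : S.𝔤) : Matrix (Fin n) (Fin n) ℂ) + ((dagH hS y : S.𝔤) : Matrix (Fin n) (Fin n) ℂ)
      rw [hc, hc, conjTranspose_add])
    rw [this, map_add, map_add, hx, hy, map_add]
  | hsmul c x hx =>
    have : dagH hS (c • x) = star c • dagH hS x := hinj (by
      rw [hc]
      change (c • ((x : S.𝔤) : Matrix (Fin n) (Fin n) ℂ))ᴴ = star c • ((dagH hS x : S.𝔤) : Matrix (Fin n) (Fin n) ℂ)
      rw [hc, conjTranspose_smul])
    rw [this, map_smul, map_smul, hx, smul_eq_mul, smul_eq_mul, map_mul]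
    rfl
  | hc α hα =>
    have : dagH hS (LieAlgebra.IsKilling.coroot α) = LieAlgebra.IsKilling.coroot α := hinj (by
      rw [hc]
      exact conjTranspose_of_mem_𝔞 hS (S.Hmat_mem_𝔞 hα))
    obtain ⟨k, hk⟩ := hl α hα
    rw [this, hk, map_intCast]

theorem dagH_eq_self (hS : S.IsAdmissible) {h : S.𝔥} {d : Fin n → ℝ}
    (hd : ((h : S.𝔤) : Matrix (Fin n) (Fin n) ℂ) = diagonal fun i => (d i : ℂ)) : dagH hS h = h := by
  refine Subtype.ext (Subtype.ext ?_)
  rw [coe_dagH, coe_dag, hd, diagonal_conjTranspose]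
  congr 1
  funext i
  exact Complex.conj_ofReal _

/-- A real diagonal μ has real coroot coordinates, so (2π/i)μ has imaginary ones and equals its own
compact part. -/
theorem compactPart_coords_eq (hS : S.IsAdmissible) {μ : S.𝔥} {d : Fin n → ℝ}
    (hd : ((μ : S.𝔤) : Matrix (Fin n) (Fin n) ℂ) = diagonal fun i => (d i : ℂ)) :
    S.compactPart (S.coords ((2 * Real.pi / Complex.I : ℂ) • μ)) = (2 * Real.pi / Complex.I : ℂ) • μ := by
  have h1 : ∀ i, (Complex.I * ((S.coords ((2 * Real.pi / Complex.I : ℂ) • μ) i).im : ℂ)) =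
      S.fundWeight i ((2 * Real.pi / Complex.I : ℂ) • μ) := by
    intro i
    have h2 := weightLattice_dagH hS (S.fundWeight_mem i) μ
    rw [dagH_eq_self hS hd] at h2
    obtain ⟨r, hr⟩ := Complex.conj_eq_iff_real.1 h2.symm
    rw [coords_apply, map_smul, hr, smul_eq_mul, Complex.div_I]
    apply Complex.ext <;> simp
  unfold compactPart
  simp only [h1]
  exact (S.eq_sum_simpleCoroot _).symm

/-- Elements of `𝔥` representing functionals with respect to the Killing form. -/
theorem exists_killingForm_eq (f : Module.Dual ℂ S.𝔥) : ∃ x : S.𝔥,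
    ∀ h : S.𝔥, killingForm ℂ S.𝔤 (x : S.𝔤) (h : S.𝔤) = f h := by
  refine ⟨(LieAlgebra.IsKilling.cartanEquivDual S.𝔥).symm f, fun h => ?_⟩
  have := LinearMap.congr_fun ((LieAlgebra.IsKilling.cartanEquivDual S.𝔥).apply_symm_apply f) h
  exact this

theorem eq_of_killingForm_eq {x y : S.𝔥} (h : ∀ z : S.𝔥, killingForm ℂ S.𝔤 (x : S.𝔤) (z : S.𝔤) =
    killingForm ℂ S.𝔤 (y : S.𝔤) (z : S.𝔤)) : x = y :=
  (LieAlgebra.IsKilling.cartanEquivDual S.𝔥).injective (LinearMap.ext h)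

/-- A loop in `G` together with its inverse. -/
def IsLoopPair (S : ChevalleyData n l) (γ γi : MatAw W n) : Prop :=
  ∀ z, ∃ g : S.G, S.mat g = γ.eval z ∧ S.mat g⁻¹ = γi.eval z

theorem IsLoopPair.symm {γ γi : MatAw W n} (h : S.IsLoopPair γ γi) : S.IsLoopPair γi γ := fun z => by
  obtain ⟨g, h1, h2⟩ := h z
  exact ⟨g⁻¹, h2, by rw [inv_inv, h1]⟩

/-- Pointwise conjugation of elements of the loop algebra. -/
def loopConj {γ γi : MatAw W n} (h : S.IsLoopPair γ γi) : S.LoopAlg W →L[ℂ] S.LoopAlg W :=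
  (((MatAw.mulCLM γ).comp (MatAw.mulCLM.flip γi)).comp (S.LoopAlg W).subtypeL).codRestrict (S.LoopAlg W)
    fun ξ z => by
      obtain ⟨g, h1, h2⟩ := h z
      change (MatAw.mulCLM γ (MatAw.mulCLM ξ.1 γi)).eval z ∈ S.𝔤
      rw [MatAw.eval_mul, MatAw.eval_mul, ← h1, ← h2, ← Matrix.mul_assoc]
      exact S.conj_mem g (S.evalAlg ξ z)

theorem eval_loopConj {γ γi : MatAw W n} (h : S.IsLoopPair γ γi) (ξ : S.LoopAlg W) (z : Circle) :
    (loopConj h ξ).1.eval z = γ.eval z * ξ.1.eval z * γi.eval z := by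
  change (MatAw.mulCLM γ (MatAw.mulCLM ξ.1 γi)).eval z = _
  rw [MatAw.eval_mul, MatAw.eval_mul, Matrix.mul_assoc]

theorem loopForm_loopConj {γ γi : MatAw W n} (h : S.IsLoopPair γ γi) (ξ η : S.LoopAlg W) :
    S.loopForm (loopConj h.symm ξ) η = S.loopForm ξ (loopConj h η) := by
  refine loopForm_congr fun z => ?_
  obtain ⟨g, h1, h2⟩ := h z
  have e1 : S.evalAlg (loopConj h.symm ξ) z = S.Ad g⁻¹ (S.evalAlg ξ z) := Subtype.ext (by
    rw [coe_Ad, inv_inv, h1, h2]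
    exact eval_loopConj h.symm ξ z)
  have e2 : S.evalAlg (loopConj h η) z = S.Ad g (S.evalAlg η z) := Subtype.ext (by
    rw [coe_Ad, h1, h2]
    exact eval_loopConj h η z)
  rw [e1, e2, ← S.killingForm_Ad g, ← Ad_mul, mul_inv_cancel, Ad_one]

/-- The affine gauge transformation by `γ⁻¹` taking `(φ, 1)` to the constant connection `(μ, 1)`. -/
def gaugeBack {γ γi : MatAw W n} (h : S.IsLoopPair γ γi) (φ : S.LoopAlg W) (μ : S.𝔥) :
    S.ExtLoopAlg W →L[ℂ] S.ExtLoopAlg W :=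
  ((loopConj h.symm).comp (ContinuousLinearMap.fst ℂ (S.LoopAlg W) ℂ -
      (ContinuousLinearMap.snd ℂ (S.LoopAlg W) ℂ).smulRight φ) +
    (ContinuousLinearMap.snd ℂ (S.LoopAlg W) ℂ).smulRight (S.constLoop μ)).prod
    (ContinuousLinearMap.snd ℂ (S.LoopAlg W) ℂ)

theorem gaugeBack_apply {γ γi : MatAw W n} (h : S.IsLoopPair γ γi) (φ : S.LoopAlg W) (μ : S.𝔥)
    (x : S.ExtLoopAlg W) : gaugeBack h φ μ x =
      (loopConj h.symm (x.1 - x.2 • φ) + x.2 • S.constLoop μ, x.2) := rfl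

theorem IsLoopPair.isLoop {γ γi : MatAw W n} (h : S.IsLoopPair γ γi) : S.IsLoop γ := fun z =>
  (h z).imp fun _ hg => hg.1

theorem gaugeAct_gaugeBack {γ γi : MatAw W n} (h : S.IsLoopPair γ γi) {φ : S.LoopAlg W} {μ : S.𝔥}
    (hφ : ∀ θ : ℝ, φ.1.eval (Circle.exp θ) = gaugeAct γ (fun _ => ((μ : S.𝔤) : Matrix (Fin n) (Fin n) ℂ)) 1 θ)
    (x : S.ExtLoopAlg W) (θ : ℝ) : x.1.1.eval (Circle.exp θ) =
      gaugeAct γ (fun s => (gaugeBack h φ μ x).1.1.eval (Circle.exp s)) x.2 θ := by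
  obtain ⟨γ', hγ⟩ := γ.exists_hasDerivAt_eval θ
  have h0 := hφ θ
  rw [gaugeAct_eq h.isLoop _ _ hγ, one_mul] at h0
  rw [gaugeAct_eq h.isLoop _ _ hγ]
  obtain ⟨g, h1, h2⟩ := h (Circle.exp θ)
  have e1 : (gaugeBack h φ μ x).1.1.eval (Circle.exp θ) =
      γi.eval (Circle.exp θ) * (x.1.1.eval (Circle.exp θ) - x.2 • φ.1.eval (Circle.exp θ)) * γ.eval (Circle.exp θ) +
        x.2 • ((μ : S.𝔤) : Matrix (Fin n) (Fin n) ℂ) := by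
    rw [gaugeBack_apply]
    change ((loopConj h.symm (x.1 - x.2 • φ)).1 + x.2 • (S.constLoop μ).1).eval (Circle.exp θ) = _
    rw [MatAw.eval_add, MatAw.eval_smul, eval_loopConj]
    change _ * (x.1.1 - x.2 • φ.1).eval _ * _ + x.2 • (MatAw.const _ : MatAw W n).eval _ = _
    rw [MatAw.eval_sub, MatAw.eval_smul, MatAw.eval_const]
  rw [e1]
  rw [← h1, ← mat_inv] at h0 ⊢
  rw [← h2]
  have e2 : S.mat g * (S.mat g⁻¹ * (x.1.1.eval (Circle.exp θ) - x.2 • φ.1.eval (Circle.exp θ)) * S.mat g) *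
      S.mat g⁻¹ = x.1.1.eval (Circle.exp θ) - x.2 • φ.1.eval (Circle.exp θ) := by
    rw [Matrix.mul_assoc, Matrix.mul_assoc, Matrix.mul_assoc, mat_mul_inv, Matrix.mul_one, ← Matrix.mul_assoc,
      mat_mul_inv, Matrix.one_mul]
  rw [Matrix.mul_add, Matrix.add_mul, e2, Matrix.mul_smul, Matrix.smul_mul, mul_smul]
  conv_lhs => rw [← sub_add_cancel (x.1.1.eval (Circle.exp θ)) (x.2 • φ.1.eval (Circle.exp θ))]
  rw [add_assoc, ← smul_add, ← h0]

theorem IsGaugeConjConst.of_gaugeBack {γ γi : MatAw W n} (h : S.IsLoopPair γ γi) {φ : S.LoopAlg W} {μ : S.𝔥}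
    (hφ : ∀ θ : ℝ, φ.1.eval (Circle.exp θ) = gaugeAct γ (fun _ => ((μ : S.𝔤) : Matrix (Fin n) (Fin n) ℂ)) 1 θ)
    {x : S.ExtLoopAlg W} {ν : S.𝔥} (hx : S.IsGaugeConjConst ν (gaugeBack h φ μ x)) :
    S.IsGaugeConjConst ν x := by
  obtain ⟨η, hη, hη2⟩ := hx
  refine ⟨MatAw.mulCLM γ η, h.isLoop.mul hη, fun θ => ?_⟩
  rw [gaugeAct_mul h.isLoop hη, gaugeAct_gaugeBack h hφ x θ]
  congr 1
  funext s
  exact hη2 s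

theorem pairing_sub_right (y a b : S.ExtLoopAlg W) : S.pairing y (a - b) = S.pairing y a - S.pairing y b := by
  have h1 : S.loopForm y.1 (a.1 - b.1) = S.loopForm y.1 a.1 - S.loopForm y.1 b.1 := by
    rw [loopForm_comm, sub_eq_add_neg, ← neg_one_smul ℂ b.1, loopForm_add_left, loopForm_smul_left,
      loopForm_comm a.1, loopForm_comm b.1]
    ring
  unfold pairing
  rw [Prod.fst_sub, Prod.snd_sub, h1, ← Complex.sub_re]
  congr 1
  ring

theorem HasGrad.unique (hS : S.IsAdmissible) {f : S.ExtLoopAlg W → ℝ} {x v v' : S.ExtLoopAlg W}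
    (h : S.HasGrad f x v) (h' : S.HasGrad f x v') : v = v' := by
  obtain ⟨f', hf, hd⟩ := h
  obtain ⟨f'', hf', hd'⟩ := h'
  refine sub_eq_zero.1 (pairing_eq_zero hS fun y => ?_)
  rw [pairing_sub_right, ← hf, ← hf', hd.unique hd', sub_self]

/-- Compatibility of f and of the Killing form with the conjugate transpose makes the dual vector
Hermitian, and elements of 𝔥 are diagonal. -/
theorem exists_diagonal_of_real (hS : S.IsAdmissible) {f : Module.Dual ℂ S.𝔥}
    (hf : ∀ h, f (dagH hS h) = (starRingEnd ℂ) (f h)) {x : S.𝔥}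
    (hx : ∀ h : S.𝔥, killingForm ℂ S.𝔤 (x : S.𝔤) (h : S.𝔤) = f h) :
    ∃ d : Fin n → ℝ, ((x : S.𝔤) : Matrix (Fin n) (Fin n) ℂ) = diagonal fun i => (d i : ℂ) := by
  have h1 : dagH hS x = x := eq_of_killingForm_eq fun z => by
    have h2 := killingForm_dag hS (x : S.𝔤) (dagH hS z : S.𝔤)
    rw [coe_dagH hS z, dag_dag, ← coe_dagH, ← coe_dagH, hx, hf] at h2
    rw [h2, hx, Complex.star_def, Complex.conj_conj]
  obtain ⟨d, hd⟩ := diagonal_of_mem_cartan hS x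
  have h3 : ((x : S.𝔤) : Matrix (Fin n) (Fin n) ℂ)ᴴ = (x : S.𝔤) := by
    rw [← coe_dag hS, ← coe_dagH hS x, h1]
  rw [hd, diagonal_conjTranspose] at h3
  refine ⟨fun i => (d i).re, hd.trans ?_⟩
  congr 1
  funext i
  have h4 := congrFun (diagonal_injective h3) i
  exact (Complex.conj_eq_iff_re.1 h4).symm

end ChevalleyData

/-! ### Differentiation in the normal form and transport of the gradient -/

open Matrix
open scoped ComplexOrder

namespace ChevalleyData

variable {n l : ℕ} {S : ChevalleyData n l} {W : LoopWeight}

theorem exists_coords_clm {q : S.LoopAlg W →ₗ[ℂ] S.𝔥}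
    (hq : Continuous fun ψ => ((q ψ : S.𝔤) : Matrix (Fin n) (Fin n) ℂ)) :
    ∃ Q : S.LoopAlg W →L[ℂ] (Fin l → ℂ), ∀ ψ, Q ψ = S.coords (q ψ) := by
  let ι : S.𝔥 →ₗ[ℂ] Matrix (Fin n) (Fin n) ℂ := S.𝔤.toSubmodule.subtype.comp S.𝔥.toSubmodule.subtype
  obtain ⟨r, hr⟩ := LinearMap.exists_leftInverse_of_injective ι (LinearMap.ker_eq_bot.2
    (Subtype.val_injective.comp Subtype.val_injective))
  have h1 : ∀ ψ, S.coords (q ψ) = (S.coords.toLinearMap.comp r) ((q ψ : S.𝔤) : Matrix (Fin n) (Fin n) ℂ) :=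
    fun ψ => congrArg S.coords (LinearMap.congr_fun hr (q ψ)).symm
  refine ⟨⟨S.coords.toLinearMap.comp q, ?_⟩, fun ψ => rfl⟩
  have h2 : Continuous fun ψ => (S.coords.toLinearMap.comp r) ((q ψ : S.𝔤) : Matrix (Fin n) (Fin n) ℂ) :=
    (LinearMap.continuous_of_finiteDimensional (S.coords.toLinearMap.comp r)).comp hq
  exact h2.congr fun ψ => (h1 ψ).symm

/-- Product rule at p = 1 and normal form coordinate zero: the factor 1/p contributes minus the
central increment times the coordinates of μ. -/
theorem hasFDerivAt_coords {μ : S.𝔥} {A : S.ExtLoopAlg W →L[ℂ] S.ExtLoopAlg W} {x₀ : S.ExtLoopAlg W}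
    (hA : A x₀ = (S.constLoop μ, 1)) (hx₀ : x₀.2 = 1) {Ξ : S.ExtLoopAlg W → S.ExtLoopAlg W}
    (hΞ : HasFDerivAt Ξ (ContinuousLinearMap.id ℂ (S.ExtLoopAlg W)) (S.constLoop μ, 1))
    (hΞ0 : Ξ (S.constLoop μ, 1) = (0, 1)) (Q : S.LoopAlg W →L[ℂ] (Fin l → ℂ)) :
    ∃ s' : S.ExtLoopAlg W →L[ℂ] (Fin l → ℂ),
      (∀ y, s' y = (2 * Real.pi / Complex.I : ℂ) • (Q (A y).1 - y.2 • S.coords μ)) ∧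
      HasFDerivAt (fun x : S.ExtLoopAlg W => (2 * Real.pi / Complex.I : ℂ) •
        ((x.2)⁻¹ • (S.coords μ + Q (Ξ (A x)).1))) s' x₀ := by
  have h1 : HasFDerivAt (fun x => S.coords μ + Q (Ξ (A x)).1)
      ((Q.comp (ContinuousLinearMap.fst ℂ (S.LoopAlg W) ℂ)).comp A) x₀ := by
    have h2 : HasFDerivAt (fun x => Ξ (A x)) ((ContinuousLinearMap.id ℂ (S.ExtLoopAlg W)).comp A) x₀ := by
      rw [← hA] at hΞ
      exact hΞ.comp x₀ A.hasFDerivAt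
    have h3 := ((Q.comp (ContinuousLinearMap.fst ℂ (S.LoopAlg W) ℂ)).hasFDerivAt (x := Ξ (A x₀))).comp x₀ h2
    exact h3.const_add (S.coords μ)
  have h4 : HasFDerivAt (fun x : S.ExtLoopAlg W => (x.2)⁻¹) _ x₀ :=
    (hasDerivAt_inv (by rw [hx₀]; exact one_ne_zero)).comp_hasFDerivAt x₀
      (ContinuousLinearMap.snd ℂ (S.LoopAlg W) ℂ).hasFDerivAt
  refine ⟨_, fun y => ?_, (h4.smul h1).const_smul (2 * Real.pi / Complex.I : ℂ)⟩
  rw [ContinuousLinearMap.smul_apply]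
  congr 1
  simp only [ContinuousLinearMap.add_apply, ContinuousLinearMap.smul_apply, ContinuousLinearMap.smulRight_apply,
    ContinuousLinearMap.comp_apply, ContinuousLinearMap.coe_fst', ContinuousLinearMap.coe_snd', hA, hΞ0, hx₀,
    map_zero, add_zero, inv_one, one_smul, one_pow, smul_eq_mul, neg_mul, one_mul, neg_smul]
  rw [← sub_eq_add_neg]

/-- The functional `∑ -2π L_i ω_i`. -/
def weightFun (S : ChevalleyData n l) (L : Fin l → ℝ) : Module.Dual ℂ S.𝔥 :=
  ∑ i, ((-(2 * Real.pi * L i) : ℝ) : ℂ) • S.fundWeight i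

theorem weightFun_apply (L : Fin l → ℝ) (h : S.𝔥) :
    S.weightFun L h = ∑ i, ((-(2 * Real.pi * L i) : ℝ) : ℂ) * S.coords h i := by
  unfold weightFun
  rw [LinearMap.sum_apply]
  rfl

theorem weightFun_dagH (hS : S.IsAdmissible) (L : Fin l → ℝ) (h : S.𝔥) :
    S.weightFun L (dagH hS h) = (starRingEnd ℂ) (S.weightFun L h) := by
  rw [weightFun_apply, weightFun_apply, map_sum]
  refine Finset.sum_congr rfl fun i _ => ?_
  rw [coords_apply, coords_apply, weightLattice_dagH hS (S.fundWeight_mem i), map_mul, Complex.conj_ofReal]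

theorem weightFun_eq_zero {L : Fin l → ℝ} : S.weightFun L = 0 ↔ ∀ i, L i = 0 := by
  constructor
  · intro h i
    have h1 := LinearMap.congr_fun h (S.simpleCoroot i)
    rw [weightFun_apply, Finset.sum_eq_single i] at h1
    · rw [coords_apply, fundWeight_simpleCoroot, if_pos rfl, mul_one, LinearMap.zero_apply,
        Complex.ofReal_eq_zero] at h1
      have := Real.pi_pos
      rcases mul_eq_zero.1 (neg_eq_zero.1 h1) with h2 | h2
      · linarith
      · exact h2
    · intro j _ hj
      rw [coords_apply, fundWeight_simpleCoroot, if_neg (Ne.symm hj), mul_zero]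
    · intro h2
      exact absurd (Finset.mem_univ i) h2
  · intro h
    unfold weightFun
    refine Finset.sum_eq_zero fun i _ => ?_
    rw [h i]
    simp

/-- Multiplication by 2π/i turns imaginary parts into -2π times real parts, whence the constants in
`weightFun`. -/
theorem sum_im_eq_re_weightFun (L : Fin l → ℝ) (h : S.𝔥) :
    ∑ i, L i * ((2 * Real.pi / Complex.I : ℂ) * S.coords h i).im = (S.weightFun L h).re := by
  rw [weightFun_apply, Complex.re_sum]
  refine Finset.sum_congr rfl fun i _ => ?_
  rw [Complex.div_I, Complex.re_ofReal_mul]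
  simp
  ring

theorem loopForm_sub_left (a b ψ : S.LoopAlg W) : S.loopForm (a - b) ψ = S.loopForm a ψ - S.loopForm b ψ := by
  rw [sub_eq_add_neg, ← neg_one_smul ℂ b, loopForm_add_left, loopForm_smul_left]
  ring

/-- The gradient at `(φ, 1)`, obtained by transporting `x ∈ 𝔥` by `γ`. -/
def transportGrad {γ γi : MatAw W n} (h : S.IsLoopPair γ γi) (φ : S.LoopAlg W) (x : S.𝔥) : S.ExtLoopAlg W :=
  (loopConj h (S.constLoop x), -S.loopForm φ (loopConj h (S.constLoop x)))

/-- Invariance moves the conjugation from x to y, and the Killing form with x sees only the 𝔥-part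
of the zeroth coefficient. The central component of the gradient compensates the subtraction of y.2
• φ in `gaugeBack`. -/
theorem pairing_transportGrad {γ γi : MatAw W n} (h : S.IsLoopPair γ γi) (φ : S.LoopAlg W) {μ x : S.𝔥}
    {q : S.LoopAlg W →ₗ[ℂ] S.𝔥}
    (hq : ∀ (h : S.𝔥) (ψ : S.LoopAlg W), killingForm ℂ S.𝔤 h ⟨ψ.1.coeff 0, S.mem_loopAlg_iff_coeff.1 ψ.2 0⟩ =
      killingForm ℂ S.𝔤 h (q ψ)) (y : S.ExtLoopAlg W) :
    S.pairing y (transportGrad h φ x) =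
      (killingForm ℂ S.𝔤 (x : S.𝔤) ((q (gaugeBack h φ μ y).1 - y.2 • μ : S.𝔥) : S.𝔤)).re := by
  have h1 : killingForm ℂ S.𝔤 (x : S.𝔤) ((q (gaugeBack h φ μ y).1 - y.2 • μ : S.𝔥) : S.𝔤) =
      killingForm ℂ S.𝔤 (x : S.𝔤) (q (gaugeBack h φ μ y).1 : S.𝔤) - y.2 * killingForm ℂ S.𝔤 (x : S.𝔤) (μ : S.𝔤) := by
    rw [← smul_eq_mul, ← map_smul, ← map_sub]
    rfl
  have h2 : killingForm ℂ S.𝔤 (x : S.𝔤) (μ : S.𝔤) = S.loopForm (S.constLoop (W := W) μ) (S.constLoop x) := by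
    rw [loopForm_constLoop]
    congr 1
  rw [h1, h2, ← hq, ← loopForm_constLoop, gaugeBack_apply, loopForm_add_left, loopForm_smul_left,
    loopForm_loopConj h, add_sub_cancel_right, loopForm_sub_left, loopForm_smul_left]
  unfold pairing transportGrad
  congr 1
  ring

/-- The loop component is Hermitian, and the form of two Hermitian loops is real; multiplication by
-i leads into `kHat`. -/
theorem transportGrad_mem_iKHat (hS : S.IsAdmissible) {γ γi : MatAw W n} (h : S.IsLoopPair γ γi) {φ : S.LoopAlg W}
    (hφ : ∀ z, (φ.1.eval z)ᴴ = φ.1.eval z) {x : S.𝔥}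
    (hx : ∀ z, (γ.eval z * ((x : S.𝔤) : Matrix (Fin n) (Fin n) ℂ) * γi.eval z)ᴴ =
      γ.eval z * ((x : S.𝔤) : Matrix (Fin n) (Fin n) ℂ) * γi.eval z) :
    transportGrad h φ x ∈ S.iKHat W := by
  have hv : ∀ z, ((loopConj h (S.constLoop x)).1.eval z)ᴴ = (loopConj h (S.constLoop x)).1.eval z := fun z => by
    rw [eval_loopConj]
    have : (S.constLoop (W := W) x).1.eval z = ((x : S.𝔤) : Matrix (Fin n) (Fin n) ℂ) := MatAw.eval_const _ z
    rw [this]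
    exact hx z
  have hd : ∀ ψ : S.LoopAlg W, (∀ z, (ψ.1.eval z)ᴴ = ψ.1.eval z) → loopDag hS ψ = ψ := fun ψ hψ =>
    Subtype.ext (MatAw.ext_eval fun z => (MatAw.eval_dag _ z).trans (hψ z))
  have hr := loopForm_loopDag hS φ (loopConj h (S.constLoop x))
  rw [hd φ hφ, hd _ hv] at hr
  refine ⟨(-Complex.I) • transportGrad h φ x, ⟨fun z => ?_, ?_⟩, ?_⟩
  · have e : ((-Complex.I) • transportGrad h φ x).1.1.eval z =
        (-Complex.I) • (loopConj h (S.constLoop x)).1.eval z := MatAw.eval_smul _ _ z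
    refine ⟨?_, S.trace_eq_zero (S.evalAlg ((-Complex.I) • transportGrad h φ x).1 z)⟩
    rw [e, conjTranspose_smul, hv z, ← neg_smul]
    congr 1
    simp
  · have h2 := congrArg Complex.im hr
    change ((-Complex.I) * -S.loopForm φ (loopConj h (S.constLoop x))).re = 0
    rw [Complex.star_def, Complex.conj_im] at h2
    simp
    linarith
  · rw [smul_smul, mul_neg, Complex.I_mul_I, neg_neg, one_smul]

theorem transportGrad_eq_zero {γ γi : MatAw W n} (h : S.IsLoopPair γ γi) (φ : S.LoopAlg W) {x : S.𝔥} :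
    transportGrad h φ x = 0 ↔ x = 0 := by
  constructor
  · intro h0
    have h1 : loopConj h (S.constLoop x) = 0 := congrArg Prod.fst h0
    have h2 : S.constLoop (W := W) x = 0 := by
      have h3 : loopConj h.symm (loopConj h (S.constLoop (W := W) x)) = S.constLoop x := by
        refine Subtype.ext (MatAw.ext_eval fun z => ?_)
        obtain ⟨g, e1, e2⟩ := h z
        rw [eval_loopConj, eval_loopConj, ← e1, ← e2]
        rw [← Matrix.mul_assoc, ← Matrix.mul_assoc, mat_inv_mul, Matrix.one_mul, Matrix.mul_assoc, mat_inv_mul,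
          Matrix.mul_one]
      rw [← h3, h1, map_zero]
    have h4 := congrArg (fun ψ : S.LoopAlg W => ψ.1.eval 1) h2
    have h5 : (S.constLoop (W := W) x).1.eval 1 = ((x : S.𝔤) : Matrix (Fin n) (Fin n) ℂ) := MatAw.eval_const _ 1
    refine Subtype.ext (Subtype.ext ?_)
    rw [← h5]
    exact h4.trans (MatAw.eval_zero 1)
  · rintro rfl
    have h1 : S.constLoop (W := W) ((0 : S.𝔥) : S.𝔤) = 0 := Subtype.ext (MatAw.ext_eval fun z =>
      (MatAw.eval_const _ z).trans (MatAw.eval_zero z).symm)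
    unfold transportGrad
    rw [h1, map_zero, loopForm_comm, ← zero_smul ℂ (0 : S.LoopAlg W), loopForm_smul_left]
    simp

theorem hasGrad_F (hS : S.IsAdmissible) {Ψ : Fin l → S.G → ℂ} (hΨ : ∀ j, S.IsFundamentalCharacter j (Ψ j))
    (c : Fin l → ℝ) {φ : S.LoopAlg W} {γ γi : MatAw W n} (h : S.IsLoopPair γ γi) {μ : S.𝔥} {d : Fin n → ℝ}
    (hd : ((μ : S.𝔤) : Matrix (Fin n) (Fin n) ℂ) = diagonal fun i => (d i : ℂ))
    (hμ : S.IsRegular ((2 * Real.pi / Complex.I : ℂ) • μ))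
    (hφ : ∀ θ : ℝ, φ.1.eval (Circle.exp θ) = gaugeAct γ (fun _ => ((μ : S.𝔤) : Matrix (Fin n) (Fin n) ℂ)) 1 θ) :
    ∃ L : Fin l → ℝ, ((∀ i, L i = 0) ↔ ∀ j, c j = 0) ∧
      ∀ x : S.𝔥, (∀ z : S.𝔥, killingForm ℂ S.𝔤 (x : S.𝔤) (z : S.𝔤) = S.weightFun L z) →
        S.HasGrad (fun x => ∑ j, c j * S.F Ψ j x) (φ, (1 : ℂ)) (transportGrad h φ x) := by
  obtain ⟨q, Ξ, hq1, hΞ, hΞ0, hq2, hev⟩ := exists_normal_form (W := W) hμ hd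
  obtain ⟨Q, hQ⟩ := exists_coords_clm hq1
  have hA : gaugeBack h φ μ (φ, 1) = (S.constLoop μ, 1) := by
    rw [gaugeBack_apply, one_smul, one_smul, sub_self, map_zero, zero_add]
  obtain ⟨s', hs', hs⟩ := hasFDerivAt_coords (x₀ := (φ, (1 : ℂ))) hA rfl hΞ hΞ0 Q
  -- Near the base point these are the coroot coordinates of the logarithm (2π/(ip))(μ + q) of the
  -- monodromy in normal form, so F factors through them.
  set s : S.ExtLoopAlg W → Fin l → ℂ := fun x => (2 * Real.pi / Complex.I : ℂ) •
    ((x.2)⁻¹ • (S.coords μ + Q (Ξ (gaugeBack h φ μ x)).1)) with hsdef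
  have hs0 : s (φ, 1) = S.coords ((2 * Real.pi / Complex.I : ℂ) • μ) := by
    rw [hsdef]
    simp only [hA, hΞ0, map_zero, inv_one, one_smul, add_zero, map_smul]
  obtain ⟨L, hL, hLc⟩ := exists_hasFDerivAt_chi hS hΨ c (s (φ, 1))
    (by rw [hs0, compactPart_coords_eq hS hd]; exact hμ)
  refine ⟨L, hLc, fun x hx => ⟨_, fun y => ?_,
    (hL.comp (φ, (1 : ℂ)) (hs.restrictScalars ℝ)).congr_of_eventuallyEq ?_⟩⟩
  · rw [pairing_transportGrad h φ (μ := μ) hq2, hx, ← sum_im_eq_re_weightFun]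
    rw [ContinuousLinearMap.comp_apply, _root_.sum_apply]
    refine Finset.sum_congr rfl fun i _ => ?_
    change L i * ((s' y) i).im = _
    rw [hs', map_sub, map_smul, hQ]
    rfl
  · have hc : Filter.Tendsto (gaugeBack h φ μ) (𝓝 (φ, 1)) (𝓝 (S.constLoop μ, 1)) := by
      have := (gaugeBack h φ μ).continuous.tendsto (φ, 1)
      rwa [hA] at this
    have hne : ∀ᶠ x : S.ExtLoopAlg W in 𝓝 (φ, (1 : ℂ)), x.2 ≠ 0 :=
      continuous_snd.continuousAt.eventually_ne one_ne_zero
    filter_upwards [hc.eventually hev, hne] with x hx1 hx2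
    refine Finset.sum_congr rfl fun j _ => ?_
    rw [F_eq hS hΨ j hx2 (IsGaugeConjConst.of_gaugeBack h hφ hx1.2)]
    have : S.coords ((2 * Real.pi / (Complex.I * x.2) : ℂ) • (μ + q (Ξ (gaugeBack h φ μ x)).1)) = s x := by
      rw [hsdef, map_smul, map_add]
      simp only [hQ]
      rw [smul_smul, div_mul_eq_div_div, div_eq_mul_inv (2 * Real.pi / Complex.I : ℂ) x.2]
    rw [this]

theorem exists_grad (hS : S.IsAdmissible) {Ψ : Fin l → S.G → ℂ} (hΨ : ∀ j, S.IsFundamentalCharacter j (Ψ j))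
    (c : Fin l → ℝ) {φ : S.LoopAlg W} (hφ : ∀ z, (φ.1.eval z)ᴴ = φ.1.eval z)
    (hreg : S.LoopRegular ((φ, (1 : ℂ)) : S.ExtLoopAlg W)) :
    ∃ v : S.ExtLoopAlg W, S.HasGrad (fun x => ∑ j, c j * S.F Ψ j x) (φ, (1 : ℂ)) v ∧ v ∈ S.iKHat W ∧
      (v = 0 ↔ ∀ j, c j = 0) := by
  obtain ⟨μ, d, γ, γi, hd, hμ, hγ, hγi, hgauge, hherm⟩ := exists_floquet hS hφ hreg
  have h : S.IsLoopPair γ γi := fun z => by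
    obtain ⟨g, hg⟩ := hγ z
    exact ⟨g, hg, by rw [hγi, ← hg, mat_inv]⟩
  obtain ⟨L, hLc, hgrad⟩ := hasGrad_F hS hΨ c h hd hμ hgauge
  obtain ⟨x, hx⟩ := exists_killingForm_eq (S.weightFun L)
  obtain ⟨d', hd'⟩ := exists_diagonal_of_real hS (weightFun_dagH hS L) hx
  refine ⟨_, hgrad x hx, transportGrad_mem_iKHat hS h hφ (hherm x d' hd'), ?_⟩
  rw [transportGrad_eq_zero, ← hLc, ← weightFun_eq_zero (S := S)]
  constructor
  · rintro rfl
    refine LinearMap.ext fun z => ?_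
    rw [← hx]
    exact LinearMap.congr_fun (map_zero (killingForm ℂ S.𝔤)) (z : S.𝔤)
  · intro h0
    refine eq_of_killingForm_eq fun z => ?_
    rw [hx, h0]
    exact (LinearMap.congr_fun (map_zero (killingForm ℂ S.𝔤)) (z : S.𝔤)).symm

end ChevalleyData

end Toda

end

open Toda in
theorem mainTheorem6 {n l : ℕ} (W : LoopWeight) (S : ChevalleyData n l) (hS : S.IsAdmissible)
    (Ψ : Fin l → S.G → ℂ) (hΨ : ∀ j, S.IsFundamentalCharacter j (Ψ j))
    (c : Fin l → ℝ) (φ : S.LoopAlg W)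
    (hφ : (φ, (1 : ℂ)) ∈ S.todaPhaseSpace W)
    (hreg : S.LoopRegular ((φ, (1 : ℂ)) : S.ExtLoopAlg W)) :
    ∃ v : S.ExtLoopAlg W,
      S.HasGrad (fun x => ∑ j, c j * S.F Ψ j x) (φ, (1 : ℂ)) v ∧
      (∀ v', S.HasGrad (fun x => ∑ j, c j * S.F Ψ j x) (φ, (1 : ℂ)) v' → v' = v) ∧
      v ∈ S.iKHat W ∧
      (v = 0 ↔ ∀ j, c j = 0) := by
  -- Orthogonality to `kHat` supplies the Hermitian symmetry of φ.
  obtain ⟨v, hv, hk, hc⟩ := ChevalleyData.exists_grad hS hΨ c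
    (ChevalleyData.conjTranspose_of_mem_perp hS hφ.1) hreg
  exact ⟨v, hv, fun v' hv' => ChevalleyData.HasGrad.unique hS hv' hv, hk, hc⟩
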